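/- **Setting.** Identify the complexified quaternions $\mathbb{H}_{\mathbb C}$ with the complex $2\times2$ matrices $Z=(z_{ij})$, with $e_0=1$, $e_1=\begin{pmatrix}0&-i\\-i&0\end{pmatrix}$, $e_2=\begin{pmatrix}0&-1\\1&0\end{pmatrix}$, $e_3=\begin{pmatrix}-i&0\\0&i\end{pmatrix}$; put $N(Z)=\det Z$, let $\mathbb H$ be the real span of $e_0,\dots,e_3$ and $S^3=\{X\in\mathbb H: N(X)=1\}$ with its Euclidean surface measure $dS$. Let $\mathbb S$ (resp. $\mathbb S'$) be the space of columns (resp. rows) of two complex numbers, and let $s^+$ denote the conjugate transpose of a column or row $s$. Put $$\nabla=2\begin{pmatrix}\partial_{11}&\partial_{21}\\ \partial_{12}&\partial_{22}\end{pmatrix},\qquad \square=4(\partial_{11}\partial_{22}-\partial_{12}\partial_{21}),\qquad \partial_{ij}=\partial/\partial z_{ij}.$$ Let $$\mathcal U=\{f\in\mathbb C[z_{ij},N(Z)^{-1}]\otimes\mathbb S:\nabla\square f=0\},\qquad \mathcal U'=\{g\in\mathbb C[z_{ij},N(Z)^{-1}]\otimes\mathbb S':(\square g)\overleftarrow\nabla=0\},$$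 and let $\mathcal U^+,\mathcal U'^+$ (resp. $\mathcal U^-,\mathcal U'^-$) be the sums of their homogeneous components of degrees $d\ge0$ (resp. $d<0$). The Lie algebra $\mathfrak{gl}(2,\mathbb H_{\mathbb C})=\mathfrak{gl}(4,\mathbb C)$ acts by the derivatives $\pi'_l$, $\pi'_r$ of $$(\pi'_l(h)f)(Z)=\frac{a'-Zc'}{N(a'-Zc')}\,f\bigl((a'-Zc')^{-1}(-b'+Zd')\bigr),\qquad (\pi'_r(h)g)(Z)=g\bigl((aZ+b)(cZ+d)^{-1}\bigr)\,\frac{cZ+d}{N(cZ+d)},$$ where $h=\begin{pmatrix}a'&b'\\c'&d'\end{pmatrix}$, $h^{-1}=\begin{pmatrix}a&b\\c&d\end{pmatrix}$, and $\mathfrak u(2,2)=\left\{\begin{pmatrix}A&B\\B^*&D\end{pmatrix}:A=-A^*,\ D=-D^*\right\}$. Let $$t^l_{n\,\underline m}(Z)=\frac1{2\pi i}\oint(sz_{11}+z_{21})^{l-m}(sz_{12}+z_{22})^{l+m}s^{-l+n}\,\frac{ds}s$$ (integral over the unit circle), for $l\in\tfrac12\mathbb Z_{\ge0}$, $m\in\{-l,-l+1,\dots,l\}$,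 $n\in l+\mathbb Z$; a term below whose numerical coefficient is $0$ is read as $0$. Write $\langle k\rangle=\{-k,-k+1,\dots,k\}$ for $k\in\frac12\mathbb Z_{\ge0}$ and $\langle k\rangle=\emptyset$ for $k<0$. For $l\in\frac12\mathbb Z_{\ge0}$ define the functions $f^{(\alpha)}_{l,m,n}$: $$f^{(1)}_{l,m,n}=\begin{pmatrix}t^l_{n-\frac12\,\underline m}(Z)\\-t^l_{n+\frac12\,\underline m}(Z)\end{pmatrix},\quad f^{(2)}_{l,m,n}=\begin{pmatrix}(l-n+\frac12)t^l_{n-\frac12\,\underline m}(Z)\\(l+n+\frac12)t^l_{n+\frac12\,\underline m}(Z)\end{pmatrix},\quad f^{(3)}_{l,m,n}=N(Z)\begin{pmatrix}t^{l-1}_{n-\frac12\,\underline m}(Z)\\-t^{l-1}_{n+\frac12\,\underline m}(Z)\end{pmatrix},$$ with $(m,n)$ in $\langle l\rangle\times\langle l+\frac12\rangle$, $\langle l\rangle\times\langle l-\frac12\rangle$, $\langle l-1\rangle\times\langle l-\frac12\rangle$ for $\alpha=1,2,3$ respectively; the functions $\tilde f^{(\alpha)}_{l,m,n}$: $$\tilde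 f^{(1)}_{l,m,n}=\begin{pmatrix}t^{l+\frac12}_{m\,\underline{n+\frac12}}(Z^{-1})\\-t^{l+\frac12}_{m\,\underline{n-\frac12}}(Z^{-1})\end{pmatrix},\quad \tilde f^{(2)}_{l,m,n}=\frac1{N(Z)}\begin{pmatrix}(l-n)t^{l-\frac12}_{m\,\underline{n+\frac12}}(Z^{-1})\\(l+n)t^{l-\frac12}_{m\,\underline{n-\frac12}}(Z^{-1})\end{pmatrix},\quad \tilde f^{(3)}_{l,m,n}=\frac1{N(Z)}\begin{pmatrix}t^{l-\frac12}_{m\,\underline{n+\frac12}}(Z^{-1})\\-t^{l-\frac12}_{m\,\underline{n-\frac12}}(Z^{-1})\end{pmatrix},$$ with $(n,m)$ in these same three sets; the functions $g^{(\alpha)}_{l,m,n}$: $$g^{(1)}_{l,m,n}=\bigl((l+m+\tfrac12)t^l_{n\,\underline{m-\frac12}}(Z),-(l-m+\tfrac12)t^l_{n\,\underline{m+\frac12}}(Z)\bigr),\quad g^{(2)}_{l,m,n}=\bigl(t^l_{n\,\underline{m-\frac12}}(Z),t^l_{n\,\underline{m+\frac12}}(Z)\bigr),$$ $$g^{(3)}_{l,m,n}=N(Z)\bigl((l+m-\tfrac12)t^{l-1}_{n\,\underline{m-\frac12}}(Z),-(l-m-\tfrac12)t^{l-1}_{n\,\underline{m+\frac12}}(Z)\bigr),$$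 with $(n,m)$ in the same three sets; and the functions $\tilde g^{(\alpha)}_{l,m,n}$: $$\tilde g^{(1)}_{l,m,n}=\bigl((l+m+1)t^{l+\frac12}_{m+\frac12\,\underline n}(Z^{-1}),-(l-m+1)t^{l+\frac12}_{m-\frac12\,\underline n}(Z^{-1})\bigr),\quad \tilde g^{(2)}_{l,m,n}=\frac1{N(Z)}\bigl(t^{l-\frac12}_{m+\frac12\,\underline n}(Z^{-1}),t^{l-\frac12}_{m-\frac12\,\underline n}(Z^{-1})\bigr),$$ $$\tilde g^{(3)}_{l,m,n}=\frac1{N(Z)}\bigl((l+m)t^{l-\frac12}_{m+\frac12\,\underline n}(Z^{-1}),-(l-m)t^{l-\frac12}_{m-\frac12\,\underline n}(Z^{-1})\bigr),$$ with $(m,n)$ in the same three sets. **Theorem.** Let $(\pi,\mathcal X)$ with functions $e^{(\alpha)}_{l,m,n}$ be one of $(\pi'_l,\mathcal U^+)$ with $f^{(\alpha)}_{l,m,n}$; $(\pi'_l,\mathcal U^-)$ with $\tilde f^{(\alpha)}_{l,m,n}$; $(\pi'_r,\mathcal U'^+)$ with $g^{(\alpha)}_{l,m,n}$; $(\pi'_r,\mathcal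 U'^-)$ with $\tilde g^{(\alpha)}_{l,m,n}$. Then $\mathcal X$ is non-zero, stable under $\pi(\mathfrak{gl}(2,\mathbb H_{\mathbb C}))$, and has no complex subspaces stable under $\pi(\mathfrak u(2,2))$ other than $0$ and $\mathcal X$; the functions $e^{(\alpha)}_{l,m,n}$ form a basis of $\mathcal X$. There is a Hermitian form $(\cdot,\cdot)$ on $\mathcal X$ (linear in the first argument) which is non-degenerate, indefinite and $\mathfrak u(2,2)$-invariant, i.e. $(\pi(X)u,v)+(u,\pi(X)v)=0$ for all $X\in\mathfrak u(2,2)$, and which is given on the basis by $$\bigl(e^{(\alpha)}_{l,m,n},e^{(\alpha)}_{l',m',n'}\bigr)=\frac{w_\alpha(l)}{2\pi^2}\int_{S^3}\bigl\langle e^{(\alpha)}_{l,m,n}(X),e^{(\alpha)}_{l',m',n'}(X)\bigr\rangle\,dS,\qquad \bigl(e^{(\alpha)}_{l,m,n},e^{(\alpha')}_{l',m',n'}\bigr)=0\ \text{ if }\alpha\ne\alpha',$$ where $w_1(l)=2l+1$, $w_2(l)=-2l(2l+1)$, $w_3(l)=-2l$, and $\langle s,s'\rangle$ is the standard Hermitian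 product ($s'^+s$ for columns, $s\,s'^+$ for rows). Every $\mathfrak u(2,2)$-invariant Hermitian form on $\mathcal X$ is a real multiple of this one. Consequently $\mathcal X$ admits no $\mathfrak u(2,2)$-invariant unitary structure, i.e. no positive definite $\mathfrak u(2,2)$-invariant Hermitian form. -/

import Mathlib

open scoped ComplexConjugate Matrix

namespace QAR

noncomputable section

/-- The complexified quaternions, identified with the complex `2 × 2` matrices. The unit `e₀` is
the identity matrix, the quaternionic norm `N(Z)` is the determinant. -/
abbrev HC := Matrix (Fin 2) (Fin 2) ℂ

/-- The invertible complexified quaternions. -/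
abbrev HCx := {Z : HC // Z.det ≠ 0}

/-- Functions on the invertible complexified quaternions with values in `ℂ²`. The values are read
as columns (the left module `𝕊`) or as rows (the right module `𝕊'`). -/
abbrev Fn := HCx → Fin 2 → ℂ

open Classical in
/-- Extension by zero of a function on the open set of invertible elements. -/
def ext {V : Type} [Zero V] (f : HCx → V) (Z : HC) : V :=
  if h : Z.det ≠ 0 then f ⟨Z, h⟩ else 0

/-- The partial derivative `∂/∂z_{ij}`. -/
def pd (i j : Fin 2) (f : HCx → ℂ) : HCx → ℂ := fun Z =>
  deriv (fun s : ℂ => ext f (Z.1 + s • Matrix.single i j (1 : ℂ))) 0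

/-- A component of a vector valued function. -/
def comp (f : Fn) (k : Fin 2) : HCx → ℂ := fun Z => f Z k

/-- `□ = 4 (∂₁₁ ∂₂₂ - ∂₁₂ ∂₂₁)`, the complex Laplacian, on scalar functions. -/
def box (f : HCx → ℂ) : HCx → ℂ := fun Z =>
  4 * (pd 0 0 (pd 1 1 f) Z - pd 0 1 (pd 1 0 f) Z)

/-- `□` on vector valued functions. -/
def boxV (f : Fn) : Fn := fun Z k => box (comp f k) Z

/-- `∇ f` for column valued `f`, where `∇ = 2 ∂` and `∂` is the matrix of operators whose entry in
row `i` and column `j` is `∂/∂z_{ji}`. -/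
def nablaL (f : Fn) : Fn := fun Z i => 2 * ∑ j, pd j i (comp f j) Z

/-- `g ∇` (the operator acting from the right) for row valued `g`. -/
def nablaR (g : Fn) : Fn := fun Z j => 2 * ∑ i, pd j i (comp g i) Z

/-- Membership in `ℂ[z₁₁, z₁₂, z₂₁, z₂₂, N(Z)⁻¹]`. -/
def IsLaurent (f : HCx → ℂ) : Prop :=
  ∃ (P : MvPolynomial (Fin 2 × Fin 2) ℂ) (k : ℕ), ∀ Z : HCx,
    f Z = MvPolynomial.eval (fun p => Z.1 p.1 p.2) P / Z.1.det ^ k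

/-! Elementary facts, which show that the function spaces below are linear subspaces. -/

def detP : MvPolynomial (Fin 2 × Fin 2) ℂ :=
  MvPolynomial.X (0, 0) * MvPolynomial.X (1, 1) - MvPolynomial.X (0, 1) * MvPolynomial.X (1, 0)

theorem eval_detP (Z : HC) : MvPolynomial.eval (fun p => Z p.1 p.2) detP = Z.det := by
  simp [detP, Matrix.det_fin_two]

theorem hasDerivAt_eval (P : MvPolynomial (Fin 2 × Fin 2) ℂ) (Z : HC) (i j : Fin 2) :
    HasDerivAt (fun s : ℂ => MvPolynomial.eval
        (fun p => (Z + s • Matrix.single i j (1 : ℂ)) p.1 p.2) P)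
      (MvPolynomial.eval (fun p => Z p.1 p.2) (MvPolynomial.pderiv (i, j) P)) 0 := by
  induction P using MvPolynomial.induction_on with
  | C a => simpa using hasDerivAt_const (0 : ℂ) a
  | add p q hp hq =>
    rw [map_add, map_add]
    refine (hp.add hq).congr_of_eventuallyEq (Filter.Eventually.of_forall fun s => ?_)
    simp only [map_add, Pi.add_apply]
  | mul_X p x hp =>
    have hx : HasDerivAt (fun s : ℂ => (Z + s • Matrix.single i j (1 : ℂ)) x.1 x.2)
        (MvPolynomial.eval (fun p => Z p.1 p.2)
          (MvPolynomial.pderiv (i, j) (MvPolynomial.X x : MvPolynomial (Fin 2 × Fin 2) ℂ))) 0 := by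
      have h1 : HasDerivAt (fun s : ℂ => Z x.1 x.2 + s * Matrix.single i j (1 : ℂ) x.1 x.2)
          (1 * Matrix.single i j (1 : ℂ) x.1 x.2) 0 :=
        ((hasDerivAt_id (0 : ℂ)).mul_const _).const_add _
      refine h1.congr_deriv ?_
      rw [MvPolynomial.pderiv_X]
      obtain ⟨a, b⟩ := x
      by_cases h : i = a ∧ j = b
      · obtain ⟨rfl, rfl⟩ := h
        simp
      · have h2 : ((a, b) : Fin 2 × Fin 2) ≠ (i, j) := fun h3 => h (by simp_all)
        simp [h]
    refine ((hp.mul hx).congr_deriv ?_).congr_of_eventuallyEq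
      (Filter.Eventually.of_forall fun s => ?_)
    · simp only [Derivation.leibniz, smul_eq_mul, map_add, map_mul, MvPolynomial.eval_X,
        zero_smul, add_zero]
      ring
    · simp only [map_mul, MvPolynomial.eval_X, Pi.mul_apply]

theorem hasDerivAt_ext {f : HCx → ℂ} {P : MvPolynomial (Fin 2 × Fin 2) ℂ} {k : ℕ}
    (hf : ∀ Z : HCx, f Z = MvPolynomial.eval (fun p => Z.1 p.1 p.2) P / Z.1.det ^ k)
    (i j : Fin 2) (Z : HCx) :
    HasDerivAt (fun s : ℂ => ext f (Z.1 + s • Matrix.single i j (1 : ℂ)))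
      (MvPolynomial.eval (fun p => Z.1 p.1 p.2)
        (MvPolynomial.pderiv (i, j) P * detP -
          MvPolynomial.C (k : ℂ) * P * MvPolynomial.pderiv (i, j) detP)
          / Z.1.det ^ (k + 1)) 0 := by
  have hP := hasDerivAt_eval P Z.1 i j
  have hD := hasDerivAt_eval detP Z.1 i j
  have hZ := Z.2
  have h0 : MvPolynomial.eval
      (fun p => (Z.1 + (0 : ℂ) • Matrix.single i j (1 : ℂ)) p.1 p.2) detP ≠ 0 := by
    rw [eval_detP]; simpa using Z.2
  have hq := hP.div (hD.pow k) (pow_ne_zero k h0)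
  have hev : (fun s : ℂ => ext f (Z.1 + s • Matrix.single i j (1 : ℂ))) =ᶠ[nhds 0]
      fun s : ℂ => MvPolynomial.eval
          (fun p => (Z.1 + s • Matrix.single i j (1 : ℂ)) p.1 p.2) P /
        MvPolynomial.eval (fun p => (Z.1 + s • Matrix.single i j (1 : ℂ)) p.1 p.2) detP ^ k := by
    filter_upwards [hD.continuousAt.eventually_ne h0] with s hs
    rw [eval_detP] at hs ⊢
    rw [ext, dif_pos hs, hf]
  refine HasDerivAt.congr_of_eventuallyEq ?_ hev
  refine hq.congr_deriv ?_
  simp only [zero_smul, add_zero, eval_detP, MvPolynomial.eval_sub, MvPolynomial.eval_mul,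
    MvPolynomial.eval_C, Pi.pow_apply]
  have : Z.1.det ≠ 0 := Z.2
  rcases k with _ | k
  · simp; field_simp
  · simp only [Nat.add_sub_cancel]
    field_simp
    ring

theorem IsLaurent.zero : IsLaurent (fun _ => 0) := ⟨0, 0, by simp⟩

theorem IsLaurent.add {f g : HCx → ℂ} (hf : IsLaurent f) (hg : IsLaurent g) :
    IsLaurent (fun Z => f Z + g Z) := by
  obtain ⟨P, k, hP⟩ := hf
  obtain ⟨Q, l, hQ⟩ := hg
  refine ⟨P * detP ^ l + Q * detP ^ k, k + l, fun Z => ?_⟩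
  have := Z.2
  beta_reduce
  rw [hP, hQ]
  simp only [map_add, map_mul, map_pow, eval_detP]
  field_simp
  ring

theorem IsLaurent.smul {f : HCx → ℂ} (c : ℂ) (hf : IsLaurent f) :
    IsLaurent (fun Z => c * f Z) := by
  obtain ⟨P, k, hP⟩ := hf
  refine ⟨MvPolynomial.C c * P, k, fun Z => ?_⟩
  beta_reduce
  rw [hP]
  simp [mul_div_assoc]

theorem IsLaurent.pd {f : HCx → ℂ} (hf : IsLaurent f) (i j : Fin 2) : IsLaurent (pd i j f) := by
  obtain ⟨P, k, hP⟩ := hf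
  exact ⟨_, k + 1, fun Z => (hasDerivAt_ext hP i j Z).deriv⟩

theorem pd_zero (i j : Fin 2) : pd i j (fun _ => 0) = fun _ => 0 := by
  funext Z
  have : (fun s : ℂ => ext (fun _ : HCx => (0 : ℂ)) (Z.1 + s • Matrix.single i j (1 : ℂ)))
      = fun _ => 0 := by
    funext s; simp [ext]
  rw [QAR.pd, this, deriv_const]

theorem pd_add {f g : HCx → ℂ} (hf : IsLaurent f) (hg : IsLaurent g) (i j : Fin 2) :
    pd i j (fun Z => f Z + g Z) = fun Z => pd i j f Z + pd i j g Z := by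
  obtain ⟨P, k, hP⟩ := hf
  obtain ⟨Q, l, hQ⟩ := hg
  funext Z
  have h := (hasDerivAt_ext hP i j Z).add (hasDerivAt_ext hQ i j Z)
  have e : (fun s : ℂ => ext (fun Z => f Z + g Z) (Z.1 + s • Matrix.single i j (1 : ℂ))) =
      (fun s : ℂ => ext f (Z.1 + s • Matrix.single i j (1 : ℂ))) +
      (fun s : ℂ => ext g (Z.1 + s • Matrix.single i j (1 : ℂ))) := by
    funext s
    simp only [ext, Pi.add_apply]
    split_ifs <;> simp
  rw [QAR.pd, e, h.deriv, QAR.pd, QAR.pd, (hasDerivAt_ext hP i j Z).deriv,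
    (hasDerivAt_ext hQ i j Z).deriv]

theorem pd_smul (f : HCx → ℂ) (c : ℂ) (i j : Fin 2) :
    pd i j (fun Z => c * f Z) = fun Z => c * pd i j f Z := by
  funext Z
  have e : (fun s : ℂ => ext (fun Z => c * f Z) (Z.1 + s • Matrix.single i j (1 : ℂ))) =
      (fun s : ℂ => c * ext f (Z.1 + s • Matrix.single i j (1 : ℂ))) := by
    funext s
    simp only [ext]
    split_ifs <;> simp
  rw [QAR.pd, e, deriv_const_mul_field', QAR.pd]

theorem IsLaurent.box {f : HCx → ℂ} (hf : IsLaurent f) : IsLaurent (box f) := by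
  have h := (((hf.pd 1 1).pd 0 0).add (((hf.pd 1 0).pd 0 1).smul (-1))).smul 4
  have e : QAR.box f = fun Z => 4 * (QAR.pd 0 0 (QAR.pd 1 1 f) Z
      + -1 * QAR.pd 0 1 (QAR.pd 1 0 f) Z) := by
    funext Z; simp only [QAR.box]; ring
  rw [e]; exact h

theorem box_add {f g : HCx → ℂ} (hf : IsLaurent f) (hg : IsLaurent g) :
    box (fun Z => f Z + g Z) = fun Z => box f Z + box g Z := by
  funext Z
  simp only [box]
  rw [pd_add hf hg, pd_add hf hg, pd_add (hf.pd _ _) (hg.pd _ _),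
    pd_add (hf.pd _ _) (hg.pd _ _)]
  ring

theorem box_smul (f : HCx → ℂ) (c : ℂ) : box (fun Z => c * f Z) = fun Z => c * box f Z := by
  funext Z
  simp only [box]
  rw [pd_smul, pd_smul, pd_smul, pd_smul]
  ring

/-- The space `𝒰` of quasi left anti regular functions in `ℂ[z, N(Z)⁻¹] ⊗ 𝕊`. -/
def UL : Submodule ℂ Fn where
  carrier := {f | (∀ k, IsLaurent (comp f k)) ∧ nablaL (boxV f) = 0}
  zero_mem' := by
    refine ⟨fun k => IsLaurent.zero, ?_⟩
    have hc : ∀ k, comp (boxV 0) k = fun _ => 0 := by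
      intro k; funext Z
      have : comp (0 : Fn) k = fun _ => 0 := rfl
      simp [comp, boxV, box, this, pd_zero]
    funext Z i
    simp [nablaL, hc, pd_zero]
  add_mem' := by
    rintro f g ⟨hf, hf'⟩ ⟨hg, hg'⟩
    refine ⟨fun k => (hf k).add (hg k), ?_⟩
    have hc : ∀ k, comp (boxV (f + g)) k = fun Z => comp (boxV f) k Z + comp (boxV g) k Z :=
      fun k => box_add (hf k) (hg k)
    funext Z i
    have h1 := congrFun (congrFun hf' Z) i
    have h2 := congrFun (congrFun hg' Z) i
    have hF : ∀ k, IsLaurent (comp (boxV f) k) := fun k => (hf k).box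
    have hG : ∀ k, IsLaurent (comp (boxV g) k) := fun k => (hg k).box
    simp only [nablaL, hc, pd_add (hF _) (hG _), Finset.sum_add_distrib, mul_add] at h1 h2 ⊢
    rw [h1, h2]; simp
  smul_mem' := by
    rintro c f ⟨hf, hf'⟩
    refine ⟨fun k => (hf k).smul c, ?_⟩
    have hc : ∀ k, comp (boxV (c • f)) k = fun Z => c * comp (boxV f) k Z :=
      fun k => box_smul _ c
    funext Z i
    have h1 := congrFun (congrFun hf' Z) i
    simp only [nablaL, hc, pd_smul, ← Finset.mul_sum] at h1 ⊢
    rw [mul_left_comm, h1]; simp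

/-- The space `𝒰'` of quasi right anti regular functions in `ℂ[z, N(Z)⁻¹] ⊗ 𝕊'`. -/
def UR : Submodule ℂ Fn where
  carrier := {g | (∀ k, IsLaurent (comp g k)) ∧ nablaR (boxV g) = 0}
  zero_mem' := by
    refine ⟨fun k => IsLaurent.zero, ?_⟩
    have hc : ∀ k, comp (boxV 0) k = fun _ => 0 := by
      intro k; funext Z
      have : comp (0 : Fn) k = fun _ => 0 := rfl
      simp [comp, boxV, box, this, pd_zero]
    funext Z i
    simp [nablaR, hc, pd_zero]
  add_mem' := by
    rintro f g ⟨hf, hf'⟩ ⟨hg, hg'⟩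
    refine ⟨fun k => (hf k).add (hg k), ?_⟩
    have hc : ∀ k, comp (boxV (f + g)) k = fun Z => comp (boxV f) k Z + comp (boxV g) k Z :=
      fun k => box_add (hf k) (hg k)
    funext Z i
    have h1 := congrFun (congrFun hf' Z) i
    have h2 := congrFun (congrFun hg' Z) i
    have hF : ∀ k, IsLaurent (comp (boxV f) k) := fun k => (hf k).box
    have hG : ∀ k, IsLaurent (comp (boxV g) k) := fun k => (hg k).box
    simp only [nablaR, hc, pd_add (hF _) (hG _), Finset.sum_add_distrib, mul_add] at h1 h2 ⊢
    rw [h1, h2]; simp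
  smul_mem' := by
    rintro c f ⟨hf, hf'⟩
    refine ⟨fun k => (hf k).smul c, ?_⟩
    have hc : ∀ k, comp (boxV (c • f)) k = fun Z => c * comp (boxV f) k Z :=
      fun k => box_smul _ c
    funext Z i
    have h1 := congrFun (congrFun hf' Z) i
    simp only [nablaR, hc, pd_smul, ← Finset.mul_sum] at h1 ⊢
    rw [mul_left_comm, h1]; simp

/-- The functions that are homogeneous of degree `d`: `f (c Z) = c ^ d f (Z)` for `c ≠ 0`. -/
def homog (d : ℤ) : Submodule ℂ Fn where
  carrier := {f | ∀ (c : ℂ), c ≠ 0 → ∀ Z W : HCx, W.1 = c • Z.1 → f W = c ^ d • f Z}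
  zero_mem' := by intro c _ Z W _; simp
  add_mem' := by
    intro f g hf hg c hc Z W h
    simp [hf c hc Z W h, hg c hc Z W h]
  smul_mem' := by
    intro a f hf c hc Z W h
    simp only [Pi.smul_apply, hf c hc Z W h]
    exact smul_comm _ _ _

/-- The group action `π'_l` on column valued functions, for `h = (a', b'; c', d')` in `GL(2, ℍ_ℂ)`:
`f(Z) ↦ N(a' - Z c')⁻¹ (a' - Z c') f((a' - Z c')⁻¹ (-b' + Z d'))`. -/
def actL (h : Matrix (Fin 2 ⊕ Fin 2) (Fin 2 ⊕ Fin 2) ℂ) (f : Fn) : Fn := fun Z =>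
  (h.toBlocks₁₁ - Z.1 * h.toBlocks₂₁).det⁻¹ •
    ((h.toBlocks₁₁ - Z.1 * h.toBlocks₂₁) *ᵥ
      ext f ((h.toBlocks₁₁ - Z.1 * h.toBlocks₂₁)⁻¹ * (-h.toBlocks₁₂ + Z.1 * h.toBlocks₂₂)))

/-- The group action `π'_r` on row valued functions, for `h⁻¹ = (a, b; c, d)` in `GL(2, ℍ_ℂ)`:
`g(Z) ↦ N(c Z + d)⁻¹ g((a Z + b) (c Z + d)⁻¹) (c Z + d)`. -/
def actR (h : Matrix (Fin 2 ⊕ Fin 2) (Fin 2 ⊕ Fin 2) ℂ) (g : Fn) : Fn := fun Z =>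
  (h⁻¹.toBlocks₂₁ * Z.1 + h⁻¹.toBlocks₂₂).det⁻¹ •
    (ext g ((h⁻¹.toBlocks₁₁ * Z.1 + h⁻¹.toBlocks₁₂) *
        (h⁻¹.toBlocks₂₁ * Z.1 + h⁻¹.toBlocks₂₂)⁻¹) ᵥ*
      (h⁻¹.toBlocks₂₁ * Z.1 + h⁻¹.toBlocks₂₂))

/-- The action `π'_l` of the Lie algebra `𝔤𝔩(2, ℍ_ℂ)`, by differentiating the group action. -/
def piL (X : Matrix (Fin 2 ⊕ Fin 2) (Fin 2 ⊕ Fin 2) ℂ) (f : Fn) : Fn := fun Z =>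
  deriv (fun t : ℝ => actL (NormedSpace.exp (t • X)) f Z) 0

/-- The action `π'_r` of the Lie algebra `𝔤𝔩(2, ℍ_ℂ)`, by differentiating the group action. -/
def piR (X : Matrix (Fin 2 ⊕ Fin 2) (Fin 2 ⊕ Fin 2) ℂ) (g : Fn) : Fn := fun Z =>
  deriv (fun t : ℝ => actR (NormedSpace.exp (t • X)) g Z) 0

/-- The real form `𝔲(2,2)` of `𝔤𝔩(2, ℍ_ℂ)`: the matrices `(A, B; B*, D)` with
`A = -A*` and `D = -D*`. -/
def u22 : Set (Matrix (Fin 2 ⊕ Fin 2) (Fin 2 ⊕ Fin 2) ℂ) :=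
  {X | ∃ A B D : HC, A = -Aᴴ ∧ D = -Dᴴ ∧ X = Matrix.fromBlocks A B Bᴴ D}

/-- The matrix coefficients `t^l_{n m}(Z)` of `SU(2)`, extended to complexified quaternions. The
indices are half-integers with `l - m`, `l + m` natural numbers and `n - l` an integer. -/
def tcoef (l n m : ℚ) (Z : HC) : ℂ :=
  (2 * Real.pi * Complex.I)⁻¹ * ∮ s in C(0, 1),
    (s * Z 0 0 + Z 1 0) ^ ⌊l - m⌋₊ * (s * Z 0 1 + Z 1 1) ^ ⌊l + m⌋₊ * s ^ ⌊n - l⌋ * s⁻¹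

/-- `m ∈ {-l, -l + 1, …, l}`, where `2 l` is a natural number (no `m` qualifies otherwise). -/
def InRange (l m : ℚ) : Prop := (∃ a : ℕ, l - m = a) ∧ ∃ b : ℕ, l + m = b

/-- The functions `f^{(1)}`, `f^{(2)}`, `f^{(3)}` (for `α = 0, 1, 2`). -/
def fPlus (α : Fin 3) (l m n : ℚ) : Fn := fun Z =>
  match α with
  | 0 => ![tcoef l (n - 1 / 2) m Z.1, -tcoef l (n + 1 / 2) m Z.1]
  | 1 => ![((l - n + 1 / 2 : ℚ) : ℂ) * tcoef l (n - 1 / 2) m Z.1,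
           ((l + n + 1 / 2 : ℚ) : ℂ) * tcoef l (n + 1 / 2) m Z.1]
  | 2 => ![Z.1.det * tcoef (l - 1) (n - 1 / 2) m Z.1,
           -(Z.1.det * tcoef (l - 1) (n + 1 / 2) m Z.1)]

/-- The functions `g^{(1)}`, `g^{(2)}`, `g^{(3)}`. -/
def gPlus (α : Fin 3) (l m n : ℚ) : Fn := fun Z =>
  match α with
  | 0 => ![((l + m + 1 / 2 : ℚ) : ℂ) * tcoef l n (m - 1 / 2) Z.1,
           -(((l - m + 1 / 2 : ℚ) : ℂ) * tcoef l n (m + 1 / 2) Z.1)]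
  | 1 => ![tcoef l n (m - 1 / 2) Z.1, tcoef l n (m + 1 / 2) Z.1]
  | 2 => ![Z.1.det * (((l + m - 1 / 2 : ℚ) : ℂ) * tcoef (l - 1) n (m - 1 / 2) Z.1),
           -(Z.1.det * (((l - m - 1 / 2 : ℚ) : ℂ) * tcoef (l - 1) n (m + 1 / 2) Z.1))]

/-- The functions `f̃^{(1)}`, `f̃^{(2)}`, `f̃^{(3)}`. -/
def fMinus (α : Fin 3) (l m n : ℚ) : Fn := fun Z =>
  match α with
  | 0 => ![tcoef (l + 1 / 2) m (n + 1 / 2) Z.1⁻¹, -tcoef (l + 1 / 2) m (n - 1 / 2) Z.1⁻¹]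
  | 1 => ![((l - n : ℚ) : ℂ) * Z.1.det⁻¹ * tcoef (l - 1 / 2) m (n + 1 / 2) Z.1⁻¹,
           ((l + n : ℚ) : ℂ) * Z.1.det⁻¹ * tcoef (l - 1 / 2) m (n - 1 / 2) Z.1⁻¹]
  | 2 => ![Z.1.det⁻¹ * tcoef (l - 1 / 2) m (n + 1 / 2) Z.1⁻¹,
           -(Z.1.det⁻¹ * tcoef (l - 1 / 2) m (n - 1 / 2) Z.1⁻¹)]

/-- The functions `g̃^{(1)}`, `g̃^{(2)}`, `g̃^{(3)}`. -/
def gMinus (α : Fin 3) (l m n : ℚ) : Fn := fun Z =>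
  match α with
  | 0 => ![((l + m + 1 : ℚ) : ℂ) * tcoef (l + 1 / 2) (m + 1 / 2) n Z.1⁻¹,
           -(((l - m + 1 : ℚ) : ℂ) * tcoef (l + 1 / 2) (m - 1 / 2) n Z.1⁻¹)]
  | 1 => ![Z.1.det⁻¹ * tcoef (l - 1 / 2) (m + 1 / 2) n Z.1⁻¹,
           Z.1.det⁻¹ * tcoef (l - 1 / 2) (m - 1 / 2) n Z.1⁻¹]
  | 2 => ![Z.1.det⁻¹ * (((l + m : ℚ) : ℂ) * tcoef (l - 1 / 2) (m + 1 / 2) n Z.1⁻¹),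
           -(Z.1.det⁻¹ * (((l - m : ℚ) : ℂ) * tcoef (l - 1 / 2) (m - 1 / 2) n Z.1⁻¹))]

/-- The range of the indices of `f^{(α)}_{l,m,n}`; also that of `g̃^{(α)}_{l,m,n}`. With `m` and `n`
exchanged it is the range of the indices of `g^{(α)}_{l,m,n}` and of `f̃^{(α)}_{l,m,n}`. -/
def idx (α : Fin 3) (l m n : ℚ) : Prop :=
  match α with
  | 0 => InRange l m ∧ InRange (l + 1 / 2) n
  | 1 => InRange l m ∧ InRange (l - 1 / 2) n
  | 2 => InRange (l - 1) m ∧ InRange (l - 1 / 2) n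

/-- The weights `2l + 1`, `-2l(2l + 1)`, `-2l`. -/
def weight (α : Fin 3) (l : ℚ) : ℚ :=
  match α with
  | 0 => 2 * l + 1
  | 1 => -(2 * l * (2 * l + 1))
  | 2 => -(2 * l)

/-- Labels of the four representations `(π'_l, 𝒰⁺)`, `(π'_l, 𝒰⁻)`, `(π'_r, 𝒰'⁺)`,
`(π'_r, 𝒰'⁻)`. -/
inductive Label
  | lplus
  | lminus
  | rplus
  | rminus

/-- The underlying spaces: `𝒰⁺` and `𝒰'⁺` are the sums of the homogeneous parts of degrees
`d ≥ 0`, `𝒰⁻` and `𝒰'⁻` the sums of those of degrees `d < 0`. -/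
def space : Label → Submodule ℂ Fn
  | .lplus => ⨆ d : ℤ, ⨆ _ : 0 ≤ d, UL ⊓ homog d
  | .lminus => ⨆ d : ℤ, ⨆ _ : d < 0, UL ⊓ homog d
  | .rplus => ⨆ d : ℤ, ⨆ _ : 0 ≤ d, UR ⊓ homog d
  | .rminus => ⨆ d : ℤ, ⨆ _ : d < 0, UR ⊓ homog d

/-- The action of `𝔤𝔩(2, ℍ_ℂ)`. -/
def act : Label → Matrix (Fin 2 ⊕ Fin 2) (Fin 2 ⊕ Fin 2) ℂ → Fn → Fn
  | .lplus => piL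
  | .lminus => piL
  | .rplus => piR
  | .rminus => piR

/-- The `K`-type basis functions. -/
def ktype : Label → Fin 3 → ℚ → ℚ → ℚ → Fn
  | .lplus => fPlus
  | .lminus => fMinus
  | .rplus => gPlus
  | .rminus => gMinus

/-- The range of the indices of the `K`-type basis functions. -/
def kidx : Label → Fin 3 → ℚ → ℚ → ℚ → Prop
  | .lplus => idx
  | .lminus => fun α l m n => idx α l n m
  | .rplus => fun α l m n => idx α l n m
  | .rminus => idx

/-- The real quaternion `x⁰ e₀ + x¹ e₁ + x² e₂ + x³ e₃` as a complex `2 × 2` matrix. -/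
def quat (x : EuclideanSpace ℝ (Fin 4)) : HC :=
  !![(x 0 : ℂ) - Complex.I * x 3, -Complex.I * x 1 - x 2;
     -Complex.I * x 1 + x 2, (x 0 : ℂ) + Complex.I * x 3]

/-- `∫_{S³} g⁺ · f dS` (for rows: `∫_{S³} f · g⁺ dS`) over the unit sphere of the real quaternions,
with the Euclidean surface measure. -/
def sphereInner (f g : Fn) : ℂ :=
  ∫ x : Metric.sphere (0 : EuclideanSpace ℝ (Fin 4)) 1,
    ∑ i, conj (ext g (quat x.1) i) * ext f (quat x.1) i ∂MeasureTheory.volume.toSphere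

/-- A Hermitian form, linear in the first argument. -/
def IsHermitianForm {W : Submodule ℂ Fn} (B : W →ₗ[ℂ] W →ₗ⋆[ℂ] ℂ) : Prop :=
  ∀ u v : W, B v u = conj (B u v)

/-- `𝔲(2,2)`-invariance `(π(X) u, v) + (u, π(X) v) = 0` of a form on one of the four spaces. -/
def IsInvariantForm (c : Label) (B : space c →ₗ[ℂ] space c →ₗ⋆[ℂ] ℂ) : Prop :=
  ∀ X ∈ u22, ∀ u v u' v' : space c, (u' : Fn) = act c X u → (v' : Fn) = act c X v →
    B u' v + B u v' = 0

end

end QAR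

open scoped ComplexConjugate Matrix

namespace QAR

/-! All four representations are carried to one model: the span `SS` of the vectors f^{(1)},
f^{(2)}, f^{(3)} over the Laurent algebra `LA`, on which gl(4) acts by the differential operators
`pL`. Inversion Z ↦ Z⁻¹ (`opJ`) exchanges 𝒰⁺ and 𝒰⁻, and transposition (`tr`) exchanges columns and
rows. Both intertwine the actions up to an automorphism of gl(4) preserving u(2,2), both act on S³
by isometries, and together they match the given basis functions with those of the model up to
non-zero scalars. So everything is proved on `SS` only, and `Realization` lists what is needed to
transport it.

In the model the contour integrals become the coefficients `tt` of (s z₁₁ + z₂₁)^a (s z₁₂ + z₂₂)^b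
with a = l - m, b = l + m. These are harmonic, and the vectors N^p f^{(1)}, N^p f^{(2)} span all
Laurent vectors (`LV_span`). The operator N Z∇□ is diagonal on them with completely factored
eigenvalues, so the solutions of ∇□f = 0 are read off (`UL_inf_homog`): in degrees d ≥ 0 they are
spanned by f^{(1)}, f^{(2)} and f^{(3)} = N f^{(1)}. Linear independence holds because the four
diagonal operators `sepOp` have different joint eigenvalues on different basis vectors.

Multiplication by a coordinate splits a coefficient into one of higher degree and N times one of
lower degree. This yields explicit formulas for the translations `opD` and the special conformal
operators `opK` on the three families. The form `BB` makes the family orthogonal, with the square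
norms on S³ (Schur orthogonality, `integral_conj_tt_mul_tt`) multiplied by the weights. Comparing
matrix coefficients shows that `opD i j` and `opK i j` are adjoint. The remaining off-diagonal
matrix units are commutators of these and the diagonal ones have real eigenvalues, so `BB` is
u(2,2)-invariant. The passages between f^{(1)} and f^{(2)}, and between f^{(1)} and f^{(3)}, have
coefficients of opposite sign for `opD` and `opK`; this is why the weights w₂ and w₃ are negative
and the form is indefinite.

A non-zero stable subspace contains a non-zero constant, since derivatives lower the degree. It then
contains both constants, and `opK` generates from them f^{(1)}, then f^{(3)}, then f^{(2)}; this is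
irreducibility (`SS_irreducible`). The constant `f1 0 0 0` spans its joint weight space, so an
invariant form that vanishes at it has it in the radical; the radical is stable, hence everything.
Therefore an invariant Hermitian form is determined by one real number, and no real multiple of an
indefinite form is positive definite. -/

noncomputable section

/-! ### Matrix coefficients of symmetric powers: recursions and products with coordinates -/

section MatrixCoefficients

variable {A : Type*} [CommRing A]

/-- The coefficient of `s ^ k` in `(s z₁₁ + z₂₁) ^ a (s z₁₂ + z₂₂) ^ b`. -/
def tt (Z : Matrix (Fin 2) (Fin 2) A) : ℕ → ℕ → ℤ → A
  | 0, 0, k => if k = 0 then 1 else 0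
  | 0, b + 1, k => Z 0 1 * tt Z 0 b (k - 1) + Z 1 1 * tt Z 0 b k
  | a + 1, b, k => Z 0 0 * tt Z a b (k - 1) + Z 1 0 * tt Z a b k

theorem tt_zero (Z : Matrix (Fin 2) (Fin 2) A) (k : ℤ) : tt Z 0 0 k = if k = 0 then 1 else 0 := by
  rw [tt]

theorem tt_succ_left (Z : Matrix (Fin 2) (Fin 2) A) (a b : ℕ) (k : ℤ) :
    tt Z (a + 1) b k = Z 0 0 * tt Z a b (k - 1) + Z 1 0 * tt Z a b k := by
  rw [tt]

/-- The defining recursion peels off the first factor as long as there is one; since the product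
commutes, the second factor may be peeled off for every `a`. -/
theorem tt_succ_right (Z : Matrix (Fin 2) (Fin 2) A) (a b : ℕ) (k : ℤ) :
    tt Z a (b + 1) k = Z 0 1 * tt Z a b (k - 1) + Z 1 1 * tt Z a b k := by
  induction a generalizing k with
  | zero => rw [tt]
  | succ a ih => rw [tt_succ_left, ih, ih, tt_succ_left, tt_succ_left]; ring

theorem tt_of_neg (Z : Matrix (Fin 2) (Fin 2) A) (a b : ℕ) (k : ℤ) (hk : k < 0) :
    tt Z a b k = 0 := by
  induction a generalizing k with
  | zero =>
    induction b generalizing k with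
    | zero => rw [tt_zero, if_neg hk.ne]
    | succ b ih => rw [tt_succ_right, ih _ (by omega), ih _ hk]; ring
  | succ a ih => rw [tt_succ_left, ih _ (by omega), ih _ hk]; ring

theorem tt_of_gt (Z : Matrix (Fin 2) (Fin 2) A) (a b : ℕ) (k : ℤ) (hk : (a + b : ℤ) < k) :
    tt Z a b k = 0 := by
  induction a generalizing k with
  | zero =>
    induction b generalizing k with
    | zero => rw [tt_zero, if_neg (by push_cast at hk; omega)]
    | succ b ih =>
      push_cast at hk ih
      rw [tt_succ_right, ih _ (by omega), ih _ (by omega)]; ring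
  | succ a ih =>
    push_cast at hk ih
    rw [tt_succ_left, ih _ (by omega), ih _ (by omega)]; ring

theorem map_tt {B : Type*} [CommRing B] (φ : A →+* B) (Z : Matrix (Fin 2) (Fin 2) A) (a b : ℕ)
    (k : ℤ) : φ (tt Z a b k) = tt (Z.map φ) a b k := by
  induction a generalizing k with
  | zero =>
    induction b generalizing k with
    | zero => simp only [tt_zero]; split_ifs <;> simp
    | succ b ih => simp [tt_succ_right, ih]
  | succ a ih => simp [tt_succ_left, ih]

theorem tt_smul (c : A) (Z : Matrix (Fin 2) (Fin 2) A) (a b : ℕ) (k : ℤ) :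
    tt (c • Z) a b k = c ^ (a + b) * tt Z a b k := by
  induction a generalizing k with
  | zero =>
    induction b generalizing k with
    | zero => simp [tt_zero]
    | succ b ih => rw [tt_succ_right, ih, ih, tt_succ_right]; simp; ring
  | succ a ih => rw [tt_succ_left, ih, ih, tt_succ_left]; simp; ring

/-- The factor `a` makes the recursion true at `a = 0`, where `a - 1` is truncated. The identities
below keep such a factor next to every `a - 1` and `b - 1` for the same reason. -/
theorem left_mul_tt (Z : Matrix (Fin 2) (Fin 2) A) (a b : ℕ) (k : ℤ) :
    (a : A) * tt Z a b k =
      a * (Z 0 0 * tt Z (a - 1) b (k - 1) + Z 1 0 * tt Z (a - 1) b k) := by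
  rcases a with _ | a
  · simp
  · rw [tt_succ_left, Nat.add_sub_cancel]

theorem right_mul_tt (Z : Matrix (Fin 2) (Fin 2) A) (a b : ℕ) (k : ℤ) :
    (b : A) * tt Z a b k =
      b * (Z 0 1 * tt Z a (b - 1) (k - 1) + Z 1 1 * tt Z a (b - 1) k) := by
  rcases b with _ | b
  · simp
  · rw [tt_succ_right, Nat.add_sub_cancel]

/-- Eliminating s between the two linear factors: z₁₁(s z₁₂ + z₂₂) - z₁₂(s z₁₁ + z₂₁) = N(Z). The
companion `tt_cancel_right` eliminates the constant terms and leaves s N(Z). -/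
theorem tt_cancel_left (Z : Matrix (Fin 2) (Fin 2) A) (a b : ℕ) (k : ℤ) :
    Z 0 0 * tt Z a (b + 1) k - Z 0 1 * tt Z (a + 1) b k = Z.det * tt Z a b k := by
  rw [tt_succ_left, tt_succ_right, Matrix.det_fin_two]; ring

theorem tt_cancel_right (Z : Matrix (Fin 2) (Fin 2) A) (a b : ℕ) (k : ℤ) :
    Z 1 1 * tt Z (a + 1) b k - Z 1 0 * tt Z a (b + 1) k = Z.det * tt Z a b (k - 1) := by
  rw [tt_succ_left, tt_succ_right, Matrix.det_fin_two]; ring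

/-- The operator s d/ds multiplies the coefficient of s^k by k, and on the product it acts by the
Leibniz rule. -/
theorem index_mul_tt (Z : Matrix (Fin 2) (Fin 2) A) (a b : ℕ) (k : ℤ) :
    (k : A) * tt Z a b k =
      a * (Z 0 0 * tt Z (a - 1) b (k - 1)) + b * (Z 0 1 * tt Z a (b - 1) (k - 1)) := by
  induction a generalizing k with
  | zero =>
    induction b generalizing k with
    | zero => rw [tt_zero]; split_ifs with h <;> simp [h]
    | succ b ih =>
      have h1 := ih k
      have h2 := ih (k - 1)
      have h3 := right_mul_tt Z 0 b (k - 1)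
      simp only [Nat.cast_zero, zero_mul, zero_add, Nat.add_sub_cancel, Nat.cast_add,
        Nat.cast_one] at *
      push_cast at *
      rw [tt_succ_right]
      linear_combination Z 1 1 * h1 + Z 0 1 * h2 - Z 0 1 * h3
  | succ a ih =>
    have h1 := ih k
    have h2 := ih (k - 1)
    have h3 := left_mul_tt Z a b (k - 1)
    have h4 : (b : A) * tt Z (a + 1) (b - 1) (k - 1) =
      b * (Z 0 0 * tt Z a (b - 1) (k - 1 - 1) + Z 1 0 * tt Z a (b - 1) (k - 1)) := by
      rw [tt_succ_left]
    simp only [Nat.add_sub_cancel, Nat.cast_add, Nat.cast_one] at *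
    push_cast at *
    rw [tt_succ_left]
    linear_combination Z 1 0 * h1 + Z 0 0 * h2 - Z 0 0 * h3 - Z 0 1 * h4

theorem coindex_mul_tt (Z : Matrix (Fin 2) (Fin 2) A) (a b : ℕ) (k : ℤ) :
    ((a : A) + b - k) * tt Z a b k =
      a * (Z 1 0 * tt Z (a - 1) b k) + b * (Z 1 1 * tt Z a (b - 1) k) := by
  linear_combination left_mul_tt Z a b k + right_mul_tt Z a b k - index_mul_tt Z a b k

/-- Clebsch–Gordan rule for the product with the defining representation: one component of degree a
+ b + 1, and N(Z) times one of degree a + b - 1. It combines the Leibniz rule for s d/ds with the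
elimination of s. -/
theorem z00_mul_tt (Z : Matrix (Fin 2) (Fin 2) A) (a b : ℕ) (k : ℤ) :
    ((a : A) + b + 1) * (Z 0 0 * tt Z a b k) =
      (k + 1) * tt Z (a + 1) b (k + 1) + b * (Z.det * tt Z a (b - 1) k) := by
  have h1 := index_mul_tt Z (a + 1) b (k + 1)
  have h2 : (b : A) * (Z 0 0 * tt Z a b k - Z 0 1 * tt Z (a + 1) (b - 1) k) =
      b * (Z.det * tt Z a (b - 1) k) := by
    rcases b with _ | b
    · simp
    · rw [← tt_cancel_left]; rfl
  simp only [Nat.add_sub_cancel, add_sub_cancel_right] at *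
  push_cast at *
  linear_combination h2 - h1

theorem z01_mul_tt (Z : Matrix (Fin 2) (Fin 2) A) (a b : ℕ) (k : ℤ) :
    ((a : A) + b + 1) * (Z 0 1 * tt Z a b k) =
      (k + 1) * tt Z a (b + 1) (k + 1) - a * (Z.det * tt Z (a - 1) b k) := by
  have h1 := index_mul_tt Z a (b + 1) (k + 1)
  have h2 : (a : A) * (Z 0 0 * tt Z (a - 1) (b + 1) k - Z 0 1 * tt Z a b k) =
      a * (Z.det * tt Z (a - 1) b k) := by
    rcases a with _ | a
    · simp
    · rw [← tt_cancel_left]; rfl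
  simp only [Nat.add_sub_cancel, add_sub_cancel_right] at *
  push_cast at *
  linear_combination - h2 - h1

theorem z10_mul_tt (Z : Matrix (Fin 2) (Fin 2) A) (a b : ℕ) (k : ℤ) :
    ((a : A) + b + 1) * (Z 1 0 * tt Z a b k) =
      (a + b + 1 - k) * tt Z (a + 1) b k - b * (Z.det * tt Z a (b - 1) (k - 1)) := by
  have h1 := coindex_mul_tt Z (a + 1) b k
  have h2 : (b : A) * (Z 1 1 * tt Z (a + 1) (b - 1) k - Z 1 0 * tt Z a b k) =
      b * (Z.det * tt Z a (b - 1) (k - 1)) := by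
    rcases b with _ | b
    · simp
    · rw [← tt_cancel_right]; rfl
  simp only [Nat.add_sub_cancel] at *
  push_cast at *
  linear_combination - h2 - h1

theorem z11_mul_tt (Z : Matrix (Fin 2) (Fin 2) A) (a b : ℕ) (k : ℤ) :
    ((a : A) + b + 1) * (Z 1 1 * tt Z a b k) =
      (a + b + 1 - k) * tt Z a (b + 1) k + a * (Z.det * tt Z (a - 1) b (k - 1)) := by
  have h1 := coindex_mul_tt Z a (b + 1) k
  have h2 : (a : A) * (Z 1 1 * tt Z a b k - Z 1 0 * tt Z (a - 1) (b + 1) k) =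
      a * (Z.det * tt Z (a - 1) b (k - 1)) := by
    rcases a with _ | a
    · simp
    · rw [← tt_cancel_right]; rfl
  simp only [Nat.add_sub_cancel] at *
  push_cast at *
  linear_combination h2 - h1

end MatrixCoefficients

/-! ### Symmetries of the coefficients: transposition, reversal, adjugate -/

section MatrixCoefficients

variable {A : Type*} [CommRing A]

theorem tt_transpose_zero (Z : Matrix (Fin 2) (Fin 2) A) (j a b : ℕ) (h : a + b = j) :
    (j.factorial : A) * tt Z a b 0 = a.factorial * b.factorial * tt Zᵀ 0 j a := by
  induction j generalizing a b with
  | zero =>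
    obtain ⟨rfl, rfl⟩ : a = 0 ∧ b = 0 := by omega
    simp [tt_zero]
  | succ j ih =>
    have h1 := coindex_mul_tt Z a b 0
    have h2 : (a : A) + b = j + 1 := by exact_mod_cast congrArg (Nat.cast (R := A)) h
    have h3 : (a : A) * (j.factorial * tt Z (a - 1) b 0) =
        a.factorial * b.factorial * tt Zᵀ 0 j ((a : ℤ) - 1) := by
      rcases a with _ | a
      · rw [tt_of_neg Zᵀ 0 j _ (by simp)]; simp
      · have := ih a b (by omega)
        simp only [Nat.add_sub_cancel, this, Nat.factorial_succ]
        push_cast; rw [add_sub_cancel_right]; ring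
    have h4 : (b : A) * (j.factorial * tt Z a (b - 1) 0) =
        a.factorial * b.factorial * tt Zᵀ 0 j a := by
      rcases b with _ | b
      · rw [tt_of_gt Zᵀ 0 j _ (by push_cast; omega)]; simp
      · have := ih a b (by omega)
        simp only [Nat.add_sub_cancel, this, Nat.factorial_succ]
        push_cast; ring
    rw [tt_succ_right, Nat.factorial_succ]
    simp only [Matrix.transpose_apply]
    push_cast at h1 ⊢
    linear_combination (j.factorial : A) * h1 + Z 1 0 * h3 + Z 1 1 * h4
      - (j.factorial : A) * tt Z a b 0 * h2

/-- The exponential generating function in a and b of the binary forms is exp(u(s z₁₁ + t z₂₁) + v(s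
z₁₂ + t z₂₂)), which is symmetric under Z ↦ Zᵀ together with (u, v) ↔ (s, t). Comparing coefficients
gives the quotient of factorials. -/
theorem tt_transpose (Z : Matrix (Fin 2) (Fin 2) A) (k j a b : ℕ) (h : a + b = k + j) :
    (k.factorial : A) * j.factorial * tt Z a b k =
      a.factorial * b.factorial * tt Zᵀ k j a := by
  induction k generalizing a b with
  | zero => simpa using tt_transpose_zero Z j a b (by omega)
  | succ k ih =>
    have h1 := index_mul_tt Z a b (k + 1)
    have h3 : (a : A) * (k.factorial * j.factorial * tt Z (a - 1) b k) =
        a.factorial * b.factorial * tt Zᵀ k j ((a : ℤ) - 1) := by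
      rcases a with _ | a
      · rw [tt_of_neg Zᵀ k j _ (by simp)]; simp
      · have := ih a b (by omega)
        simp only [Nat.add_sub_cancel, this, Nat.factorial_succ]
        push_cast; rw [add_sub_cancel_right]; ring
    have h4 : (b : A) * (k.factorial * j.factorial * tt Z a (b - 1) k) =
        a.factorial * b.factorial * tt Zᵀ k j a := by
      rcases b with _ | b
      · rw [tt_of_gt Zᵀ k j _ (by omega)]; simp
      · have := ih a b (by omega)
        simp only [Nat.add_sub_cancel, this, Nat.factorial_succ]
        push_cast; ring
    rw [tt_succ_left, Nat.factorial_succ]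
    simp only [Matrix.transpose_apply, add_sub_cancel_right] at *
    push_cast at h1 ⊢
    linear_combination (k.factorial : A) * j.factorial * h1 + Z 0 0 * h3 + Z 0 1 * h4

/-- Replace s by 1/s and multiply by s^(a+b). -/
theorem tt_rev (Z : Matrix (Fin 2) (Fin 2) A) (a b : ℕ) (k : ℤ) :
    tt !![Z 1 1, Z 1 0; Z 0 1, Z 0 0] a b k = tt Z b a (a + b - k) := by
  induction a generalizing k with
  | zero =>
    induction b generalizing k with
    | zero => simp [tt_zero]
    | succ b ih =>
      rw [tt_succ_right, tt_succ_left, ih, ih]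
      push_cast
      rw [show (0 + b - (k - 1) : ℤ) = 0 + (b + 1) - k by ring,
        show (0 + b - k : ℤ) = 0 + (b + 1) - k - 1 by ring]
      simp; ring
  | succ a ih =>
    rw [tt_succ_left, tt_succ_right, ih, ih]
    push_cast
    rw [show (a + b - (k - 1) : ℤ) = a + 1 + b - k by ring,
      show (a + b - k : ℤ) = a + 1 + b - k - 1 by ring]
    simp; ring

/-- The sign `(-1) ^ k` for an integer `k`. -/
def sg (A : Type*) [CommRing A] (k : ℤ) : A := ((k.negOnePow : ℤ) : A)

theorem sg_pred (k : ℤ) : sg A (k - 1) = -sg A k := by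
  simp [sg, Int.negOnePow_sub]

theorem sg_natCast (k : ℕ) : sg A k = (-1) ^ k := by
  simp [sg, Int.negOnePow]

/-- Replace s by -s; the first factor contributes the sign (-1)^a. -/
theorem tt_neg_offdiag (Z : Matrix (Fin 2) (Fin 2) A) (a b : ℕ) (k : ℤ) :
    tt !![Z 0 0, -Z 0 1; -Z 1 0, Z 1 1] a b k = (-1) ^ a * sg A k * tt Z a b k := by
  induction a generalizing k with
  | zero =>
    induction b generalizing k with
    | zero =>
      simp only [tt_zero]
      split_ifs with h
      · subst h; simp [sg]
      · simp
    | succ b ih =>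
      rw [tt_succ_right, tt_succ_right, ih, ih, sg_pred]
      simp; ring
  | succ a ih =>
    rw [tt_succ_left, tt_succ_left, ih, ih, sg_pred]
    simp; ring

theorem tt_adjugate (Z : Matrix (Fin 2) (Fin 2) A) (a b k j : ℕ) (h : a + b = k + j) :
    (k.factorial : A) * j.factorial * tt Z.adjugate a b k =
      (-1) ^ (a + k) * (a.factorial * b.factorial * tt Z j k b) := by
  have e1 := tt_neg_offdiag !![Z 1 1, Z 0 1; Z 1 0, Z 0 0] a b k
  have e2 := tt_rev Zᵀ a b k
  have e3 := tt_transpose Zᵀ j k b a (by omega)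
  rw [Matrix.transpose_transpose] at e3
  simp only [Matrix.of_apply, Matrix.cons_val', Matrix.cons_val_zero, Matrix.cons_val_one,
    Matrix.cons_val_fin_one, Matrix.transpose_apply] at e1 e2
  rw [e2, show (a + b - k : ℤ) = j by omega, sg_natCast] at e1
  rw [Matrix.adjugate_fin_two, e1, pow_add]
  linear_combination (-1) ^ a * (-1) ^ k * e3

end MatrixCoefficients

/-- On real quaternions conj z₁₁ = z₂₂ and conj z₁₂ = -z₂₁, so conjugation amounts to exchanging
rows and columns with a change of sign off the diagonal. This turns Hermitian integrals over S³ into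
integrals of polynomials. -/
theorem conj_tt_quat (x : EuclideanSpace ℝ (Fin 4)) (a b : ℕ) (k : ℤ) :
    conj (tt (quat x) a b k) = (-1) ^ a * sg ℂ k * tt (quat x) b a (a + b - k) := by
  have e1 := tt_neg_offdiag !![quat x 1 1, quat x 1 0; quat x 0 1, quat x 0 0] a b k
  have e2 := tt_rev (quat x) a b k
  simp only [Matrix.of_apply, Matrix.cons_val', Matrix.cons_val_zero, Matrix.cons_val_one,
    Matrix.cons_val_fin_one] at e1
  rw [e2] at e1
  rw [map_tt, ← e1]
  congr 1
  ext i j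
  fin_cases i <;> fin_cases j <;> simp [quat] <;> ring

/-- Both sides obey the same recursion in a and b, by linearity of the integral. For a = b = 0 the
integral of s^(-k-1) is 2πi exactly when k = 0. -/
theorem circleIntegral_eq_tt (Z : HC) (a b : ℕ) (k : ℤ) :
    (2 * Real.pi * Complex.I)⁻¹ * ∮ s in C(0, 1),
      (s * Z 0 0 + Z 1 0) ^ a * (s * Z 0 1 + Z 1 1) ^ b * s ^ (-k) * s⁻¹ = tt Z a b k := by
  have hs : ∀ z ∈ Metric.sphere (0 : ℂ) 1, z ≠ 0 := by
    rintro z hz rfl; simp at hz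
  have hint : ∀ (c : ℂ) (a b : ℕ) (k : ℤ), CircleIntegrable (fun s : ℂ =>
      c * ((s * Z 0 0 + Z 1 0) ^ a * (s * Z 0 1 + Z 1 1) ^ b * s ^ (-k) * s⁻¹)) 0 1 := by
    intro c a b k
    refine ContinuousOn.circleIntegrable zero_le_one ?_
    refine ContinuousOn.mul (by fun_prop) (ContinuousOn.mul (ContinuousOn.mul (by fun_prop) ?_) ?_)
    · exact continuousOn_id.zpow₀ _ fun z hz => Or.inl (hs z hz)
    · exact continuousOn_id.inv₀ hs
  -- One linear factor c s + c' is taken out; the two recursions are the two choices of this factor.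
  have key : ∀ (c c' : ℂ) (a b a' b' : ℕ) (k : ℤ),
      (∀ s : ℂ, (s * Z 0 0 + Z 1 0) ^ a' * (s * Z 0 1 + Z 1 1) ^ b' =
        (c * s + c') * ((s * Z 0 0 + Z 1 0) ^ a * (s * Z 0 1 + Z 1 1) ^ b)) →
      (2 * Real.pi * Complex.I)⁻¹ * ∮ s in C(0, 1),
        (s * Z 0 0 + Z 1 0) ^ a' * (s * Z 0 1 + Z 1 1) ^ b' * s ^ (-k) * s⁻¹ =
      c * ((2 * Real.pi * Complex.I)⁻¹ * ∮ s in C(0, 1),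
        (s * Z 0 0 + Z 1 0) ^ a * (s * Z 0 1 + Z 1 1) ^ b * s ^ (-(k - 1)) * s⁻¹) +
      c' * ((2 * Real.pi * Complex.I)⁻¹ * ∮ s in C(0, 1),
        (s * Z 0 0 + Z 1 0) ^ a * (s * Z 0 1 + Z 1 1) ^ b * s ^ (-k) * s⁻¹) := by
    intro c c' a b a' b' k h
    have H : ∮ s in C(0, 1), (s * Z 0 0 + Z 1 0) ^ a' * (s * Z 0 1 + Z 1 1) ^ b' * s ^ (-k) * s⁻¹ =
        (∮ s in C(0, 1), c * ((s * Z 0 0 + Z 1 0) ^ a * (s * Z 0 1 + Z 1 1) ^ b *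
          s ^ (-(k - 1)) * s⁻¹)) +
        ∮ s in C(0, 1), c' * ((s * Z 0 0 + Z 1 0) ^ a * (s * Z 0 1 + Z 1 1) ^ b *
          s ^ (-k) * s⁻¹) := by
      rw [← circleIntegral.integral_add (hint _ _ _ _) (hint _ _ _ _)]
      refine circleIntegral.integral_congr zero_le_one fun s hs' => ?_
      have hs0 := hs s hs'
      have : s ^ (-(k - 1)) = s * s ^ (-k) := by
        rw [show -(k - 1) = 1 + -k by ring, zpow_add₀ hs0, zpow_one]
      simp only [h, this]
      ring
    rw [H, circleIntegral.integral_const_mul, circleIntegral.integral_const_mul]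
    ring
  induction a generalizing k with
  | zero =>
    induction b generalizing k with
    | zero =>
      rw [tt_zero]
      have e : (∮ s in C(0, 1), (s * Z 0 0 + Z 1 0) ^ 0 * (s * Z 0 1 + Z 1 1) ^ 0 * s ^ (-k) * s⁻¹)
          = ∮ s in C(0, 1), (s - 0) ^ (-k - 1) := by
        refine circleIntegral.integral_congr zero_le_one fun s hs' => ?_
        have hs0 := hs s hs'
        simp [zpow_sub₀ hs0, div_eq_mul_inv]
      rw [e]
      split_ifs with h
      · subst h
        have := circleIntegral.integral_sub_center_inv (0 : ℂ) (one_ne_zero (α := ℝ))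
        simp only [neg_zero, zero_sub, zpow_neg_one]
        rw [this]
        have : (Real.pi : ℂ) ≠ 0 := by exact_mod_cast Real.pi_ne_zero
        field_simp
      · rw [circleIntegral.integral_sub_zpow_of_ne (by omega)]; simp
    | succ b ih =>
      rw [tt_succ_right, ← ih, ← ih]
      exact key (Z 0 1) (Z 1 1) 0 b 0 (b + 1) k fun s => by ring
  | succ a ih =>
    rw [tt_succ_left, ← ih, ← ih]
    exact key (Z 0 0) (Z 1 0) a b (a + 1) b k fun s => by ring

/-- The hypotheses make the three rounded arguments in `tcoef` integers of the right sign, so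
rounding changes nothing. -/
theorem tcoef_eq_tt (l n m : ℚ) (Z : HC) (a b : ℕ) (k : ℤ) (ha : l - m = a) (hb : l + m = b)
    (hk : l - n = k) : tcoef l n m Z = tt Z a b k := by
  have h : ⌊n - l⌋ = -k := by
    rw [show n - l = ((-k : ℤ) : ℚ) by push_cast; linarith, Int.floor_intCast]
  rw [tcoef, ha, hb, h, Nat.floor_natCast, Nat.floor_natCast, circleIntegral_eq_tt]

/-! ### Moments of monomials over S³ by Gaussian integration -/

section SphereIntegrals

open MeasureTheory

/-- For p = q this is a Gamma integral. For p ≠ q the rotation by the angle π/(p - q) preserves the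
measure and reverses the sign of the integrand. -/
theorem integral_pow_mul_conj_pow_gaussian (p q : ℕ) :
    ∫ z : ℂ, z ^ p * conj z ^ q * (Real.exp (-‖z‖ ^ 2) : ℂ) =
      if p = q then (Real.pi : ℂ) * p.factorial else 0 := by
  split_ifs with h
  · subst h
    have h1 := Complex.integral_rpow_mul_exp_neg_rpow (p := 2) (q := 2 * p) (by norm_num)
      (by have : (0 : ℝ) ≤ p := Nat.cast_nonneg p
          linarith)
    rw [show ((2 * p + 2) / 2 : ℝ) = p + 1 by ring, Real.Gamma_nat_eq_factorial,
      show (2 * Real.pi / 2 : ℝ) = Real.pi by ring] at h1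
    have h2 : ∀ z : ℂ, z ^ p * conj z ^ p * (Real.exp (-‖z‖ ^ 2) : ℂ) =
        ((‖z‖ ^ (2 * (p : ℝ)) * Real.exp (-‖z‖ ^ (2 : ℝ)) : ℝ) : ℂ) := by
      intro z
      rw [← mul_pow, Complex.mul_conj, Complex.normSq_eq_norm_sq]
      have : ‖z‖ ^ (2 * (p : ℝ)) = (‖z‖ ^ 2) ^ p := by
        rw [← pow_mul, ← Real.rpow_natCast]; push_cast; rfl
      rw [this, Real.rpow_two]
      push_cast; rfl
    simp_rw [h2]
    rw [integral_complex_ofReal, h1]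
    push_cast; rfl
  · set c : Circle := Circle.exp (Real.pi / ((p : ℝ) - q)) with hc
    have hpq : ((p : ℂ) - q) ≠ 0 := sub_ne_zero.2 (by exact_mod_cast h)
    have hc1 : (c : ℂ) ^ p * conj (c : ℂ) ^ q = -1 := by
      rw [hc, Circle.coe_exp, ← Complex.exp_conj, ← Complex.exp_nat_mul, ← Complex.exp_nat_mul,
        ← Complex.exp_add, ← Complex.exp_pi_mul_I]
      congr 1
      simp
      field_simp
      ring
    have h1 := ((rotation c).measurePreserving).integral_comp
      (rotation c).toHomeomorph.measurableEmbedding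
      (fun z : ℂ => z ^ p * conj z ^ q * (Real.exp (-‖z‖ ^ 2) : ℂ))
    have h2 : ∀ z : ℂ, (rotation c z) ^ p * conj (rotation c z) ^ q *
        (Real.exp (-‖rotation c z‖ ^ 2) : ℂ) =
        (-1) * (z ^ p * conj z ^ q * (Real.exp (-‖z‖ ^ 2) : ℂ)) := by
      intro z
      rw [LinearIsometryEquiv.norm_map, rotation_apply, map_mul, mul_pow, mul_pow, ← hc1]
      ring
    simp_rw [h2] at h1
    rw [integral_const_mul] at h1
    linear_combination (-1 / 2 : ℂ) * h1

/-- A quaternion as a pair of complex numbers. -/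
def quatPair : EuclideanSpace ℝ (Fin 4) ≃ₗᵢ[ℝ] WithLp 2 (ℂ × ℂ) :=
  LinearIsometry.toLinearIsometryEquiv
    { toFun := fun x => WithLp.toLp 2
        ((x 0 : ℂ) - Complex.I * x 3, (x 2 : ℂ) - Complex.I * x 1)
      map_add' := by
        intro x y
        rw [← WithLp.toLp_add]
        congr 1
        ext <;> simp <;> ring
      map_smul' := by
        intro c x
        rw [RingHom.id_apply, ← WithLp.toLp_smul]
        congr 1
        ext <;> simp <;> ring
      norm_map' := by
        intro x
        rw [← sq_eq_sq₀ (norm_nonneg _) (norm_nonneg _)]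
        rw [WithLp.prod_norm_sq_eq_of_L2, EuclideanSpace.norm_sq_eq, Fin.sum_univ_four]
        simp only [LinearMap.coe_mk, AddHom.coe_mk, ← Complex.normSq_eq_norm_sq,
          Complex.normSq_apply]
        simp
        ring }
    (by
      rw [finrank_euclideanSpace_fin]
      have e : WithLp 2 (ℂ × ℂ) ≃ₗ[ℝ] ℂ × ℂ := WithLp.linearEquiv 2 ℝ (ℂ × ℂ)
      rw [e.finrank_eq, Module.finrank_prod, Complex.finrank_real_complex])

theorem quatPair_apply (x : EuclideanSpace ℝ (Fin 4)) : quatPair x =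
    WithLp.toLp 2 ((x 0 : ℂ) - Complex.I * x 3, (x 2 : ℂ) - Complex.I * x 1) := rfl

theorem integral_comp_quatPair (F : ℂ × ℂ → ℂ) :
    ∫ x : EuclideanSpace ℝ (Fin 4), F ((quatPair x).ofLp) = ∫ w : ℂ × ℂ, F w := by
  have h := (WithLp.volume_preserving_ofLp ℂ ℂ).comp quatPair.measurePreserving
  exact h.integral_comp ((MeasurableEquiv.toLp 2 (ℂ × ℂ)).symm.measurableEmbedding.comp
    quatPair.toHomeomorph.measurableEmbedding) F

/-- Polar coordinates: the radial integrand is r^(D+3) exp(-r²), whose integral is Γ((D+4)/2)/2.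
Sphere integrals are thereby reduced to Gaussian integrals, which factor over ℝ⁴ = ℂ². -/
theorem integral_gaussian_homogeneous (F : EuclideanSpace ℝ (Fin 4) → ℂ) (D : ℕ)
    (hF : ∀ r : ℝ, 0 < r → ∀ x, F (r • x) = (r : ℂ) ^ D * F x) :
    ∫ x : EuclideanSpace ℝ (Fin 4), F x * (Real.exp (-‖x‖ ^ 2) : ℂ) =
      (∫ x : Metric.sphere (0 : EuclideanSpace ℝ (Fin 4)) 1, F x ∂volume.toSphere) *
        ((Real.Gamma ((D + 4) / 2) / 2 : ℝ) : ℂ) := by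
  set μ : Measure (EuclideanSpace ℝ (Fin 4)) := volume
  set G : EuclideanSpace ℝ (Fin 4) → ℂ := fun x => F x * (Real.exp (-‖x‖ ^ 2) : ℂ) with hG
  have hdim : Module.finrank ℝ (EuclideanSpace ℝ (Fin 4)) - 1 = 3 := by
    rw [finrank_euclideanSpace_fin]
  calc
    ∫ x, G x ∂μ = ∫ x : ({(0)}ᶜ : Set (EuclideanSpace ℝ (Fin 4))), G x.1 ∂(μ.comap (↑)) := by
      rw [integral_subtype_comap (measurableSet_singleton _).compl fun x ↦ G x,
        restrict_compl_singleton]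
    _ = ∫ w : Metric.sphere (0 : EuclideanSpace ℝ (Fin 4)) 1 × Set.Ioi (0 : ℝ),
          F w.1 * ((w.2.1 ^ D * Real.exp (-w.2.1 ^ 2) : ℝ) : ℂ)
          ∂μ.toSphere.prod (.volumeIoiPow 3) := by
      have := μ.measurePreserving_homeomorphUnitSphereProd.integral_comp
        (Homeomorph.measurableEmbedding _) (fun w => F w.1 *
          ((w.2.1 ^ D * Real.exp (-w.2.1 ^ 2) : ℝ) : ℂ))
      rw [hdim] at this
      rw [← this]
      refine integral_congr_ae (Filter.Eventually.of_forall fun x => ?_)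
      have hx : (0 : ℝ) < ‖x.1‖ := norm_pos_iff.2 x.2
      have h1 := hF ‖x.1‖⁻¹ (inv_pos.2 hx) x.1
      simp only [hG, homeomorphUnitSphereProd_apply_snd_coe,
        homeomorphUnitSphereProd_apply_fst_coe, h1]
      push_cast
      have h3 : (‖x.1‖ : ℂ) ≠ 0 := by exact_mod_cast hx.ne'
      have h4 : (‖x.1‖ : ℂ)⁻¹ ^ D * (‖x.1‖ : ℂ) ^ D = 1 := by
        rw [← mul_pow, inv_mul_cancel₀ h3, one_pow]
      linear_combination -F x.1 * Complex.exp (-(‖x.1‖ : ℂ) ^ 2) * h4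
    _ = (∫ x : Metric.sphere (0 : EuclideanSpace ℝ (Fin 4)) 1, F x ∂μ.toSphere) *
          ∫ r : Set.Ioi (0 : ℝ), ((r.1 ^ D * Real.exp (-r.1 ^ 2) : ℝ) : ℂ)
            ∂.volumeIoiPow 3 :=
      integral_prod_mul (fun x : Metric.sphere (0 : EuclideanSpace ℝ (Fin 4)) 1 => F x)
        (fun r : Set.Ioi (0 : ℝ) => ((r.1 ^ D * Real.exp (-r.1 ^ 2) : ℝ) : ℂ))
    _ = _ := by
      congr 1
      rw [integral_complex_ofReal]
      congr 1
      simp only [Measure.volumeIoiPow, ENNReal.ofReal]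
      have h2 := integral_rpow_mul_exp_neg_rpow (p := 2) (q := D + 3) (by norm_num)
        (by have : (0 : ℝ) ≤ D := Nat.cast_nonneg D
            linarith)
      rw [integral_withDensity_eq_integral_smul,
        integral_subtype_comap measurableSet_Ioi fun a : ℝ ↦ Real.toNNReal (a ^ 3) •
          (a ^ D * Real.exp (-a ^ 2)),
        show (Real.Gamma ((D + 4) / 2) / 2 : ℝ) = 1 / 2 * Real.Gamma ((D + 3 + 1) / 2) by
          rw [show ((D : ℝ) + 3 + 1) = D + 4 by ring]; ring, ← h2]
      · refine setIntegral_congr_fun measurableSet_Ioi fun x hx ↦ ?_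
        have hx' : 0 < x := hx
        simp only [NNReal.smul_def, Real.coe_toNNReal _ (pow_nonneg hx'.le _), smul_eq_mul]
        rw [show ((D : ℝ) + 3) = ((D + 3 : ℕ) : ℝ) by push_cast; ring, Real.rpow_natCast,
          Real.rpow_two]
        ring
      · exact (measurable_subtype_coe.pow_const _).real_toNNReal

/-- Integration of polynomials in the entries over the sphere. -/
def sphereInt (P : MvPolynomial (Fin 2 × Fin 2) ℂ) : ℂ :=
  ∫ x : Metric.sphere (0 : EuclideanSpace ℝ (Fin 4)) 1,
    MvPolynomial.eval (fun p => quat x.1 p.1 p.2) P ∂volume.toSphere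

theorem continuous_quat (i j : Fin 2) :
    Continuous fun x : EuclideanSpace ℝ (Fin 4) => quat x i j := by
  fin_cases i <;> fin_cases j <;> simp [quat] <;> fun_prop

theorem integrable_eval_quat (P : MvPolynomial (Fin 2 × Fin 2) ℂ) :
    Integrable (fun x : Metric.sphere (0 : EuclideanSpace ℝ (Fin 4)) 1 =>
      MvPolynomial.eval (fun p => quat x.1 p.1 p.2) P) volume.toSphere := by
  have hc : Continuous fun x : Metric.sphere (0 : EuclideanSpace ℝ (Fin 4)) 1 =>
      MvPolynomial.eval (fun p => quat x.1 p.1 p.2) P := by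
    refine (MvPolynomial.continuous_eval P).comp ?_
    exact continuous_pi fun p => (continuous_quat p.1 p.2).comp continuous_subtype_val
  exact hc.integrable_of_hasCompactSupport (HasCompactSupport.of_compactSpace _)

theorem sphereInt_add (P Q : MvPolynomial (Fin 2 × Fin 2) ℂ) :
    sphereInt (P + Q) = sphereInt P + sphereInt Q := by
  simp only [sphereInt, map_add]
  exact integral_add (integrable_eval_quat P) (integrable_eval_quat Q)

theorem sphereInt_smul (c : ℂ) (P : MvPolynomial (Fin 2 × Fin 2) ℂ) :
    sphereInt (c • P) = c * sphereInt P := by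
  simp only [sphereInt, MvPolynomial.smul_eval]
  exact integral_const_mul c _

/-- Under ℝ⁴ = ℂ² the entries are z₁₁ = w₁, z₂₂ = conj w₁, z₂₁ = w₂, z₁₂ = -conj w₂; the last gives
the sign. The Gaussian integral is a product of two plane integrals, and the radial factor is (p + q
+ 1)!/2 when p = p' and q = q'. -/
theorem sphereInt_moment (p p' q q' : ℕ) :
    ∫ x : Metric.sphere (0 : EuclideanSpace ℝ (Fin 4)) 1,
      quat x.1 0 0 ^ p * quat x.1 1 1 ^ p' * quat x.1 1 0 ^ q * quat x.1 0 1 ^ q'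
        ∂volume.toSphere =
      if p = p' ∧ q = q' then
        (-1) ^ q * (2 * (Real.pi : ℂ) ^ 2 * p.factorial * q.factorial) / (p + q + 1).factorial
      else 0 := by
  have h1 := integral_gaussian_homogeneous (fun x =>
    quat x 0 0 ^ p * quat x 1 1 ^ p' * quat x 1 0 ^ q * quat x 0 1 ^ q') (p + p' + q + q') (by
      intro r _ x
      have hq : ∀ i j, quat (r • x) i j = r * quat x i j := by
        intro i j
        fin_cases i <;> fin_cases j <;> simp [quat] <;> ring
      simp only [hq]
      ring)
  let F : ℂ × ℂ → ℂ := fun w => (w.1 ^ p * conj w.1 ^ p' * (Real.exp (-‖w.1‖ ^ 2) : ℂ)) *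
    ((-1) ^ q' * (w.2 ^ q * conj w.2 ^ q' * (Real.exp (-‖w.2‖ ^ 2) : ℂ)))
  have h2 : ∀ x : EuclideanSpace ℝ (Fin 4),
      quat x 0 0 ^ p * quat x 1 1 ^ p' * quat x 1 0 ^ q * quat x 0 1 ^ q' *
        (Real.exp (-‖x‖ ^ 2) : ℂ) =
      F ((quatPair x).ofLp) := by
    intro x
    have e1 : ‖x‖ ^ 2 = ‖(quatPair x).ofLp.1‖ ^ 2 + ‖(quatPair x).ofLp.2‖ ^ 2 := by
      rw [← quatPair.norm_map x, WithLp.prod_norm_sq_eq_of_L2]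
      rfl
    have e2 : quat x 0 0 = (quatPair x).ofLp.1 := by simp [quat, quatPair_apply]
    have e3 : quat x 1 1 = conj (quatPair x).ofLp.1 := by
      simp [quat, quatPair_apply]
    have e4 : quat x 1 0 = (quatPair x).ofLp.2 := by simp [quat, quatPair_apply]; ring
    have e5 : quat x 0 1 = -conj (quatPair x).ofLp.2 := by
      simp [quat, quatPair_apply]; ring
    simp only [F]
    rw [e2, e3, e4, e5, e1, neg_add, Real.exp_add, neg_pow (conj _)]
    push_cast
    ring
  have h2' := (integral_congr_ae (μ := volume) (Filter.Eventually.of_forall h2)).trans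
    (integral_comp_quatPair F)
  rw [h1] at h2'
  replace h1 := h2'.symm
  have h3 := integral_prod_mul (μ := (volume : Measure ℂ)) (ν := (volume : Measure ℂ))
    (fun w : ℂ => w ^ p * conj w ^ p' * (Real.exp (-‖w‖ ^ 2) : ℂ))
    (fun w : ℂ => (-1) ^ q' * (w ^ q * conj w ^ q' * (Real.exp (-‖w‖ ^ 2) : ℂ)))
  rw [Measure.volume_eq_prod, h3, integral_const_mul, integral_pow_mul_conj_pow_gaussian,
    integral_pow_mul_conj_pow_gaussian] at h1
  have hG : ((Real.Gamma (((p + p' + q + q' : ℕ) + 4) / 2) / 2 : ℝ) : ℂ) ≠ 0 := by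
    have : 0 < Real.Gamma (((p + p' + q + q' : ℕ) + 4) / 2) / 2 := by
      have := Real.Gamma_pos_of_pos (s := ((p + p' + q + q' : ℕ) + 4) / 2) (by positivity)
      positivity
    exact_mod_cast this.ne'
  split_ifs with h
  · obtain ⟨rfl, rfl⟩ := h
    rw [if_pos rfl, if_pos rfl, show ((p + p + q + q : ℕ) + 4 : ℝ) / 2 = ((p + q + 1 : ℕ) : ℝ) + 1
      by push_cast; ring, Real.Gamma_nat_eq_factorial] at h1
    have hf : ((p + q + 1).factorial : ℂ) ≠ 0 := by exact_mod_cast Nat.factorial_ne_zero _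
    rw [eq_div_iff hf]
    push_cast at h1
    linear_combination -2 * h1
  · have : ¬ (p = p') ∨ ¬ (q = q') := by tauto
    rcases this with h' | h'
    · rw [if_neg h', zero_mul] at h1
      exact (mul_eq_zero.1 h1.symm).resolve_right hG
    · rw [if_neg h', mul_zero, mul_zero] at h1
      exact (mul_eq_zero.1 h1.symm).resolve_right hG

end SphereIntegrals

theorem derivation_tt {A : Type*} [CommRing A] [Algebra ℂ A] (D : Derivation ℂ A A)
    (Z : Matrix (Fin 2) (Fin 2) A) (a b : ℕ) (k : ℤ) :
    D (tt Z a b k) =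
      a * (D (Z 0 0) * tt Z (a - 1) b (k - 1) + D (Z 1 0) * tt Z (a - 1) b k) +
      b * (D (Z 0 1) * tt Z a (b - 1) (k - 1) + D (Z 1 1) * tt Z a (b - 1) k) := by
  induction a generalizing k with
  | zero =>
    induction b generalizing k with
    | zero =>
      rw [tt_zero]
      split_ifs <;> simp
    | succ b ih =>
      rw [tt_succ_right, map_add, Derivation.leibniz, Derivation.leibniz, ih, ih]
      simp only [smul_eq_mul, Nat.add_sub_cancel]
      have h1 := right_mul_tt Z 0 b k
      have h2 := right_mul_tt Z 0 b (k - 1)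
      push_cast
      linear_combination -D (Z 1 1) * h1 - D (Z 0 1) * h2
  | succ a ih =>
    rw [tt_succ_left, map_add, Derivation.leibniz, Derivation.leibniz, ih, ih]
    simp only [smul_eq_mul, Nat.add_sub_cancel]
    have h1 := left_mul_tt Z a b k
    have h2 := left_mul_tt Z a b (k - 1)
    have h3 := tt_succ_left Z a (b - 1) k
    have h4 := tt_succ_left Z a (b - 1) (k - 1)
    push_cast
    linear_combination -D (Z 1 0) * h1 - D (Z 0 0) * h2 - b * D (Z 1 1) * h3
      - b * D (Z 0 1) * h4

/-- The reciprocal factorial, zero at negative integers. -/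
def ifac (k : ℤ) : ℂ := if k < 0 then 0 else ((k.toNat.factorial : ℕ) : ℂ)⁻¹

theorem ifac_natCast (k : ℕ) : ifac k = ((k.factorial : ℕ) : ℂ)⁻¹ := by
  simp [ifac]

theorem ifac_of_neg {k : ℤ} (hk : k < 0) : ifac k = 0 := if_pos hk

/-- The value zero at negative integers makes the recursion valid for every integer, so norm
identities need no boundary cases. -/
theorem ifac_pred (k : ℤ) : ifac (k - 1) = k * ifac k := by
  rcases lt_trichotomy k 0 with h | h | h
  · rw [ifac_of_neg h, ifac_of_neg (by omega), mul_zero]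
  · subst h; rw [ifac_of_neg (by omega)]; simp
  · obtain ⟨n, rfl⟩ : ∃ n : ℕ, k = (n + 1 : ℕ) := ⟨k.toNat - 1, by omega⟩
    rw [show ((n + 1 : ℕ) : ℤ) - 1 = n by push_cast; ring, ifac_natCast, ifac_natCast,
      Nat.factorial_succ]
    have : (n.factorial : ℂ) ≠ 0 := by exact_mod_cast Nat.factorial_ne_zero n
    have : (n + 1 : ℂ) ≠ 0 := by exact_mod_cast Nat.succ_ne_zero n
    push_cast
    field_simp

/-! ### Schur orthogonality on S³ -/

section SphereOrthogonality

open MvPolynomial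

/-- The matrix of the coordinates. -/
def Zx : Matrix (Fin 2) (Fin 2) (MvPolynomial (Fin 2 × Fin 2) ℂ) := fun i j => X (i, j)

theorem eval_tt_Zx (Z : HC) (a b : ℕ) (k : ℤ) :
    eval (fun p => Z p.1 p.2) (tt Zx a b k) = tt Z a b k := by
  rw [map_tt]
  congr 1
  ext i j
  simp [Zx]

theorem sphereInt_monomial (p p' q q' : ℕ) :
    sphereInt (Zx 0 0 ^ p * Zx 1 1 ^ p' * Zx 1 0 ^ q * Zx 0 1 ^ q') =
      if p = p' ∧ q = q' then
        (-1) ^ q * (2 * (Real.pi : ℂ) ^ 2 * p.factorial * q.factorial) / (p + q + 1).factorial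
      else 0 := by
  rw [← sphereInt_moment, sphereInt]
  simp [Zx]

theorem sphereInt_comp_eq_zero (D : MvPolynomial (Fin 2 × Fin 2) ℂ →ₗ[ℂ]
    MvPolynomial (Fin 2 × Fin 2) ℂ)
    (h : ∀ p p' q q', sphereInt (D (Zx 0 0 ^ p * Zx 1 1 ^ p' * Zx 1 0 ^ q * Zx 0 1 ^ q')) = 0)
    (P : MvPolynomial (Fin 2 × Fin 2) ℂ) : sphereInt (D P) = 0 := by
  induction P using MvPolynomial.induction_on' with
  | monomial s c =>
    have e : monomial s c = c • (Zx 0 0 ^ s (0, 0) * Zx 1 1 ^ s (1, 1) * Zx 1 0 ^ s (1, 0) *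
        Zx 0 1 ^ s (0, 1)) := by
      rw [monomial_eq, Finsupp.prod_fintype _ _ (by simp), Fintype.prod_prod_type, smul_eq_C_mul]
      simp only [Fin.prod_univ_two, Zx]
      ring
    rw [e, map_smul, sphereInt_smul, h, mul_zero]
  | add p q hp hq => rw [map_add, sphereInt_add, hp, hq, add_zero]

/-- The derivation with prescribed values on the coordinates. -/
def coordDerivation (f : Fin 2 × Fin 2 → MvPolynomial (Fin 2 × Fin 2) ℂ) :
    Derivation ℂ (MvPolynomial (Fin 2 × Fin 2) ℂ) (MvPolynomial (Fin 2 × Fin 2) ℂ) :=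
  mkDerivation ℂ f

theorem coordDerivation_Zx (f : Fin 2 × Fin 2 → MvPolynomial (Fin 2 × Fin 2) ℂ) (i j : Fin 2) :
    coordDerivation f (Zx i j) = f (i, j) := mkDerivation_X ℂ f (i, j)

theorem derivation_monomial {A : Type*} [CommRing A] [Algebra ℂ A] (D : Derivation ℂ A A)
    (w x y z : A) (p p' q q' : ℕ) :
    D (w ^ p * x ^ p' * y ^ q * z ^ q') =
      (p : ℂ) • (w ^ (p - 1) * x ^ p' * y ^ q * z ^ q' * D w) +
      (p' : ℂ) • (w ^ p * x ^ (p' - 1) * y ^ q * z ^ q' * D x) +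
      (q : ℂ) • (w ^ p * x ^ p' * y ^ (q - 1) * z ^ q' * D y) +
      (q' : ℂ) • (w ^ p * x ^ p' * y ^ q * z ^ (q' - 1) * D z) := by
  simp only [Derivation.leibniz, Derivation.leibniz_pow, smul_eq_mul, nsmul_eq_mul,
    Nat.cast_smul_eq_nsmul]
  ring

/-- Infinitesimal invariance of the surface measure under left multiplication by the diagonal torus.
On monomials the derivation is a scalar, which is zero whenever the moment is not. The column
version is invariance under right multiplication. -/
theorem sphereInt_rowWeight (P : MvPolynomial (Fin 2 × Fin 2) ℂ) :
    sphereInt (coordDerivation (fun p => if p.1 = 0 then Zx 0 p.2 else -Zx 1 p.2) P) = 0 := by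
  refine sphereInt_comp_eq_zero
    (coordDerivation (fun p => if p.1 = 0 then Zx 0 p.2 else -Zx 1 p.2)).toLinearMap ?_ P
  intro p p' q q'
  have e : (coordDerivation (fun p => if p.1 = 0 then Zx 0 p.2 else -Zx 1 p.2))
      (Zx 0 0 ^ p * Zx 1 1 ^ p' * Zx 1 0 ^ q * Zx 0 1 ^ q') =
      ((p : ℂ) - p' - q + q') • (Zx 0 0 ^ p * Zx 1 1 ^ p' * Zx 1 0 ^ q * Zx 0 1 ^ q') := by
    rw [derivation_monomial]
    simp only [coordDerivation_Zx, smul_eq_C_mul, map_add, map_sub, if_true, one_ne_zero, if_false]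
    rcases p with _ | p <;> rcases p' with _ | p' <;> rcases q with _ | q <;>
      rcases q' with _ | q' <;> simp [pow_succ] <;> ring
  rw [Derivation.coeFn_coe, e, sphereInt_smul, sphereInt_monomial]
  split_ifs with h
  · obtain ⟨rfl, rfl⟩ := h; ring
  · ring

theorem sphereInt_colWeight (P : MvPolynomial (Fin 2 × Fin 2) ℂ) :
    sphereInt (coordDerivation (fun p => if p.2 = 0 then Zx p.1 0 else -Zx p.1 1) P) = 0 := by
  refine sphereInt_comp_eq_zero
    (coordDerivation (fun p => if p.2 = 0 then Zx p.1 0 else -Zx p.1 1)).toLinearMap ?_ P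
  intro p p' q q'
  have e : (coordDerivation (fun p => if p.2 = 0 then Zx p.1 0 else -Zx p.1 1))
      (Zx 0 0 ^ p * Zx 1 1 ^ p' * Zx 1 0 ^ q * Zx 0 1 ^ q') =
      ((p : ℂ) - p' + q - q') • (Zx 0 0 ^ p * Zx 1 1 ^ p' * Zx 1 0 ^ q * Zx 0 1 ^ q') := by
    rw [derivation_monomial]
    simp only [coordDerivation_Zx, smul_eq_C_mul, map_add, map_sub, if_true, one_ne_zero, if_false]
    rcases p with _ | p <;> rcases p' with _ | p' <;> rcases q with _ | q <;>
      rcases q' with _ | q' <;> simp [pow_succ] <;> ring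
  rw [Derivation.coeFn_coe, e, sphereInt_smul, sphereInt_monomial]
  split_ifs with h
  · obtain ⟨rfl, rfl⟩ := h; ring
  · ring

/-- The derivation `z₂₁ ∂₁₁ + z₂₂ ∂₁₂`. -/
def rowLower : Derivation ℂ (MvPolynomial (Fin 2 × Fin 2) ℂ) (MvPolynomial (Fin 2 × Fin 2) ℂ) :=
  coordDerivation (fun p => if p.1 = 0 then Zx 1 p.2 else 0)

/-- Infinitesimal invariance under a nilpotent element of the complexified SU(2). The image of a
monomial has two terms, whose moments cancel because they differ by one in the power of -1. -/
theorem sphereInt_rowLower (P : MvPolynomial (Fin 2 × Fin 2) ℂ) : sphereInt (rowLower P) = 0 := by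
  refine sphereInt_comp_eq_zero rowLower.toLinearMap ?_ P
  intro p p' q q'
  have e : rowLower (Zx 0 0 ^ p * Zx 1 1 ^ p' * Zx 1 0 ^ q * Zx 0 1 ^ q') =
      (p : ℂ) • (Zx 0 0 ^ (p - 1) * Zx 1 1 ^ p' * Zx 1 0 ^ (q + 1) * Zx 0 1 ^ q') +
      (q' : ℂ) • (Zx 0 0 ^ p * Zx 1 1 ^ (p' + 1) * Zx 1 0 ^ q * Zx 0 1 ^ (q' - 1)) := by
    rw [derivation_monomial]
    simp only [rowLower, coordDerivation_Zx, if_true, one_ne_zero, if_false, mul_zero, smul_zero,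
      add_zero]
    simp only [smul_eq_C_mul]
    ring
  rw [Derivation.coeFn_coe, e, sphereInt_add, sphereInt_smul, sphereInt_smul, sphereInt_monomial,
    sphereInt_monomial]
  rcases p with _ | p <;> rcases q' with _ | q'
  · simp
  · simp
  · simp
  · simp only [Nat.add_sub_cancel]
    by_cases h : p = p' ∧ q = q'
    · obtain ⟨rfl, rfl⟩ := h
      have hf : ((p + q + 2).factorial : ℂ) ≠ 0 := by exact_mod_cast Nat.factorial_ne_zero _
      simp only [and_self, if_true, Nat.factorial_succ,
        show p + (q + 1) + 1 = p + q + 2 by ring, show p + 1 + q + 1 = p + q + 2 by ring]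
      field_simp
      push_cast
      ring
    · rw [if_neg (by omega), if_neg (by omega)]; simp

theorem rowLower_tt (a b : ℕ) (k : ℤ) :
    rowLower (tt Zx a b k) = ((a : ℂ) + b - k + 1) • tt Zx a b (k - 1) := by
  have h := coindex_mul_tt Zx a b (k - 1)
  rw [derivation_tt]
  simp only [rowLower, coordDerivation_Zx, if_true, one_ne_zero, if_false, smul_eq_C_mul]
  simp only [map_add, map_sub, map_natCast, map_one, map_intCast]
  push_cast at h ⊢
  linear_combination -h

/-- Integration by parts for `rowLower`: one index goes down while the other goes up. -/
theorem sphereInt_tt_rowLower (a' b' a b : ℕ) (j k : ℤ) :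
    ((a : ℂ) + b - k) * sphereInt (tt Zx a' b' j * tt Zx a b k) =
      -((a' : ℂ) + b' - j + 1) * sphereInt (tt Zx a' b' (j - 1) * tt Zx a b (k + 1)) := by
  have h := sphereInt_rowLower (tt Zx a' b' j * tt Zx a b (k + 1))
  rw [Derivation.leibniz, rowLower_tt, rowLower_tt, smul_eq_mul, smul_eq_mul, mul_smul_comm,
    mul_smul_comm, sphereInt_add, sphereInt_smul, sphereInt_smul, add_sub_cancel_right,
    mul_comm (tt Zx a b (k + 1))] at h
  push_cast at h
  linear_combination h

/-- A product of weight vectors of total weight different from zero integrates to zero; the next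
lemma does the same with the weights of the columns. -/
theorem sphereInt_tt_row (a' b' a b : ℕ) (j k : ℤ) (h : 2 * j + 2 * k ≠ a + b + a' + b') :
    sphereInt (tt Zx a' b' j * tt Zx a b k) = 0 := by
  have hw : ∀ (a b : ℕ) (k : ℤ),
      coordDerivation (fun p => if p.1 = 0 then Zx 0 p.2 else -Zx 1 p.2) (tt Zx a b k) =
        ((2 : ℂ) * k - a - b) • tt Zx a b k := by
    intro a b k
    have h1 := index_mul_tt Zx a b k
    have h2 := coindex_mul_tt Zx a b k
    rw [derivation_tt]
    simp only [coordDerivation_Zx, if_true, one_ne_zero, if_false, smul_eq_C_mul]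
    simp only [map_sub, map_natCast, map_mul, map_ofNat, map_intCast]
    linear_combination -h1 + h2
  have h1 := sphereInt_rowWeight (tt Zx a' b' j * tt Zx a b k)
  rw [Derivation.leibniz, hw, hw, smul_eq_mul, smul_eq_mul, mul_smul_comm, mul_smul_comm,
    sphereInt_add, sphereInt_smul, sphereInt_smul, mul_comm (tt Zx a b k), ← add_mul] at h1
  refine (mul_eq_zero.1 h1).resolve_left fun h2 => h ?_
  have h3 : ((2 * j + 2 * k : ℤ) : ℂ) = ((a + b + a' + b' : ℤ) : ℂ) := by
    push_cast; linear_combination h2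
  exact_mod_cast h3

theorem sphereInt_tt_col (a' b' a b : ℕ) (j k : ℤ) (h : a' + a ≠ b' + b) :
    sphereInt (tt Zx a' b' j * tt Zx a b k) = 0 := by
  have hw : ∀ (a b : ℕ) (k : ℤ),
      coordDerivation (fun p => if p.2 = 0 then Zx p.1 0 else -Zx p.1 1) (tt Zx a b k) =
        ((a : ℂ) - b) • tt Zx a b k := by
    intro a b k
    have h1 := left_mul_tt Zx a b k
    have h2 := right_mul_tt Zx a b k
    rw [derivation_tt]
    simp only [coordDerivation_Zx, if_true, one_ne_zero, if_false, smul_eq_C_mul]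
    simp only [map_sub, map_natCast]
    linear_combination -h1 + h2
  have h1 := sphereInt_colWeight (tt Zx a' b' j * tt Zx a b k)
  rw [Derivation.leibniz, hw, hw, smul_eq_mul, smul_eq_mul, mul_smul_comm, mul_smul_comm,
    sphereInt_add, sphereInt_smul, sphereInt_smul, mul_comm (tt Zx a b k), ← add_mul] at h1
  refine (mul_eq_zero.1 h1).resolve_left fun h2 => h ?_
  have h3 : ((a' + a : ℕ) : ℂ) = ((b' + b : ℕ) : ℂ) := by
    push_cast; linear_combination h2
  exact_mod_cast h3

/-- Integration by parts lowers j until the first factor vanishes. The coefficient a + b - k divided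
by on the way is non-zero: the weight condition 2j + 2k = a + b + a' + b' and the smaller degree of
the first factor give k < a + b. -/
theorem sphereInt_tt_of_lt (a' b' a b : ℕ) (hd : a' + b' < a + b) (j k : ℤ) :
    sphereInt (tt Zx a' b' j * tt Zx a b k) = 0 := by
  by_cases hw : 2 * j + 2 * k = a + b + a' + b'
  swap
  · exact sphereInt_tt_row _ _ _ _ _ _ hw
  rcases lt_or_ge j 0 with hj | hj
  · rw [tt_of_neg _ _ _ _ hj, zero_mul]; simp [sphereInt]
  lift j to ℕ using hj
  induction j generalizing k with
  | zero =>
    have h := sphereInt_tt_rowLower a' b' a b 0 k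
    rw [tt_of_neg Zx a' b' (0 - 1) (by omega), zero_mul] at h
    have hz : sphereInt 0 = 0 := by simp [sphereInt]
    rw [hz, mul_zero] at h
    refine (mul_eq_zero.1 h).resolve_left fun h2 => ?_
    have h3 : ((a + b : ℤ) : ℂ) = (k : ℂ) := by push_cast; linear_combination h2
    have h4 : (a + b : ℤ) = k := by exact_mod_cast h3
    push_cast at hw; omega
  | succ j ih =>
    have h := sphereInt_tt_rowLower a' b' a b (j + 1 : ℕ) k
    rw [show ((j + 1 : ℕ) : ℤ) - 1 = j by push_cast; ring,
      ih (k + 1) (by push_cast at hw ⊢; omega), mul_zero] at h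
    refine (mul_eq_zero.1 h).resolve_left fun h2 => ?_
    have h3 : ((a + b : ℤ) : ℂ) = (k : ℂ) := by push_cast; linear_combination h2
    have h4 : (a + b : ℤ) = k := by exact_mod_cast h3
    push_cast at hw; omega

theorem tt_bot {A : Type*} [CommRing A] (Z : Matrix (Fin 2) (Fin 2) A) (a b : ℕ) :
    tt Z a b 0 = Z 1 0 ^ a * Z 1 1 ^ b := by
  induction a with
  | zero =>
    induction b with
    | zero => simp [tt_zero]
    | succ b ih => rw [tt_succ_right, ih, tt_of_neg _ _ _ _ (by omega)]; ring
  | succ a ih => rw [tt_succ_left, ih, tt_of_neg _ _ _ _ (by omega)]; ring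

theorem tt_top {A : Type*} [CommRing A] (Z : Matrix (Fin 2) (Fin 2) A) (a b : ℕ) :
    tt Z a b (a + b) = Z 0 0 ^ a * Z 0 1 ^ b := by
  induction a with
  | zero =>
    induction b with
    | zero => simp [tt_zero]
    | succ b ih =>
      rw [tt_succ_right, tt_of_gt _ _ _ (((0 : ℕ) : ℤ) + ((b + 1 : ℕ) : ℤ)) (by push_cast; omega),
        show ((0 : ℕ) : ℤ) + ((b + 1 : ℕ) : ℤ) - 1 = ((0 : ℕ) : ℤ) + b by push_cast; ring, ih]
      ring
  | succ a ih =>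
    rw [tt_succ_left, tt_of_gt _ _ _ (((a + 1 : ℕ) : ℤ) + b) (by push_cast; omega),
      show ((a + 1 : ℕ) : ℤ) + b - 1 = (a : ℤ) + b by push_cast; ring, ih]
    ring

/-- At j = 0 both factors are extreme coefficients and the product is one monomial, whose moment is
known; integration by parts increases j. -/
theorem sphereInt_tt_self (a b j : ℕ) :
    sphereInt (tt Zx b a j * tt Zx a b (a + b - j)) =
      (-1) ^ (b + j) * (2 * (Real.pi : ℂ) ^ 2 * a.factorial * b.factorial * ifac j *
        ifac (a + b - j)) / (a + b + 1) := by
  have hd : (a + b + 1 : ℂ) ≠ 0 := by exact_mod_cast Nat.succ_ne_zero (a + b)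
  induction j with
  | zero =>
    have h := sphereInt_monomial a a b b
    rw [if_pos ⟨rfl, rfl⟩] at h
    rw [Nat.cast_zero, sub_zero, tt_bot, tt_top,
      show Zx 1 0 ^ b * Zx 1 1 ^ a * (Zx 0 0 ^ a * Zx 0 1 ^ b) =
        Zx 0 0 ^ a * Zx 1 1 ^ a * Zx 1 0 ^ b * Zx 0 1 ^ b by ring, h,
      show (a + b : ℤ) = ((a + b : ℕ) : ℤ) by push_cast; rfl, ifac_natCast,
      show (0 : ℤ) = ((0 : ℕ) : ℤ) by rfl, ifac_natCast, Nat.factorial_succ]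
    have : ((a + b).factorial : ℂ) ≠ 0 := by exact_mod_cast Nat.factorial_ne_zero _
    push_cast
    rw [Nat.factorial_zero, Nat.cast_one]
    field_simp
    simp
    ring
  | succ j ih =>
    have h := sphereInt_tt_rowLower b a a b (j + 1 : ℕ) (a + b - (j + 1 : ℕ))
    have e1 := ifac_pred (j + 1 : ℕ)
    have e2 := ifac_pred (a + b - j)
    rw [show ((j + 1 : ℕ) : ℤ) - 1 = j by push_cast; ring] at h e1
    rw [show (a + b - (j + 1 : ℕ) + 1 : ℤ) = a + b - j by push_cast; ring, ih] at h
    rw [show (a + b - (j : ℤ)) - 1 = a + b - (j + 1 : ℕ) by push_cast; ring] at e2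
    have hj : (j + 1 : ℂ) ≠ 0 := by exact_mod_cast Nat.succ_ne_zero j
    have e1' : ifac j = (j + 1) * ifac (j + 1 : ℕ) := by rw [e1]; push_cast; ring
    rw [e2]
    rw [e1'] at h
    push_cast at h ⊢
    refine mul_left_cancel₀ hj ?_
    rw [show (j + 1 : ℂ) * sphereInt (tt Zx b a (j + 1) * tt Zx a b (a + b - (j + 1))) =
      (a + b - (a + b - (j + 1)) : ℂ) * sphereInt (tt Zx b a (j + 1) *
        tt Zx a b (a + b - (j + 1))) by ring, h]
    field_simp
    ring

/-- After conjugation the integrand is a product of two coefficients. Different total degrees give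
zero by `sphereInt_tt_of_lt`; for equal degrees the column weights separate the pairs (a, b) and the
row weights separate k. -/
theorem integral_conj_tt_mul_tt (a' b' a b : ℕ) (k' k : ℤ) :
    ∫ x : Metric.sphere (0 : EuclideanSpace ℝ (Fin 4)) 1,
      conj (tt (quat x.1) a' b' k') * tt (quat x.1) a b k ∂MeasureTheory.volume.toSphere =
    if a' = a ∧ b' = b ∧ k' = k then
      2 * (Real.pi : ℂ) ^ 2 * (a.factorial * b.factorial * ifac k * ifac (a + b - k)) /
        (a + b + 1)
    else 0 := by
  have h1 : ∫ x : Metric.sphere (0 : EuclideanSpace ℝ (Fin 4)) 1,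
      conj (tt (quat x.1) a' b' k') * tt (quat x.1) a b k ∂MeasureTheory.volume.toSphere =
      (-1) ^ a' * sg ℂ k' * sphereInt (tt Zx b' a' (a' + b' - k') * tt Zx a b k) := by
    rw [sphereInt, ← MeasureTheory.integral_const_mul]
    refine MeasureTheory.integral_congr_ae (Filter.Eventually.of_forall fun x => ?_)
    simp only [conj_tt_quat, map_mul, eval_tt_Zx]
    ring
  have hz : sphereInt 0 = 0 := by simp [sphereInt]
  rw [h1]
  split_ifs with h
  · obtain ⟨rfl, rfl, rfl⟩ := h
    rcases lt_or_ge k' 0 with hk | hk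
    · rw [tt_of_neg _ a' b' k' hk, ifac_of_neg hk, mul_zero, hz]; simp
    rcases lt_or_ge (a' + b' - k') 0 with hk2 | hk2
    · rw [tt_of_neg _ b' a' _ hk2, ifac_of_neg hk2, zero_mul, hz]; simp
    lift k' to ℕ using hk
    obtain ⟨j, hj⟩ : ∃ j : ℕ, (a' + b' - k' : ℤ) = j := ⟨(a' + b' - k' : ℤ).toNat, by omega⟩
    have h2 := sphereInt_tt_self a' b' j
    rw [show (a' + b' - j : ℤ) = k' by omega] at h2
    have h3 : (-1 : ℂ) ^ a' * (-1) ^ k' * (-1) ^ (b' + j) = 1 := by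
      rw [← pow_add, ← pow_add]
      exact Even.neg_one_pow ⟨a' + b', by omega⟩
    rw [hj, h2, sg_natCast]
    linear_combination (2 * (Real.pi : ℂ) ^ 2 * (a'.factorial * b'.factorial * ifac k' * ifac j) /
        (a' + b' + 1)) * h3
  · have : sphereInt (tt Zx b' a' (a' + b' - k') * tt Zx a b k) = 0 := by
      rcases lt_trichotomy (b' + a') (a + b) with hd | hd | hd
      · exact sphereInt_tt_of_lt _ _ _ _ hd _ _
      · by_cases hc : b' + a = a' + b
        · refine sphereInt_tt_row _ _ _ _ _ _ ?_
          omega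
        · exact sphereInt_tt_col _ _ _ _ _ _ hc
      · rw [mul_comm]
        exact sphereInt_tt_of_lt _ _ _ _ hd _ _
    rw [this, mul_zero]

end SphereOrthogonality

/-! ### The Laurent algebra and its derivations -/

theorem IsLaurent.mul {f g : HCx → ℂ} (hf : IsLaurent f) (hg : IsLaurent g) :
    IsLaurent (fun Z => f Z * g Z) := by
  obtain ⟨P, k, hP⟩ := hf
  obtain ⟨Q, l, hQ⟩ := hg
  refine ⟨P * Q, k + l, fun Z => ?_⟩
  beta_reduce
  rw [hP, hQ, map_mul, pow_add, div_mul_div_comm]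

/-- The algebra `ℂ[z₁₁, z₁₂, z₂₁, z₂₂, N(Z)⁻¹]`. -/
def LA : Subalgebra ℂ (HCx → ℂ) where
  carrier := {f | IsLaurent f}
  mul_mem' hf hg := hf.mul hg
  add_mem' hf hg := hf.add hg
  algebraMap_mem' c := ⟨MvPolynomial.C c, 0, fun Z => by simp⟩

theorem ext_mk {V : Type} [Zero V] (f : HCx → V) (Z : HCx) : ext f Z.1 = f Z := by
  rw [ext, dif_pos Z.2]

theorem ext_of_ne {V : Type} [Zero V] (f : HCx → V) {Z : HC} (h : Z.det ≠ 0) :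
    ext f Z = f ⟨Z, h⟩ := dif_pos h

theorem IsLaurent.hasDerivAt {f : HCx → ℂ} (hf : IsLaurent f) (i j : Fin 2) (Z : HCx) :
    HasDerivAt (fun s : ℂ => ext f (Z.1 + s • Matrix.single i j (1 : ℂ))) (QAR.pd i j f Z) 0 := by
  obtain ⟨P, k, hP⟩ := hf
  have h := hasDerivAt_ext hP i j Z
  rwa [QAR.pd, h.deriv]

/-- The derivation `∂/∂z_{ij}` of the algebra of Laurent polynomials. -/
def D (i j : Fin 2) : Derivation ℂ LA LA :=
  Derivation.mk'
    { toFun := fun f => ⟨pd i j f.1, IsLaurent.pd f.2 i j⟩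
      map_add' := fun f g => Subtype.ext (pd_add f.2 g.2 i j)
      map_smul' := fun c f => Subtype.ext (pd_smul f.1 c i j) }
    (by
      intro f g
      refine Subtype.ext (funext fun Z => ?_)
      have h := (IsLaurent.hasDerivAt f.2 i j Z).mul (IsLaurent.hasDerivAt g.2 i j Z)
      have e : (fun s : ℂ => ext (f * g : LA).1 (Z.1 + s • Matrix.single i j (1 : ℂ))) =
          (fun s : ℂ => ext f.1 (Z.1 + s • Matrix.single i j (1 : ℂ))) *
            fun s : ℂ => ext g.1 (Z.1 + s • Matrix.single i j (1 : ℂ)) := by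
        funext s
        simp only [ext, Pi.mul_apply]
        split_ifs <;> simp
      change pd i j (f * g : LA).1 Z = f.1 Z * pd i j g.1 Z + g.1 Z * pd i j f.1 Z
      rw [pd, e, h.deriv]
      simp only [zero_smul, add_zero, ext_mk]
      ring)

theorem D_coe (i j : Fin 2) (f : LA) : (D i j f).1 = pd i j f.1 := rfl

/-- The matrix of the coordinate functions. -/
def zM : Matrix (Fin 2) (Fin 2) LA := fun i j =>
  ⟨fun Z => Z.1 i j, MvPolynomial.X (i, j), 0, fun Z => by simp⟩

/-- Evaluation at a point. -/
def evalAt (Z : HCx) : LA →ₐ[ℂ] ℂ := (Pi.evalAlgHom ℂ (fun _ : HCx => ℂ) Z).comp LA.val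

theorem evalAt_apply (Z : HCx) (f : LA) : evalAt Z f = f.1 Z := rfl

theorem LA_ext {f g : LA} (h : ∀ Z, evalAt Z f = evalAt Z g) : f = g :=
  Subtype.ext (funext h)

theorem evalAt_zM (Z : HCx) (i j : Fin 2) : evalAt Z (zM i j) = Z.1 i j := rfl

theorem evalAt_tt (Z : HCx) (a b : ℕ) (k : ℤ) : evalAt Z (tt zM a b k) = tt Z.1 a b k :=
  map_tt (evalAt Z : LA →+* ℂ) zM a b k

theorem evalAt_det (Z : HCx) : evalAt Z zM.det = Z.1.det := by
  simp [Matrix.det_fin_two, evalAt_zM]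

/-- The powers of `N(Z)`. -/
def Np (p : ℤ) : LA := ⟨fun Z => Z.1.det ^ p, by
  rcases p with p | p
  · exact ⟨detP ^ p, 0, fun Z => by simp [eval_detP]⟩
  · exact ⟨1, p + 1, fun Z => by simp⟩⟩

theorem evalAt_Np (Z : HCx) (p : ℤ) : evalAt Z (Np p) = Z.1.det ^ p := rfl

theorem Np_add (p q : ℤ) : Np (p + q) = Np p * Np q :=
  LA_ext fun Z => by rw [map_mul]; simp only [evalAt_Np]; exact zpow_add₀ Z.2 p q

theorem Np_one : Np 1 = zM.det := LA_ext fun Z => by rw [evalAt_Np, evalAt_det, zpow_one]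

theorem Np_zero : Np 0 = 1 := LA_ext fun Z => by rw [evalAt_Np, zpow_zero, map_one]

/-- Constants, coordinates and N⁻¹ generate the algebra, so a statement stable under sums has to be
checked only against multiplication by these generators. -/
theorem LA_induction {p : LA → Prop} (hC : ∀ c : ℂ, p (algebraMap ℂ LA c))
    (hadd : ∀ f g, p f → p g → p (f + g)) (hz : ∀ f i j, p f → p (f * zM i j))
    (hN : ∀ f, p f → p (f * Np (-1))) (f : LA) : p f := by
  obtain ⟨f, P, k, hP⟩ := f
  have hpoly : ∀ P : MvPolynomial (Fin 2 × Fin 2) ℂ,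
      p ⟨fun Z => MvPolynomial.eval (fun q => Z.1 q.1 q.2) P, P, 0, fun Z => by simp⟩ := by
    intro P
    induction P using MvPolynomial.induction_on with
    | C a =>
      convert hC a using 1
      exact Subtype.ext (funext fun Z => by simp)
    | add P Q hP hQ =>
      convert hadd _ _ hP hQ using 1
      exact Subtype.ext (funext fun Z => by simp)
    | mul_X P q hP =>
      convert hz _ q.1 q.2 hP using 1
      exact Subtype.ext (funext fun Z => by simp [zM])
  have hk : ∀ k : ℕ, ∀ f, p f → p (f * Np (-k)) := by
    intro k
    induction k with
    | zero => intro f hf; simpa [Np_zero] using hf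
    | succ k ih =>
      intro f hf
      rw [show (-((k + 1 : ℕ) : ℤ)) = -(k : ℤ) + -1 by push_cast; ring, Np_add, ← mul_assoc]
      exact hN _ (ih f hf)
  convert hk k _ (hpoly P) using 1
  refine Subtype.ext (funext fun Z => ?_)
  change f Z = _ * Z.1.det ^ (-(k : ℤ))
  rw [hP, zpow_neg, zpow_natCast, div_eq_mul_inv]

theorem D_zM (i j r s : Fin 2) : D i j (zM r s) = if r = i ∧ s = j then 1 else 0 := by
  refine LA_ext fun Z => ?_
  have h : HasDerivAt (fun s' : ℂ => Z.1 r s + s' * Matrix.single i j (1 : ℂ) r s)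
      (1 * Matrix.single i j (1 : ℂ) r s) 0 := ((hasDerivAt_id (0 : ℂ)).mul_const _).const_add _
  have h1 := IsLaurent.hasDerivAt (zM r s).2 i j Z
  have h2 : (fun s' : ℂ => ext (zM r s).1 (Z.1 + s' • Matrix.single i j (1 : ℂ))) =ᶠ[nhds 0]
      (fun s' : ℂ => Z.1 r s + s' * Matrix.single i j (1 : ℂ) r s) := by
    have hD := hasDerivAt_eval detP Z.1 i j
    have h0 : MvPolynomial.eval
        (fun p => (Z.1 + (0 : ℂ) • Matrix.single i j (1 : ℂ)) p.1 p.2) detP ≠ 0 := by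
      rw [eval_detP]; simpa using Z.2
    filter_upwards [hD.continuousAt.eventually_ne h0] with s' hs
    rw [eval_detP] at hs
    rw [ext, dif_pos hs]
    simp [zM, Matrix.single_apply]
  have h3 := (h.congr_of_eventuallyEq h2).unique h1
  rw [evalAt_apply, D_coe, ← h3, one_mul, Matrix.single_apply]
  by_cases h4 : r = i ∧ s = j
  · rw [if_pos h4, if_pos ⟨h4.1.symm, h4.2.symm⟩]; rfl
  · rw [if_neg h4, if_neg (fun h5 => h4 ⟨h5.1.symm, h5.2.symm⟩)]; rfl

theorem D_det (i j : Fin 2) : D i j zM.det = zM.adjugate j i := by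
  rw [Matrix.det_fin_two, Matrix.adjugate_fin_two, map_sub, Derivation.leibniz, Derivation.leibniz]
  fin_cases i <;> fin_cases j <;> simp [D_zM]

/-- Non-negative exponents follow from the Leibniz rule by induction; negative ones come from
applying the derivation to N^(-m) N^m = 1. -/
theorem derivation_Np (δ : Derivation ℂ LA LA) (p : ℤ) :
    δ (Np p) = (p : ℂ) • (Np (p - 1) * δ zM.det) := by
  have hpos : ∀ n : ℕ, δ (Np n) = (n : ℂ) • (Np ((n : ℤ) - 1) * δ zM.det) := by
    intro n
    induction n with
    | zero => simp [Np_zero]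
    | succ n ih =>
      have e : Np ((n + 1 : ℕ) : ℤ) = Np n * zM.det := by
        rw [← Np_one, ← Np_add]; push_cast; rfl
      have e2 : Np (n : ℤ) = Np ((n : ℤ) - 1) * zM.det := by
        rw [← Np_one, ← Np_add, sub_add_cancel]
      rw [e, Derivation.leibniz, ih, show ((n + 1 : ℕ) : ℤ) - 1 = n by push_cast; ring]
      simp only [smul_eq_mul, Algebra.smul_def, map_natCast]
      rw [e2]
      push_cast; ring
  rcases p with n | n
  · simpa using hpos n
  · have h1 := hpos (n + 1)
    set m : ℕ := n + 1
    have hm : Int.negSucc n = -(m : ℤ) := rfl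
    rw [hm]
    have h2 : Np (-(m : ℤ)) * Np m = 1 := by rw [← Np_add, neg_add_cancel, Np_zero]
    have h3 : δ (Np (-(m : ℤ)) * Np m) = 0 := by rw [h2, Derivation.map_one_eq_zero]
    rw [Derivation.leibniz, h1, smul_eq_mul, smul_eq_mul] at h3
    have h4 : Np (-(m : ℤ)) * Np ((m : ℤ) - 1) = Np (-1) := by
      rw [← Np_add]; congr 1; omega
    have h5 : Np (-(m : ℤ)) * Np (-1) = Np (-(m : ℤ) - 1) := by
      rw [← Np_add]; congr 1
    have h6 : δ (Np (-(m : ℤ))) = (Np (-(m : ℤ)) * Np m) * δ (Np (-(m : ℤ))) := by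
      rw [h2, one_mul]
    simp only [Algebra.smul_def] at h3 ⊢
    rw [h6, ← h5]
    push_cast
    simp only [map_natCast] at h3 ⊢
    linear_combination Np (-(m : ℤ)) * h3 - m * Np (-(m : ℤ)) * δ zM.det * h4

theorem derivation_eq_zero {δ : Derivation ℂ LA LA} (h : ∀ i j, δ (zM i j) = 0) : δ = 0 := by
  refine Derivation.ext fun f => ?_
  rw [Derivation.zero_apply]
  have hdet : δ zM.det = 0 := by
    rw [Matrix.det_fin_two, map_sub, Derivation.leibniz, Derivation.leibniz]
    simp [h]
  induction f using LA_induction with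
  | hC c => exact δ.map_algebraMap c
  | hadd f g hf hg => rw [map_add, hf, hg, add_zero]
  | hz f i j hf => rw [Derivation.leibniz, hf, h]; simp
  | hN f hf => rw [Derivation.leibniz, hf, derivation_Np, hdet]; simp

/-- The commutator is again a derivation and kills the coordinates, hence vanishes. -/
theorem D_comm (i j r s : Fin 2) (f : LA) : D i j (D r s f) = D r s (D i j f) := by
  have h : ⁅D i j, D r s⁆ = 0 := derivation_eq_zero fun a b => by
    rw [Derivation.commutator_apply, D_zM, D_zM]
    split_ifs <;> simp
  have h2 := congrArg (fun δ : Derivation ℂ LA LA => δ f) h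
  simp only [Derivation.commutator_apply, Derivation.zero_apply] at h2
  exact sub_eq_zero.1 h2

/-- The chain rule along a curve. -/
theorem hasDerivAt_ext_curve (f : LA) (W : ℝ → HC) (W' : HC) (t : ℝ) (Z : HCx)
    (hW : ∀ i j, HasDerivAt (fun s => W s i j) (W' i j) t) (hZ : W t = Z.1) :
    HasDerivAt (fun s => ext f.1 (W s)) (∑ i, ∑ j, W' i j * evalAt Z (D i j f)) t := by
  have hdet : HasDerivAt (fun s => (W s).det)
      (∑ i, ∑ j, W' i j * evalAt Z (D i j zM.det)) t := by
    simp only [Matrix.det_fin_two (W _)]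
    refine (((hW 0 0).mul (hW 1 1)).sub ((hW 0 1).mul (hW 1 0))).congr_deriv ?_
    simp only [D_det, Matrix.adjugate_fin_two, Fin.sum_univ_two, hZ]
    simp [evalAt_zM]
    ring
  have hne : ∀ᶠ s in nhds t, (W s).det ≠ 0 :=
    hdet.continuousAt.eventually_ne (by rw [hZ]; exact Z.2)
  induction f using LA_induction with
  | hC c =>
    have : HasDerivAt (fun _ : ℝ => c) 0 t := hasDerivAt_const t c
    refine (this.congr_of_eventuallyEq ?_).congr_deriv ?_
    · filter_upwards [hne] with s hs
      rw [ext, dif_pos hs]; rfl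
    · simp
  | hadd f g hf hg =>
    refine ((hf.add hg).congr_of_eventuallyEq ?_).congr_deriv ?_
    · filter_upwards [hne] with s hs
      rw [Pi.add_apply, ext_of_ne _ hs, ext_of_ne _ hs, ext_of_ne _ hs]
      rfl
    · simp only [map_add, mul_add, Finset.sum_add_distrib]
  | hz f r s hf =>
    refine ((hf.mul (hW r s)).congr_of_eventuallyEq ?_).congr_deriv ?_
    · filter_upwards [hne] with s' hs
      rw [Pi.mul_apply, ext_of_ne _ hs, ext_of_ne _ hs]
      rfl
    · simp only [Derivation.leibniz, smul_eq_mul, map_add, map_mul, D_zM, hZ, ext_mk,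
        Fin.sum_univ_two, evalAt_zM, ← evalAt_apply]
      fin_cases r <;> fin_cases s <;> simp <;> ring
  | hN f hf =>
    have h0 : (W t).det ≠ 0 := by rw [hZ]; exact Z.2
    refine ((hf.mul (hdet.inv h0)).congr_of_eventuallyEq ?_).congr_deriv ?_
    · filter_upwards [hne] with s' hs
      rw [Pi.mul_apply, ext_of_ne _ hs, ext_of_ne _ hs, Pi.inv_apply, ← zpow_neg_one]
      rfl
    · simp only [Derivation.leibniz, derivation_Np, smul_eq_mul, map_add, map_mul, map_smul, hZ,
        ext_mk, Fin.sum_univ_two, ← evalAt_apply, evalAt_Np]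
      have := Z.2
      rw [show (-1 - 1 : ℤ) = -(2 : ℕ) by norm_num, zpow_neg, zpow_natCast, zpow_neg_one,
        Pi.inv_apply, hZ]
      push_cast
      field_simp
      ring

/-! ### Vectors of Laurent polynomials and the differential operators of the matrix units -/

/-- Column vectors of Laurent polynomials. -/
abbrev LV := Fin 2 → LA

/-- A vector of Laurent polynomials as a function. -/
def toFn : LV →ₗ[ℂ] Fn where
  toFun v := fun Z k => evalAt Z (v k)
  map_add' _ _ := by funext Z k; simp
  map_smul' _ _ := by funext Z k; simp

theorem toFn_apply (v : LV) (Z : HCx) (k : Fin 2) : toFn v Z k = evalAt Z (v k) := rfl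

theorem toFn_injective : Function.Injective toFn := fun _ _ h =>
  funext fun k => LA_ext fun Z => congrFun (congrFun h Z) k

/-- `∂/∂z_{ij}` on vectors. -/
def opD (i j : Fin 2) : LV →ₗ[ℂ] LV where
  toFun v := fun r => D i j (v r)
  map_add' _ _ := by funext r; simp
  map_smul' c v := by funext r; simp

/-- The action of the matrix unit `e_{ij}` in the upper left block. -/
def opA (i j : Fin 2) : LV →ₗ[ℂ] LV where
  toFun v := fun r => (if r = i then v j else 0) - (if i = j then v r else 0)
    - ∑ b, zM j b * D i b (v r)
  map_add' u v := by
    funext r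
    simp only [Pi.add_apply, map_add, mul_add, Finset.sum_add_distrib]
    split_ifs <;> ring
  map_smul' c v := by
    funext r
    simp only [Pi.smul_apply, Derivation.map_smul, mul_smul_comm, ← Finset.smul_sum,
      RingHom.id_apply]
    split_ifs <;> module

/-- The action of the matrix unit `e_{ij}` in the lower right block. -/
def opE (i j : Fin 2) : LV →ₗ[ℂ] LV where
  toFun v := fun r => ∑ a, zM a i * D a j (v r)
  map_add' u v := by
    funext r
    simp only [Pi.add_apply, map_add, mul_add, Finset.sum_add_distrib]
  map_smul' c v := by
    funext r
    simp only [Pi.smul_apply, Derivation.map_smul, mul_smul_comm, ← Finset.smul_sum,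
      RingHom.id_apply]

/-- The action of the matrix unit `e_{ji}` in the lower left block. -/
def opK (i j : Fin 2) : LV →ₗ[ℂ] LV where
  toFun v := fun r => zM i j * v r - zM r j * v i + ∑ a, ∑ b, zM a j * zM i b * D a b (v r)
  map_add' u v := by
    funext r
    simp only [Pi.add_apply, map_add, mul_add, Finset.sum_add_distrib]
    ring
  map_smul' c v := by
    funext r
    simp only [Pi.smul_apply, Derivation.map_smul, mul_smul_comm, ← Finset.smul_sum,
      RingHom.id_apply]
    module

theorem opD_apply (i j : Fin 2) (v : LV) (r : Fin 2) : opD i j v r = D i j (v r) := rfl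

theorem opA_apply (i j : Fin 2) (v : LV) (r : Fin 2) : opA i j v r =
    (if r = i then v j else 0) - (if i = j then v r else 0) - ∑ b, zM j b * D i b (v r) := rfl

theorem opE_apply (i j : Fin 2) (v : LV) (r : Fin 2) :
    opE i j v r = ∑ a, zM a i * D a j (v r) := rfl

theorem opK_apply (i j : Fin 2) (v : LV) (r : Fin 2) : opK i j v r =
    zM i j * v r - zM r j * v i + ∑ a, ∑ b, zM a j * zM i b * D a b (v r) := rfl

/-- The matrices representing `𝔤𝔩(2, ℍ_ℂ)`. -/
abbrev Mat4 := Matrix (Fin 2 ⊕ Fin 2) (Fin 2 ⊕ Fin 2) ℂ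

/-- The action of `𝔤𝔩(2, ℍ_ℂ)` by differential operators. -/
def pL (X : Mat4) : LV →ₗ[ℂ] LV :=
  ∑ i, ∑ j, (X (.inl i) (.inl j) • opA i j + X (.inr i) (.inr j) • opE i j
    - X (.inl i) (.inr j) • opD i j + X (.inr j) (.inl i) • opK i j)

theorem pL_apply (X : Mat4) (v : LV) : pL X v =
    ∑ i, ∑ j, (X (.inl i) (.inl j) • opA i j v + X (.inr i) (.inr j) • opE i j v
      - X (.inl i) (.inr j) • opD i j v + X (.inr j) (.inl i) • opK i j v) := by
  simp [pL]

theorem pL_add (X Y : Mat4) : pL (X + Y) = pL X + pL Y := by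
  simp only [pL, Fin.sum_univ_two, Matrix.add_apply, add_smul]
  abel

theorem pL_smul (c : ℂ) (X : Mat4) : pL (c • X) = c • pL X := by
  refine LinearMap.ext fun v => ?_
  simp only [pL_apply, LinearMap.smul_apply, Fin.sum_univ_two, Matrix.smul_apply, smul_eq_mul]
  module

/-! ### The infinitesimal action as a differential operator -/

section Derivative

open scoped Matrix.Norms.Operator in
theorem hasDerivAt_exp_entry (X : Mat4) (i j : Fin 2 ⊕ Fin 2) :
    HasDerivAt (fun t : ℝ => NormedSpace.exp (t • X) i j) (X i j) 0 := by
  have h := hasDerivAt_exp_smul_const (𝕂 := ℝ) X 0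
  rw [zero_smul, NormedSpace.exp_zero, one_mul] at h
  exact hasDerivAt_pi.1 (hasDerivAt_pi.1 h i) j

theorem exp_zero_entry (X : Mat4) : NormedSpace.exp ((0 : ℝ) • X) = 1 := by
  rw [zero_smul, NormedSpace.exp_zero]

/-- Along exp(tX) put P = a' - Zc' and Q = -b' + Zd'. At t = 0 these are 1 and Z, so the argument
P⁻¹Q has derivative Q' - P'Z and the multiplier N(P)⁻¹P has derivative P' minus the trace of P'. The
chain rule then gives the matrix-unit operators. -/
theorem hasDerivAt_actL (X : Mat4) (v : LV) (Z : HCx) (r : Fin 2) :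
    HasDerivAt (fun t : ℝ => actL (NormedSpace.exp (t • X)) (toFn v) Z r)
      (toFn (pL X v) Z r) 0 := by
  set P : ℝ → HC := fun t => (NormedSpace.exp (t • X)).toBlocks₁₁ -
    Z.1 * (NormedSpace.exp (t • X)).toBlocks₂₁ with hP
  set Q : ℝ → HC := fun t => -(NormedSpace.exp (t • X)).toBlocks₁₂ +
    Z.1 * (NormedSpace.exp (t • X)).toBlocks₂₂ with hQ
  have hX := hasDerivAt_exp_entry X
  have hP' : ∀ i j, HasDerivAt (fun t => P t i j)
      (X (.inl i) (.inl j) - (Z.1 i 0 * X (.inr 0) (.inl j) + Z.1 i 1 * X (.inr 1) (.inl j))) 0 := by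
    intro i j
    have := (hX (.inl i) (.inl j)).sub (((hX (.inr 0) (.inl j)).const_mul (Z.1 i 0)).add
      ((hX (.inr 1) (.inl j)).const_mul (Z.1 i 1)))
    refine this.congr_of_eventuallyEq (Filter.Eventually.of_forall fun t => ?_)
    simp [hP, Matrix.mul_apply, Fin.sum_univ_two, Matrix.toBlocks₁₁, Matrix.toBlocks₂₁]
  have hQ' : ∀ i j, HasDerivAt (fun t => Q t i j)
      (-X (.inl i) (.inr j) + (Z.1 i 0 * X (.inr 0) (.inr j) + Z.1 i 1 * X (.inr 1) (.inr j)))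
      0 := by
    intro i j
    have := (hX (.inl i) (.inr j)).neg.add (((hX (.inr 0) (.inr j)).const_mul (Z.1 i 0)).add
      ((hX (.inr 1) (.inr j)).const_mul (Z.1 i 1)))
    refine this.congr_of_eventuallyEq (Filter.Eventually.of_forall fun t => ?_)
    simp [hQ, Matrix.mul_apply, Fin.sum_univ_two, Matrix.toBlocks₁₂, Matrix.toBlocks₂₂]
  have hP0 : P 0 = 1 := by
    simp only [hP, exp_zero_entry]
    ext i j
    simp [Matrix.mul_apply, Matrix.toBlocks₁₁, Matrix.toBlocks₂₁, Matrix.one_apply]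
  have hQ0 : Q 0 = Z.1 := by
    simp only [hQ, exp_zero_entry]
    ext i j
    fin_cases j <;> simp [Matrix.mul_apply, Matrix.toBlocks₁₂, Matrix.toBlocks₂₂, Matrix.one_apply]
  have hdet : HasDerivAt (fun t => (P t).det) _ 0 :=
    ((((hP' 0 0).mul (hP' 1 1)).sub ((hP' 0 1).mul (hP' 1 0))).congr_of_eventuallyEq
      (Filter.Eventually.of_forall fun t => Matrix.det_fin_two (P t)))
  have hdet0 : (P 0).det = 1 := by rw [hP0, Matrix.det_one]
  have hinv := hdet.inv (by rw [hdet0]; exact one_ne_zero)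
  -- the derivative of the argument
  have hW : ∀ i j, HasDerivAt (fun t => ((P t)⁻¹ * Q t) i j)
      (-X (.inl i) (.inr j) + (Z.1 i 0 * X (.inr 0) (.inr j) + Z.1 i 1 * X (.inr 1) (.inr j))
        - ∑ k, (X (.inl i) (.inl k) - (Z.1 i 0 * X (.inr 0) (.inl k) +
          Z.1 i 1 * X (.inr 1) (.inl k))) * Z.1 k j) 0 := by
    intro i j
    fin_cases i
    · refine ((hinv.mul (((hP' 1 1).mul (hQ' 0 j)).sub ((hP' 0 1).mul
        (hQ' 1 j)))).congr_of_eventuallyEq (Filter.Eventually.of_forall fun t => ?_)).congr_deriv ?_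
      · simp [Matrix.inv_def, Matrix.adjugate_fin_two, Matrix.mul_apply, Fin.sum_univ_two,
          Ring.inverse_eq_inv']
        ring
      · simp [hP0, hQ0, Fin.sum_univ_two]
        ring
    · refine ((hinv.mul (((hP' 0 0).mul (hQ' 1 j)).sub ((hP' 1 0).mul
        (hQ' 0 j)))).congr_of_eventuallyEq (Filter.Eventually.of_forall fun t => ?_)).congr_deriv ?_
      · simp [Matrix.inv_def, Matrix.adjugate_fin_two, Matrix.mul_apply, Fin.sum_univ_two,
          Ring.inverse_eq_inv']
        ring
      · simp [hP0, hQ0, Fin.sum_univ_two]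
        ring
  have hW0 : (P 0)⁻¹ * Q 0 = Z.1 := by rw [hP0, hQ0, inv_one, one_mul]
  have hf : ∀ k, HasDerivAt (fun t => ext (v k).1 ((P t)⁻¹ * Q t)) _ 0 := fun k =>
    hasDerivAt_ext_curve (v k) (fun t => (P t)⁻¹ * Q t) _ 0 Z hW hW0
  have he : ∀ t k, ext (toFn v) ((P t)⁻¹ * Q t) k = ext (v k).1 ((P t)⁻¹ * Q t) := by
    intro t k
    simp only [ext]
    split_ifs
    · rfl
    · rfl
  have hact : ∀ t, actL (NormedSpace.exp (t • X)) (toFn v) Z r = ((P t).det)⁻¹ *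
      (P t r 0 * ext (v 0).1 ((P t)⁻¹ * Q t) + P t r 1 * ext (v 1).1 ((P t)⁻¹ * Q t)) := by
    intro t
    rw [← he, ← he]
    simp only [actL, Pi.smul_apply, smul_eq_mul, Matrix.mulVec, dotProduct, Fin.sum_univ_two]
    rfl
  refine ((hinv.mul (((hP' r 0).mul (hf 0)).add ((hP' r 1).mul
    (hf 1)))).congr_of_eventuallyEq (Filter.Eventually.of_forall fun t => hact t)).congr_deriv ?_
  have hv : ∀ k, (v k).1 Z = evalAt Z (v k) := fun k => rfl
  simp only [Pi.mul_apply, Pi.add_apply, Pi.inv_apply, hP0, hQ0, inv_one, one_mul, ext_mk,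
    toFn_apply, pL_apply, hv]
  simp only [Fin.sum_univ_two, Pi.add_apply, Pi.sub_apply, Pi.smul_apply, opA_apply, opD_apply,
    opE_apply, opK_apply, map_add, map_sub, map_smul, map_mul, evalAt_zM, smul_eq_mul]
  fin_cases r <;> simp [Matrix.one_apply] <;> ring

theorem piL_toFn (X : Mat4) (v : LV) : piL X (toFn v) = toFn (pL X v) := by
  funext Z
  exact (hasDerivAt_pi.2 fun r => hasDerivAt_actL X v Z r).deriv

end Derivative

/-! ### Action of row and column operators on the coefficients -/

theorem LV_ext {u v : LV} (h : ∀ Z r, evalAt Z (u r) = evalAt Z (v r)) : u = v :=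
  funext fun r => LA_ext fun Z => h Z r

/-- The derivation `∑ b, z_{ib} ∂_{ab}`. -/
def rowOp (i a : Fin 2) : Derivation ℂ LA LA := zM i 0 • D a 0 + zM i 1 • D a 1

/-- The derivation `∑ a, z_{ai} ∂_{aj}`. -/
def colOp (i j : Fin 2) : Derivation ℂ LA LA := zM 0 i • D 0 j + zM 1 i • D 1 j

theorem rowOp_apply (i a : Fin 2) (f : LA) :
    rowOp i a f = zM i 0 * D a 0 f + zM i 1 * D a 1 f := rfl

theorem colOp_apply (i j : Fin 2) (f : LA) :
    colOp i j f = zM 0 i * D 0 j f + zM 1 i * D 1 j f := rfl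

theorem opA_eq (i j : Fin 2) (v : LV) (r : Fin 2) : opA i j v r =
    (if r = i then v j else 0) - (if i = j then v r else 0) - rowOp j i (v r) := by
  rw [opA_apply, Fin.sum_univ_two, rowOp_apply]

theorem opE_eq (i j : Fin 2) (v : LV) (r : Fin 2) : opE i j v r = colOp i j (v r) := by
  rw [opE_apply, Fin.sum_univ_two, colOp_apply]

theorem opK_eq (i j : Fin 2) (v : LV) (r : Fin 2) : opK i j v r =
    zM i j * v r - zM r j * v i + (zM 0 j * rowOp i 0 (v r) + zM 1 j * rowOp i 1 (v r)) := by
  rw [opK_apply]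
  simp only [Fin.sum_univ_two, rowOp_apply]
  ring

theorem D_tt (i j : Fin 2) (a b : ℕ) (k : ℤ) : D i j (tt zM a b k) =
    if j = 0 then a * tt zM (a - 1) b (if i = 0 then k - 1 else k)
    else b * tt zM a (b - 1) (if i = 0 then k - 1 else k) := by
  rw [derivation_tt]
  simp only [D_zM]
  fin_cases i <;> fin_cases j <;> simp

theorem rowOp_zM (i a r s : Fin 2) : rowOp i a (zM r s) = if r = a then zM i s else 0 := by
  rw [rowOp_apply, D_zM, D_zM]
  fin_cases s <;> by_cases h : r = a <;> simp [h]

theorem colOp_zM (i j r s : Fin 2) : colOp i j (zM r s) = if s = j then zM r i else 0 := by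
  rw [colOp_apply, D_zM, D_zM]
  fin_cases r <;> by_cases h : s = j <;> simp [h]

theorem rowOp_det (i a : Fin 2) : rowOp i a zM.det = if i = a then zM.det else 0 := by
  rw [Matrix.det_fin_two, map_sub, Derivation.leibniz, Derivation.leibniz]
  simp only [rowOp_zM, smul_eq_mul]
  fin_cases i <;> fin_cases a <;> simp <;> ring

theorem colOp_det (i a : Fin 2) : colOp i a zM.det = if i = a then zM.det else 0 := by
  rw [Matrix.det_fin_two, map_sub, Derivation.leibniz, Derivation.leibniz]
  simp only [colOp_zM, smul_eq_mul]
  fin_cases i <;> fin_cases a <;> simp <;> ring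

/-- The operators `rowOp` are the gl(2) acting by rows: they preserve a and b and move only k. Each
formula is the Leibniz rule followed by `index_mul_tt` or `coindex_mul_tt`. -/
theorem rowOp00_tt (a b : ℕ) (k : ℤ) : rowOp 0 0 (tt zM a b k) = (k : ℂ) • tt zM a b k := by
  rw [derivation_tt, Algebra.smul_def, map_intCast]
  simp only [rowOp_zM]
  simp
  linear_combination -index_mul_tt zM a b k

theorem rowOp01_tt (a b : ℕ) (k : ℤ) :
    rowOp 0 1 (tt zM a b k) = ((k : ℂ) + 1) • tt zM a b (k + 1) := by
  rw [derivation_tt, Algebra.smul_def, map_add, map_intCast, map_one]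
  simp only [rowOp_zM]
  have := index_mul_tt zM a b (k + 1)
  simp at this ⊢
  linear_combination -this

theorem rowOp10_tt (a b : ℕ) (k : ℤ) :
    rowOp 1 0 (tt zM a b k) = ((a : ℂ) + b - k + 1) • tt zM a b (k - 1) := by
  rw [derivation_tt, Algebra.smul_def]
  simp only [rowOp_zM, map_add, map_sub, map_natCast, map_intCast, map_one]
  have := coindex_mul_tt zM a b (k - 1)
  simp at this ⊢
  linear_combination -this

theorem rowOp11_tt (a b : ℕ) (k : ℤ) :
    rowOp 1 1 (tt zM a b k) = ((a : ℂ) + b - k) • tt zM a b k := by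
  rw [derivation_tt, Algebra.smul_def]
  simp only [rowOp_zM, map_add, map_sub, map_natCast, map_intCast]
  have := coindex_mul_tt zM a b k
  simp at this ⊢
  linear_combination -this

theorem colOp00_tt (a b : ℕ) (k : ℤ) : colOp 0 0 (tt zM a b k) = (a : ℂ) • tt zM a b k := by
  rw [derivation_tt, Algebra.smul_def, map_natCast]
  simp only [colOp_zM]
  simp
  linear_combination -left_mul_tt zM a b k

theorem colOp11_tt (a b : ℕ) (k : ℤ) : colOp 1 1 (tt zM a b k) = (b : ℂ) • tt zM a b k := by
  rw [derivation_tt, Algebra.smul_def, map_natCast]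
  simp only [colOp_zM]
  simp
  linear_combination -right_mul_tt zM a b k

section Multiplication

variable (Z : HC) (a b : ℕ) (k : ℤ)

theorem cast_add_one_ne : (a : ℂ) + b + 1 ≠ 0 := by exact_mod_cast Nat.succ_ne_zero (a + b)

theorem cast_add_two_ne : (a : ℂ) + b + 2 ≠ 0 := by
  have := Nat.succ_ne_zero (a + b + 1)
  exact_mod_cast this

theorem z00_tt : Z 0 0 * tt Z a b k =
    ((k + 1) * tt Z (a + 1) b (k + 1) + b * (Z.det * tt Z a (b - 1) k)) / (a + b + 1) := by
  rw [eq_div_iff (cast_add_one_ne a b)]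
  linear_combination z00_mul_tt Z a b k

theorem z01_tt : Z 0 1 * tt Z a b k =
    ((k + 1) * tt Z a (b + 1) (k + 1) - a * (Z.det * tt Z (a - 1) b k)) / (a + b + 1) := by
  rw [eq_div_iff (cast_add_one_ne a b)]
  linear_combination z01_mul_tt Z a b k

theorem z10_tt : Z 1 0 * tt Z a b k =
    ((a + b + 1 - k) * tt Z (a + 1) b k - b * (Z.det * tt Z a (b - 1) (k - 1))) /
      (a + b + 1) := by
  rw [eq_div_iff (cast_add_one_ne a b)]
  linear_combination z10_mul_tt Z a b k

theorem z11_tt : Z 1 1 * tt Z a b k =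
    ((a + b + 1 - k) * tt Z a (b + 1) k + a * (Z.det * tt Z (a - 1) b (k - 1))) /
      (a + b + 1) := by
  rw [eq_div_iff (cast_add_one_ne a b)]
  linear_combination z11_mul_tt Z a b k

end Multiplication

/-! ### The three families and the translations on them -/

/-- The vectors `f^{(1)}`. -/
def f1 (a b : ℕ) (k : ℤ) : LV := ![tt zM a b k, -tt zM a b (k - 1)]

/-- The vectors `f^{(2)}`. -/
def f2 (a b : ℕ) (k : ℤ) : LV :=
  ![((k : ℂ) + 1) • tt zM a b (k + 1), ((a : ℂ) + b - k) • tt zM a b k]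

/-- The vectors `f^{(3)}`. -/
def f3 (a b : ℕ) (k : ℤ) : LV := fun r => zM.det * f1 a b k r

theorem f1_zero (a b : ℕ) (k : ℤ) : f1 a b k 0 = tt zM a b k := rfl
theorem f1_one (a b : ℕ) (k : ℤ) : f1 a b k 1 = -tt zM a b (k - 1) := rfl
theorem f2_zero (a b : ℕ) (k : ℤ) : f2 a b k 0 = ((k : ℂ) + 1) • tt zM a b (k + 1) := rfl
theorem f2_one (a b : ℕ) (k : ℤ) : f2 a b k 1 = ((a : ℂ) + b - k) • tt zM a b k := rfl
theorem f3_apply (a b : ℕ) (k : ℤ) (r : Fin 2) : f3 a b k r = zM.det * f1 a b k r := rfl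

section Translations

variable (a b : ℕ) (k : ℤ)

theorem opD_f3 (i j : Fin 2) :
    opD i j (f3 a b k) =
      (fun r => zM.adjugate j i * f1 a b k r) + fun r => zM.det * opD i j (f1 a b k) r := by
  funext r
  rw [Pi.add_apply, opD_apply, f3_apply, Derivation.leibniz, D_det, opD_apply]
  simp only [smul_eq_mul]
  ring

/-- The entries of f^{(1)} carry no numerical coefficients depending on k, so a derivative acts on
both alike and stays in this family. -/
theorem opD00_f1 : opD 0 0 (f1 a b k) = (a : ℂ) • f1 (a - 1) b (k - 1) := by
  refine LV_ext fun Z r => ?_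
  fin_cases r <;> simp [opD_apply, f1, D_tt, evalAt_tt]

theorem opD10_f1 : opD 1 0 (f1 a b k) = (a : ℂ) • f1 (a - 1) b k := by
  refine LV_ext fun Z r => ?_
  fin_cases r <;> simp [opD_apply, f1, D_tt, evalAt_tt]

theorem opD01_f1 : opD 0 1 (f1 a b k) = (b : ℂ) • f1 a (b - 1) (k - 1) := by
  refine LV_ext fun Z r => ?_
  fin_cases r <;> simp [opD_apply, f1, D_tt, evalAt_tt]

theorem opD11_f1 : opD 1 1 (f1 a b k) = (b : ℂ) • f1 a (b - 1) k := by
  refine LV_ext fun Z r => ?_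
  fin_cases r <;> simp [opD_apply, f1, D_tt, evalAt_tt]

/-- Differentiation lowers the degree but leaves the coefficients k + 1 and a + b - k of the old
degree, so a multiple of f^{(1)} appears as correction. Writing a + 1 avoids a truncated a - 1; the
missing case is `opD_f2_left`. -/
theorem opD00_f2 : opD 0 0 (f2 (a + 1) b k) = ((a : ℂ) + 1) •
    ((((a : ℂ) + b + 2) / (a + b + 1)) • f2 a b (k - 1) +
      (((a : ℂ) + b + 1 - k) / (a + b + 1)) • f1 a b k) := by
  have := cast_add_one_ne a b
  refine LV_ext fun Z r => ?_
  fin_cases r <;> simp [opD_apply, f1, f2, D_tt, evalAt_tt] <;> field_simp <;> ring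

theorem opD10_f2 : opD 1 0 (f2 (a + 1) b k) = ((a : ℂ) + 1) •
    ((((a : ℂ) + b + 2) / (a + b + 1)) • f2 a b k +
      (-((k : ℂ) + 1) / (a + b + 1)) • f1 a b (k + 1)) := by
  have := cast_add_one_ne a b
  refine LV_ext fun Z r => ?_
  fin_cases r <;> simp [opD_apply, f1, f2, D_tt, evalAt_tt] <;> field_simp <;> ring

theorem opD01_f2 : opD 0 1 (f2 a (b + 1) k) = ((b : ℂ) + 1) •
    ((((a : ℂ) + b + 2) / (a + b + 1)) • f2 a b (k - 1) +
      (((a : ℂ) + b + 1 - k) / (a + b + 1)) • f1 a b k) := by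
  have := cast_add_one_ne a b
  refine LV_ext fun Z r => ?_
  fin_cases r <;> simp [opD_apply, f1, f2, D_tt, evalAt_tt] <;> field_simp <;> ring

theorem opD11_f2 : opD 1 1 (f2 a (b + 1) k) = ((b : ℂ) + 1) •
    ((((a : ℂ) + b + 2) / (a + b + 1)) • f2 a b k +
      (-((k : ℂ) + 1) / (a + b + 1)) • f1 a b (k + 1)) := by
  have := cast_add_one_ne a b
  refine LV_ext fun Z r => ?_
  fin_cases r <;> simp [opD_apply, f1, f2, D_tt, evalAt_tt] <;> field_simp <;> ring

/-- The derivative of N is an entry of the adjugate. The Clebsch–Gordan rule splits its product with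
f^{(1)} into the two families of degree a + b + 1 and a multiple of f^{(3)}. -/
theorem opD00_f3 : opD 0 0 (f3 a b k) =
    (((a : ℂ) + b + 2 - k) / (a + b + 2)) • f1 a (b + 1) k +
    (-1 / (((a : ℂ) + b + 1) * (a + b + 2))) • f2 a (b + 1) (k - 1) +
    ((a : ℂ) * (a + b + 2) / (a + b + 1)) • f3 (a - 1) b (k - 1) := by
  have := cast_add_one_ne a b
  have := cast_add_two_ne a b
  rw [opD_f3, opD00_f1]
  refine LV_ext fun Z r => ?_
  fin_cases r <;> simp [f1, f2, f3, evalAt_tt, evalAt_det, evalAt_zM, z11_tt,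
    Matrix.adjugate_fin_two] <;>
    field_simp <;> ring

theorem opD10_f3 : opD 1 0 (f3 a b k) =
    (-((k : ℂ) + 1) / (a + b + 2)) • f1 a (b + 1) (k + 1) +
    (-1 / (((a : ℂ) + b + 1) * (a + b + 2))) • f2 a (b + 1) k +
    ((a : ℂ) * (a + b + 2) / (a + b + 1)) • f3 (a - 1) b k := by
  have := cast_add_one_ne a b
  have := cast_add_two_ne a b
  rw [opD_f3, opD10_f1]
  refine LV_ext fun Z r => ?_
  fin_cases r <;> simp [f1, f2, f3, evalAt_tt, evalAt_det, evalAt_zM, z01_tt,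
    Matrix.adjugate_fin_two] <;>
    field_simp <;> ring

theorem opD01_f3 : opD 0 1 (f3 a b k) =
    (-((a : ℂ) + b + 2 - k) / (a + b + 2)) • f1 (a + 1) b k +
    (1 / (((a : ℂ) + b + 1) * (a + b + 2))) • f2 (a + 1) b (k - 1) +
    ((b : ℂ) * (a + b + 2) / (a + b + 1)) • f3 a (b - 1) (k - 1) := by
  have := cast_add_one_ne a b
  have := cast_add_two_ne a b
  rw [opD_f3, opD01_f1]
  refine LV_ext fun Z r => ?_
  fin_cases r <;> simp [f1, f2, f3, evalAt_tt, evalAt_det, evalAt_zM, z10_tt,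
    Matrix.adjugate_fin_two] <;>
    field_simp <;> ring

theorem opD11_f3 : opD 1 1 (f3 a b k) =
    (((k : ℂ) + 1) / (a + b + 2)) • f1 (a + 1) b (k + 1) +
    (1 / (((a : ℂ) + b + 1) * (a + b + 2))) • f2 (a + 1) b k +
    ((b : ℂ) * (a + b + 2) / (a + b + 1)) • f3 a (b - 1) k := by
  have := cast_add_one_ne a b
  have := cast_add_two_ne a b
  rw [opD_f3, opD11_f1]
  refine LV_ext fun Z r => ?_
  fin_cases r <;> simp [f1, f2, f3, evalAt_tt, evalAt_det, evalAt_zM, z00_tt,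
    Matrix.adjugate_fin_two] <;>
    field_simp <;> ring

end Translations

/-! ### The special conformal operators on the three families -/

section SpecialConformal

variable (a b : ℕ) (k : ℤ)

theorem opK_f3 (i j : Fin 2) : opK i j (f3 a b k) =
    fun r => zM.det * (opK i j (f1 a b k) r + zM i j * f1 a b k r) := by
  funext r
  simp only [opK_eq, f3_apply, Derivation.leibniz, smul_eq_mul, rowOp_det]
  fin_cases i <;> fin_cases j <;> simp <;> ring

/-- Only on f^{(1)} does `opK` reach all three families. Its coefficients at f^{(2)} and f^{(3)}
have the opposite sign to the reverse coefficients of `opD`, the source of the negative weights. -/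
theorem opK00_f1 : opK 0 0 (f1 a b k) =
    (((a : ℂ) + b + 1) * (k + 1) / (a + b + 2)) • f1 (a + 1) b (k + 1) +
    (-1 / (((a : ℂ) + b + 1) * (a + b + 2))) • f2 (a + 1) b k +
    (-(b : ℂ) / (a + b + 1)) • f3 a (b - 1) k := by
  have := cast_add_one_ne a b
  have := cast_add_two_ne a b
  refine LV_ext fun Z r => ?_
  fin_cases r <;>
    simp [opK_eq, f1, f2, f3, rowOp00_tt, rowOp01_tt, evalAt_tt, evalAt_det, evalAt_zM,
      mul_left_comm (Z.1 _ _), z00_tt, z10_tt] <;>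
    field_simp <;> ring

theorem opK10_f1 : opK 1 0 (f1 a b k) =
    (((a : ℂ) + b + 1) * (a + b + 2 - k) / (a + b + 2)) • f1 (a + 1) b k +
    (1 / (((a : ℂ) + b + 1) * (a + b + 2))) • f2 (a + 1) b (k - 1) +
    ((b : ℂ) / (a + b + 1)) • f3 a (b - 1) (k - 1) := by
  have := cast_add_one_ne a b
  have := cast_add_two_ne a b
  refine LV_ext fun Z r => ?_
  fin_cases r <;>
    simp [opK_eq, f1, f2, f3, rowOp10_tt, rowOp11_tt, evalAt_tt, evalAt_det, evalAt_zM,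
      mul_left_comm (Z.1 _ _), z00_tt, z10_tt] <;>
    field_simp <;> ring

theorem opK01_f1 : opK 0 1 (f1 a b k) =
    (((a : ℂ) + b + 1) * (k + 1) / (a + b + 2)) • f1 a (b + 1) (k + 1) +
    (-1 / (((a : ℂ) + b + 1) * (a + b + 2))) • f2 a (b + 1) k +
    ((a : ℂ) / (a + b + 1)) • f3 (a - 1) b k := by
  have := cast_add_one_ne a b
  have := cast_add_two_ne a b
  refine LV_ext fun Z r => ?_
  fin_cases r <;>
    simp [opK_eq, f1, f2, f3, rowOp00_tt, rowOp01_tt, evalAt_tt, evalAt_det, evalAt_zM,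
      mul_left_comm (Z.1 _ _), z01_tt, z11_tt] <;>
    field_simp <;> ring

theorem opK11_f1 : opK 1 1 (f1 a b k) =
    (((a : ℂ) + b + 1) * (a + b + 2 - k) / (a + b + 2)) • f1 a (b + 1) k +
    (1 / (((a : ℂ) + b + 1) * (a + b + 2))) • f2 a (b + 1) (k - 1) +
    (-(a : ℂ) / (a + b + 1)) • f3 (a - 1) b (k - 1) := by
  have := cast_add_one_ne a b
  have := cast_add_two_ne a b
  refine LV_ext fun Z r => ?_
  fin_cases r <;>
    simp [opK_eq, f1, f2, f3, rowOp10_tt, rowOp11_tt, evalAt_tt, evalAt_det, evalAt_zM,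
      mul_left_comm (Z.1 _ _), z01_tt, z11_tt] <;>
    field_simp <;> ring

/-- There is no f^{(1)} component, in agreement with `opD` keeping f^{(1)} within its family. -/
theorem opK00_f2 : opK 0 0 (f2 a b k) =
    (((a : ℂ) + b) * (k + 1) / (a + b + 1)) • f2 (a + 1) b (k + 1) +
    (-(b : ℂ) * (k + 1) / (a + b + 1)) • f3 a (b - 1) (k + 1) := by
  have := cast_add_one_ne a b
  refine LV_ext fun Z r => ?_
  fin_cases r <;>
    simp [opK_eq, f1, f2, f3, rowOp00_tt, rowOp01_tt, evalAt_tt, evalAt_det, evalAt_zM,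
      z00_tt, z10_tt] <;>
    field_simp <;> ring

theorem opK10_f2 : opK 1 0 (f2 a b k) =
    (((a : ℂ) + b) * (a + b - k) / (a + b + 1)) • f2 (a + 1) b k +
    (-(b : ℂ) * (a + b - k) / (a + b + 1)) • f3 a (b - 1) k := by
  have := cast_add_one_ne a b
  refine LV_ext fun Z r => ?_
  fin_cases r <;>
    simp [opK_eq, f1, f2, f3, rowOp10_tt, rowOp11_tt, evalAt_tt, evalAt_det, evalAt_zM,
      z00_tt, z10_tt] <;>
    field_simp <;> ring

theorem opK01_f2 : opK 0 1 (f2 a b k) =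
    (((a : ℂ) + b) * (k + 1) / (a + b + 1)) • f2 a (b + 1) (k + 1) +
    ((a : ℂ) * (k + 1) / (a + b + 1)) • f3 (a - 1) b (k + 1) := by
  have := cast_add_one_ne a b
  refine LV_ext fun Z r => ?_
  fin_cases r <;>
    simp [opK_eq, f1, f2, f3, rowOp00_tt, rowOp01_tt, evalAt_tt, evalAt_det, evalAt_zM,
      z01_tt, z11_tt] <;>
    field_simp <;> ring

theorem opK11_f2 : opK 1 1 (f2 a b k) =
    (((a : ℂ) + b) * (a + b - k) / (a + b + 1)) • f2 a (b + 1) k +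
    ((a : ℂ) * (a + b - k) / (a + b + 1)) • f3 (a - 1) b k := by
  have := cast_add_one_ne a b
  refine LV_ext fun Z r => ?_
  fin_cases r <;>
    simp [opK_eq, f1, f2, f3, rowOp10_tt, rowOp11_tt, evalAt_tt, evalAt_det, evalAt_zM,
      z01_tt, z11_tt] <;>
    field_simp <;> ring

/-- The multiples of N stay in their family under `opK`; dually, derivatives of f^{(1)} and f^{(2)}
never involve f^{(3)}. -/
theorem opK00_f3 : opK 0 0 (f3 a b k) = ((k : ℂ) + 1) • f3 (a + 1) b (k + 1) := by
  have := cast_add_one_ne a b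
  rw [opK_f3]
  refine LV_ext fun Z r => ?_
  fin_cases r <;>
    simp [opK_eq, f1, f3, rowOp00_tt, rowOp01_tt, evalAt_tt, evalAt_det, evalAt_zM,
      mul_left_comm (Z.1 _ _), z00_tt, z10_tt] <;>
    field_simp <;> ring

theorem opK10_f3 : opK 1 0 (f3 a b k) = ((a : ℂ) + b + 2 - k) • f3 (a + 1) b k := by
  have := cast_add_one_ne a b
  rw [opK_f3]
  refine LV_ext fun Z r => ?_
  fin_cases r <;>
    simp [opK_eq, f1, f3, rowOp10_tt, rowOp11_tt, evalAt_tt, evalAt_det, evalAt_zM,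
      mul_left_comm (Z.1 _ _), z00_tt, z10_tt] <;>
    field_simp <;> ring

theorem opK01_f3 : opK 0 1 (f3 a b k) = ((k : ℂ) + 1) • f3 a (b + 1) (k + 1) := by
  have := cast_add_one_ne a b
  rw [opK_f3]
  refine LV_ext fun Z r => ?_
  fin_cases r <;>
    simp [opK_eq, f1, f3, rowOp00_tt, rowOp01_tt, evalAt_tt, evalAt_det, evalAt_zM,
      mul_left_comm (Z.1 _ _), z01_tt, z11_tt] <;>
    field_simp <;> ring

theorem opK11_f3 : opK 1 1 (f3 a b k) = ((a : ℂ) + b + 2 - k) • f3 a (b + 1) k := by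
  have := cast_add_one_ne a b
  rw [opK_f3]
  refine LV_ext fun Z r => ?_
  fin_cases r <;>
    simp [opK_eq, f1, f3, rowOp10_tt, rowOp11_tt, evalAt_tt, evalAt_det, evalAt_zM,
      mul_left_comm (Z.1 _ _), z01_tt, z11_tt] <;>
    field_simp <;> ring

end SpecialConformal

/-- The bracket relation of gl(4) between the two off-diagonal blocks. It expresses the off-diagonal
units of the diagonal blocks through translations and special conformal operators, which settles
their stability and adjointness. -/
theorem opD_opK (i j r s : Fin 2) (v : LV) : opD i j (opK r s v) - opK r s (opD i j v) =
    (if i = r then opE s j v else 0) - (if j = s then opA i r v else 0) := by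
  have e : ∀ (p : Prop) [Decidable p] (w : LV) (c : Fin 2),
      (if p then w else 0) c = if p then w c else 0 := by
    intro p _ w c; split_ifs <;> rfl
  have e' : ∀ (p : Prop) [Decidable p] (f : LA) (Z : HCx),
      evalAt Z (if p then f else 0) = if p then evalAt Z f else 0 := by
    intro p _ f Z; split_ifs <;> simp
  refine LV_ext fun Z c => ?_
  have h := fun a b => D_comm i j a b (v c)
  simp only [Pi.sub_apply, opD_apply, opK_apply, opE_apply, opA_apply, Fin.sum_univ_two, map_add,
    map_sub, map_mul, Derivation.leibniz, D_zM, smul_eq_mul, h, e, e', map_one, evalAt_zM]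
  generalize hF : (fun c => evalAt Z (v c)) = F
  generalize hG : (fun a b c => evalAt Z (D a b (v c))) = G
  generalize hH : (fun a b => evalAt Z (D a b (D i j (v c)))) = H
  have hF' : ∀ c, evalAt Z (v c) = F c := fun c => by rw [← hF]
  have hG' : ∀ a b c, evalAt Z (D a b (v c)) = G a b c := fun a b c => by rw [← hG]
  have hH' : ∀ a b, evalAt Z (D a b (D i j (v c))) = H a b := fun a b => by rw [← hH]
  simp only [hF', hG', hH']
  clear hF hG hH hF' hG' hH' h e e'
  fin_cases i <;> fin_cases j <;> fin_cases r <;> fin_cases s <;> fin_cases c <;>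
    simp <;> ring

/-- The operator `½ Z ∇`. -/
def opC : LV →ₗ[ℂ] LV where
  toFun v := fun r => ∑ i, ∑ j, zM r i * D j i (v j)
  map_add' u v := by
    funext r
    simp only [Pi.add_apply, map_add, mul_add, Finset.sum_add_distrib]
  map_smul' c v := by
    funext r
    simp only [Pi.smul_apply, Derivation.map_smul, mul_smul_comm, ← Finset.smul_sum,
      RingHom.id_apply]

theorem opC_eq (v : LV) (r : Fin 2) : opC v r = rowOp r 0 (v 0) + rowOp r 1 (v 1) := by
  change ∑ i, ∑ j, zM r i * D j i (v j) = _
  simp only [Fin.sum_univ_two, rowOp_apply]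
  ring

/-- The f^{(1)} satisfy ∇f = 0, while ½Z∇ multiplies f^{(2)} by the non-zero number a + b + 1; so
this operator separates the two families. -/
theorem opC_f1 (a b : ℕ) (k : ℤ) : opC (f1 a b k) = 0 := by
  refine LV_ext fun Z r => ?_
  fin_cases r <;>
    simp [opC_eq, f1, rowOp00_tt, rowOp01_tt, rowOp10_tt, rowOp11_tt, evalAt_tt] <;> ring

theorem opC_f2 (a b : ℕ) (k : ℤ) : opC (f2 a b k) = ((a : ℂ) + b + 1) • f2 a b k := by
  refine LV_ext fun Z r => ?_
  fin_cases r <;>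
    simp [opC_eq, f2, rowOp00_tt, rowOp01_tt, rowOp10_tt, rowOp11_tt, evalAt_tt] <;> ring

theorem rowOp_Np (i a : Fin 2) (p : ℤ) :
    rowOp i a (Np p) = if i = a then (p : ℂ) • Np p else 0 := by
  rw [derivation_Np, rowOp_det]
  split_ifs
  · rw [← Np_one, ← Np_add, sub_add_cancel]
  · simp

theorem colOp_Np (i a : Fin 2) (p : ℤ) :
    colOp i a (Np p) = if i = a then (p : ℂ) • Np p else 0 := by
  rw [derivation_Np, colOp_det]
  split_ifs
  · rw [← Np_one, ← Np_add, sub_add_cancel]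
  · simp

/-- Multiplication by `N(Z) ^ p`. -/
def mulN (p : ℤ) : LV →ₗ[ℂ] LV where
  toFun v := fun r => Np p * v r
  map_add' u v := by funext r; simp [mul_add]
  map_smul' c v := by funext r; simp

theorem mulN_apply (p : ℤ) (v : LV) (r : Fin 2) : mulN p v r = Np p * v r := rfl

theorem mulN_mulN (p q : ℤ) (v : LV) : mulN p (mulN q v) = mulN (p + q) v := by
  funext r; simp only [mulN_apply, Np_add, mul_assoc]

theorem mulN_zero (v : LV) : mulN 0 v = v := by
  funext r; simp only [mulN_apply, Np_zero, one_mul]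

theorem mulN_one_f1 (a b : ℕ) (k : ℤ) : mulN 1 (f1 a b k) = f3 a b k := by
  funext r; rw [mulN_apply, Np_one, f3_apply]

theorem opC_mulN (p : ℤ) (v : LV) : opC (mulN p v) = (p : ℂ) • mulN p v + mulN p (opC v) := by
  refine LV_ext fun Z r => ?_
  rw [Pi.add_apply, Pi.smul_apply]
  simp only [opC_eq, mulN_apply, Derivation.leibniz, rowOp_Np, smul_eq_mul]
  fin_cases r <;> simp <;> ring

theorem opE_mulN (p : ℤ) (i : Fin 2) (v : LV) :
    opE i i (mulN p v) = (p : ℂ) • mulN p v + mulN p (opE i i v) := by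
  refine LV_ext fun Z r => ?_
  rw [Pi.add_apply, Pi.smul_apply]
  simp only [opE_eq, mulN_apply, Derivation.leibniz, colOp_Np, smul_eq_mul, if_true]
  simp
  ring

theorem opA_mulN (p : ℤ) (i : Fin 2) (v : LV) :
    opA i i (mulN p v) = -(p : ℂ) • mulN p v + mulN p (opA i i v) := by
  refine LV_ext fun Z r => ?_
  rw [Pi.add_apply, Pi.smul_apply]
  simp only [opA_eq, mulN_apply, Derivation.leibniz, rowOp_Np, smul_eq_mul, if_true]
  split_ifs <;> simp <;> ring

theorem opE00_f1 (a b : ℕ) (k : ℤ) : opE 0 0 (f1 a b k) = (a : ℂ) • f1 a b k := by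
  refine LV_ext fun Z r => ?_
  fin_cases r <;> simp [opE_eq, f1, colOp00_tt, evalAt_tt]

theorem opE11_f1 (a b : ℕ) (k : ℤ) : opE 1 1 (f1 a b k) = (b : ℂ) • f1 a b k := by
  refine LV_ext fun Z r => ?_
  fin_cases r <;> simp [opE_eq, f1, colOp11_tt, evalAt_tt]

theorem opE00_f2 (a b : ℕ) (k : ℤ) : opE 0 0 (f2 a b k) = (a : ℂ) • f2 a b k := by
  refine LV_ext fun Z r => ?_
  fin_cases r <;> simp [opE_eq, f2, colOp00_tt, evalAt_tt] <;> ring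

theorem opE11_f2 (a b : ℕ) (k : ℤ) : opE 1 1 (f2 a b k) = (b : ℂ) • f2 a b k := by
  refine LV_ext fun Z r => ?_
  fin_cases r <;> simp [opE_eq, f2, colOp11_tt, evalAt_tt] <;> ring

theorem opA00_f1 (a b : ℕ) (k : ℤ) : opA 0 0 (f1 a b k) = (-(k : ℂ)) • f1 a b k := by
  refine LV_ext fun Z r => ?_
  fin_cases r <;> simp [opA_eq, f1, rowOp00_tt, evalAt_tt] <;> ring

theorem opA00_f2 (a b : ℕ) (k : ℤ) : opA 0 0 (f2 a b k) = (-((k : ℂ) + 1)) • f2 a b k := by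
  refine LV_ext fun Z r => ?_
  fin_cases r <;> simp [opA_eq, f2, rowOp00_tt, evalAt_tt] <;> ring

/-- A scalar matrix λ acts by λ/N(λ) = λ⁻¹, so the identity matrix acts by -1. This recovers `opA 1
1` from the other three diagonal units. -/
theorem opA_add_opE (v : LV) :
    opA 0 0 v + opA 1 1 v + opE 0 0 v + opE 1 1 v = -v := by
  funext r
  simp only [Pi.add_apply, Pi.neg_apply, opA_apply, opE_apply, Fin.sum_univ_two]
  fin_cases r <;> simp <;> ring

/-! ### Square norms of the three families on S³ -/

section Sphere

theorem det_quat (x : Metric.sphere (0 : EuclideanSpace ℝ (Fin 4)) 1) : (quat x.1).det = 1 := by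
  have h : ‖x.1‖ ^ 2 = 1 := by rw [mem_sphere_zero_iff_norm.1 x.2, one_pow]
  rw [EuclideanSpace.norm_sq_eq, Fin.sum_univ_four] at h
  simp only [Real.norm_eq_abs, sq_abs] at h
  have h2 : ((x.1 0 : ℂ) ^ 2 + (x.1 1 : ℂ) ^ 2 + (x.1 2 : ℂ) ^ 2 + (x.1 3 : ℂ) ^ 2) = 1 := by
    exact_mod_cast h
  rw [Matrix.det_fin_two]
  simp only [quat, Matrix.of_apply, Matrix.cons_val', Matrix.cons_val_zero, Matrix.cons_val_one,
    Matrix.cons_val_fin_one]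
  linear_combination h2 - ((x.1 3 : ℂ) ^ 2 + (x.1 1 : ℂ) ^ 2) * Complex.I_sq

/-- A point of the sphere as an invertible matrix. -/
def sphPt (x : Metric.sphere (0 : EuclideanSpace ℝ (Fin 4)) 1) : HCx :=
  ⟨quat x.1, by rw [det_quat]; exact one_ne_zero⟩

theorem sphereInner_eq (f g : Fn) : sphereInner f g =
    ∫ x : Metric.sphere (0 : EuclideanSpace ℝ (Fin 4)) 1,
      ∑ i, conj (g (sphPt x) i) * f (sphPt x) i ∂MeasureTheory.volume.toSphere := by
  rw [sphereInner]
  refine MeasureTheory.integral_congr_ae (Filter.Eventually.of_forall fun x => ?_)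
  have : ∀ f : Fn, ext f (quat x.1) = f (sphPt x) := fun f => ext_mk f (sphPt x)
  simp only [this]

theorem integrable_conj_tt_mul_tt (a' b' a b : ℕ) (k' k : ℤ) :
    MeasureTheory.Integrable (fun x : Metric.sphere (0 : EuclideanSpace ℝ (Fin 4)) 1 =>
      conj (tt (quat x.1) a' b' k') * tt (quat x.1) a b k) MeasureTheory.volume.toSphere := by
  have h := integrable_eval_quat
    (((-1) ^ a' * sg ℂ k') • (tt Zx b' a' (a' + b' - k') * tt Zx a b k))
  refine h.congr (Filter.Eventually.of_forall fun x => ?_)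
  simp only [conj_tt_quat, MvPolynomial.smul_eval, map_mul, eval_tt_Zx]
  ring

theorem sphereInner_toFn_tt (a b a' b' : ℕ) (k₀ k₁ k₀' k₁' : ℤ) (c₀ c₁ c₀' c₁' : ℂ) (u v : LV)
    (hu₀ : ∀ x, evalAt (sphPt x) (u 0) = c₀ * tt (quat x.1) a b k₀)
    (hu₁ : ∀ x, evalAt (sphPt x) (u 1) = c₁ * tt (quat x.1) a b k₁)
    (hv₀ : ∀ x, evalAt (sphPt x) (v 0) = c₀' * tt (quat x.1) a' b' k₀')
    (hv₁ : ∀ x, evalAt (sphPt x) (v 1) = c₁' * tt (quat x.1) a' b' k₁') :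
    sphereInner (toFn u) (toFn v) =
      (conj c₀' * c₀) * (if a' = a ∧ b' = b ∧ k₀' = k₀ then
        2 * (Real.pi : ℂ) ^ 2 * (a.factorial * b.factorial * ifac k₀ * ifac (a + b - k₀)) /
          (a + b + 1) else 0) +
      (conj c₁' * c₁) * (if a' = a ∧ b' = b ∧ k₁' = k₁ then
        2 * (Real.pi : ℂ) ^ 2 * (a.factorial * b.factorial * ifac k₁ * ifac (a + b - k₁)) /
          (a + b + 1) else 0) := by
  rw [sphereInner_eq, ← integral_conj_tt_mul_tt, ← integral_conj_tt_mul_tt,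
    ← MeasureTheory.integral_const_mul, ← MeasureTheory.integral_const_mul,
    ← MeasureTheory.integral_add ((integrable_conj_tt_mul_tt _ _ _ _ _ _).const_mul _)
      ((integrable_conj_tt_mul_tt _ _ _ _ _ _).const_mul _)]
  refine MeasureTheory.integral_congr_ae (Filter.Eventually.of_forall fun x => ?_)
  simp only [Fin.sum_univ_two, toFn_apply, hu₀, hu₁, hv₀, hv₁, map_mul]
  ring

/-- The two entries contribute in the ratio (a + b + 1 - k) : k, and their sum cancels the
denominator a + b + 1. For f^{(2)} the ratio is (k + 1) : (a + b - k). -/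
theorem sphereInner_f1 (a b a' b' : ℕ) (k k' : ℤ) :
    sphereInner (toFn (f1 a b k)) (toFn (f1 a' b' k')) =
      if a' = a ∧ b' = b ∧ k' = k then
        2 * (Real.pi : ℂ) ^ 2 * (a.factorial * b.factorial * ifac k * ifac (a + b + 1 - k))
      else 0 := by
  rw [sphereInner_toFn_tt a b a' b' k (k - 1) k' (k' - 1) 1 (-1) 1 (-1)
    _ _ (fun x => by rw [f1_zero, evalAt_tt, one_mul]; rfl)
    (fun x => by rw [f1_one, map_neg, evalAt_tt, neg_one_mul]; rfl)
    (fun x => by rw [f1_zero, evalAt_tt, one_mul]; rfl)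
    (fun x => by rw [f1_one, map_neg, evalAt_tt, neg_one_mul]; rfl)]
  have h1 := ifac_pred k
  have h2 := ifac_pred (a + b + 1 - k)
  rw [show (a + b + 1 - k - 1 : ℤ) = a + b - k by ring] at h2
  have h3 := cast_add_one_ne a b
  by_cases h : a' = a ∧ b' = b ∧ k' = k
  · obtain ⟨rfl, rfl, rfl⟩ := h
    simp only [and_self, if_true, map_one, map_neg]
    rw [show (a' + b' - (k' - 1) : ℤ) = a' + b' + 1 - k' by ring, h1, h2]
    field_simp
    push_cast
    ring
  · rw [if_neg h, if_neg h, if_neg (by rw [sub_left_inj]; exact h)]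
    ring

theorem sphereInner_f2 (a b a' b' : ℕ) (k k' : ℤ) :
    sphereInner (toFn (f2 a b k)) (toFn (f2 a' b' k')) =
      if a' = a ∧ b' = b ∧ k' = k then
        2 * (Real.pi : ℂ) ^ 2 * (a.factorial * b.factorial * ifac k * ifac (a + b - 1 - k))
      else 0 := by
  rw [sphereInner_toFn_tt a b a' b' (k + 1) k (k' + 1) k' (k + 1) (a + b - k) (k' + 1)
    (a' + b' - k') _ _
    (fun x => by rw [f2_zero, map_smul, evalAt_tt, smul_eq_mul]; rfl)
    (fun x => by rw [f2_one, map_smul, evalAt_tt, smul_eq_mul]; rfl)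
    (fun x => by rw [f2_zero, map_smul, evalAt_tt, smul_eq_mul]; rfl)
    (fun x => by rw [f2_one, map_smul, evalAt_tt, smul_eq_mul]; rfl)]
  have h1 := ifac_pred (k + 1)
  have h2 := ifac_pred (a + b - k)
  rw [show (a + b - k - 1 : ℤ) = a + b - 1 - k by ring] at h2
  rw [add_sub_cancel_right] at h1
  have h3 := cast_add_one_ne a b
  by_cases h : a' = a ∧ b' = b ∧ k' = k
  · obtain ⟨rfl, rfl, rfl⟩ := h
    simp only [and_self, if_true, map_one, map_add, map_sub, Complex.conj_natCast, map_intCast]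
    rw [show (a' + b' - (k' + 1) : ℤ) = a' + b' - 1 - k' by ring]
    rw [h1, h2]
    field_simp
    push_cast
    ring
  · rw [if_neg h, if_neg h, if_neg (by rw [add_left_inj]; exact h)]
    ring

theorem sphereInner_f3 (a b a' b' : ℕ) (k k' : ℤ) :
    sphereInner (toFn (f3 a b k)) (toFn (f3 a' b' k')) =
      sphereInner (toFn (f1 a b k)) (toFn (f1 a' b' k')) := by
  rw [sphereInner_eq, sphereInner_eq]
  have h : ∀ a b k x i, toFn (f3 a b k) (sphPt x) i = toFn (f1 a b k) (sphPt x) i := by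
    intro a b k x i
    rw [toFn_apply, toFn_apply, f3_apply, map_mul, evalAt_det]
    change (quat x.1).det * _ = _
    rw [det_quat, one_mul]
  simp only [h]

end Sphere

/-! ### Linear algebra of joint eigenvectors -/

section JointEigenvectors

variable {ι κ M : Type*} [AddCommGroup M] [Module ℂ M] {v : ι → M} {T : κ → Module.End ℂ M}
  {μ : κ → ι → ℂ}

/-- Joint eigenvectors with different systems of eigenvalues are separated by a polynomial in the
operators. -/
theorem exists_separating (hT : ∀ s x, T s (v x) = μ s x • v x)
    (hμ : ∀ x y, (∀ s, μ s x = μ s y) → x = y) (y : ι) (F : Finset ι) (hy : y ∉ F) :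
    ∃ (P : Module.End ℂ M) (ν : ι → ℂ), (∀ x, P (v x) = ν x • v x) ∧ (∀ x ∈ F, ν x = 0) ∧
      ν y ≠ 0 := by
  classical
  induction F using Finset.induction_on with
  | empty => exact ⟨1, fun _ => 1, fun x => by simp, by simp, one_ne_zero⟩
  | insert z F _ ih =>
    rw [Finset.mem_insert, not_or] at hy
    obtain ⟨P, ν, h1, h2, h3⟩ := ih hy.2
    obtain ⟨s, hs⟩ : ∃ s, μ s y ≠ μ s z := by
      by_contra! h
      exact hy.1 (hμ y z h)
    refine ⟨P * (T s - algebraMap ℂ _ (μ s z)), fun x => (μ s x - μ s z) * ν x, fun x => ?_,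
      fun x hx => ?_, mul_ne_zero (sub_ne_zero.2 hs) h3⟩
    · rw [Module.End.mul_apply, LinearMap.sub_apply, hT, Module.algebraMap_end_apply, ← sub_smul,
        map_smul, h1, smul_smul]
    · rcases Finset.mem_insert.1 hx with rfl | hx
      · simp
      · simp [h2 x hx]

theorem linearIndependent_of_jointEigenvectors (hT : ∀ s x, T s (v x) = μ s x • v x)
    (hμ : ∀ x y, (∀ s, μ s x = μ s y) → x = y) (hv : ∀ x, v x ≠ 0) : LinearIndependent ℂ v := by
  classical
  rw [linearIndependent_iff']
  intro F c hc y hy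
  obtain ⟨P, ν, h1, h2, h3⟩ := exists_separating hT hμ y (F.erase y) (Finset.notMem_erase y F)
  have h := congrArg P hc
  rw [map_sum, map_zero, Finset.sum_eq_single y] at h
  · rw [map_smul, h1, smul_smul] at h
    exact (mul_eq_zero.1 ((smul_eq_zero.1 h).resolve_right (hv y))).resolve_right h3
  · intro x hx hxy
    rw [map_smul, h1, h2 x (Finset.mem_erase.2 ⟨hxy, hx⟩), zero_smul, smul_zero]
  · exact fun h => absurd hy h

/-- An eigenvector in the span of eigenvectors lies in the span of those with its eigenvalue. -/
theorem mem_span_of_eigenvector {A : Module.End ℂ M} {ν : ι → ℂ} (hA : ∀ x, A (v x) = ν x • v x)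
    {c : ℂ} {u : M} (hu : u ∈ Submodule.span ℂ (Set.range v)) (hc : A u = c • u) :
    u ∈ Submodule.span ℂ (v '' {x | ν x = c}) := by
  classical
  obtain ⟨l, rfl⟩ := (Finsupp.mem_span_range_iff_exists_finsupp).1 hu
  set p := ∑ x ∈ l.support.filter (fun x => ν x = c), l x • v x with hp
  set q := ∑ x ∈ l.support.filter (fun x => ¬ ν x = c), l x • v x with hq
  have hsum : (l.sum fun x a => a • v x) = p + q :=
    (Finset.sum_filter_add_sum_filter_not l.support (fun x => ν x = c) _).symm
  have hpm : p ∈ Submodule.span ℂ (v '' {x | ν x = c}) :=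
    Submodule.sum_mem _ fun x hx => Submodule.smul_mem _ _
      (Submodule.subset_span ⟨x, (Finset.mem_filter.1 hx).2, rfl⟩)
  rw [hsum] at hc ⊢
  have hpA : A p = c • p := by
    rw [hp, map_sum, Finset.smul_sum]
    refine Finset.sum_congr rfl fun x hx => ?_
    rw [map_smul, hA, (Finset.mem_filter.1 hx).2, smul_comm]
  have hqA : A q = c • q := by
    rw [map_add, hpA, smul_add] at hc
    exact add_left_cancel hc
  have hq0 : q = 0 := by
    have hqi : q ∈ ⨆ d ∈ {d : ℂ | d ≠ c}, A.eigenspace d := by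
      refine Submodule.sum_mem _ fun x hx => Submodule.smul_mem _ _ ?_
      refine Submodule.mem_iSup_of_mem (ν x) (Submodule.mem_iSup_of_mem
        (show ν x ∈ {d : ℂ | d ≠ c} from (Finset.mem_filter.1 hx).2) ?_)
      exact Module.End.mem_eigenspace_iff.2 (hA x)
    have hd := (Module.End.eigenspaces_iSupIndep A) c
    exact Submodule.disjoint_def.1 hd q (Module.End.mem_eigenspace_iff.2 hqA) hqi
  rw [hq0, add_zero]
  exact hpm

end JointEigenvectors

/-! ### The combined family, its linear independence and the form -/

/-- The indices of the functions `f^{(1)}`, `f^{(2)}`, `f^{(3)}`. -/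
abbrev Ix := Fin 3 × ℕ × ℕ × ℤ

/-- The functions `f^{(1)}`, `f^{(2)}`, `f^{(3)}` as one family. -/
def ee : Ix → LV
  | (0, a, b, k) => f1 a b k
  | (1, a, b, k) => f2 a b k
  | (2, a, b, k) => f3 a b k

/-- The indices of the non-zero functions of the family. -/
def Valid : Ix → Prop
  | (0, a, b, k) => 0 ≤ k ∧ k ≤ a + b + 1
  | (1, a, b, k) => 0 ≤ k ∧ k + 1 ≤ a + b
  | (2, a, b, k) => 0 ≤ k ∧ k ≤ a + b + 1

/-- The signed weights of the invariant form. -/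
def wgt : Ix → ℂ
  | (0, a, b, _) => a + b + 1
  | (1, a, b, _) => -((a + b) * (a + b + 1))
  | (2, a, b, _) => -(a + b + 2)

/-- The norms of `f^{(1)}` and `f^{(3)}`. -/
def nn (a b : ℕ) (k : ℤ) : ℂ := a.factorial * b.factorial * ifac k * ifac (a + b + 1 - k)

/-- The norms of `f^{(2)}`. -/
def mm (a b : ℕ) (k : ℤ) : ℂ := a.factorial * b.factorial * ifac k * ifac (a + b - 1 - k)

/-- The square norms on the sphere. -/
def nrm : Ix → ℂ
  | (0, a, b, k) => nn a b k
  | (1, a, b, k) => mm a b k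
  | (2, a, b, k) => nn a b k

/-- Outside the admissible range of k the vectors are zero. Hence the formulas for `opD` and `opK`
hold for every integer k and the ends of the ranges need no separate treatment. -/
theorem f1_eq_zero {a b : ℕ} {k : ℤ} (h : ¬ (0 ≤ k ∧ k ≤ a + b + 1)) : f1 a b k = 0 := by
  have h1 : tt zM a b k = 0 := by
    rcases lt_or_ge k 0 with h0 | h0
    · exact tt_of_neg _ _ _ _ h0
    · exact tt_of_gt _ _ _ _ (by push Not at h; have := h h0; omega)
  have h2 : tt zM a b (k - 1) = 0 := by
    rcases lt_or_ge k 0 with h0 | h0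
    · exact tt_of_neg _ _ _ _ (by omega)
    · exact tt_of_gt _ _ _ _ (by push Not at h; have := h h0; omega)
  funext r
  fin_cases r <;> simp [f1, h1, h2]

theorem f3_eq_zero {a b : ℕ} {k : ℤ} (h : ¬ (0 ≤ k ∧ k ≤ a + b + 1)) : f3 a b k = 0 := by
  funext r
  rw [f3_apply, f1_eq_zero h, Pi.zero_apply, mul_zero]

theorem f2_eq_zero {a b : ℕ} {k : ℤ} (h : ¬ (0 ≤ k ∧ k + 1 ≤ a + b)) : f2 a b k = 0 := by
  have h1 : ((k : ℂ) + 1) • tt zM a b (k + 1) = 0 := by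
    by_cases hk : k = -1
    · simp [hk]
    rcases lt_or_ge k 0 with h0 | h0
    · rw [tt_of_neg _ _ _ _ (by omega), smul_zero]
    · rw [tt_of_gt _ _ _ _ (by push Not at h; have := h h0; omega), smul_zero]
  have h2 : ((a : ℂ) + b - k) • tt zM a b k = 0 := by
    by_cases hk : k = a + b
    · simp [hk]
    rcases lt_or_ge k 0 with h0 | h0
    · rw [tt_of_neg _ _ _ _ (by omega), smul_zero]
    · rw [tt_of_gt _ _ _ _ (by push Not at h; have := h h0; omega), smul_zero]
  funext r
  fin_cases r
  · exact h1
  · exact h2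

theorem ee_eq_zero {x : Ix} (h : ¬ Valid x) : ee x = 0 := by
  obtain ⟨α, a, b, k⟩ := x
  fin_cases α
  · exact f1_eq_zero h
  · exact f2_eq_zero h
  · exact f3_eq_zero h

theorem ifac_ne_zero {k : ℤ} (hk : 0 ≤ k) : ifac k ≠ 0 := by
  lift k to ℕ using hk
  rw [ifac_natCast]
  exact inv_ne_zero (by exact_mod_cast k.factorial_ne_zero)

theorem conj_ifac (k : ℤ) : conj (ifac k) = ifac k := by
  rcases lt_or_ge k 0 with h | h
  · rw [ifac_of_neg h, map_zero]
  · lift k to ℕ using h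
    rw [ifac_natCast, map_inv₀, Complex.conj_natCast]

/-- The norm vanishes at the same indices as the vector, so `BB_ee` needs no validity hypothesis. -/
theorem nrm_eq_zero {x : Ix} (h : ¬ Valid x) : nrm x = 0 := by
  obtain ⟨α, a, b, k⟩ := x
  fin_cases α
  all_goals
    simp only [Valid, not_and_or, not_le] at h
    rcases h with h | h
    · simp [nrm, nn, mm, ifac_of_neg h]
  · simp [nrm, nn, ifac_of_neg (show (a + b + 1 - k : ℤ) < 0 by omega)]
  · simp [nrm, mm, ifac_of_neg (show (a + b - 1 - k : ℤ) < 0 by omega)]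
  · simp [nrm, nn, ifac_of_neg (show (a + b + 1 - k : ℤ) < 0 by omega)]

theorem nrm_ne_zero {x : Ix} (h : Valid x) : nrm x ≠ 0 := by
  obtain ⟨α, a, b, k⟩ := x
  have ha : (a.factorial : ℂ) ≠ 0 := by exact_mod_cast a.factorial_ne_zero
  have hb : (b.factorial : ℂ) ≠ 0 := by exact_mod_cast b.factorial_ne_zero
  fin_cases α
  all_goals
    simp only [Valid] at h
    simp only [nrm, nn, mm]
    refine mul_ne_zero (mul_ne_zero (mul_ne_zero ha hb) (ifac_ne_zero h.1)) (ifac_ne_zero ?_)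
    have := h.2
    omega

theorem conj_nrm (x : Ix) : conj (nrm x) = nrm x := by
  obtain ⟨α, a, b, k⟩ := x
  fin_cases α <;> simp [nrm, nn, mm, conj_ifac]

theorem conj_wgt (x : Ix) : conj (wgt x) = wgt x := by
  obtain ⟨α, a, b, k⟩ := x
  fin_cases α <;> simp [wgt, map_ofNat]

theorem wgt_ne_zero {x : Ix} (h : Valid x) : wgt x ≠ 0 := by
  obtain ⟨α, a, b, k⟩ := x
  have h1 := cast_add_one_ne a b
  have h2 := cast_add_two_ne a b
  fin_cases α
  · exact h1
  · have h3 : (a : ℂ) + b ≠ 0 := by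
      have : a + b ≠ 0 := by
        simp only [Valid] at h
        omega
      exact_mod_cast this
    exact neg_ne_zero.2 (mul_ne_zero h3 h1)
  · exact neg_ne_zero.2 h2

theorem sphereInner_ee (α : Fin 3) (y z : ℕ × ℕ × ℤ) :
    sphereInner (toFn (ee (α, y))) (toFn (ee (α, z))) =
      if y = z then 2 * (Real.pi : ℂ) ^ 2 * nrm (α, y) else 0 := by
  obtain ⟨a, b, k⟩ := y
  obtain ⟨a', b', k'⟩ := z
  have e : ((a, b, k) = (a', b', k')) = (a' = a ∧ b' = b ∧ k' = k) := by
    simp only [Prod.mk.injEq, eq_comm]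
  fin_cases α
  · simp only [e]; exact sphereInner_f1 a b a' b' k k'
  · simp only [e]; exact sphereInner_f2 a b a' b' k k'
  · simp only [e]
    exact (sphereInner_f3 a b a' b' k k').trans (sphereInner_f1 a b a' b' k k')

/-- Its square norm on the sphere is non-zero. -/
theorem ee_ne_zero {x : Ix} (h : Valid x) : ee x ≠ 0 := by
  intro h0
  have h1 := sphereInner_ee x.1 x.2 x.2
  rw [if_pos rfl, Prod.mk.eta, h0, map_zero, sphereInner_eq] at h1
  simp only [Pi.zero_apply, mul_zero, Finset.sum_const_zero, MeasureTheory.integral_zero] at h1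
  refine mul_ne_zero ?_ (nrm_ne_zero h) h1.symm
  exact mul_ne_zero two_ne_zero (pow_ne_zero 2 (by exact_mod_cast Real.pi_ne_zero))

/-- A commuting family of operators that separates the functions of the family. -/
def sepOp : Fin 4 → Module.End ℂ LV := ![opE 0 0, opE 1 1, opA 0 0, opC]

/-- The eigenvalues of these operators. -/
def sepEig : Fin 4 → Ix → ℂ
  | 0, (0, a, _, _) => a
  | 0, (1, a, _, _) => a
  | 0, (2, a, _, _) => a + 1
  | 1, (0, _, b, _) => b
  | 1, (1, _, b, _) => b
  | 1, (2, _, b, _) => b + 1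
  | 2, (0, _, _, k) => -k
  | 2, (1, _, _, k) => -(k + 1)
  | 2, (2, _, _, k) => -(k + 1)
  | 3, (0, _, _, _) => 0
  | 3, (1, a, b, _) => a + b + 1
  | 3, (2, _, _, _) => 1

theorem sepOp_ee (s : Fin 4) (x : Ix) : sepOp s (ee x) = sepEig s x • ee x := by
  obtain ⟨α, a, b, k⟩ := x
  fin_cases α <;> fin_cases s
  · exact opE00_f1 a b k
  · exact opE11_f1 a b k
  · exact opA00_f1 a b k
  · exact (opC_f1 a b k).trans (zero_smul ℂ _).symm
  · exact opE00_f2 a b k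
  · exact opE11_f2 a b k
  · exact opA00_f2 a b k
  · exact opC_f2 a b k
  · change opE 0 0 (f3 a b k) = ((a : ℂ) + 1) • f3 a b k
    rw [← mulN_one_f1, opE_mulN, opE00_f1, map_smul]
    push_cast; module
  · change opE 1 1 (f3 a b k) = ((b : ℂ) + 1) • f3 a b k
    rw [← mulN_one_f1, opE_mulN, opE11_f1, map_smul]
    push_cast; module
  · change opA 0 0 (f3 a b k) = (-((k : ℂ) + 1)) • f3 a b k
    rw [← mulN_one_f1, opA_mulN, opA00_f1, map_smul]
    push_cast; module
  · change opC (f3 a b k) = (1 : ℂ) • f3 a b k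
    rw [← mulN_one_f1, opC_mulN, opC_f1, map_zero]
    push_cast; module

/-- The eigenvalue of ½Z∇ is 0 on f^{(1)}, a + b + 1 on f^{(2)} and 1 on f^{(3)}. The last two can
agree only for f^{(2)} of degree 0, whereas f^{(3)} has degree at least 2. Inside a family the other
three operators determine a, b, k. -/
theorem sepEig_injective (x y : Ix) (h : ∀ s, sepEig s x = sepEig s y) : x = y := by
  obtain ⟨α, a, b, k⟩ := x
  obtain ⟨α', a', b', k'⟩ := y
  have h0 := h 0
  have h1 := h 1
  have h2 := h 2
  have h3 := h 3
  fin_cases α <;> fin_cases α' <;> simp only [sepEig] at h0 h1 h2 h3 <;> norm_cast at h0 h1 h2 h3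
  all_goals first
    | (exfalso; omega)
    | (simp only [Prod.mk.injEq, true_and]; refine ⟨?_, ?_, ?_⟩ <;> omega)

theorem linearIndependent_ee : LinearIndependent ℂ (fun x : {x : Ix // Valid x} => ee x.1) :=
  linearIndependent_of_jointEigenvectors (T := sepOp) (μ := fun s x => sepEig s x.1)
    (fun s x => sepOp_ee s x.1) (fun x y h => Subtype.ext (sepEig_injective x.1 y.1 h))
    (fun x => ee_ne_zero x.2)

/-- The span of the family, a model of `𝒰⁺`. -/
def SS : Submodule ℂ LV := Submodule.span ℂ (Set.range ee)

theorem ee_mem (x : Ix) : ee x ∈ SS := Submodule.subset_span ⟨x, rfl⟩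

theorem SS_eq : SS = Submodule.span ℂ (Set.range fun x : {x : Ix // Valid x} => ee x.1) := by
  refine le_antisymm (Submodule.span_le.2 ?_) (Submodule.span_mono ?_)
  · rintro _ ⟨x, rfl⟩
    by_cases h : Valid x
    · exact Submodule.subset_span ⟨⟨x, h⟩, rfl⟩
    · rw [ee_eq_zero h]; exact Submodule.zero_mem _
  · rintro _ ⟨x, rfl⟩
    exact ⟨x.1, rfl⟩

/-- The coordinates are extended from `SS` to all vectors by an arbitrary left inverse. Only their
values on `SS` matter, so statements about `BB` below are made there. -/
theorem exists_coord : ∃ φ : LV →ₗ[ℂ] ({x : Ix // Valid x} →₀ ℂ),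
    φ ∘ₗ Finsupp.linearCombination ℂ (fun x : {x : Ix // Valid x} => ee x.1) = LinearMap.id :=
  LinearMap.exists_leftInverse_of_injective _ (LinearMap.ker_eq_bot.2 linearIndependent_ee)

/-- Coordinates with respect to the family. -/
def coord : LV →ₗ[ℂ] ({x : Ix // Valid x} →₀ ℂ) := Classical.choose exists_coord

theorem coord_ee (x : {x : Ix // Valid x}) : coord (ee x.1) = Finsupp.single x 1 := by
  have h := LinearMap.congr_fun (Classical.choose_spec exists_coord) (Finsupp.single x 1)
  rwa [LinearMap.comp_apply, Finsupp.linearCombination_single, one_smul] at h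

theorem linearCombination_coord {u : LV} (hu : u ∈ SS) :
    Finsupp.linearCombination ℂ (fun x : {x : Ix // Valid x} => ee x.1) (coord u) = u := by
  rw [SS_eq, ← Finsupp.range_linearCombination] at hu
  obtain ⟨l, rfl⟩ := hu
  have h := LinearMap.congr_fun (Classical.choose_spec exists_coord) l
  rw [LinearMap.comp_apply] at h
  exact congrArg _ h

/-- The invariant Hermitian form. -/
def BB : LV →ₗ[ℂ] LV →ₗ⋆[ℂ] ℂ :=
  LinearMap.mk₂'ₛₗ (RingHom.id ℂ) (starRingEnd ℂ)
    (fun u v => (coord u).sum fun x c => c * (conj (coord v x) * (wgt x.1 * nrm x.1)))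
    (fun u u' v => by
      rw [map_add]
      exact Finsupp.sum_add_index' (fun _ => zero_mul _) (fun _ _ _ => add_mul _ _ _))
    (fun c u v => by
      rw [map_smul, Finsupp.sum_smul_index (fun _ => zero_mul _), RingHom.id_apply, Finsupp.sum,
        Finsupp.sum, Finset.smul_sum]
      simp only [mul_assoc, smul_eq_mul])
    (fun u v v' => by
      simp only [Finsupp.sum, map_add, Finsupp.add_apply, add_mul, mul_add,
        Finset.sum_add_distrib])
    (fun c u v => by
      simp only [Finsupp.sum, map_smul, Finsupp.smul_apply, smul_eq_mul, map_mul,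
        Finset.mul_sum]
      exact Finset.sum_congr rfl fun x _ => by ring)

theorem BB_apply (u v : LV) : BB u v =
    (coord u).sum fun x c => c * (conj (coord v x) * (wgt x.1 * nrm x.1)) := rfl

theorem BB_conj (u v : LV) : BB v u = conj (BB u v) := by
  classical
  have h : ∀ u v : LV, BB u v = ∑ x ∈ (coord u).support ∪ (coord v).support,
      coord u x * (conj (coord v x) * (wgt x.1 * nrm x.1)) := fun u v =>
    Finsupp.sum_of_support_subset (coord u) Finset.subset_union_left
      (fun x c => c * (conj (coord v x) * (wgt x.1 * nrm x.1))) (fun _ _ => zero_mul _)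
  rw [h, h, Finset.union_comm, map_sum]
  refine Finset.sum_congr rfl fun x _ => ?_
  simp only [map_mul, conj_wgt, conj_nrm, Complex.conj_conj]
  ring

theorem BB_ee_left (x : {x : Ix // Valid x}) (v : LV) :
    BB (ee x.1) v = conj (coord v x) * (wgt x.1 * nrm x.1) := by
  rw [BB_apply, coord_ee, Finsupp.sum_single_index (zero_mul _), one_mul]

theorem BB_ee (x y : Ix) : BB (ee x) (ee y) = if x = y then wgt x * nrm x else 0 := by
  classical
  by_cases hx : Valid x
  · by_cases hy : Valid y
    · rw [BB_ee_left ⟨x, hx⟩, coord_ee ⟨y, hy⟩, Finsupp.single_apply]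
      simp only [Subtype.mk.injEq, @eq_comm _ y x]
      split_ifs <;> simp
    · rw [ee_eq_zero hy, map_zero, if_neg]
      rintro rfl
      exact hy hx
  · rw [ee_eq_zero hx, map_zero, LinearMap.zero_apply, nrm_eq_zero hx, mul_zero, ite_self]

theorem BB_nondegenerate {u : LV} (hu : u ∈ SS) (h : ∀ v ∈ SS, BB u v = 0) : u = 0 := by
  have h0 : coord u = 0 := by
    ext x
    have h1 := h _ (ee_mem x.1)
    rw [BB_conj, BB_ee_left, map_mul, Complex.conj_conj] at h1
    refine (mul_eq_zero.1 h1).resolve_right ?_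
    refine (map_ne_zero (starRingEnd ℂ)).2 ?_
    exact mul_ne_zero (wgt_ne_zero x.2) (nrm_ne_zero x.2)
  rw [← linearCombination_coord hu, h0, map_zero]

/-! ### Recursions between the norms -/

section NormRecursions

variable (a b : ℕ) (k : ℤ)

theorem ifac_succ_mul : ((k : ℂ) + 1) * ifac (k + 1) = ifac k := by
  have := ifac_pred (k + 1)
  rw [add_sub_cancel_right] at this
  rw [this]; push_cast; ring

theorem cast_succ_ne (n : ℕ) : (n : ℂ) + 1 ≠ 0 := Nat.cast_add_one_ne_zero n

theorem nn_left_up : nn a b k = ((k : ℂ) + 1) / (a + 1) * nn (a + 1) b (k + 1) := by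
  have h := ifac_succ_mul k
  have := cast_succ_ne a
  rw [nn, nn, ← h, Nat.factorial_succ, show ((a + 1 : ℕ) + b + 1 - (k + 1) : ℤ) = a + b + 1 - k by
    push_cast; ring]
  push_cast; field_simp

theorem nn_right_up : nn a b k = ((k : ℂ) + 1) / (b + 1) * nn a (b + 1) (k + 1) := by
  have h := ifac_succ_mul k
  have := cast_succ_ne b
  rw [nn, nn, ← h, Nat.factorial_succ, show (a + (b + 1 : ℕ) + 1 - (k + 1) : ℤ) = a + b + 1 - k by
    push_cast; ring]
  push_cast; field_simp

theorem nn_left_down : nn a b k = ((a : ℂ) + b + 2 - k) / (a + 1) * nn (a + 1) b k := by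
  have h := ifac_succ_mul (a + b + 1 - k)
  have := cast_succ_ne a
  rw [nn, nn, ← h, Nat.factorial_succ, show ((a + 1 : ℕ) + b + 1 - k : ℤ) = a + b + 1 - k + 1 by
    push_cast; ring]
  push_cast; field_simp; ring

theorem nn_right_down : nn a b k = ((a : ℂ) + b + 2 - k) / (b + 1) * nn a (b + 1) k := by
  have h := ifac_succ_mul (a + b + 1 - k)
  have := cast_succ_ne b
  rw [nn, nn, ← h, Nat.factorial_succ, show (a + (b + 1 : ℕ) + 1 - k : ℤ) = a + b + 1 - k + 1 by
    push_cast; ring]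
  push_cast; field_simp; ring

theorem mm_left_up : mm a b k = ((k : ℂ) + 1) / (a + 1) * mm (a + 1) b (k + 1) := by
  have h := ifac_succ_mul k
  have := cast_succ_ne a
  rw [mm, mm, ← h, Nat.factorial_succ, show ((a + 1 : ℕ) + b - 1 - (k + 1) : ℤ) = a + b - 1 - k by
    push_cast; ring]
  push_cast; field_simp

theorem mm_right_up : mm a b k = ((k : ℂ) + 1) / (b + 1) * mm a (b + 1) (k + 1) := by
  have h := ifac_succ_mul k
  have := cast_succ_ne b
  rw [mm, mm, ← h, Nat.factorial_succ, show (a + (b + 1 : ℕ) - 1 - (k + 1) : ℤ) = a + b - 1 - k by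
    push_cast; ring]
  push_cast; field_simp

theorem mm_left_down : mm a b k = ((a : ℂ) + b - k) / (a + 1) * mm (a + 1) b k := by
  have h := ifac_succ_mul (a + b - 1 - k)
  have := cast_succ_ne a
  rw [mm, mm, ← h, Nat.factorial_succ, show ((a + 1 : ℕ) + b - 1 - k : ℤ) = a + b - 1 - k + 1 by
    push_cast; ring]
  push_cast; field_simp; ring

theorem mm_right_down : mm a b k = ((a : ℂ) + b - k) / (b + 1) * mm a (b + 1) k := by
  have h := ifac_succ_mul (a + b - 1 - k)
  have := cast_succ_ne b
  rw [mm, mm, ← h, Nat.factorial_succ, show (a + (b + 1 : ℕ) - 1 - k : ℤ) = a + b - 1 - k + 1 by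
    push_cast; ring]
  push_cast; field_simp; ring

/-- This and the next three relate f^{(2)} to f^{(1)} and f^{(3)} with a + b smaller by one; they
settle the matrix coefficients between different families. -/
theorem mm_left_nn : mm (a + 1) b k = ((a : ℂ) + 1) * (a + b + 1 - k) * nn a b k := by
  have h := ifac_succ_mul (a + b - k)
  rw [mm, nn, Nat.factorial_succ, show ((a + 1 : ℕ) + b - 1 - k : ℤ) = a + b - k by
    push_cast; ring, show (a + b + 1 - k : ℤ) = a + b - k + 1 by ring, ← h]
  push_cast; ring

theorem mm_right_nn : mm a (b + 1) k = ((b : ℂ) + 1) * (a + b + 1 - k) * nn a b k := by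
  have h := ifac_succ_mul (a + b - k)
  rw [mm, nn, Nat.factorial_succ, show (a + (b + 1 : ℕ) - 1 - k : ℤ) = a + b - k by
    push_cast; ring, show (a + b + 1 - k : ℤ) = a + b - k + 1 by ring, ← h]
  push_cast; ring

theorem mm_left_nn_succ : mm (a + 1) b k = ((a : ℂ) + 1) * (k + 1) * nn a b (k + 1) := by
  have h := ifac_succ_mul k
  rw [mm, nn, Nat.factorial_succ, show ((a + 1 : ℕ) + b - 1 - k : ℤ) = a + b - k by
    push_cast; ring, show (a + b + 1 - (k + 1) : ℤ) = a + b - k by ring, ← h]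
  push_cast; ring

theorem mm_right_nn_succ : mm a (b + 1) k = ((b : ℂ) + 1) * (k + 1) * nn a b (k + 1) := by
  have h := ifac_succ_mul k
  rw [mm, nn, Nat.factorial_succ, show (a + (b + 1 : ℕ) - 1 - k : ℤ) = a + b - k by
    push_cast; ring, show (a + b + 1 - (k + 1) : ℤ) = a + b - k by ring, ← h]
  push_cast; ring

end NormRecursions

/-! ### Values of the form on pairs of families -/

section FormValues

variable (a b a' b' : ℕ) (k k' : ℤ)

theorem BB_f1_f1 : BB (f1 a b k) (f1 a' b' k') =
    if a = a' ∧ b = b' ∧ k = k' then ((a : ℂ) + b + 1) * nn a b k else 0 := by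
  have := BB_ee (0, a, b, k) (0, a', b', k')
  simpa [ee, wgt, nrm] using this

theorem BB_f2_f2 : BB (f2 a b k) (f2 a' b' k') =
    if a = a' ∧ b = b' ∧ k = k' then -(((a : ℂ) + b) * (a + b + 1)) * mm a b k else 0 := by
  have := BB_ee (1, a, b, k) (1, a', b', k')
  simpa [ee, wgt, nrm] using this

theorem BB_f3_f3 : BB (f3 a b k) (f3 a' b' k') =
    if a = a' ∧ b = b' ∧ k = k' then -((a : ℂ) + b + 2) * nn a b k else 0 := by
  have := BB_ee (2, a, b, k) (2, a', b', k')
  simpa [ee, wgt, nrm] using this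

theorem BB_f1_f2 : BB (f1 a b k) (f2 a' b' k') = 0 := by
  exact (BB_ee (0, a, b, k) (1, a', b', k')).trans (if_neg (by simp))

theorem BB_f1_f3 : BB (f1 a b k) (f3 a' b' k') = 0 := by
  exact (BB_ee (0, a, b, k) (2, a', b', k')).trans (if_neg (by simp))

theorem BB_f2_f1 : BB (f2 a b k) (f1 a' b' k') = 0 := by
  exact (BB_ee (1, a, b, k) (0, a', b', k')).trans (if_neg (by simp))

theorem BB_f2_f3 : BB (f2 a b k) (f3 a' b' k') = 0 := by
  exact (BB_ee (1, a, b, k) (2, a', b', k')).trans (if_neg (by simp))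

theorem BB_f3_f1 : BB (f3 a b k) (f1 a' b' k') = 0 := by
  exact (BB_ee (2, a, b, k) (0, a', b', k')).trans (if_neg (by simp))

theorem BB_f3_f2 : BB (f3 a b k) (f2 a' b' k') = 0 := by
  exact (BB_ee (2, a, b, k) (1, a', b', k')).trans (if_neg (by simp))

theorem opD_f2_left (i : Fin 2) : opD i 0 (f2 0 b k) = 0 := by
  refine LV_ext fun Z r => ?_
  fin_cases r <;> simp [opD_apply, f2, D_tt]

theorem opD_f2_right (i : Fin 2) : opD i 1 (f2 a 0 k) = 0 := by
  refine LV_ext fun Z r => ?_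
  fin_cases r <;> simp [opD_apply, f2, D_tt]

end FormValues

/-! ### Adjointness of translations and special conformal operators -/

section Adjointness

variable (a b a' b' : ℕ) (k k' : ℤ)

/-- The adjointness of `opD i j` and `opK i j` is a finite check: four pairs (i, j) and nine pairs
of families. Since the basis is orthogonal, each case compares one coefficient of `opD` with one of
`opK`, and a norm recursion makes them agree. -/
theorem BB_opD00_f1_f1 : BB (opD 0 0 (f1 a b k)) (f1 a' b' k') =
    BB (f1 a b k) (opK 0 0 (f1 a' b' k')) := by
  -- At a = 0 the derivative is zero, and no index on the right matches since `opK00_f1` raises a'.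
  -- Afterwards a - 1 is a genuine predecessor.
  rcases a with _ | a
  · rw [opD00_f1, opK00_f1]
    simp [BB_f1_f1, BB_f1_f2, BB_f1_f3, BB_f3_f3, BB_f3_f1, BB_f3_f2]
  · rw [opD00_f1, opK00_f1]
    have h1 := cast_add_one_ne a b
    have h2 := cast_add_two_ne a b
    have h3 := cast_succ_ne a
    have h4 := cast_add_one_ne (a + 1) b
    have h5 := cast_add_two_ne (a + 1) b
    push_cast at h4 h5
    -- The cancellation lemmas at the end of the list bring the index conditions on the two sides to
    -- the same form, so that one case distinction serves both.
    simp only [map_add, map_smul, map_smulₛₗ, LinearMap.add_apply, LinearMap.smul_apply,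
    smul_eq_mul, BB_f1_f1, BB_f2_f2, BB_f3_f3, BB_f1_f2, BB_f1_f3, BB_f2_f1, BB_f2_f3, BB_f3_f1,
    BB_f3_f2, mul_zero, add_zero, zero_add, map_div₀, map_mul, map_sub, map_neg, map_one, map_zero, map_intCast,
    map_ofNat, Complex.conj_natCast, Nat.add_sub_cancel, add_left_inj, sub_eq_iff_eq_add, eq_sub_iff_add_eq]
    split_ifs with h
    · obtain ⟨rfl, rfl, rfl⟩ := h
      rw [add_sub_cancel_right]
      rw [nn_left_up a b k']
      push_cast
      field_simp
      ring
    · simp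

/-- Both sides are zero: `opD` keeps f^{(1)} in its family and `opK` of f^{(2)} has no f^{(1)}
component. -/
theorem BB_opD00_f1_f2 : BB (opD 0 0 (f1 a b k)) (f2 a' b' k') =
    BB (f1 a b k) (opK 0 0 (f2 a' b' k')) := by
  rw [opD00_f1, opK00_f2]
  simp only [map_add, map_smul, map_smulₛₗ, LinearMap.add_apply, LinearMap.smul_apply,
    smul_eq_mul, BB_f1_f1, BB_f2_f2, BB_f3_f3, BB_f1_f2, BB_f1_f3, BB_f2_f1, BB_f2_f3, BB_f3_f1,
    BB_f3_f2, mul_zero, add_zero, zero_add, map_div₀, map_mul, map_sub, map_neg, map_one, map_zero, map_intCast,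
    map_ofNat, Complex.conj_natCast]

theorem BB_opD00_f1_f3 : BB (opD 0 0 (f1 a b k)) (f3 a' b' k') =
    BB (f1 a b k) (opK 0 0 (f3 a' b' k')) := by
  rw [opD00_f1, opK00_f3]
  simp only [map_add, map_smul, map_smulₛₗ, LinearMap.add_apply, LinearMap.smul_apply,
    smul_eq_mul, BB_f1_f1, BB_f2_f2, BB_f3_f3, BB_f1_f2, BB_f1_f3, BB_f2_f1, BB_f2_f3, BB_f3_f1,
    BB_f3_f2, mul_zero, add_zero, zero_add, map_div₀, map_mul, map_sub, map_neg, map_one, map_zero, map_intCast,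
    map_ofNat, Complex.conj_natCast]

/-- With d = a + b this case fixes the ratio of the first two weights: the weight of f^{(2)} in
degree d + 1 must be -(d + 2) times the weight d + 1 of f^{(1)} in degree d. -/
theorem BB_opD00_f2_f1 : BB (opD 0 0 (f2 a b k)) (f1 a' b' k') =
    BB (f2 a b k) (opK 0 0 (f1 a' b' k')) := by
  rcases a with _ | a
  · rw [opD_f2_left, opK00_f1]
    simp [BB_f2_f2, BB_f2_f1, BB_f2_f3]
  · rw [opD00_f2, opK00_f1]
    have h1 := cast_add_one_ne a b
    have h2 := cast_add_two_ne a b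
    have h3 := cast_succ_ne a
    have h4 := cast_add_one_ne (a + 1) b
    have h5 := cast_add_two_ne (a + 1) b
    push_cast at h4 h5
    simp only [map_add, map_smul, map_smulₛₗ, LinearMap.add_apply, LinearMap.smul_apply,
    smul_eq_mul, BB_f1_f1, BB_f2_f2, BB_f3_f3, BB_f1_f2, BB_f1_f3, BB_f2_f1, BB_f2_f3, BB_f3_f1,
    BB_f3_f2, mul_zero, add_zero, zero_add, map_div₀, map_mul, map_sub, map_neg, map_one, map_zero, map_intCast,
    map_ofNat, Complex.conj_natCast, Nat.add_sub_cancel, add_left_inj, sub_eq_iff_eq_add, eq_sub_iff_add_eq]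
    split_ifs with h
    · obtain ⟨rfl, rfl, rfl⟩ := h
      rw [mm_left_nn a b k]
      push_cast
      field_simp
      ring
    · simp

theorem BB_opD00_f2_f2 : BB (opD 0 0 (f2 a b k)) (f2 a' b' k') =
    BB (f2 a b k) (opK 0 0 (f2 a' b' k')) := by
  rcases a with _ | a
  · rw [opD_f2_left, opK00_f2]
    simp [BB_f2_f2, BB_f2_f1, BB_f2_f3]
  · rw [opD00_f2, opK00_f2]
    have h1 := cast_add_one_ne a b
    have h2 := cast_add_two_ne a b
    have h3 := cast_succ_ne a
    have h4 := cast_add_one_ne (a + 1) b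
    have h5 := cast_add_two_ne (a + 1) b
    push_cast at h4 h5
    simp only [map_add, map_smul, map_smulₛₗ, LinearMap.add_apply, LinearMap.smul_apply,
    smul_eq_mul, BB_f1_f1, BB_f2_f2, BB_f3_f3, BB_f1_f2, BB_f1_f3, BB_f2_f1, BB_f2_f3, BB_f3_f1,
    BB_f3_f2, mul_zero, add_zero, zero_add, map_div₀, map_mul, map_sub, map_neg, map_one, map_zero, map_intCast,
    map_ofNat, Complex.conj_natCast, Nat.add_sub_cancel, add_left_inj, sub_eq_iff_eq_add, eq_sub_iff_add_eq]
    split_ifs with h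
    · obtain ⟨rfl, rfl, rfl⟩ := h
      rw [add_sub_cancel_right]
      rw [mm_left_up a b k']
      push_cast
      field_simp
      ring
    · simp

theorem BB_opD00_f2_f3 : BB (opD 0 0 (f2 a b k)) (f3 a' b' k') =
    BB (f2 a b k) (opK 0 0 (f3 a' b' k')) := by
  rcases a with _ | a
  · rw [opD_f2_left, opK00_f3]
    simp only [map_zero, LinearMap.zero_apply, map_smulₛₗ, BB_f2_f3, smul_zero]
  · rw [opD00_f2, opK00_f3]
    simp only [map_add, map_smul, map_smulₛₗ, LinearMap.add_apply, LinearMap.smul_apply,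
    smul_eq_mul, BB_f1_f1, BB_f2_f2, BB_f3_f3, BB_f1_f2, BB_f1_f3, BB_f2_f1, BB_f2_f3, BB_f3_f1,
    BB_f3_f2, mul_zero, add_zero, zero_add, map_div₀, map_mul, map_sub, map_neg, map_one, map_zero, map_intCast,
    map_ofNat, Complex.conj_natCast]

/-- This case fixes the third weight: with d = a + b, the weight of N f^{(1)} must be minus the
weight d + 2 of f^{(1)} in degree d + 1. -/
theorem BB_opD00_f3_f1 : BB (opD 0 0 (f3 a b k)) (f1 a' b' k') =
    BB (f3 a b k) (opK 0 0 (f1 a' b' k')) := by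
  rcases b' with _ | b'
  · rw [opD00_f3, opK00_f1]
    simp [BB_f1_f1, BB_f2_f2, BB_f1_f2, BB_f2_f1, BB_f3_f1, BB_f3_f2, BB_f3_f3]
  · rw [opD00_f3, opK00_f1]
    have h1 := cast_add_one_ne a b
    have h2 := cast_add_two_ne a b
    have h3 := cast_succ_ne b
    have h4 := cast_add_one_ne a (b + 1)
    have h5 := cast_add_two_ne a (b + 1)
    push_cast at h4 h5
    simp only [map_add, map_smul, map_smulₛₗ, LinearMap.add_apply, LinearMap.smul_apply,
    smul_eq_mul, BB_f1_f1, BB_f2_f2, BB_f3_f3, BB_f1_f2, BB_f1_f3, BB_f2_f1, BB_f2_f3, BB_f3_f1,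
    BB_f3_f2, mul_zero, add_zero, zero_add, map_div₀, map_mul, map_sub, map_neg, map_one, map_zero, map_intCast,
    map_ofNat, Complex.conj_natCast, Nat.add_sub_cancel, add_left_inj, sub_eq_iff_eq_add, eq_sub_iff_add_eq]
    split_ifs with h
    · obtain ⟨rfl, rfl, rfl⟩ := h
      rw [nn_right_down a b k]
      push_cast
      field_simp
      ring
    · simp

theorem BB_opD00_f3_f2 : BB (opD 0 0 (f3 a b k)) (f2 a' b' k') =
    BB (f3 a b k) (opK 0 0 (f2 a' b' k')) := by
  rcases b' with _ | b'
  · rw [opD00_f3, opK00_f2]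
    simp [BB_f1_f1, BB_f2_f2, BB_f1_f2, BB_f2_f1, BB_f3_f1, BB_f3_f2, BB_f3_f3]
  · rw [opD00_f3, opK00_f2]
    have h1 := cast_add_one_ne a b
    have h2 := cast_add_two_ne a b
    have h3 := cast_succ_ne b
    have h4 := cast_add_one_ne a (b + 1)
    have h5 := cast_add_two_ne a (b + 1)
    push_cast at h4 h5
    simp only [map_add, map_smul, map_smulₛₗ, LinearMap.add_apply, LinearMap.smul_apply,
    smul_eq_mul, BB_f1_f1, BB_f2_f2, BB_f3_f3, BB_f1_f2, BB_f1_f3, BB_f2_f1, BB_f2_f3, BB_f3_f1,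
    BB_f3_f2, mul_zero, add_zero, zero_add, map_div₀, map_mul, map_sub, map_neg, map_one, map_zero, map_intCast,
    map_ofNat, Complex.conj_natCast, Nat.add_sub_cancel, add_left_inj, sub_eq_iff_eq_add, eq_sub_iff_add_eq]
    split_ifs with h
    · obtain ⟨rfl, rfl, rfl⟩ := h
      rw [add_sub_cancel_right]
      rw [mm_right_nn_succ a b k']
      push_cast
      field_simp
      ring
    · simp

theorem BB_opD00_f3_f3 : BB (opD 0 0 (f3 a b k)) (f3 a' b' k') =
    BB (f3 a b k) (opK 0 0 (f3 a' b' k')) := by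
  rcases a with _ | a
  · rw [opD00_f3, opK00_f3]
    simp [BB_f1_f3, BB_f2_f3, BB_f3_f3]
  · rw [opD00_f3, opK00_f3]
    have h1 := cast_add_one_ne a b
    have h2 := cast_add_two_ne a b
    have h3 := cast_succ_ne a
    have h4 := cast_add_one_ne (a + 1) b
    have h5 := cast_add_two_ne (a + 1) b
    push_cast at h4 h5
    simp only [map_add, map_smul, map_smulₛₗ, LinearMap.add_apply, LinearMap.smul_apply,
    smul_eq_mul, BB_f1_f1, BB_f2_f2, BB_f3_f3, BB_f1_f2, BB_f1_f3, BB_f2_f1, BB_f2_f3, BB_f3_f1,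
    BB_f3_f2, mul_zero, add_zero, zero_add, map_div₀, map_mul, map_sub, map_neg, map_one, map_zero, map_intCast,
    map_ofNat, Complex.conj_natCast, Nat.add_sub_cancel, add_left_inj, sub_eq_iff_eq_add, eq_sub_iff_add_eq]
    split_ifs with h
    · obtain ⟨rfl, rfl, rfl⟩ := h
      rw [add_sub_cancel_right]
      rw [nn_left_up a b k']
      push_cast
      field_simp
      ring
    · simp

theorem BB_opD01_f1_f1 : BB (opD 0 1 (f1 a b k)) (f1 a' b' k') =
    BB (f1 a b k) (opK 0 1 (f1 a' b' k')) := by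
  rcases b with _ | b
  · rw [opD01_f1, opK01_f1]
    simp [BB_f1_f1, BB_f1_f2, BB_f1_f3, BB_f3_f3, BB_f3_f1, BB_f3_f2]
  · rw [opD01_f1, opK01_f1]
    have h1 := cast_add_one_ne a b
    have h2 := cast_add_two_ne a b
    have h3 := cast_succ_ne b
    have h4 := cast_add_one_ne a (b + 1)
    have h5 := cast_add_two_ne a (b + 1)
    push_cast at h4 h5
    simp only [map_add, map_smul, map_smulₛₗ, LinearMap.add_apply, LinearMap.smul_apply,
    smul_eq_mul, BB_f1_f1, BB_f2_f2, BB_f3_f3, BB_f1_f2, BB_f1_f3, BB_f2_f1, BB_f2_f3, BB_f3_f1,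
    BB_f3_f2, mul_zero, add_zero, zero_add, map_div₀, map_mul, map_sub, map_neg, map_one, map_zero, map_intCast,
    map_ofNat, Complex.conj_natCast, Nat.add_sub_cancel, add_left_inj, sub_eq_iff_eq_add, eq_sub_iff_add_eq]
    split_ifs with h
    · obtain ⟨rfl, rfl, rfl⟩ := h
      rw [add_sub_cancel_right]
      rw [nn_right_up a b k']
      push_cast
      field_simp
      ring
    · simp

theorem BB_opD01_f1_f2 : BB (opD 0 1 (f1 a b k)) (f2 a' b' k') =
    BB (f1 a b k) (opK 0 1 (f2 a' b' k')) := by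
  rw [opD01_f1, opK01_f2]
  simp only [map_add, map_smul, map_smulₛₗ, LinearMap.add_apply, LinearMap.smul_apply,
    smul_eq_mul, BB_f1_f1, BB_f2_f2, BB_f3_f3, BB_f1_f2, BB_f1_f3, BB_f2_f1, BB_f2_f3, BB_f3_f1,
    BB_f3_f2, mul_zero, add_zero, zero_add, map_div₀, map_mul, map_sub, map_neg, map_one, map_zero, map_intCast,
    map_ofNat, Complex.conj_natCast]

theorem BB_opD01_f1_f3 : BB (opD 0 1 (f1 a b k)) (f3 a' b' k') =
    BB (f1 a b k) (opK 0 1 (f3 a' b' k')) := by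
  rw [opD01_f1, opK01_f3]
  simp only [map_add, map_smul, map_smulₛₗ, LinearMap.add_apply, LinearMap.smul_apply,
    smul_eq_mul, BB_f1_f1, BB_f2_f2, BB_f3_f3, BB_f1_f2, BB_f1_f3, BB_f2_f1, BB_f2_f3, BB_f3_f1,
    BB_f3_f2, mul_zero, add_zero, zero_add, map_div₀, map_mul, map_sub, map_neg, map_one, map_zero, map_intCast,
    map_ofNat, Complex.conj_natCast]

theorem BB_opD01_f2_f1 : BB (opD 0 1 (f2 a b k)) (f1 a' b' k') =
    BB (f2 a b k) (opK 0 1 (f1 a' b' k')) := by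
  rcases b with _ | b
  · rw [opD_f2_right, opK01_f1]
    simp [BB_f2_f2, BB_f2_f1, BB_f2_f3]
  · rw [opD01_f2, opK01_f1]
    have h1 := cast_add_one_ne a b
    have h2 := cast_add_two_ne a b
    have h3 := cast_succ_ne b
    have h4 := cast_add_one_ne a (b + 1)
    have h5 := cast_add_two_ne a (b + 1)
    push_cast at h4 h5
    simp only [map_add, map_smul, map_smulₛₗ, LinearMap.add_apply, LinearMap.smul_apply,
    smul_eq_mul, BB_f1_f1, BB_f2_f2, BB_f3_f3, BB_f1_f2, BB_f1_f3, BB_f2_f1, BB_f2_f3, BB_f3_f1,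
    BB_f3_f2, mul_zero, add_zero, zero_add, map_div₀, map_mul, map_sub, map_neg, map_one, map_zero, map_intCast,
    map_ofNat, Complex.conj_natCast, Nat.add_sub_cancel, add_left_inj, sub_eq_iff_eq_add, eq_sub_iff_add_eq]
    split_ifs with h
    · obtain ⟨rfl, rfl, rfl⟩ := h
      rw [mm_right_nn a b k]
      push_cast
      field_simp
      ring
    · simp

theorem BB_opD01_f2_f2 : BB (opD 0 1 (f2 a b k)) (f2 a' b' k') =
    BB (f2 a b k) (opK 0 1 (f2 a' b' k')) := by
  rcases b with _ | b
  · rw [opD_f2_right, opK01_f2]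
    simp [BB_f2_f2, BB_f2_f1, BB_f2_f3]
  · rw [opD01_f2, opK01_f2]
    have h1 := cast_add_one_ne a b
    have h2 := cast_add_two_ne a b
    have h3 := cast_succ_ne b
    have h4 := cast_add_one_ne a (b + 1)
    have h5 := cast_add_two_ne a (b + 1)
    push_cast at h4 h5
    simp only [map_add, map_smul, map_smulₛₗ, LinearMap.add_apply, LinearMap.smul_apply,
    smul_eq_mul, BB_f1_f1, BB_f2_f2, BB_f3_f3, BB_f1_f2, BB_f1_f3, BB_f2_f1, BB_f2_f3, BB_f3_f1,
    BB_f3_f2, mul_zero, add_zero, zero_add, map_div₀, map_mul, map_sub, map_neg, map_one, map_zero, map_intCast,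
    map_ofNat, Complex.conj_natCast, Nat.add_sub_cancel, add_left_inj, sub_eq_iff_eq_add, eq_sub_iff_add_eq]
    split_ifs with h
    · obtain ⟨rfl, rfl, rfl⟩ := h
      rw [add_sub_cancel_right]
      rw [mm_right_up a b k']
      push_cast
      field_simp
      ring
    · simp

theorem BB_opD01_f2_f3 : BB (opD 0 1 (f2 a b k)) (f3 a' b' k') =
    BB (f2 a b k) (opK 0 1 (f3 a' b' k')) := by
  rcases b with _ | b
  · rw [opD_f2_right, opK01_f3]
    simp only [map_zero, LinearMap.zero_apply, map_smulₛₗ, BB_f2_f3, smul_zero]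
  · rw [opD01_f2, opK01_f3]
    simp only [map_add, map_smul, map_smulₛₗ, LinearMap.add_apply, LinearMap.smul_apply,
    smul_eq_mul, BB_f1_f1, BB_f2_f2, BB_f3_f3, BB_f1_f2, BB_f1_f3, BB_f2_f1, BB_f2_f3, BB_f3_f1,
    BB_f3_f2, mul_zero, add_zero, zero_add, map_div₀, map_mul, map_sub, map_neg, map_one, map_zero, map_intCast,
    map_ofNat, Complex.conj_natCast]

theorem BB_opD01_f3_f1 : BB (opD 0 1 (f3 a b k)) (f1 a' b' k') =
    BB (f3 a b k) (opK 0 1 (f1 a' b' k')) := by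
  rcases a' with _ | a'
  · rw [opD01_f3, opK01_f1]
    simp [BB_f1_f1, BB_f2_f2, BB_f1_f2, BB_f2_f1, BB_f3_f1, BB_f3_f2, BB_f3_f3]
  · rw [opD01_f3, opK01_f1]
    have h1 := cast_add_one_ne a b
    have h2 := cast_add_two_ne a b
    have h3 := cast_succ_ne a
    have h4 := cast_add_one_ne (a + 1) b
    have h5 := cast_add_two_ne (a + 1) b
    push_cast at h4 h5
    simp only [map_add, map_smul, map_smulₛₗ, LinearMap.add_apply, LinearMap.smul_apply,
    smul_eq_mul, BB_f1_f1, BB_f2_f2, BB_f3_f3, BB_f1_f2, BB_f1_f3, BB_f2_f1, BB_f2_f3, BB_f3_f1,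
    BB_f3_f2, mul_zero, add_zero, zero_add, map_div₀, map_mul, map_sub, map_neg, map_one, map_zero, map_intCast,
    map_ofNat, Complex.conj_natCast, Nat.add_sub_cancel, add_left_inj, sub_eq_iff_eq_add, eq_sub_iff_add_eq]
    split_ifs with h
    · obtain ⟨rfl, rfl, rfl⟩ := h
      rw [nn_left_down a b k]
      push_cast
      field_simp
      ring
    · simp

theorem BB_opD01_f3_f2 : BB (opD 0 1 (f3 a b k)) (f2 a' b' k') =
    BB (f3 a b k) (opK 0 1 (f2 a' b' k')) := by
  rcases a' with _ | a'
  · rw [opD01_f3, opK01_f2]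
    simp [BB_f1_f1, BB_f2_f2, BB_f1_f2, BB_f2_f1, BB_f3_f1, BB_f3_f2, BB_f3_f3]
  · rw [opD01_f3, opK01_f2]
    have h1 := cast_add_one_ne a b
    have h2 := cast_add_two_ne a b
    have h3 := cast_succ_ne a
    have h4 := cast_add_one_ne (a + 1) b
    have h5 := cast_add_two_ne (a + 1) b
    push_cast at h4 h5
    simp only [map_add, map_smul, map_smulₛₗ, LinearMap.add_apply, LinearMap.smul_apply,
    smul_eq_mul, BB_f1_f1, BB_f2_f2, BB_f3_f3, BB_f1_f2, BB_f1_f3, BB_f2_f1, BB_f2_f3, BB_f3_f1,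
    BB_f3_f2, mul_zero, add_zero, zero_add, map_div₀, map_mul, map_sub, map_neg, map_one, map_zero, map_intCast,
    map_ofNat, Complex.conj_natCast, Nat.add_sub_cancel, add_left_inj, sub_eq_iff_eq_add, eq_sub_iff_add_eq]
    split_ifs with h
    · obtain ⟨rfl, rfl, rfl⟩ := h
      rw [add_sub_cancel_right]
      rw [mm_left_nn_succ a b k']
      push_cast
      field_simp
      ring
    · simp

theorem BB_opD01_f3_f3 : BB (opD 0 1 (f3 a b k)) (f3 a' b' k') =
    BB (f3 a b k) (opK 0 1 (f3 a' b' k')) := by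
  rcases b with _ | b
  · rw [opD01_f3, opK01_f3]
    simp [BB_f1_f3, BB_f2_f3, BB_f3_f3]
  · rw [opD01_f3, opK01_f3]
    have h1 := cast_add_one_ne a b
    have h2 := cast_add_two_ne a b
    have h3 := cast_succ_ne b
    have h4 := cast_add_one_ne a (b + 1)
    have h5 := cast_add_two_ne a (b + 1)
    push_cast at h4 h5
    simp only [map_add, map_smul, map_smulₛₗ, LinearMap.add_apply, LinearMap.smul_apply,
    smul_eq_mul, BB_f1_f1, BB_f2_f2, BB_f3_f3, BB_f1_f2, BB_f1_f3, BB_f2_f1, BB_f2_f3, BB_f3_f1,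
    BB_f3_f2, mul_zero, add_zero, zero_add, map_div₀, map_mul, map_sub, map_neg, map_one, map_zero, map_intCast,
    map_ofNat, Complex.conj_natCast, Nat.add_sub_cancel, add_left_inj, sub_eq_iff_eq_add, eq_sub_iff_add_eq]
    split_ifs with h
    · obtain ⟨rfl, rfl, rfl⟩ := h
      rw [add_sub_cancel_right]
      rw [nn_right_up a b k']
      push_cast
      field_simp
      ring
    · simp

theorem BB_opD10_f1_f1 : BB (opD 1 0 (f1 a b k)) (f1 a' b' k') =
    BB (f1 a b k) (opK 1 0 (f1 a' b' k')) := by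
  rcases a with _ | a
  · rw [opD10_f1, opK10_f1]
    simp [BB_f1_f1, BB_f1_f2, BB_f1_f3, BB_f3_f3, BB_f3_f1, BB_f3_f2]
  · rw [opD10_f1, opK10_f1]
    have h1 := cast_add_one_ne a b
    have h2 := cast_add_two_ne a b
    have h3 := cast_succ_ne a
    have h4 := cast_add_one_ne (a + 1) b
    have h5 := cast_add_two_ne (a + 1) b
    push_cast at h4 h5
    simp only [map_add, map_smul, map_smulₛₗ, LinearMap.add_apply, LinearMap.smul_apply,
    smul_eq_mul, BB_f1_f1, BB_f2_f2, BB_f3_f3, BB_f1_f2, BB_f1_f3, BB_f2_f1, BB_f2_f3, BB_f3_f1,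
    BB_f3_f2, mul_zero, add_zero, zero_add, map_div₀, map_mul, map_sub, map_neg, map_one, map_zero, map_intCast,
    map_ofNat, Complex.conj_natCast, Nat.add_sub_cancel, add_left_inj, sub_eq_iff_eq_add, eq_sub_iff_add_eq]
    split_ifs with h
    · obtain ⟨rfl, rfl, rfl⟩ := h
      rw [nn_left_down a b k]
      push_cast
      field_simp
      ring
    · simp

theorem BB_opD10_f1_f2 : BB (opD 1 0 (f1 a b k)) (f2 a' b' k') =
    BB (f1 a b k) (opK 1 0 (f2 a' b' k')) := by
  rw [opD10_f1, opK10_f2]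
  simp only [map_add, map_smul, map_smulₛₗ, LinearMap.add_apply, LinearMap.smul_apply,
    smul_eq_mul, BB_f1_f1, BB_f2_f2, BB_f3_f3, BB_f1_f2, BB_f1_f3, BB_f2_f1, BB_f2_f3, BB_f3_f1,
    BB_f3_f2, mul_zero, add_zero, zero_add, map_div₀, map_mul, map_sub, map_neg, map_one, map_zero, map_intCast,
    map_ofNat, Complex.conj_natCast]

theorem BB_opD10_f1_f3 : BB (opD 1 0 (f1 a b k)) (f3 a' b' k') =
    BB (f1 a b k) (opK 1 0 (f3 a' b' k')) := by
  rw [opD10_f1, opK10_f3]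
  simp only [map_add, map_smul, map_smulₛₗ, LinearMap.add_apply, LinearMap.smul_apply,
    smul_eq_mul, BB_f1_f1, BB_f2_f2, BB_f3_f3, BB_f1_f2, BB_f1_f3, BB_f2_f1, BB_f2_f3, BB_f3_f1,
    BB_f3_f2, mul_zero, add_zero, zero_add, map_div₀, map_mul, map_sub, map_neg, map_one, map_zero, map_intCast,
    map_ofNat, Complex.conj_natCast]

theorem BB_opD10_f2_f1 : BB (opD 1 0 (f2 a b k)) (f1 a' b' k') =
    BB (f2 a b k) (opK 1 0 (f1 a' b' k')) := by
  rcases a with _ | a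
  · rw [opD_f2_left, opK10_f1]
    simp [BB_f2_f2, BB_f2_f1, BB_f2_f3]
  · rw [opD10_f2, opK10_f1]
    have h1 := cast_add_one_ne a b
    have h2 := cast_add_two_ne a b
    have h3 := cast_succ_ne a
    have h4 := cast_add_one_ne (a + 1) b
    have h5 := cast_add_two_ne (a + 1) b
    push_cast at h4 h5
    simp only [map_add, map_smul, map_smulₛₗ, LinearMap.add_apply, LinearMap.smul_apply,
    smul_eq_mul, BB_f1_f1, BB_f2_f2, BB_f3_f3, BB_f1_f2, BB_f1_f3, BB_f2_f1, BB_f2_f3, BB_f3_f1,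
    BB_f3_f2, mul_zero, add_zero, zero_add, map_div₀, map_mul, map_sub, map_neg, map_one, map_zero, map_intCast,
    map_ofNat, Complex.conj_natCast, Nat.add_sub_cancel, add_left_inj, sub_eq_iff_eq_add, eq_sub_iff_add_eq]
    split_ifs with h
    · obtain ⟨rfl, rfl, rfl⟩ := h
      rw [mm_left_nn_succ a b k]
      push_cast
      field_simp
      ring
    · simp

theorem BB_opD10_f2_f2 : BB (opD 1 0 (f2 a b k)) (f2 a' b' k') =
    BB (f2 a b k) (opK 1 0 (f2 a' b' k')) := by
  rcases a with _ | a
  · rw [opD_f2_left, opK10_f2]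
    simp [BB_f2_f2, BB_f2_f1, BB_f2_f3]
  · rw [opD10_f2, opK10_f2]
    have h1 := cast_add_one_ne a b
    have h2 := cast_add_two_ne a b
    have h3 := cast_succ_ne a
    have h4 := cast_add_one_ne (a + 1) b
    have h5 := cast_add_two_ne (a + 1) b
    push_cast at h4 h5
    simp only [map_add, map_smul, map_smulₛₗ, LinearMap.add_apply, LinearMap.smul_apply,
    smul_eq_mul, BB_f1_f1, BB_f2_f2, BB_f3_f3, BB_f1_f2, BB_f1_f3, BB_f2_f1, BB_f2_f3, BB_f3_f1,
    BB_f3_f2, mul_zero, add_zero, zero_add, map_div₀, map_mul, map_sub, map_neg, map_one, map_zero, map_intCast,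
    map_ofNat, Complex.conj_natCast, Nat.add_sub_cancel, add_left_inj, sub_eq_iff_eq_add, eq_sub_iff_add_eq]
    split_ifs with h
    · obtain ⟨rfl, rfl, rfl⟩ := h
      rw [mm_left_down a b k]
      push_cast
      field_simp
      ring
    · simp

theorem BB_opD10_f2_f3 : BB (opD 1 0 (f2 a b k)) (f3 a' b' k') =
    BB (f2 a b k) (opK 1 0 (f3 a' b' k')) := by
  rcases a with _ | a
  · rw [opD_f2_left, opK10_f3]
    simp only [map_zero, LinearMap.zero_apply, map_smulₛₗ, BB_f2_f3, smul_zero]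
  · rw [opD10_f2, opK10_f3]
    simp only [map_add, map_smul, map_smulₛₗ, LinearMap.add_apply, LinearMap.smul_apply,
    smul_eq_mul, BB_f1_f1, BB_f2_f2, BB_f3_f3, BB_f1_f2, BB_f1_f3, BB_f2_f1, BB_f2_f3, BB_f3_f1,
    BB_f3_f2, mul_zero, add_zero, zero_add, map_div₀, map_mul, map_sub, map_neg, map_one, map_zero, map_intCast,
    map_ofNat, Complex.conj_natCast]

theorem BB_opD10_f3_f1 : BB (opD 1 0 (f3 a b k)) (f1 a' b' k') =
    BB (f3 a b k) (opK 1 0 (f1 a' b' k')) := by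
  rcases b' with _ | b'
  · rw [opD10_f3, opK10_f1]
    simp [BB_f1_f1, BB_f2_f2, BB_f1_f2, BB_f2_f1, BB_f3_f1, BB_f3_f2, BB_f3_f3]
  · rw [opD10_f3, opK10_f1]
    have h1 := cast_add_one_ne a b
    have h2 := cast_add_two_ne a b
    have h3 := cast_succ_ne b
    have h4 := cast_add_one_ne a (b + 1)
    have h5 := cast_add_two_ne a (b + 1)
    push_cast at h4 h5
    simp only [map_add, map_smul, map_smulₛₗ, LinearMap.add_apply, LinearMap.smul_apply,
    smul_eq_mul, BB_f1_f1, BB_f2_f2, BB_f3_f3, BB_f1_f2, BB_f1_f3, BB_f2_f1, BB_f2_f3, BB_f3_f1,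
    BB_f3_f2, mul_zero, add_zero, zero_add, map_div₀, map_mul, map_sub, map_neg, map_one, map_zero, map_intCast,
    map_ofNat, Complex.conj_natCast, Nat.add_sub_cancel, add_left_inj, sub_eq_iff_eq_add, eq_sub_iff_add_eq]
    split_ifs with h
    · obtain ⟨rfl, rfl, rfl⟩ := h
      rw [nn_right_up a b k]
      push_cast
      field_simp
      ring
    · simp

theorem BB_opD10_f3_f2 : BB (opD 1 0 (f3 a b k)) (f2 a' b' k') =
    BB (f3 a b k) (opK 1 0 (f2 a' b' k')) := by
  rcases b' with _ | b'
  · rw [opD10_f3, opK10_f2]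
    simp [BB_f1_f1, BB_f2_f2, BB_f1_f2, BB_f2_f1, BB_f3_f1, BB_f3_f2, BB_f3_f3]
  · rw [opD10_f3, opK10_f2]
    have h1 := cast_add_one_ne a b
    have h2 := cast_add_two_ne a b
    have h3 := cast_succ_ne b
    have h4 := cast_add_one_ne a (b + 1)
    have h5 := cast_add_two_ne a (b + 1)
    push_cast at h4 h5
    simp only [map_add, map_smul, map_smulₛₗ, LinearMap.add_apply, LinearMap.smul_apply,
    smul_eq_mul, BB_f1_f1, BB_f2_f2, BB_f3_f3, BB_f1_f2, BB_f1_f3, BB_f2_f1, BB_f2_f3, BB_f3_f1,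
    BB_f3_f2, mul_zero, add_zero, zero_add, map_div₀, map_mul, map_sub, map_neg, map_one, map_zero, map_intCast,
    map_ofNat, Complex.conj_natCast, Nat.add_sub_cancel, add_left_inj, sub_eq_iff_eq_add, eq_sub_iff_add_eq]
    split_ifs with h
    · obtain ⟨rfl, rfl, rfl⟩ := h
      rw [mm_right_nn a b k]
      push_cast
      field_simp
      ring
    · simp

theorem BB_opD10_f3_f3 : BB (opD 1 0 (f3 a b k)) (f3 a' b' k') =
    BB (f3 a b k) (opK 1 0 (f3 a' b' k')) := by
  rcases a with _ | a
  · rw [opD10_f3, opK10_f3]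
    simp [BB_f1_f3, BB_f2_f3, BB_f3_f3]
  · rw [opD10_f3, opK10_f3]
    have h1 := cast_add_one_ne a b
    have h2 := cast_add_two_ne a b
    have h3 := cast_succ_ne a
    have h4 := cast_add_one_ne (a + 1) b
    have h5 := cast_add_two_ne (a + 1) b
    push_cast at h4 h5
    simp only [map_add, map_smul, map_smulₛₗ, LinearMap.add_apply, LinearMap.smul_apply,
    smul_eq_mul, BB_f1_f1, BB_f2_f2, BB_f3_f3, BB_f1_f2, BB_f1_f3, BB_f2_f1, BB_f2_f3, BB_f3_f1,
    BB_f3_f2, mul_zero, add_zero, zero_add, map_div₀, map_mul, map_sub, map_neg, map_one, map_zero, map_intCast,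
    map_ofNat, Complex.conj_natCast, Nat.add_sub_cancel, add_left_inj, sub_eq_iff_eq_add, eq_sub_iff_add_eq]
    split_ifs with h
    · obtain ⟨rfl, rfl, rfl⟩ := h
      rw [nn_left_down a b k]
      push_cast
      field_simp
      ring
    · simp

theorem BB_opD11_f1_f1 : BB (opD 1 1 (f1 a b k)) (f1 a' b' k') =
    BB (f1 a b k) (opK 1 1 (f1 a' b' k')) := by
  rcases b with _ | b
  · rw [opD11_f1, opK11_f1]
    simp [BB_f1_f1, BB_f1_f2, BB_f1_f3, BB_f3_f3, BB_f3_f1, BB_f3_f2]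
  · rw [opD11_f1, opK11_f1]
    have h1 := cast_add_one_ne a b
    have h2 := cast_add_two_ne a b
    have h3 := cast_succ_ne b
    have h4 := cast_add_one_ne a (b + 1)
    have h5 := cast_add_two_ne a (b + 1)
    push_cast at h4 h5
    simp only [map_add, map_smul, map_smulₛₗ, LinearMap.add_apply, LinearMap.smul_apply,
    smul_eq_mul, BB_f1_f1, BB_f2_f2, BB_f3_f3, BB_f1_f2, BB_f1_f3, BB_f2_f1, BB_f2_f3, BB_f3_f1,
    BB_f3_f2, mul_zero, add_zero, zero_add, map_div₀, map_mul, map_sub, map_neg, map_one, map_zero, map_intCast,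
    map_ofNat, Complex.conj_natCast, Nat.add_sub_cancel, add_left_inj, sub_eq_iff_eq_add, eq_sub_iff_add_eq]
    split_ifs with h
    · obtain ⟨rfl, rfl, rfl⟩ := h
      rw [nn_right_down a b k]
      push_cast
      field_simp
      ring
    · simp

theorem BB_opD11_f1_f2 : BB (opD 1 1 (f1 a b k)) (f2 a' b' k') =
    BB (f1 a b k) (opK 1 1 (f2 a' b' k')) := by
  rw [opD11_f1, opK11_f2]
  simp only [map_add, map_smul, map_smulₛₗ, LinearMap.add_apply, LinearMap.smul_apply,
    smul_eq_mul, BB_f1_f1, BB_f2_f2, BB_f3_f3, BB_f1_f2, BB_f1_f3, BB_f2_f1, BB_f2_f3, BB_f3_f1,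
    BB_f3_f2, mul_zero, add_zero, zero_add, map_div₀, map_mul, map_sub, map_neg, map_one, map_zero, map_intCast,
    map_ofNat, Complex.conj_natCast]

theorem BB_opD11_f1_f3 : BB (opD 1 1 (f1 a b k)) (f3 a' b' k') =
    BB (f1 a b k) (opK 1 1 (f3 a' b' k')) := by
  rw [opD11_f1, opK11_f3]
  simp only [map_add, map_smul, map_smulₛₗ, LinearMap.add_apply, LinearMap.smul_apply,
    smul_eq_mul, BB_f1_f1, BB_f2_f2, BB_f3_f3, BB_f1_f2, BB_f1_f3, BB_f2_f1, BB_f2_f3, BB_f3_f1,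
    BB_f3_f2, mul_zero, add_zero, zero_add, map_div₀, map_mul, map_sub, map_neg, map_one, map_zero, map_intCast,
    map_ofNat, Complex.conj_natCast]

theorem BB_opD11_f2_f1 : BB (opD 1 1 (f2 a b k)) (f1 a' b' k') =
    BB (f2 a b k) (opK 1 1 (f1 a' b' k')) := by
  rcases b with _ | b
  · rw [opD_f2_right, opK11_f1]
    simp [BB_f2_f2, BB_f2_f1, BB_f2_f3]
  · rw [opD11_f2, opK11_f1]
    have h1 := cast_add_one_ne a b
    have h2 := cast_add_two_ne a b
    have h3 := cast_succ_ne b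
    have h4 := cast_add_one_ne a (b + 1)
    have h5 := cast_add_two_ne a (b + 1)
    push_cast at h4 h5
    simp only [map_add, map_smul, map_smulₛₗ, LinearMap.add_apply, LinearMap.smul_apply,
    smul_eq_mul, BB_f1_f1, BB_f2_f2, BB_f3_f3, BB_f1_f2, BB_f1_f3, BB_f2_f1, BB_f2_f3, BB_f3_f1,
    BB_f3_f2, mul_zero, add_zero, zero_add, map_div₀, map_mul, map_sub, map_neg, map_one, map_zero, map_intCast,
    map_ofNat, Complex.conj_natCast, Nat.add_sub_cancel, add_left_inj, sub_eq_iff_eq_add, eq_sub_iff_add_eq]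
    split_ifs with h
    · obtain ⟨rfl, rfl, rfl⟩ := h
      rw [mm_right_nn_succ a b k]
      push_cast
      field_simp
      ring
    · simp

theorem BB_opD11_f2_f2 : BB (opD 1 1 (f2 a b k)) (f2 a' b' k') =
    BB (f2 a b k) (opK 1 1 (f2 a' b' k')) := by
  rcases b with _ | b
  · rw [opD_f2_right, opK11_f2]
    simp [BB_f2_f2, BB_f2_f1, BB_f2_f3]
  · rw [opD11_f2, opK11_f2]
    have h1 := cast_add_one_ne a b
    have h2 := cast_add_two_ne a b
    have h3 := cast_succ_ne b
    have h4 := cast_add_one_ne a (b + 1)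
    have h5 := cast_add_two_ne a (b + 1)
    push_cast at h4 h5
    simp only [map_add, map_smul, map_smulₛₗ, LinearMap.add_apply, LinearMap.smul_apply,
    smul_eq_mul, BB_f1_f1, BB_f2_f2, BB_f3_f3, BB_f1_f2, BB_f1_f3, BB_f2_f1, BB_f2_f3, BB_f3_f1,
    BB_f3_f2, mul_zero, add_zero, zero_add, map_div₀, map_mul, map_sub, map_neg, map_one, map_zero, map_intCast,
    map_ofNat, Complex.conj_natCast, Nat.add_sub_cancel, add_left_inj, sub_eq_iff_eq_add, eq_sub_iff_add_eq]
    split_ifs with h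
    · obtain ⟨rfl, rfl, rfl⟩ := h
      rw [mm_right_down a b k]
      push_cast
      field_simp
      ring
    · simp

theorem BB_opD11_f2_f3 : BB (opD 1 1 (f2 a b k)) (f3 a' b' k') =
    BB (f2 a b k) (opK 1 1 (f3 a' b' k')) := by
  rcases b with _ | b
  · rw [opD_f2_right, opK11_f3]
    simp only [map_zero, LinearMap.zero_apply, map_smulₛₗ, BB_f2_f3, smul_zero]
  · rw [opD11_f2, opK11_f3]
    simp only [map_add, map_smul, map_smulₛₗ, LinearMap.add_apply, LinearMap.smul_apply,
    smul_eq_mul, BB_f1_f1, BB_f2_f2, BB_f3_f3, BB_f1_f2, BB_f1_f3, BB_f2_f1, BB_f2_f3, BB_f3_f1,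
    BB_f3_f2, mul_zero, add_zero, zero_add, map_div₀, map_mul, map_sub, map_neg, map_one, map_zero, map_intCast,
    map_ofNat, Complex.conj_natCast]

theorem BB_opD11_f3_f1 : BB (opD 1 1 (f3 a b k)) (f1 a' b' k') =
    BB (f3 a b k) (opK 1 1 (f1 a' b' k')) := by
  rcases a' with _ | a'
  · rw [opD11_f3, opK11_f1]
    simp [BB_f1_f1, BB_f2_f2, BB_f1_f2, BB_f2_f1, BB_f3_f1, BB_f3_f2, BB_f3_f3]
  · rw [opD11_f3, opK11_f1]
    have h1 := cast_add_one_ne a b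
    have h2 := cast_add_two_ne a b
    have h3 := cast_succ_ne a
    have h4 := cast_add_one_ne (a + 1) b
    have h5 := cast_add_two_ne (a + 1) b
    push_cast at h4 h5
    simp only [map_add, map_smul, map_smulₛₗ, LinearMap.add_apply, LinearMap.smul_apply,
    smul_eq_mul, BB_f1_f1, BB_f2_f2, BB_f3_f3, BB_f1_f2, BB_f1_f3, BB_f2_f1, BB_f2_f3, BB_f3_f1,
    BB_f3_f2, mul_zero, add_zero, zero_add, map_div₀, map_mul, map_sub, map_neg, map_one, map_zero, map_intCast,
    map_ofNat, Complex.conj_natCast, Nat.add_sub_cancel, add_left_inj, sub_eq_iff_eq_add, eq_sub_iff_add_eq]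
    split_ifs with h
    · obtain ⟨rfl, rfl, rfl⟩ := h
      rw [nn_left_up a b k]
      push_cast
      field_simp
      ring
    · simp

theorem BB_opD11_f3_f2 : BB (opD 1 1 (f3 a b k)) (f2 a' b' k') =
    BB (f3 a b k) (opK 1 1 (f2 a' b' k')) := by
  rcases a' with _ | a'
  · rw [opD11_f3, opK11_f2]
    simp [BB_f1_f1, BB_f2_f2, BB_f1_f2, BB_f2_f1, BB_f3_f1, BB_f3_f2, BB_f3_f3]
  · rw [opD11_f3, opK11_f2]
    have h1 := cast_add_one_ne a b
    have h2 := cast_add_two_ne a b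
    have h3 := cast_succ_ne a
    have h4 := cast_add_one_ne (a + 1) b
    have h5 := cast_add_two_ne (a + 1) b
    push_cast at h4 h5
    simp only [map_add, map_smul, map_smulₛₗ, LinearMap.add_apply, LinearMap.smul_apply,
    smul_eq_mul, BB_f1_f1, BB_f2_f2, BB_f3_f3, BB_f1_f2, BB_f1_f3, BB_f2_f1, BB_f2_f3, BB_f3_f1,
    BB_f3_f2, mul_zero, add_zero, zero_add, map_div₀, map_mul, map_sub, map_neg, map_one, map_zero, map_intCast,
    map_ofNat, Complex.conj_natCast, Nat.add_sub_cancel, add_left_inj, sub_eq_iff_eq_add, eq_sub_iff_add_eq]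
    split_ifs with h
    · obtain ⟨rfl, rfl, rfl⟩ := h
      rw [mm_left_nn a b k]
      push_cast
      field_simp
      ring
    · simp

theorem BB_opD11_f3_f3 : BB (opD 1 1 (f3 a b k)) (f3 a' b' k') =
    BB (f3 a b k) (opK 1 1 (f3 a' b' k')) := by
  rcases b with _ | b
  · rw [opD11_f3, opK11_f3]
    simp [BB_f1_f3, BB_f2_f3, BB_f3_f3]
  · rw [opD11_f3, opK11_f3]
    have h1 := cast_add_one_ne a b
    have h2 := cast_add_two_ne a b
    have h3 := cast_succ_ne b
    have h4 := cast_add_one_ne a (b + 1)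
    have h5 := cast_add_two_ne a (b + 1)
    push_cast at h4 h5
    simp only [map_add, map_smul, map_smulₛₗ, LinearMap.add_apply, LinearMap.smul_apply,
    smul_eq_mul, BB_f1_f1, BB_f2_f2, BB_f3_f3, BB_f1_f2, BB_f1_f3, BB_f2_f1, BB_f2_f3, BB_f3_f1,
    BB_f3_f2, mul_zero, add_zero, zero_add, map_div₀, map_mul, map_sub, map_neg, map_one, map_zero, map_intCast,
    map_ofNat, Complex.conj_natCast, Nat.add_sub_cancel, add_left_inj, sub_eq_iff_eq_add, eq_sub_iff_add_eq]
    split_ifs with h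
    · obtain ⟨rfl, rfl, rfl⟩ := h
      rw [nn_right_down a b k]
      push_cast
      field_simp
      ring
    · simp

end Adjointness

/-! ### Stability of the span and invariance of the form -/

section Invariance

/-- The operators `T` and `T'` are adjoint to each other for the form on the span `SS`. -/
def IsAdj (T T' : LV →ₗ[ℂ] LV) : Prop := ∀ u ∈ SS, ∀ v ∈ SS, BB (T u) v = BB u (T' v)

theorem isAdj_of_ee {T T' : LV →ₗ[ℂ] LV}
    (h : ∀ x y, BB (T (ee x)) (ee y) = BB (ee x) (T' (ee y))) : IsAdj T T' := by
  intro u hu v hv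
  induction hu using Submodule.span_induction with
  | mem u hu =>
    obtain ⟨x, rfl⟩ := hu
    induction hv using Submodule.span_induction with
    | mem v hv =>
      obtain ⟨y, rfl⟩ := hv
      exact h x y
    | zero => simp
    | add v w _ _ hv hw => rw [map_add, map_add, map_add, hv, hw]
    | smul c v _ hv => rw [map_smulₛₗ, map_smul, map_smulₛₗ, hv]
  | zero => simp
  | add u w _ _ hu hw =>
    rw [map_add, map_add, map_add, LinearMap.add_apply, LinearMap.add_apply, hu, hw]
  | smul c u _ hu =>
    rw [map_smul, map_smul, map_smul, LinearMap.smul_apply, LinearMap.smul_apply, hu]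

theorem isAdj_opD_opK (i j : Fin 2) : IsAdj (opD i j) (opK i j) := by
  refine isAdj_of_ee fun x y => ?_
  obtain ⟨α, a, b, k⟩ := x
  obtain ⟨β, a', b', k'⟩ := y
  fin_cases i <;> fin_cases j <;> fin_cases α <;> fin_cases β
  · exact BB_opD00_f1_f1 a b a' b' k k'
  · exact BB_opD00_f1_f2 a b a' b' k k'
  · exact BB_opD00_f1_f3 a b a' b' k k'
  · exact BB_opD00_f2_f1 a b a' b' k k'
  · exact BB_opD00_f2_f2 a b a' b' k k'
  · exact BB_opD00_f2_f3 a b a' b' k k'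
  · exact BB_opD00_f3_f1 a b a' b' k k'
  · exact BB_opD00_f3_f2 a b a' b' k k'
  · exact BB_opD00_f3_f3 a b a' b' k k'
  · exact BB_opD01_f1_f1 a b a' b' k k'
  · exact BB_opD01_f1_f2 a b a' b' k k'
  · exact BB_opD01_f1_f3 a b a' b' k k'
  · exact BB_opD01_f2_f1 a b a' b' k k'
  · exact BB_opD01_f2_f2 a b a' b' k k'
  · exact BB_opD01_f2_f3 a b a' b' k k'
  · exact BB_opD01_f3_f1 a b a' b' k k'
  · exact BB_opD01_f3_f2 a b a' b' k k'
  · exact BB_opD01_f3_f3 a b a' b' k k'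
  · exact BB_opD10_f1_f1 a b a' b' k k'
  · exact BB_opD10_f1_f2 a b a' b' k k'
  · exact BB_opD10_f1_f3 a b a' b' k k'
  · exact BB_opD10_f2_f1 a b a' b' k k'
  · exact BB_opD10_f2_f2 a b a' b' k k'
  · exact BB_opD10_f2_f3 a b a' b' k k'
  · exact BB_opD10_f3_f1 a b a' b' k k'
  · exact BB_opD10_f3_f2 a b a' b' k k'
  · exact BB_opD10_f3_f3 a b a' b' k k'
  · exact BB_opD11_f1_f1 a b a' b' k k'
  · exact BB_opD11_f1_f2 a b a' b' k k'
  · exact BB_opD11_f1_f3 a b a' b' k k'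
  · exact BB_opD11_f2_f1 a b a' b' k k'
  · exact BB_opD11_f2_f2 a b a' b' k k'
  · exact BB_opD11_f2_f3 a b a' b' k k'
  · exact BB_opD11_f3_f1 a b a' b' k k'
  · exact BB_opD11_f3_f2 a b a' b' k k'
  · exact BB_opD11_f3_f3 a b a' b' k k'

theorem IsAdj.symm {T T' : LV →ₗ[ℂ] LV} (h : IsAdj T T') : IsAdj T' T := by
  intro u hu v hv
  rw [BB_conj, ← h v hv u hu, ← BB_conj]

/-- `LinearMap`s that preserve the span `SS`. -/
def Stab (T : LV →ₗ[ℂ] LV) : Prop := ∀ u ∈ SS, T u ∈ SS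

theorem stab_of_ee {T : LV →ₗ[ℂ] LV} (h : ∀ x, T (ee x) ∈ SS) : Stab T := by
  intro u hu
  have : SS ≤ SS.comap T := Submodule.span_le.2 (by rintro _ ⟨x, rfl⟩; exact h x)
  exact this hu

theorem f1_mem (a b : ℕ) (k : ℤ) : f1 a b k ∈ SS := ee_mem (0, a, b, k)
theorem f2_mem (a b : ℕ) (k : ℤ) : f2 a b k ∈ SS := ee_mem (1, a, b, k)
theorem f3_mem (a b : ℕ) (k : ℤ) : f3 a b k ∈ SS := ee_mem (2, a, b, k)

theorem add_smul_mem {W : Submodule ℂ LV} {u v w : LV} (hu : u ∈ W) (hv : v ∈ W) (hw : w ∈ W)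
    (x y z : ℂ) : x • u + y • v + z • w ∈ W :=
  W.add_mem (W.add_mem (W.smul_mem _ hu) (W.smul_mem _ hv)) (W.smul_mem _ hw)

theorem stab_opD (i j : Fin 2) : Stab (opD i j) := by
  refine stab_of_ee fun x => ?_
  obtain ⟨α, a, b, k⟩ := x
  have h1 : opD i j (f1 a b k) ∈ SS := by
    fin_cases i <;> fin_cases j
    · exact opD00_f1 a b k ▸ SS.smul_mem _ (f1_mem _ _ _)
    · exact opD01_f1 a b k ▸ SS.smul_mem _ (f1_mem _ _ _)
    · exact opD10_f1 a b k ▸ SS.smul_mem _ (f1_mem _ _ _)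
    · exact opD11_f1 a b k ▸ SS.smul_mem _ (f1_mem _ _ _)
  have h2 : opD i j (f2 a b k) ∈ SS := by
    have key : ∀ (c x y : ℂ) (a b a' b' : ℕ) (k k' : ℤ),
        c • (x • f2 a b k + y • f1 a' b' k') ∈ SS := fun c x y a b a' b' k k' =>
      SS.smul_mem _ (SS.add_mem (SS.smul_mem _ (f2_mem _ _ _)) (SS.smul_mem _ (f1_mem _ _ _)))
    fin_cases j
    · rcases a with _ | a
      · exact (opD_f2_left b k i).symm ▸ SS.zero_mem
      · fin_cases i
        · exact opD00_f2 a b k ▸ key _ _ _ _ _ _ _ _ _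
        · exact opD10_f2 a b k ▸ key _ _ _ _ _ _ _ _ _
    · rcases b with _ | b
      · exact (opD_f2_right a k i).symm ▸ SS.zero_mem
      · fin_cases i
        · exact opD01_f2 a b k ▸ key _ _ _ _ _ _ _ _ _
        · exact opD11_f2 a b k ▸ key _ _ _ _ _ _ _ _ _
  have h3 : opD i j (f3 a b k) ∈ SS := by
    fin_cases i <;> fin_cases j
    · exact opD00_f3 a b k ▸ add_smul_mem (f1_mem _ _ _) (f2_mem _ _ _) (f3_mem _ _ _) _ _ _
    · exact opD01_f3 a b k ▸ add_smul_mem (f1_mem _ _ _) (f2_mem _ _ _) (f3_mem _ _ _) _ _ _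
    · exact opD10_f3 a b k ▸ add_smul_mem (f1_mem _ _ _) (f2_mem _ _ _) (f3_mem _ _ _) _ _ _
    · exact opD11_f3 a b k ▸ add_smul_mem (f1_mem _ _ _) (f2_mem _ _ _) (f3_mem _ _ _) _ _ _
  fin_cases α
  · exact h1
  · exact h2
  · exact h3

theorem stab_opK (i j : Fin 2) : Stab (opK i j) := by
  refine stab_of_ee fun x => ?_
  obtain ⟨α, a, b, k⟩ := x
  fin_cases α
  · change opK i j (f1 a b k) ∈ SS
    fin_cases i <;> fin_cases j
    · exact opK00_f1 a b k ▸ add_smul_mem (f1_mem _ _ _) (f2_mem _ _ _) (f3_mem _ _ _) _ _ _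
    · exact opK01_f1 a b k ▸ add_smul_mem (f1_mem _ _ _) (f2_mem _ _ _) (f3_mem _ _ _) _ _ _
    · exact opK10_f1 a b k ▸ add_smul_mem (f1_mem _ _ _) (f2_mem _ _ _) (f3_mem _ _ _) _ _ _
    · exact opK11_f1 a b k ▸ add_smul_mem (f1_mem _ _ _) (f2_mem _ _ _) (f3_mem _ _ _) _ _ _
  · change opK i j (f2 a b k) ∈ SS
    have key : ∀ (x y : ℂ) (a b a' b' : ℕ) (k k' : ℤ), x • f2 a b k + y • f3 a' b' k' ∈ SS :=
      fun x y a b a' b' k k' =>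
        SS.add_mem (SS.smul_mem _ (f2_mem _ _ _)) (SS.smul_mem _ (f3_mem _ _ _))
    fin_cases i <;> fin_cases j
    · exact opK00_f2 a b k ▸ key _ _ _ _ _ _ _ _
    · exact opK01_f2 a b k ▸ key _ _ _ _ _ _ _ _
    · exact opK10_f2 a b k ▸ key _ _ _ _ _ _ _ _
    · exact opK11_f2 a b k ▸ key _ _ _ _ _ _ _ _
  · change opK i j (f3 a b k) ∈ SS
    fin_cases i <;> fin_cases j
    · exact opK00_f3 a b k ▸ SS.smul_mem _ (f3_mem _ _ _)
    · exact opK01_f3 a b k ▸ SS.smul_mem _ (f3_mem _ _ _)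
    · exact opK10_f3 a b k ▸ SS.smul_mem _ (f3_mem _ _ _)
    · exact opK11_f3 a b k ▸ SS.smul_mem _ (f3_mem _ _ _)

theorem stab_sepOp (s : Fin 4) : Stab (sepOp s) :=
  stab_of_ee fun x => sepOp_ee s x ▸ SS.smul_mem _ (ee_mem x)

/-- The off-diagonal condition removes the `opA` term from the bracket relation; the remaining free
index is taken to be 0. -/
theorem opE_eq_bracket {s j : Fin 2} (h : s ≠ j) (v : LV) :
    opE s j v = opD 0 j (opK 0 s v) - opK 0 s (opD 0 j v) := by
  rw [opD_opK, if_pos rfl, if_neg h.symm, sub_zero]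

theorem opA_eq_bracket {i r : Fin 2} (h : i ≠ r) (v : LV) :
    opA i r v = opK r 0 (opD i 0 v) - opD i 0 (opK r 0 v) := by
  rw [← neg_sub, opD_opK, if_pos rfl, if_neg h, zero_sub, neg_neg]

theorem opA11_eq (v : LV) : opA 1 1 v = -v - opA 0 0 v - opE 0 0 v - opE 1 1 v := by
  rw [← opA_add_opE v]; abel

theorem stab_opE (i j : Fin 2) : Stab (opE i j) := by
  by_cases h : i = j
  · subst h
    fin_cases i
    · exact stab_sepOp 0
    · exact stab_sepOp 1
  · intro u hu
    rw [opE_eq_bracket h]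
    exact SS.sub_mem (stab_opD _ _ _ (stab_opK _ _ _ hu)) (stab_opK _ _ _ (stab_opD _ _ _ hu))

theorem stab_opA (i j : Fin 2) : Stab (opA i j) := by
  by_cases h : i = j
  · subst h
    fin_cases i
    · exact stab_sepOp 2
    · intro u hu
      change opA 1 1 u ∈ SS
      rw [opA11_eq]
      exact SS.sub_mem (SS.sub_mem (SS.sub_mem (SS.neg_mem hu) (stab_sepOp 2 u hu))
        (stab_sepOp 0 u hu)) (stab_sepOp 1 u hu)
  · intro u hu
    rw [opA_eq_bracket h]
    exact SS.sub_mem (stab_opK _ _ _ (stab_opD _ _ _ hu)) (stab_opD _ _ _ (stab_opK _ _ _ hu))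

theorem conj_sepEig (s : Fin 4) (x : Ix) : conj (sepEig s x) = sepEig s x := by
  obtain ⟨α, a, b, k⟩ := x
  fin_cases s <;> fin_cases α <;> simp [sepEig]

theorem isAdj_sepOp (s : Fin 4) : IsAdj (sepOp s) (sepOp s) := by
  refine isAdj_of_ee fun x y => ?_
  rw [sepOp_ee, sepOp_ee, map_smul, LinearMap.smul_apply, map_smulₛₗ, conj_sepEig, BB_ee]
  split_ifs with h
  · rw [h]
  · simp

/-- Off the diagonal, taking adjoints in the commutator of `opD` and `opK` exchanges the two
operators and reverses their order, which gives the commutator for the transposed unit. On the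
diagonal the operators have real eigenvalues on an orthogonal basis. -/
theorem isAdj_opE (i j : Fin 2) : IsAdj (opE i j) (opE j i) := by
  by_cases h : i = j
  · subst h
    fin_cases i
    · exact isAdj_sepOp 0
    · exact isAdj_sepOp 1
  · intro u hu v hv
    rw [opE_eq_bracket h, opE_eq_bracket (Ne.symm h), map_sub, map_sub, LinearMap.sub_apply,
      isAdj_opD_opK _ _ _ (stab_opK _ _ _ hu) _ hv, (isAdj_opD_opK _ _).symm _ hu _
        (stab_opK _ _ _ hv), (isAdj_opD_opK _ _).symm _ (stab_opD _ _ _ hu) _ hv,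
      isAdj_opD_opK _ _ _ hu _ (stab_opD _ _ _ hv)]

theorem isAdj_opA (i j : Fin 2) : IsAdj (opA i j) (opA j i) := by
  by_cases h : i = j
  · subst h
    fin_cases i
    · exact isAdj_sepOp 2
    · intro u hu v hv
      change BB (opA 1 1 u) v = BB u (opA 1 1 v)
      have h0 : BB (opE 0 0 u) v = BB u (opE 0 0 v) := isAdj_sepOp 0 u hu v hv
      have h1 : BB (opE 1 1 u) v = BB u (opE 1 1 v) := isAdj_sepOp 1 u hu v hv
      have h2 : BB (opA 0 0 u) v = BB u (opA 0 0 v) := isAdj_sepOp 2 u hu v hv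
      simp only [opA11_eq, map_sub, map_neg, LinearMap.sub_apply, LinearMap.neg_apply, h0, h1, h2]
  · intro u hu v hv
    rw [opA_eq_bracket h, opA_eq_bracket (Ne.symm h), map_sub, map_sub, LinearMap.sub_apply,
      isAdj_opD_opK _ _ _ (stab_opK _ _ _ hu) _ hv, (isAdj_opD_opK _ _).symm _ hu _
        (stab_opK _ _ _ hv), (isAdj_opD_opK _ _).symm _ (stab_opD _ _ _ hu) _ hv,
      isAdj_opD_opK _ _ _ hu _ (stab_opD _ _ _ hv)]

theorem pL_mem (X : Mat4) {u : LV} (hu : u ∈ SS) : pL X u ∈ SS := by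
  rw [pL_apply]
  refine SS.sum_mem fun i _ => SS.sum_mem fun j _ => ?_
  exact SS.add_mem (SS.sub_mem (SS.add_mem (SS.smul_mem _ (stab_opA i j u hu))
    (SS.smul_mem _ (stab_opE i j u hu))) (SS.smul_mem _ (stab_opD i j u hu)))
    (SS.smul_mem _ (stab_opK i j u hu))

theorem mem_u22_iff {X : Mat4} : X ∈ u22 ↔
    ∀ i j, X (.inl i) (.inl j) = -conj (X (.inl j) (.inl i)) ∧
    X (.inr i) (.inr j) = -conj (X (.inr j) (.inr i)) ∧
    X (.inr i) (.inl j) = conj (X (.inl j) (.inr i)) := by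
  constructor
  · rintro ⟨A, B, D, hA, hD, rfl⟩ i j
    refine ⟨?_, ?_, rfl⟩
    · exact congrFun (congrFun hA i) j
    · exact congrFun (congrFun hD i) j
  · intro h
    refine ⟨X.toBlocks₁₁, X.toBlocks₁₂, X.toBlocks₂₂, ?_, ?_, ?_⟩
    · ext i j; exact (h i j).1
    · ext i j; exact (h i j).2.1
    · ext (i | i) (j | j)
      · rfl
      · rfl
      · exact (h i j).2.2
      · rfl

/-- The adjoints of the four kinds of matrix units are known, so the adjoint of `pL X` is the action
of another matrix. The relations A = -A*, D = -D*, C = B* say that this matrix is -X; the sign in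
the upper right block comes from `opD` entering `pL` with a minus. -/
theorem BB_invariant {X : Mat4} (hX : X ∈ u22) {u v : LV} (hu : u ∈ SS) (hv : v ∈ SS) :
    BB (pL X u) v + BB u (pL X v) = 0 := by
  rw [mem_u22_iff] at hX
  have hA := fun i j => isAdj_opA i j u hu v hv
  have hE := fun i j => isAdj_opE i j u hu v hv
  have hD := fun i j => isAdj_opD_opK i j u hu v hv
  have hK := fun i j => (isAdj_opD_opK i j).symm u hu v hv
  simp only [pL_apply, Fin.sum_univ_two, map_add, map_sub, map_smul, map_smulₛₗ,
    LinearMap.add_apply, LinearMap.sub_apply, LinearMap.smul_apply, smul_eq_mul, hA, hE, hD, hK]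
  have a00 := (hX 0 0).1
  have a01 := (hX 0 1).1
  have a11 := (hX 1 1).1
  have a10 := (hX 1 0).1
  have d00 := (hX 0 0).2.1
  have d01 := (hX 0 1).2.1
  have d11 := (hX 1 1).2.1
  have d10 := (hX 1 0).2.1
  simp only [fun i j => (hX i j).2.2, Complex.conj_conj]
  linear_combination a00 * BB u (opA 0 0 v) + a01 * BB u (opA 1 0 v) + a10 * BB u (opA 0 1 v) +
    a11 * BB u (opA 1 1 v) + d00 * BB u (opE 0 0 v) + d01 * BB u (opE 1 0 v) +
    d10 * BB u (opE 0 1 v) + d11 * BB u (opE 1 1 v)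

end Invariance

/-! ### Irreducibility of the span -/

section Irreducibility

variable {W : Submodule ℂ LV}

/-- A subspace stable under `𝔲(2,2)` is stable under `𝔤𝔩(2, ℍ_ℂ)`. -/
theorem pL_mem_of_u22 (hW : ∀ X ∈ u22, ∀ u ∈ W, pL X u ∈ W) (X : Mat4) {u : LV} (hu : u ∈ W) :
    pL X u ∈ W := by
  -- The conjugate-linear involution X ↦ σ whose fixed points are u(2,2). Both X + σ and i(X - σ)
  -- are fixed, so gl(4) is the complexification of u(2,2).
  set σ : Mat4 := Matrix.fromBlocks (-(X.toBlocks₁₁)ᴴ) (X.toBlocks₂₁)ᴴ (X.toBlocks₁₂)ᴴ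
    (-(X.toBlocks₂₂)ᴴ) with hσ
  have h1 : X + σ ∈ u22 := by
    rw [mem_u22_iff]
    intro i j
    refine ⟨?_, ?_, ?_⟩
    · simp [hσ, Matrix.toBlocks₁₁]
    · simp [hσ, Matrix.toBlocks₂₂]
    · simp [hσ, Matrix.toBlocks₁₂, Matrix.toBlocks₂₁, add_comm]
  have h2 : Complex.I • (X - σ) ∈ u22 := by
    rw [mem_u22_iff]
    intro i j
    refine ⟨?_, ?_, ?_⟩
    · simp [hσ, Matrix.toBlocks₁₁]; ring
    · simp [hσ, Matrix.toBlocks₂₂]; ring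
    · simp [hσ, Matrix.toBlocks₁₂, Matrix.toBlocks₂₁]; ring
  have h3 : X = (2 : ℂ)⁻¹ • (X + σ) + (-(2 : ℂ)⁻¹ * Complex.I) • (Complex.I • (X - σ)) := by
    rw [smul_smul, mul_assoc, Complex.I_mul_I, mul_neg, mul_one, neg_neg, ← smul_add,
      add_add_sub_cancel, ← two_smul ℂ X, smul_smul, inv_mul_cancel₀ two_ne_zero, one_smul]
  rw [h3, pL_add, pL_smul, pL_smul, LinearMap.add_apply, LinearMap.smul_apply,
    LinearMap.smul_apply]
  exact W.add_mem (W.smul_mem _ (hW _ h1 u hu)) (W.smul_mem _ (hW _ h2 u hu))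

theorem pL_single_inl_inl (i j : Fin 2) : pL (Matrix.single (.inl i) (.inl j) 1) = opA i j := by
  refine LinearMap.ext fun v => ?_
  fin_cases i <;> fin_cases j <;> simp [pL_apply, Fin.sum_univ_two, Matrix.single_apply]

theorem pL_single_inr_inr (i j : Fin 2) : pL (Matrix.single (.inr i) (.inr j) 1) = opE i j := by
  refine LinearMap.ext fun v => ?_
  fin_cases i <;> fin_cases j <;> simp [pL_apply, Fin.sum_univ_two, Matrix.single_apply]

theorem pL_single_inl_inr (i j : Fin 2) : pL (Matrix.single (.inl i) (.inr j) 1) = -opD i j := by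
  refine LinearMap.ext fun v => ?_
  fin_cases i <;> fin_cases j <;> simp [pL_apply, Fin.sum_univ_two, Matrix.single_apply]

theorem pL_single_inr_inl (i j : Fin 2) : pL (Matrix.single (.inr j) (.inl i) 1) = opK i j := by
  refine LinearMap.ext fun v => ?_
  fin_cases i <;> fin_cases j <;> simp [pL_apply, Fin.sum_univ_two, Matrix.single_apply]

/-- Iterated kernels of the translations. -/
def nilD : ℕ → Submodule ℂ LV
  | 0 => ⊥
  | n + 1 => ⨅ i, ⨅ j, (nilD n).comap (opD i j)

theorem mem_nilD_succ {n : ℕ} {u : LV} : u ∈ nilD (n + 1) ↔ ∀ i j, opD i j u ∈ nilD n := by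
  simp [nilD]

theorem nilD_mono : Monotone nilD := by
  refine monotone_nat_of_le_succ fun n => ?_
  induction n with
  | zero => exact bot_le
  | succ n ih => exact fun u hu => mem_nilD_succ.2 fun i j => ih (mem_nilD_succ.1 hu i j)

/-- A polynomial of degree a + b is killed by any a + b + 1 successive derivatives; for f^{(3)} the
degree is a + b + 2. -/
theorem f1_mem_nilD (n : ℕ) : ∀ (a b : ℕ) (k : ℤ), a + b < n → f1 a b k ∈ nilD n := by
  induction n with
  | zero => intro a b k h; omega
  | succ n ih =>
    intro a b k h
    have hl : ∀ k', (a : ℂ) • f1 (a - 1) b k' ∈ nilD n := by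
      intro k'
      rcases a with _ | a
      · simp
      · exact (nilD n).smul_mem _ (ih _ _ _ (by omega))
    have hr : ∀ k', (b : ℂ) • f1 a (b - 1) k' ∈ nilD n := by
      intro k'
      rcases b with _ | b
      · simp
      · exact (nilD n).smul_mem _ (ih _ _ _ (by omega))
    refine mem_nilD_succ.2 fun i j => ?_
    fin_cases i <;> fin_cases j
    · exact opD00_f1 a b k ▸ hl _
    · exact opD01_f1 a b k ▸ hr _
    · exact opD10_f1 a b k ▸ hl _
    · exact opD11_f1 a b k ▸ hr _

theorem f2_mem_nilD (n : ℕ) : ∀ (a b : ℕ) (k : ℤ), a + b < n → f2 a b k ∈ nilD n := by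
  induction n with
  | zero => intro a b k h; omega
  | succ n ih =>
    intro a b k h
    have key : ∀ (c x y : ℂ) (a b a' b' : ℕ) (k k' : ℤ), a + b < n → a' + b' < n →
        c • (x • f2 a b k + y • f1 a' b' k') ∈ nilD n := fun c x y a b a' b' k k' h h' =>
      (nilD n).smul_mem _ ((nilD n).add_mem ((nilD n).smul_mem _ (ih _ _ _ h))
        ((nilD n).smul_mem _ (f1_mem_nilD _ _ _ _ h')))
    refine mem_nilD_succ.2 fun i j => ?_
    fin_cases j
    · rcases a with _ | a
      · exact (opD_f2_left b k i).symm ▸ (nilD n).zero_mem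
      · fin_cases i
        · exact opD00_f2 a b k ▸ key _ _ _ _ _ _ _ _ _ (by omega) (by omega)
        · exact opD10_f2 a b k ▸ key _ _ _ _ _ _ _ _ _ (by omega) (by omega)
    · rcases b with _ | b
      · exact (opD_f2_right a k i).symm ▸ (nilD n).zero_mem
      · fin_cases i
        · exact opD01_f2 a b k ▸ key _ _ _ _ _ _ _ _ _ (by omega) (by omega)
        · exact opD11_f2 a b k ▸ key _ _ _ _ _ _ _ _ _ (by omega) (by omega)

theorem f3_mem_nilD (n : ℕ) : ∀ (a b : ℕ) (k : ℤ), a + b + 2 < n → f3 a b k ∈ nilD n := by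
  induction n with
  | zero => intro a b k h; omega
  | succ n ih =>
    intro a b k h
    have hl : ∀ (c d : ℂ) k', ((a : ℂ) * c / d) • f3 (a - 1) b k' ∈ nilD n := by
      intro c d k'
      rcases a with _ | a
      · simp
      · exact (nilD n).smul_mem _ (ih _ _ _ (by omega))
    have hr : ∀ (c d : ℂ) k', ((b : ℂ) * c / d) • f3 a (b - 1) k' ∈ nilD n := by
      intro c d k'
      rcases b with _ | b
      · simp
      · exact (nilD n).smul_mem _ (ih _ _ _ (by omega))
    have key : ∀ (x y : ℂ) (a b a' b' : ℕ) (k k' : ℤ) (w : LV), a + b < n → a' + b' < n →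
        w ∈ nilD n → x • f1 a b k + y • f2 a' b' k' + w ∈ nilD n :=
      fun x y a b a' b' k k' w h h' hw => (nilD n).add_mem ((nilD n).add_mem
        ((nilD n).smul_mem _ (f1_mem_nilD _ _ _ _ h))
        ((nilD n).smul_mem _ (f2_mem_nilD _ _ _ _ h'))) hw
    refine mem_nilD_succ.2 fun i j => ?_
    fin_cases i <;> fin_cases j
    · exact opD00_f3 a b k ▸ key _ _ _ _ _ _ _ _ _ (by omega) (by omega) (hl _ _ _)
    · exact opD01_f3 a b k ▸ key _ _ _ _ _ _ _ _ _ (by omega) (by omega) (hr _ _ _)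
    · exact opD10_f3 a b k ▸ key _ _ _ _ _ _ _ _ _ (by omega) (by omega) (hl _ _ _)
    · exact opD11_f3 a b k ▸ key _ _ _ _ _ _ _ _ _ (by omega) (by omega) (hr _ _ _)

theorem exists_mem_nilD {u : LV} (hu : u ∈ SS) : ∃ n, u ∈ nilD n := by
  have h : SS ≤ ⨆ n, nilD n := by
    refine Submodule.span_le.2 ?_
    rintro _ ⟨⟨α, a, b, k⟩, rfl⟩
    refine Submodule.mem_iSup_of_mem (a + b + 3) ?_
    fin_cases α
    · exact f1_mem_nilD _ a b k (by omega)
    · exact f2_mem_nilD _ a b k (by omega)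
    · exact f3_mem_nilD _ a b k (by omega)
  exact (Submodule.mem_iSup_of_directed _ nilD_mono.directed_le).1 (h hu)

/-- The sum `E₀₀ + E₁₁`, the Euler operator. -/
def eulerOp : Module.End ℂ LV := opE 0 0 + opE 1 1

theorem eulerOp_ee (x : Ix) : eulerOp (ee x) = (sepEig 0 x + sepEig 1 x) • ee x := by
  rw [add_smul, ← sepOp_ee, ← sepOp_ee]
  rfl

theorem eulerOp_eq_zero {u : LV} (h : ∀ i j, opD i j u = 0) : eulerOp u = 0 := by
  have h' : ∀ i j r, D i j (u r) = 0 := fun i j r => congrFun (h i j) r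
  funext r
  change opE 0 0 u r + opE 1 1 u r = 0
  simp [opE_apply, h']

theorem constants_of_degree_zero {x : Ix} (h : sepEig 0 x + sepEig 1 x = 0) :
    ee x ∈ Submodule.span ℂ {f1 0 0 0, f1 0 0 1} := by
  by_cases hx : Valid x
  · obtain ⟨α, a, b, k⟩ := x
    fin_cases α
    · simp only [sepEig] at h
      norm_cast at h
      obtain ⟨rfl, rfl⟩ : a = 0 ∧ b = 0 := by omega
      simp only [Valid] at hx
      have hk : k = 0 ∨ k = 1 := by omega
      rcases hk with rfl | rfl
      · exact Submodule.subset_span (Or.inl rfl)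
      · exact Submodule.subset_span (Or.inr rfl)
    · simp only [sepEig] at h
      norm_cast at h
      simp only [Valid] at hx
      omega
    · simp only [sepEig] at h
      norm_cast at h
  · rw [ee_eq_zero hx]
    exact Submodule.zero_mem _

/-- If all derivatives vanish, so does the Euler operator, and the vector lies in the span of basis
vectors of degree 0. Such f^{(2)} are zero and f^{(3)} has degree at least 2, so only the two
constants remain. -/
theorem mem_constants {u : LV} (hu : u ∈ SS) (h : ∀ i j, opD i j u = 0) :
    u ∈ Submodule.span ℂ {f1 0 0 0, f1 0 0 1} := by
  have h1 := mem_span_of_eigenvector (v := ee) (A := eulerOp) eulerOp_ee hu (c := 0)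
    (by rw [eulerOp_eq_zero h, zero_smul])
  refine (Submodule.span_le.2 ?_) h1
  rintro _ ⟨x, hx, rfl⟩
  exact constants_of_degree_zero hx

/-- Differentiate a non-zero element as long as some derivative is non-zero; local nilpotency makes
this stop. -/
theorem exists_constant (hWS : W ≤ SS) (hD : ∀ i j, ∀ u ∈ W, opD i j u ∈ W) (h0 : W ≠ ⊥) :
    ∃ u ∈ W, u ≠ 0 ∧ ∀ i j, opD i j u = 0 := by
  obtain ⟨w, hw, hw0⟩ := Submodule.exists_mem_ne_zero_of_ne_bot h0
  obtain ⟨n, hn⟩ := exists_mem_nilD (hWS hw)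
  induction n generalizing w with
  | zero => exact absurd hn hw0
  | succ n ih =>
    by_cases h : ∀ i j, opD i j w = 0
    · exact ⟨w, hw, hw0, h⟩
    · push Not at h
      obtain ⟨i, j, hij⟩ := h
      exact ih _ (hD i j w hw) hij (mem_nilD_succ.1 hn i j)

theorem opA10_f1_zero : opA 1 0 (f1 0 0 0) = -f1 0 0 1 := by
  refine LV_ext fun Z r => ?_
  fin_cases r <;> simp [opA_eq, f1, rowOp01_tt, rowOp00_tt, evalAt_tt, tt]

theorem opA01_f1_one : opA 0 1 (f1 0 0 1) = -f1 0 0 0 := by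
  refine LV_ext fun Z r => ?_
  fin_cases r <;> simp [opA_eq, f1, rowOp10_tt, rowOp11_tt, evalAt_tt, tt]

/-- `opA 0 0` has eigenvalues 0 and -1 on the two constants and separates them; `opA 1 0` and `opA 0
1` map each to minus the other. For other k the vector is zero. -/
theorem constants_mem (hA : ∀ i j, ∀ u ∈ W, opA i j u ∈ W) {u : LV} (hu : u ∈ W) (hu0 : u ≠ 0)
    (hc : u ∈ Submodule.span ℂ {f1 0 0 0, f1 0 0 1}) (k : ℤ) : f1 0 0 k ∈ W := by
  obtain ⟨x, y, rfl⟩ := Submodule.mem_span_pair.1 hc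
  have e0 : opA 0 0 (f1 0 0 0) = 0 := by rw [opA00_f1]; simp
  have e1 : opA 0 0 (f1 0 0 1) = -f1 0 0 1 := by rw [opA00_f1]; push_cast; module
  have h1 : y • f1 0 0 1 ∈ W := by
    have := W.neg_mem (hA 0 0 _ hu)
    rwa [map_add, map_smul, map_smul, e0, e1, smul_zero, zero_add, smul_neg, neg_neg] at this
  have h0 : x • f1 0 0 0 ∈ W := by
    have := W.sub_mem hu h1
    rwa [add_sub_cancel_right] at this
  have hboth : f1 0 0 0 ∈ W ∧ f1 0 0 1 ∈ W := by
    by_cases hy : y = 0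
    · have hx : x ≠ 0 := by
        rintro rfl
        exact hu0 (by simp [hy])
      have h2 := (W.smul_mem_iff hx).1 h0
      have h3 := W.neg_mem (hA 1 0 _ h2)
      rw [opA10_f1_zero, neg_neg] at h3
      exact ⟨h2, h3⟩
    · have h2 := (W.smul_mem_iff hy).1 h1
      have h3 := W.neg_mem (hA 0 1 _ h2)
      rw [opA01_f1_one, neg_neg] at h3
      exact ⟨h3, h2⟩
  by_cases hk : 0 ≤ k ∧ k ≤ (0 : ℕ) + (0 : ℕ) + 1
  · have : k = 0 ∨ k = 1 := by omega
    rcases this with rfl | rfl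
    · exact hboth.1
    · exact hboth.2
  · rw [f1_eq_zero hk]
    exact W.zero_mem

/-- In K₀₀ f^{(1)}(a, b, k - 1) + K₁₀ f^{(1)}(a, b, k) the components in the other two families
cancel, and (a + b + 1) f^{(1)}(a + 1, b, k) remains. The same holds for b with K₀₁ and K₁₁. -/
theorem generates_f1 (hK : ∀ i j, ∀ u ∈ W, opK i j u ∈ W) (hc : ∀ k, f1 0 0 k ∈ W) (a b : ℕ) :
    ∀ k, f1 a b k ∈ W := by
  have hl : ∀ a b, (∀ k, f1 a b k ∈ W) → ∀ k, f1 (a + 1) b k ∈ W := by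
    intro a b h k
    have h1 := W.add_mem (hK 0 0 _ (h (k - 1))) (hK 1 0 _ (h k))
    rw [opK00_f1, opK10_f1] at h1
    have e1 := cast_add_one_ne a b
    have e2 := cast_add_two_ne a b
    rw [← W.smul_mem_iff e1]
    convert h1 using 1
    simp only [sub_add_cancel]
    push_cast
    match_scalars <;> field_simp <;> ring
  have hr : ∀ a b, (∀ k, f1 a b k ∈ W) → ∀ k, f1 a (b + 1) k ∈ W := by
    intro a b h k
    have h1 := W.add_mem (hK 0 1 _ (h (k - 1))) (hK 1 1 _ (h k))
    rw [opK01_f1, opK11_f1] at h1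
    have e1 := cast_add_one_ne a b
    have e2 := cast_add_two_ne a b
    rw [← W.smul_mem_iff e1]
    convert h1 using 1
    simp only [sub_add_cancel]
    push_cast
    match_scalars <;> field_simp <;> ring
  induction a with
  | zero =>
    induction b with
    | zero => exact hc
    | succ b ih => exact hr 0 b ih
  | succ a ih => exact hl a b ih

/-- In K₀₁ f^{(1)}(a + 1, b, k) - K₀₀ f^{(1)}(a, b + 1, k) the components in f^{(1)} and f^{(2)}
cancel. -/
theorem generates_f3 (hK : ∀ i j, ∀ u ∈ W, opK i j u ∈ W) (h1 : ∀ a b k, f1 a b k ∈ W)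
    (a b : ℕ) (k : ℤ) : f3 a b k ∈ W := by
  have e1 := cast_add_two_ne a b
  have e2 := cast_add_one_ne a (b + 1)
  have e3 := cast_add_two_ne a (b + 1)
  have e4 := cast_add_one_ne (a + 1) b
  have e5 := cast_add_two_ne (a + 1) b
  have h2 := W.sub_mem (hK 0 1 _ (h1 (a + 1) b k)) (hK 0 0 _ (h1 a (b + 1) k))
  rw [opK01_f1, opK00_f1] at h2
  -- The subtracted vector is zero: the difference in `h2` already equals `f3 a b k`, because its
  -- coefficients a + 1 and b + 1 add up to the denominator a + b + 2.
  convert W.sub_mem h2 (W.smul_mem 0 (h1 a b k)) using 1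
  simp only [Nat.add_sub_cancel]
  push_cast at e2 e3 e4 e5 ⊢
  match_scalars <;> field_simp <;> ring

/-- `opK` of f^{(1)} contains f^{(2)} with a non-zero coefficient, and its other two components are
already available. A vector f^{(2)} with a = b = 0 is zero. -/
theorem generates_f2 (hK : ∀ i j, ∀ u ∈ W, opK i j u ∈ W) (h1 : ∀ a b k, f1 a b k ∈ W)
    (h3 : ∀ a b k, f3 a b k ∈ W) (a b : ℕ) (k : ℤ) : f2 a b k ∈ W := by
  rcases a with _ | a
  · rcases b with _ | b
    · rw [f2_eq_zero (by push_cast; omega)]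
      exact W.zero_mem
    · have e1 := cast_add_one_ne 0 b
      have e2 := cast_add_two_ne 0 b
      have h := hK 0 1 _ (h1 0 b k)
      rw [opK01_f1, W.add_mem_iff_left (W.smul_mem _ (h3 _ _ _)),
        W.add_mem_iff_right (W.smul_mem _ (h1 _ _ _)), W.smul_mem_iff] at h
      · exact h
      · exact div_ne_zero (by norm_num) (mul_ne_zero e1 e2)
  · have e1 := cast_add_one_ne a b
    have e2 := cast_add_two_ne a b
    have h := hK 0 0 _ (h1 a b k)
    rw [opK00_f1, W.add_mem_iff_left (W.smul_mem _ (h3 _ _ _)),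
      W.add_mem_iff_right (W.smul_mem _ (h1 _ _ _)), W.smul_mem_iff] at h
    · exact h
    · exact div_ne_zero (by norm_num) (mul_ne_zero e1 e2)

/-- The span of the family is an irreducible representation of `𝔲(2,2)`. -/
theorem SS_irreducible (hWS : W ≤ SS) (hW : ∀ X ∈ u22, ∀ u ∈ W, pL X u ∈ W) :
    W = ⊥ ∨ W = SS := by
  have hA : ∀ i j, ∀ u ∈ W, opA i j u ∈ W := fun i j u hu => by
    rw [← pL_single_inl_inl]; exact pL_mem_of_u22 hW _ hu
  have hD : ∀ i j, ∀ u ∈ W, opD i j u ∈ W := fun i j u hu => by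
    have := W.neg_mem (pL_mem_of_u22 hW (Matrix.single (.inl i) (.inr j) 1) hu)
    rwa [pL_single_inl_inr, LinearMap.neg_apply, neg_neg] at this
  have hK : ∀ i j, ∀ u ∈ W, opK i j u ∈ W := fun i j u hu => by
    rw [← pL_single_inr_inl]; exact pL_mem_of_u22 hW _ hu
  by_cases h0 : W = ⊥
  · exact Or.inl h0
  · obtain ⟨u, hu, hu0, hu'⟩ := exists_constant hWS hD h0
    have hc := constants_mem hA hu hu0 (mem_constants (hWS hu) hu')
    have h1 := generates_f1 hK hc
    have h3 := generates_f3 hK h1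
    refine Or.inr (le_antisymm hWS (Submodule.span_le.2 ?_))
    rintro _ ⟨⟨α, a, b, k⟩, rfl⟩
    fin_cases α
    · exact h1 a b k
    · exact generates_f2 hK h1 h3 a b k
    · exact h3 a b k

end Irreducibility

/-! ### Uniqueness of the invariant form -/

section Uniqueness

theorem f1_ne_zero : f1 0 0 0 ≠ 0 := ee_ne_zero (x := (0, 0, 0, 0)) (by simp [Valid])

theorem single_I_mem_u22 (p : Fin 2 ⊕ Fin 2) : (Complex.I • Matrix.single p p 1 : Mat4) ∈ u22 := by
  rw [mem_u22_iff]
  intro i j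
  rcases p with p | p <;> refine ⟨?_, ?_, ?_⟩ <;>
    simp [Matrix.single_apply, and_comm, apply_ite (starRingEnd ℂ)] <;> split_ifs <;> simp

/-- Invariant sesquilinear forms on the span. -/
def FormInvariant (H : SS →ₗ[ℂ] SS →ₗ⋆[ℂ] ℂ) : Prop :=
  ∀ X ∈ u22, ∀ u v : SS, H ⟨pL X u, pL_mem X u.2⟩ v + H u ⟨pL X v, pL_mem X v.2⟩ = 0

/-- i times a diagonal matrix unit lies in u(2,2); invariance under it makes eigenvectors with
different eigenvalues orthogonal when the second eigenvalue is real. -/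
theorem FormInvariant.orthogonal {H : SS →ₗ[ℂ] SS →ₗ⋆[ℂ] ℂ} (hH : FormInvariant H)
    {p : Fin 2 ⊕ Fin 2} {u v : SS} {x y : ℂ} (hu : pL (Matrix.single p p 1) u.1 = x • u.1)
    (hv : pL (Matrix.single p p 1) v.1 = y • v.1) (hy : conj y = y) (hxy : x ≠ y) : H u v = 0 := by
  have h := hH _ (single_I_mem_u22 p) u v
  have e1 : (⟨pL (Complex.I • Matrix.single p p 1) u, pL_mem _ u.2⟩ : SS) = (Complex.I * x) • u :=
    Subtype.ext (by
      change pL _ u.1 = _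
      rw [pL_smul, LinearMap.smul_apply, hu, smul_smul]; rfl)
  have e2 : (⟨pL (Complex.I • Matrix.single p p 1) v, pL_mem _ v.2⟩ : SS) = (Complex.I * y) • v :=
    Subtype.ext (by
      change pL _ v.1 = _
      rw [pL_smul, LinearMap.smul_apply, hv, smul_smul]; rfl)
  rw [e1, e2, map_smul, LinearMap.smul_apply, map_smulₛₗ, map_mul, Complex.conj_I, hy, smul_eq_mul,
    smul_eq_mul] at h
  have h2 : Complex.I * (x - y) * H u v = 0 := by linear_combination h
  exact (mul_eq_zero.1 h2).resolve_left (mul_ne_zero Complex.I_ne_zero (sub_ne_zero.2 hxy))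

/-- Among non-zero basis vectors only `f1 0 0 0` has its eigenvalues under the three diagonal matrix
units. So the hypothesis puts it in the radical, and the radical is a stable subspace, hence all of
`SS`. -/
theorem FormInvariant.eq_zero {H : SS →ₗ[ℂ] SS →ₗ⋆[ℂ] ℂ} (hH : FormInvariant H)
    (h0 : H ⟨f1 0 0 0, f1_mem 0 0 0⟩ ⟨f1 0 0 0, f1_mem 0 0 0⟩ = 0) : H = 0 := by
  set c : SS := ⟨f1 0 0 0, f1_mem 0 0 0⟩ with hc
  have hbasis : ∀ x : Ix, H c ⟨ee x, ee_mem x⟩ = 0 := by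
    intro x
    by_cases h : ∀ s : Fin 3, sepEig s.castSucc (0, 0, 0, 0) = sepEig s.castSucc x
    · by_cases hx : Valid x
      · have hx0 : x = (0, 0, 0, 0) := by
          obtain ⟨α, a, b, k⟩ := x
          have e0 := h 0
          have e1 := h 1
          have e2 := h 2
          fin_cases α <;> simp [sepEig] at e0 e1 e2 <;> norm_cast at e0 e1
          · simp [← e0, ← e1, e2]
          · simp only [Valid] at hx
            omega
        subst hx0
        exact h0
      · have : (⟨ee x, ee_mem x⟩ : SS) = 0 := Subtype.ext (ee_eq_zero hx)
        rw [this, map_zero]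
    · push Not at h
      obtain ⟨s, hs⟩ := h
      have key : ∀ (p : Fin 2 ⊕ Fin 2), pL (Matrix.single p p 1) = sepOp s.castSucc →
          H c ⟨ee x, ee_mem x⟩ = 0 := by
        intro p hp
        refine hH.orthogonal (p := p) ?_ ?_ (conj_sepEig _ _) hs
        · rw [hp]; exact sepOp_ee s.castSucc (0, 0, 0, 0)
        · rw [hp]; exact sepOp_ee s.castSucc x
      fin_cases s
      · exact key (.inr 0) (pL_single_inr_inr 0 0)
      · exact key (.inr 1) (pL_single_inr_inr 1 1)
      · exact key (.inl 0) (pL_single_inl_inl 0 0)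
  have hcv : ∀ v, H c v = 0 := by
    rintro ⟨v, hv⟩
    induction hv using Submodule.span_induction with
    | mem v hv => obtain ⟨x, rfl⟩ := hv; exact hbasis x
    | zero => exact map_zero _
    | add u w hu hw h1 h2 =>
      have : (⟨u + w, SS.add_mem hu hw⟩ : SS) = ⟨u, hu⟩ + ⟨w, hw⟩ := rfl
      rw [this, map_add, h1, h2, add_zero]
    | smul a u hu h1 =>
      have : (⟨a • u, SS.smul_mem a hu⟩ : SS) = a • ⟨u, hu⟩ := rfl
      rw [this, map_smulₛₗ, h1, smul_zero]
  have hR := SS_irreducible (W := (LinearMap.ker H).map SS.subtype)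
    (by rintro _ ⟨u, _, rfl⟩; exact u.2)
    (by
      rintro X hX _ ⟨u, hu, rfl⟩
      refine ⟨⟨pL X u, pL_mem X u.2⟩, ?_, rfl⟩
      refine LinearMap.ext fun v => ?_
      have h1 := hH X hX u v
      rw [LinearMap.mem_ker.1 hu, LinearMap.zero_apply, add_zero] at h1
      exact h1)
  have hcR : f1 0 0 0 ∈ (LinearMap.ker H).map SS.subtype := ⟨c, LinearMap.ext hcv, rfl⟩
  rcases hR with hR | hR
  · rw [hR] at hcR
    exact absurd hcR f1_ne_zero
  · refine LinearMap.ext fun u => ?_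
    have hu : u.1 ∈ (LinearMap.ker H).map SS.subtype := by rw [hR]; exact u.2
    obtain ⟨w, hw, hwu⟩ := hu
    have : w = u := Subtype.ext hwu
    rw [← this]
    exact hw

/-- The restriction of the invariant form to the span. -/
def BS : SS →ₗ[ℂ] SS →ₗ⋆[ℂ] ℂ :=
  LinearMap.mk₂'ₛₗ (RingHom.id ℂ) (starRingEnd ℂ) (fun u v => BB u.1 v.1)
    (fun u u' v => by rw [Submodule.coe_add, map_add, LinearMap.add_apply])
    (fun c u v => by rw [Submodule.coe_smul, map_smul, LinearMap.smul_apply]; rfl)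
    (fun u v v' => by rw [Submodule.coe_add, map_add])
    (fun c u v => by rw [Submodule.coe_smul, map_smulₛₗ])

theorem BS_apply (u v : SS) : BS u v = BB u.1 v.1 := rfl

theorem BS_invariant : FormInvariant BS := fun _ hX u v => BB_invariant hX u.2 v.2

theorem BS_f1 : BS ⟨f1 0 0 0, f1_mem 0 0 0⟩ ⟨f1 0 0 0, f1_mem 0 0 0⟩ = 1 := by
  have h : ifac 0 = 1 := by simpa using ifac_natCast 0
  have h1 : ifac 1 = 1 := by simpa using ifac_natCast 1
  rw [BS_apply, BB_f1_f1]
  simp [nn, h, h1]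

/-- The factor is the value of H at `f1 0 0 0`, real by Hermitian symmetry; `BS` has value 1 there,
so the difference vanishes there and hence everywhere. -/
theorem FormInvariant.eq_smul {H : SS →ₗ[ℂ] SS →ₗ⋆[ℂ] ℂ} (hH : FormInvariant H)
    (hconj : ∀ u v, H v u = conj (H u v)) : ∃ r : ℝ, ∀ u v, H u v = (r : ℂ) * BB u.1 v.1 := by
  set c : SS := ⟨f1 0 0 0, f1_mem 0 0 0⟩ with hc
  obtain ⟨r, hr⟩ := Complex.conj_eq_iff_real.1 (hconj c c).symm
  refine ⟨r, ?_⟩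
  have h : H - (r : ℂ) • BS = 0 := by
    refine FormInvariant.eq_zero ?_ ?_
    · intro X hX u v
      have h1 := hH X hX u v
      have h2 := BS_invariant X hX u v
      simp only [LinearMap.sub_apply, LinearMap.smul_apply, smul_eq_mul]
      linear_combination h1 - (r : ℂ) * h2
    · simp only [LinearMap.sub_apply, LinearMap.smul_apply, smul_eq_mul, ← hc, hr]
      rw [hc, BS_f1]
      ring
  intro u v
  have h1 := LinearMap.congr_fun (LinearMap.congr_fun h u) v
  simp only [LinearMap.sub_apply, LinearMap.smul_apply, smul_eq_mul, LinearMap.zero_apply] at h1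
  exact sub_eq_zero.1 h1

end Uniqueness

/-! ### Transport from the model to a representation -/

section Transport

/-- A realization of one of the four representations on the span `SS`. -/
structure Realization (c : Label) where
  toFun : LV →ₗ[ℂ] Fn
  injective : Function.Injective toFun
  map_eq : SS.map toFun = space c
  twist : Mat4 → Mat4
  twist_mem : ∀ X ∈ u22, twist X ∈ u22
  twist_twist : ∀ X, twist (twist X) = X
  act_eq : ∀ X, ∀ u ∈ SS, act c X (toFun u) = toFun (pL (twist X) u)
  index : Fin 3 → ℚ → ℚ → ℚ → ℕ × ℕ × ℤ
  factor : Fin 3 → ℚ → ℚ → ℚ → ℂ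
  valid : ∀ α l m n, kidx c α l m n → Valid (α, index α l m n)
  factor_ne : ∀ α l m n, kidx c α l m n → factor α l m n ≠ 0
  ktype_eq : ∀ α l m n, kidx c α l m n →
    ktype c α l m n = factor α l m n • toFun (ee (α, index α l m n))
  weight_eq : ∀ α l m n, kidx c α l m n → ((weight α l : ℚ) : ℂ) = wgt (α, index α l m n)
  index_injective : ∀ α l m n l' m' n', kidx c α l m n → kidx c α l' m' n' →
    index α l m n = index α l' m' n' → l = l' ∧ m = m' ∧ n = n'
  index_surjective : ∀ α y, Valid (α, y) → ∃ l m n, kidx c α l m n ∧ index α l m n = y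
  sphere : ∀ u v, sphereInner (toFun u) (toFun v) = sphereInner (toFn u) (toFn v)

variable {c : Label}

namespace Realization

/-- The span is isomorphic to the space. -/
def equiv (R : Realization c) : SS ≃ₗ[ℂ] space c :=
  (Submodule.equivMapOfInjective R.toFun R.injective SS).trans (LinearEquiv.ofEq _ _ R.map_eq)

theorem coe_equiv (R : Realization c) (u : SS) : (R.equiv u : Fn) = R.toFun u := rfl

theorem toFun_symm (R : Realization c) (f : space c) : R.toFun (R.equiv.symm f).1 = f := by
  rw [← coe_equiv, LinearEquiv.apply_symm_apply]

theorem mem_iff (R : Realization c) {f : Fn} : f ∈ space c ↔ ∃ u ∈ SS, R.toFun u = f := by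
  rw [← R.map_eq, Submodule.mem_map]

theorem stable (R : Realization c) (X : Mat4) {f : Fn} (hf : f ∈ space c) :
    act c X f ∈ space c := by
  obtain ⟨u, hu, rfl⟩ := R.mem_iff.1 hf
  rw [R.act_eq X u hu]
  exact R.mem_iff.2 ⟨_, pL_mem _ hu, rfl⟩

theorem ne_bot (R : Realization c) : space c ≠ ⊥ := by
  intro h
  have h1 : R.toFun (f1 0 0 0) ∈ space c := R.mem_iff.2 ⟨_, f1_mem 0 0 0, rfl⟩
  rw [h, Submodule.mem_bot, map_eq_zero_iff _ R.injective] at h1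
  exact f1_ne_zero h1

/-- The preimage of a stable subspace is stable in the model, because the twist is an involution of
u(2,2): applying the hypothesis to the twist of X gives the action of X itself. -/
theorem irreducible (R : Realization c) (W : Submodule ℂ Fn) (hW : W ≤ space c)
    (h : ∀ X ∈ u22, ∀ f ∈ W, act c X f ∈ W) : W = ⊥ ∨ W = space c := by
  have hmap : (SS ⊓ W.comap R.toFun).map R.toFun = W := by
    refine le_antisymm ?_ ?_
    · rintro _ ⟨u, hu, rfl⟩
      exact hu.2
    · intro f hf
      obtain ⟨u, hu, rfl⟩ := R.mem_iff.1 (hW hf)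
      exact ⟨u, ⟨hu, hf⟩, rfl⟩
  have h1 := SS_irreducible (W := SS ⊓ W.comap R.toFun) inf_le_left (by
    rintro X hX u ⟨hu, hu'⟩
    refine ⟨pL_mem X hu, ?_⟩
    have h2 := h _ (R.twist_mem X hX) _ hu'
    rw [R.act_eq _ u hu, R.twist_twist] at h2
    exact h2)
  rcases h1 with h1 | h1
  · left
    rw [← hmap, h1, Submodule.map_bot]
  · right
    rw [← hmap, h1, R.map_eq]

theorem span_eq (R : Realization c) :
    Submodule.span ℂ {f | ∃ α l m n, kidx c α l m n ∧ f = ktype c α l m n} =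
    space c := by
  refine le_antisymm (Submodule.span_le.2 ?_) ?_
  · rintro _ ⟨α, l, m, n, h, rfl⟩
    rw [R.ktype_eq α l m n h, ← map_smul]
    exact R.mem_iff.2 ⟨_, SS.smul_mem _ (ee_mem _), rfl⟩
  · rw [← R.map_eq, SS, Submodule.map_span, Submodule.span_le]
    rintro _ ⟨_, ⟨⟨α, y⟩, rfl⟩, rfl⟩
    by_cases hy : Valid (α, y)
    · obtain ⟨l, m, n, h, rfl⟩ := R.index_surjective α y hy
      have h1 := R.factor_ne α l m n h
      refine (Submodule.smul_mem_iff _ h1).1 (Submodule.subset_span ⟨α, l, m, n, h, ?_⟩)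
      exact (R.ktype_eq α l m n h).symm
    · rw [ee_eq_zero hy, map_zero]
      exact Submodule.zero_mem _

theorem linearIndependent (R : Realization c) : LinearIndependent ℂ
    (fun p : {p : Fin 3 × ℚ × ℚ × ℚ // kidx c p.1 p.2.1 p.2.2.1 p.2.2.2} =>
      ktype c p.1.1 p.1.2.1 p.1.2.2.1 p.1.2.2.2) := by
  have h1 : LinearIndependent ℂ (fun x : {x : Ix // Valid x} => R.toFun (ee x.1)) :=
    linearIndependent_ee.map' R.toFun (LinearMap.ker_eq_bot.2 R.injective)
  let σ : {p : Fin 3 × ℚ × ℚ × ℚ // kidx c p.1 p.2.1 p.2.2.1 p.2.2.2} → {x : Ix // Valid x} :=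
    fun p => ⟨(p.1.1, R.index p.1.1 p.1.2.1 p.1.2.2.1 p.1.2.2.2), R.valid _ _ _ _ p.2⟩
  have hσ : Function.Injective σ := by
    rintro ⟨⟨α, l, m, n⟩, hp⟩ ⟨⟨α', l', m', n'⟩, hp'⟩ h
    have h2 := congrArg Subtype.val h
    simp only [σ, Prod.mk.injEq] at h2
    obtain ⟨rfl, h2⟩ := h2
    obtain ⟨rfl, rfl, rfl⟩ := R.index_injective _ _ _ _ _ _ _ hp hp' h2
    rfl
  -- The basis functions are the transported vectors rescaled by non-zero factors.
  have h2 := (h1.comp σ hσ).units_smul fun p => Units.mk0 _ (R.factor_ne _ _ _ _ p.2)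
  convert h2 using 1
  funext p
  exact R.ktype_eq _ _ _ _ p.2

/-- The invariant form on the space. -/
def form (R : Realization c) : space c →ₗ[ℂ] space c →ₗ⋆[ℂ] ℂ :=
  LinearMap.mk₂'ₛₗ (RingHom.id ℂ) (starRingEnd ℂ)
    (fun u v => BS (R.equiv.symm u) (R.equiv.symm v))
    (fun u u' v => by rw [map_add, map_add, LinearMap.add_apply])
    (fun c u v => by rw [map_smul, map_smul, LinearMap.smul_apply]; rfl)
    (fun u v v' => by rw [map_add, map_add])
    (fun c u v => by rw [map_smul, map_smulₛₗ])

theorem form_apply (R : Realization c) (u v : space c) :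
    R.form u v = BB (R.equiv.symm u).1 (R.equiv.symm v).1 := rfl

theorem form_hermitian (R : Realization c) : IsHermitianForm R.form := fun u v => BB_conj _ _

theorem equiv_symm_act (R : Realization c) {X : Mat4} {u u' : space c} (h : (u' : Fn) = act c X u) :
    (R.equiv.symm u').1 = pL (R.twist X) (R.equiv.symm u).1 := by
  refine R.injective ?_
  rw [toFun_symm, ← R.act_eq X _ (R.equiv.symm u).2, toFun_symm, h]

theorem form_invariant (R : Realization c) : IsInvariantForm c R.form := by
  intro X hX u v u' v' hu hv
  rw [form_apply, form_apply, R.equiv_symm_act hu, R.equiv_symm_act hv]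
  exact BB_invariant (R.twist_mem X hX) (R.equiv.symm u).2 (R.equiv.symm v).2

theorem form_nondegenerate (R : Realization c) {u : space c} (h : ∀ v, R.form u v = 0) : u = 0 := by
  have h1 : (R.equiv.symm u).1 = 0 := by
    refine BB_nondegenerate (R.equiv.symm u).2 fun v hv => ?_
    have h2 := h (R.equiv ⟨v, hv⟩)
    rwa [form_apply, LinearEquiv.symm_apply_apply] at h2
  rw [← R.equiv.apply_symm_apply u, show R.equiv.symm u = 0 from Subtype.ext h1,
    LinearEquiv.map_zero]

theorem form_equiv (R : Realization c) (u v : SS) :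
    R.form (R.equiv u) (R.equiv v) = BB u.1 v.1 := by
  rw [form_apply, LinearEquiv.symm_apply_apply, LinearEquiv.symm_apply_apply]

theorem form_pos (R : Realization c) : ∃ u, 0 < (R.form u u).re := by
  refine ⟨R.equiv ⟨f1 0 0 0, f1_mem 0 0 0⟩, ?_⟩
  rw [form_equiv, ← BS_apply, BS_f1]
  exact one_pos

theorem form_neg (R : Realization c) : ∃ u, (R.form u u).re < 0 := by
  refine ⟨R.equiv ⟨f3 0 0 0, f3_mem 0 0 0⟩, ?_⟩
  have h : ifac 0 = 1 := by simpa using ifac_natCast 0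
  have h1 : ifac 1 = 1 := by simpa using ifac_natCast 1
  rw [form_equiv, BB_f3_f3]
  simp [nn, h, h1]

theorem symm_ktype (R : Realization c) {α : Fin 3} {l m n : ℚ} (hk : kidx c α l m n) {u : space c}
    (hu : (u : Fn) = ktype c α l m n) :
    (R.equiv.symm u).1 = R.factor α l m n • ee (α, R.index α l m n) := by
  refine R.injective ?_
  rw [toFun_symm, hu, map_smul, R.ktype_eq α l m n hk]

theorem sphereInner_smul (a b : ℂ) (f g : Fn) :
    sphereInner (a • f) (b • g) = a * conj b * sphereInner f g := by
  rw [sphereInner_eq, sphereInner_eq, ← MeasureTheory.integral_const_mul]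
  refine MeasureTheory.integral_congr_ae (Filter.Eventually.of_forall fun x => ?_)
  simp only [Pi.smul_apply, smul_eq_mul, map_mul, Finset.mul_sum]
  exact Finset.sum_congr rfl fun i _ => by ring

/-- The scalar of the first function and the conjugate scalar of the second occur on both sides, so
the formula does not depend on the normalization of the basis functions. -/
theorem form_ktype (R : Realization c) (α : Fin 3) (l m n : ℚ) (α' : Fin 3) (l' m' n' : ℚ)
    (hk : kidx c α l m n)
    (hk' : kidx c α' l' m' n') (u v : space c) (hu : (u : Fn) = ktype c α l m n)
    (hv : (v : Fn) = ktype c α' l' m' n') :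
    R.form u v = if α = α' then
        ((weight α l : ℚ) : ℂ) / (2 * (Real.pi : ℂ) ^ 2) *
          sphereInner (ktype c α l m n) (ktype c α' l' m' n')
      else 0 := by
  rw [form_apply, R.symm_ktype hk hu, R.symm_ktype hk' hv, map_smulₛₗ, map_smul,
    LinearMap.smul_apply, BB_ee]
  by_cases hα : α = α'
  · subst hα
    rw [if_pos rfl, R.ktype_eq α l m n hk, R.ktype_eq α l' m' n' hk', sphereInner_smul, R.sphere,
      sphereInner_ee, R.weight_eq α l m n hk]
    have hpi : (Real.pi : ℂ) ≠ 0 := by exact_mod_cast Real.pi_ne_zero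
    simp only [Prod.mk.injEq, true_and, smul_eq_mul]
    split_ifs with h
    · field_simp
    · ring
  · rw [if_neg hα, if_neg (fun h => hα (congrArg Prod.fst h)), smul_zero, smul_zero]

theorem form_unique (R : Realization c) (H : space c →ₗ[ℂ] space c →ₗ⋆[ℂ] ℂ)
    (hH : IsHermitianForm H)
    (hH' : IsInvariantForm c H) : ∃ r : ℝ, ∀ u v, H u v = (r : ℂ) * R.form u v := by
  let H' : SS →ₗ[ℂ] SS →ₗ⋆[ℂ] ℂ :=
    LinearMap.mk₂'ₛₗ (RingHom.id ℂ) (starRingEnd ℂ) (fun u v => H (R.equiv u) (R.equiv v))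
      (fun u u' v => by rw [map_add, map_add, LinearMap.add_apply])
      (fun c u v => by rw [map_smul, map_smul, LinearMap.smul_apply]; rfl)
      (fun u v v' => by rw [map_add, map_add])
      (fun c u v => by rw [map_smul, map_smulₛₗ])
  have h1 : FormInvariant H' := by
    intro X hX u v
    refine hH' (R.twist X) (R.twist_mem X hX) _ _ _ _ ?_ ?_
    · rw [coe_equiv, coe_equiv, R.act_eq _ _ u.2, R.twist_twist]
    · rw [coe_equiv, coe_equiv, R.act_eq _ _ v.2, R.twist_twist]
  obtain ⟨r, hr⟩ := h1.eq_smul fun u v => hH _ _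
  refine ⟨r, fun u v => ?_⟩
  have h2 := hr (R.equiv.symm u) (R.equiv.symm v)
  rw [form_apply, ← h2]
  change H u v = H (R.equiv (R.equiv.symm u)) (R.equiv (R.equiv.symm v))
  rw [LinearEquiv.apply_symm_apply, LinearEquiv.apply_symm_apply]

/-- A positive definite form would be r times the invariant form; a vector with positive square
forces r > 0, and a vector with negative square then gives a contradiction. -/
theorem not_unitary (R : Realization c) : ¬ ∃ H : space c →ₗ[ℂ] space c →ₗ⋆[ℂ] ℂ,
    IsHermitianForm H ∧ IsInvariantForm c H ∧ ∀ u, u ≠ 0 → 0 < (H u u).re := by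
  rintro ⟨H, h1, h2, h3⟩
  obtain ⟨r, hr⟩ := R.form_unique H h1 h2
  obtain ⟨u, hu⟩ := R.form_pos
  obtain ⟨v, hv⟩ := R.form_neg
  have hu0 : u ≠ 0 := by rintro rfl; simp at hu
  have hv0 : v ≠ 0 := by rintro rfl; simp at hv
  have hu1 := h3 u hu0
  have hv1 := h3 v hv0
  rw [hr, Complex.re_ofReal_mul] at hu1 hv1
  have hr0 : 0 < r := (pos_iff_pos_of_mul_pos hu1).2 hu
  exact absurd hv1 (not_lt.2 (mul_nonpos_of_nonneg_of_nonpos hr0.le hv.le))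

end Realization

end Transport

/-! ### The Laplacian on powers of N times coefficients -/

section Laplacian

/-- The operator `□ / 4` on Laurent polynomials. -/
def lap : LA →ₗ[ℂ] LA :=
  (D 0 0 : LA →ₗ[ℂ] LA) ∘ₗ (D 1 1 : LA →ₗ[ℂ] LA) - (D 0 1 : LA →ₗ[ℂ] LA) ∘ₗ (D 1 0 : LA →ₗ[ℂ] LA)

theorem lap_apply (f : LA) : lap f = D 0 0 (D 1 1 f) - D 0 1 (D 1 0 f) := rfl

/-- The coefficients are harmonic of degree a + b; the factor comes from ¼□N^p = p(p + 1)N^(p-1) and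
a mixed term in which the Euler operator acts on the coefficient. -/
theorem lap_Np_tt (p : ℤ) (a b : ℕ) (k : ℤ) : lap (Np p * tt zM a b k) =
    ((p : ℂ) * (p + a + b + 1)) • (Np (p - 1) * tt zM a b k) := by
  refine LA_ext fun Z => ?_
  have hp : Z.1.det ^ (p - 1) = Z.1.det ^ (p - 1 - 1) * Z.1.det := by
    rw [zpow_sub_one₀ Z.2 (p - 1), inv_mul_cancel_right₀ Z.2]
  have hp' : Z.1.det ^ p = Z.1.det ^ (p - 1 - 1) * Z.1.det * Z.1.det := by
    rw [← hp, zpow_sub_one₀ Z.2, inv_mul_cancel_right₀ Z.2]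
  have h1 := left_mul_tt Z.1 a b k
  have h2 := right_mul_tt Z.1 a b k
  simp only [lap_apply, Derivation.leibniz, derivation_Np, D_det, D_tt, smul_eq_mul,
    Matrix.adjugate_fin_two, Matrix.of_apply, Matrix.cons_val', Matrix.cons_val_zero,
    Matrix.cons_val_one, Matrix.cons_val_fin_one, map_add, map_sub, map_mul, map_neg, map_smul,
    evalAt_Np, evalAt_tt, evalAt_zM]
  simp [evalAt_tt, evalAt_Np, evalAt_zM, D_zM, derivation_Np, D_det, D_tt,
    Matrix.adjugate_fin_two]
  rw [hp', hp]
  have hd := Matrix.det_fin_two Z.1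
  generalize Z.1.det ^ (p - 1 - 1) = Y
  linear_combination (-Y * Z.1.det * p) * (h1 + h2) - Y * p * (p - 1) * tt Z.1 a b k * hd

/-- The operator `□ / 4` on vectors. -/
def opBox : LV →ₗ[ℂ] LV where
  toFun v := fun r => lap (v r)
  map_add' u v := by funext r; simp
  map_smul' c v := by funext r; simp

theorem opBox_apply (v : LV) (r : Fin 2) : opBox v r = lap (v r) := rfl

theorem lap_Np_smul_tt (p : ℤ) (a b : ℕ) (c : ℂ) (k : ℤ) : lap (Np p * c • tt zM a b k) =
    ((p : ℂ) * (p + a + b + 1)) • (Np (p - 1) * c • tt zM a b k) := by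
  rw [mul_smul_comm, map_smul, lap_Np_tt, mul_smul_comm, smul_comm]

theorem opBox_mulN_f1 (p : ℤ) (a b : ℕ) (k : ℤ) : opBox (mulN p (f1 a b k)) =
    ((p : ℂ) * (p + a + b + 1)) • mulN (p - 1) (f1 a b k) := by
  have e : f1 a b k 1 = (-1 : ℂ) • tt zM a b (k - 1) := LA_ext fun Z => by simp [f1]
  funext r
  rw [opBox_apply, Pi.smul_apply, mulN_apply, mulN_apply]
  fin_cases r
  · exact lap_Np_tt p a b k
  · change lap (Np p * f1 a b k 1) = _ • (Np (p - 1) * f1 a b k 1)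
    rw [e, lap_Np_smul_tt]

theorem opBox_mulN_f2 (p : ℤ) (a b : ℕ) (k : ℤ) : opBox (mulN p (f2 a b k)) =
    ((p : ℂ) * (p + a + b + 1)) • mulN (p - 1) (f2 a b k) := by
  funext r
  rw [opBox_apply, Pi.smul_apply, mulN_apply, mulN_apply]
  fin_cases r
  · exact lap_Np_smul_tt p a b _ _
  · exact lap_Np_smul_tt p a b _ _

/-- The vectors `N ^ p f^{(1)}` and `N ^ p f^{(2)}`. -/
def gg : Bool × ℤ × ℕ × ℕ × ℤ → LV
  | (false, p, a, b, k) => mulN p (f1 a b k)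
  | (true, p, a, b, k) => mulN p (f2 a b k)

/-- The operator `N Z ∇ □`, up to a factor. -/
def opM : Module.End ℂ LV := mulN 1 ∘ₗ opC ∘ₗ opBox

/-- The eigenvalues of `opM`. -/
def opMEig : Bool × ℤ × ℕ × ℕ × ℤ → ℂ
  | (false, p, a, b, _) => p * (p + a + b + 1) * (p - 1)
  | (true, p, a, b, _) => p * (p + a + b + 1) * (p + a + b)

/-- The degrees of homogeneity. -/
def ggDeg : Bool × ℤ × ℕ × ℕ × ℤ → ℤ
  | (_, p, a, b, _) => 2 * p + a + b

/-- After `opBox` the exponent is p - 1, so ½Z∇ contributes p - 1 on f^{(1)}, and (p - 1) + (a + b +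
1) on f^{(2)}. -/
theorem opC_opBox_gg (x : Bool × ℤ × ℕ × ℕ × ℤ) :
    opC (opBox (gg x)) = opMEig x • mulN (-1) (gg x) := by
  obtain ⟨_ | _, p, a, b, k⟩ := x
  · change opC (opBox (mulN p (f1 a b k))) = _ • mulN (-1) (mulN p (f1 a b k))
    rw [opBox_mulN_f1, map_smul, opC_mulN, opC_f1, map_zero, add_zero, smul_smul, mulN_mulN,
      show -1 + p = p - 1 by ring]
    simp only [opMEig]
    push_cast
    rfl
  · change opC (opBox (mulN p (f2 a b k))) = _ • mulN (-1) (mulN p (f2 a b k))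
    rw [opBox_mulN_f2, map_smul, opC_mulN, opC_f2, map_smul, ← add_smul, smul_smul, mulN_mulN,
      show -1 + p = p - 1 by ring]
    simp only [opMEig]
    congr 1
    push_cast
    ring

theorem opM_gg (x : Bool × ℤ × ℕ × ℕ × ℤ) : opM (gg x) = opMEig x • gg x := by
  change mulN 1 (opC (opBox (gg x))) = _
  rw [opC_opBox_gg, map_smul, mulN_mulN, add_neg_cancel, mulN_zero]

theorem eulerOp_mulN (p : ℤ) (v : LV) :
    eulerOp (mulN p v) = (2 * p : ℂ) • mulN p v + mulN p (eulerOp v) := by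
  change opE 0 0 (mulN p v) + opE 1 1 (mulN p v) = _ + mulN p (opE 0 0 v + opE 1 1 v)
  rw [opE_mulN, opE_mulN, map_add]
  module

theorem eulerOp_f1 (a b : ℕ) (k : ℤ) : eulerOp (f1 a b k) = ((a : ℂ) + b) • f1 a b k :=
  eulerOp_ee (0, a, b, k)

theorem eulerOp_f2 (a b : ℕ) (k : ℤ) : eulerOp (f2 a b k) = ((a : ℂ) + b) • f2 a b k :=
  eulerOp_ee (1, a, b, k)

theorem eulerOp_gg (x : Bool × ℤ × ℕ × ℕ × ℤ) : eulerOp (gg x) = (ggDeg x : ℂ) • gg x := by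
  obtain ⟨_ | _, p, a, b, k⟩ := x
  · simp only [gg, ggDeg, eulerOp_mulN, eulerOp_f1, map_smul]
    push_cast
    module
  · simp only [gg, ggDeg, eulerOp_mulN, eulerOp_f2, map_smul]
    push_cast
    module

end Laplacian

/-! ### Spanning sets for all Laurent polynomials and vectors -/

section Spanning

/-- The span contains the constants and, by the Clebsch–Gordan rule, is closed under multiplication
by coordinates; multiplication by N⁻¹ only shifts p. -/
theorem LA_span : Submodule.span ℂ (Set.range fun x : ℤ × ℕ × ℕ × ℤ =>
    Np x.1 * tt zM x.2.1 x.2.2.1 x.2.2.2) = ⊤ := by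
  set S := Submodule.span ℂ (Set.range fun x : ℤ × ℕ × ℕ × ℤ =>
    Np x.1 * tt zM x.2.1 x.2.2.1 x.2.2.2) with hS
  have hmem : ∀ p a b k, Np p * tt zM a b k ∈ S := fun p a b k =>
    Submodule.subset_span ⟨(p, a, b, k), rfl⟩
  have hclosed : ∀ g : LA, (∀ p a b k, Np p * tt zM a b k * g ∈ S) → ∀ f ∈ S, f * g ∈ S := by
    intro g hg f hf
    have : S ≤ S.comap (LinearMap.mulRight ℂ g) := by
      rw [hS, Submodule.span_le]
      rintro _ ⟨⟨p, a, b, k⟩, rfl⟩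
      exact hg p a b k
    exact this hf
  have key : ∀ (c d : ℂ) (p : ℤ) (a b a' b' : ℕ) (k k' : ℤ),
      c • (Np p * tt zM a b k) + d • (Np (p + 1) * tt zM a' b' k') ∈ S :=
    fun c d p a b a' b' k k' =>
    S.add_mem (S.smul_mem _ (hmem _ _ _ _)) (S.smul_mem _ (hmem _ _ _ _))
  have hz : ∀ i j p a b k, Np p * tt zM a b k * zM i j ∈ S := by
    intro i j p a b k
    have hdet : ∀ Z : HCx, Z.1.det ^ (p + 1) = Z.1.det ^ p * Z.1.det := fun Z => zpow_add_one₀ Z.2 p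
    have e := cast_add_one_ne a b
    fin_cases i <;> fin_cases j
    · convert key (((k : ℂ) + 1) / (a + b + 1)) ((b : ℂ) / (a + b + 1)) p (a + 1) b a (b - 1)
        (k + 1) k using 1
      refine LA_ext fun Z => ?_
      simp [evalAt_Np, evalAt_tt, evalAt_zM, hdet]
      linear_combination Z.1.det ^ p * z00_tt Z.1 a b k
    · convert key (((k : ℂ) + 1) / (a + b + 1)) (-(a : ℂ) / (a + b + 1)) p a (b + 1) (a - 1) b
        (k + 1) k using 1
      refine LA_ext fun Z => ?_
      simp [evalAt_Np, evalAt_tt, evalAt_zM, hdet]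
      linear_combination Z.1.det ^ p * z01_tt Z.1 a b k
    · convert key (((a : ℂ) + b + 1 - k) / (a + b + 1)) (-(b : ℂ) / (a + b + 1)) p (a + 1) b a
        (b - 1) k (k - 1) using 1
      refine LA_ext fun Z => ?_
      simp [evalAt_Np, evalAt_tt, evalAt_zM, hdet]
      linear_combination Z.1.det ^ p * z10_tt Z.1 a b k
    · convert key (((a : ℂ) + b + 1 - k) / (a + b + 1)) ((a : ℂ) / (a + b + 1)) p a (b + 1)
        (a - 1) b k (k - 1) using 1
      refine LA_ext fun Z => ?_
      simp [evalAt_Np, evalAt_tt, evalAt_zM, hdet]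
      linear_combination Z.1.det ^ p * z11_tt Z.1 a b k
  refine eq_top_iff.2 fun f _ => ?_
  induction f using LA_induction with
  | hC c =>
    have h := S.smul_mem c (hmem 0 0 0 0)
    rwa [Np_zero, one_mul, tt_zero, if_pos rfl, ← Algebra.algebraMap_eq_smul_one] at h
  | hadd f g hf hg => exact S.add_mem (hf trivial) (hg trivial)
  | hz f i j hf => exact hclosed _ (hz i j) f (hf trivial)
  | hN f hf =>
    refine hclosed _ (fun p a b k => ?_) f (hf trivial)
    rw [mul_right_comm, ← Np_add]
    exact hmem _ _ _ _

/-- For fixed p, a, b, two suitable combinations of f^{(1)} and f^{(2)} have a single non-zero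
entry, equal to a + b + 1 times a coefficient. -/
theorem LV_span (v : LV) : v ∈ Submodule.span ℂ (Set.range gg) := by
  set S := Submodule.span ℂ (Set.range gg) with hS
  have hf1 : ∀ p a b k, mulN p (f1 a b k) ∈ S := fun p a b k =>
    Submodule.subset_span ⟨(false, p, a, b, k), rfl⟩
  have hf2 : ∀ p a b k, mulN p (f2 a b k) ∈ S := fun p a b k =>
    Submodule.subset_span ⟨(true, p, a, b, k), rfl⟩
  have h0 : ∀ f : LA, (LinearMap.single ℂ (fun _ : Fin 2 => LA) 0 f) ∈ S := by
    intro f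
    have : (⊤ : Submodule ℂ LA) ≤ S.comap (LinearMap.single ℂ (fun _ : Fin 2 => LA) 0) := by
      rw [← LA_span, Submodule.span_le]
      rintro _ ⟨⟨p, a, b, k⟩, rfl⟩
      have e := cast_add_one_ne a b
      have h := S.add_mem (S.smul_mem ((a : ℂ) + b + 1 - k) (hf1 p a b k)) (hf2 p a b (k - 1))
      refine (S.smul_mem_iff e).1 ?_
      convert h using 1
      refine LV_ext fun Z r => ?_
      fin_cases r <;> simp [mulN_apply, f1, f2, evalAt_tt] <;> ring
    exact this trivial
  have h1 : ∀ f : LA, (LinearMap.single ℂ (fun _ : Fin 2 => LA) 1 f) ∈ S := by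
    intro f
    have : (⊤ : Submodule ℂ LA) ≤ S.comap (LinearMap.single ℂ (fun _ : Fin 2 => LA) 1) := by
      rw [← LA_span, Submodule.span_le]
      rintro _ ⟨⟨p, a, b, k⟩, rfl⟩
      have e := cast_add_one_ne a b
      have h := S.sub_mem (hf2 p a b k) (S.smul_mem ((k : ℂ) + 1) (hf1 p a b (k + 1)))
      refine (S.smul_mem_iff e).1 ?_
      convert h using 1
      refine LV_ext fun Z r => ?_
      fin_cases r <;> simp [mulN_apply, f1, f2, evalAt_tt] <;> ring
    exact this trivial
  have h := S.add_mem (h0 (v 0)) (h1 (v 1))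
  convert h using 1
  funext r
  fin_cases r <;> simp

end Spanning

/-! ### Solving ∇□f = 0 -/

section Classification

theorem opC_apply (v : LV) (r : Fin 2) : opC v r = ∑ i, ∑ j, zM r i * D j i (v j) := rfl

theorem nablaL_boxV (v : LV) (Z : HCx) (i : Fin 2) : nablaL (boxV (toFn v)) Z i =
    8 * ∑ j, evalAt Z (D j i (lap (v j))) := by
  have h : ∀ k, comp (boxV (toFn v)) k = ((4 : ℂ) • lap (v k)).1 := fun k => rfl
  simp only [nablaL, h]
  have h2 : ∀ j, pd j i ((4 : ℂ) • lap (v j)).1 Z = 4 * evalAt Z (D j i (lap (v j))) := fun j => by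
    rw [← D_coe, ← evalAt_apply, Derivation.map_smul, map_smul, smul_eq_mul]
  simp only [h2, ← Finset.mul_sum]
  ring

/-- Multiplication by the invertible matrix Z loses nothing, and Z∇□ is diagonal after
multiplication by N, unlike ∇□ itself. -/
theorem toFn_mem_UL_iff {v : LV} : toFn v ∈ UL ↔ opC (opBox v) = 0 := by
  have e : ∀ Z r, evalAt Z (opC (opBox v) r) =
      (Z.1 *ᵥ fun i => ∑ j, evalAt Z (D j i (lap (v j)))) r := by
    intro Z r
    simp only [opC_apply, opBox_apply, Matrix.mulVec, dotProduct, map_sum, map_mul, evalAt_zM,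
      Finset.mul_sum]
  constructor
  · rintro ⟨-, h⟩
    refine LV_ext fun Z r => ?_
    have h1 : (fun i => ∑ j, evalAt Z (D j i (lap (v j)))) = 0 := by
      funext i
      have h2 := congrFun (congrFun h Z) i
      rw [nablaL_boxV] at h2
      exact (mul_eq_zero.1 h2).resolve_left (by norm_num)
    rw [e, h1, Matrix.mulVec_zero, Pi.zero_apply, Pi.zero_apply, map_zero]
  · intro h
    refine ⟨fun k => (v k).2, funext fun Z => funext fun i => ?_⟩
    have h1 : (Z.1 *ᵥ fun i => ∑ j, evalAt Z (D j i (lap (v j)))) = 0 := by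
      funext r
      rw [← e, h, Pi.zero_apply, Pi.zero_apply, map_zero]
    have h2 := congrFun (Matrix.eq_zero_of_mulVec_eq_zero Z.2 h1) i
    rw [nablaL_boxV, h2]
    simp

theorem exists_toFn {f : Fn} (hf : f ∈ UL) : ∃ v, toFn v = f :=
  ⟨fun k => ⟨comp f k, hf.1 k⟩, rfl⟩

/-- Euler's identity: differentiate f(sZ) = s^d f(Z) at s = 1. -/
theorem eulerOp_of_homog {v : LV} {d : ℤ} (h : toFn v ∈ homog d) : eulerOp v = (d : ℂ) • v := by
  refine LV_ext fun Z r => ?_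
  have h1 := hasDerivAt_ext_curve (v r) (fun s : ℝ => (s : ℂ) • Z.1) Z.1 1 Z (fun i j => by
    have h2 : HasDerivAt (fun s : ℝ => (s : ℂ)) 1 1 := Complex.ofRealCLM.hasDerivAt
    simpa using h2.mul_const (Z.1 i j)) (by simp)
  have h2 : (fun s : ℝ => ext (v r).1 ((s : ℂ) • Z.1)) =ᶠ[nhds 1]
      fun s : ℝ => (s : ℂ) ^ d * evalAt Z (v r) := by
    filter_upwards [lt_mem_nhds (zero_lt_one' ℝ)] with s hs
    have hs' : (s : ℂ) ≠ 0 := by exact_mod_cast hs.ne'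
    have hd : ((s : ℂ) • Z.1).det ≠ 0 := by
      rw [Matrix.det_smul]
      exact mul_ne_zero (pow_ne_zero _ hs') Z.2
    rw [ext_of_ne _ hd]
    exact congrFun (h (s : ℂ) hs' Z ⟨_, hd⟩ rfl) r
  have h3 : HasDerivAt (fun s : ℝ => (s : ℂ) ^ d * evalAt Z (v r)) (d * evalAt Z (v r)) 1 := by
    have h4 := (hasDerivAt_zpow d (1 : ℂ) (Or.inl one_ne_zero)).comp_ofReal (z := 1)
    simpa using h4.mul_const (evalAt Z (v r))
  have h5 := (h1.congr_of_eventuallyEq h2.symm).unique h3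
  rw [Pi.smul_apply, map_smul, smul_eq_mul, ← h5]
  change evalAt Z (opE 0 0 v r + opE 1 1 v r) = _
  simp only [opE_apply, Fin.sum_univ_two, map_add, map_mul, evalAt_zM]
  ring

theorem gg_homog (x : Bool × ℤ × ℕ × ℕ × ℤ) : toFn (gg x) ∈ homog (ggDeg x) := by
  intro c hc Z W hW
  have hNp : ∀ p, evalAt W (Np p) = c ^ (2 * p) * evalAt Z (Np p) := fun p => by
    rw [evalAt_Np, evalAt_Np, hW, Matrix.det_smul, Fintype.card_fin, mul_zpow, zpow_mul]
    norm_cast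
  have htt : ∀ a b k, evalAt W (tt zM a b k) = c ^ ((a : ℤ) + b) * evalAt Z (tt zM a b k) :=
    fun a b k => by
      rw [evalAt_tt, evalAt_tt, hW, tt_smul]
      norm_cast
  obtain ⟨_ | _, p, a, b, k⟩ := x
  all_goals
    funext r
    have e : c ^ (2 * p + (a : ℤ) + b) = c ^ (2 * p) * c ^ ((a : ℤ) + b) := by
      rw [← zpow_add₀ hc, add_assoc]
    simp only [gg, ggDeg, toFn_apply, mulN_apply, map_mul, hNp, Pi.smul_apply, smul_eq_mul, e]
    fin_cases r <;> simp [f1, f2, htt] <;> ring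

theorem gg_mem_UL {x : Bool × ℤ × ℕ × ℕ × ℤ} (hx : opMEig x = 0) : toFn (gg x) ∈ UL := by
  rw [toFn_mem_UL_iff, opC_opBox_gg, hx, zero_smul]

/-- A solution is an eigenvector of `opM` with eigenvalue 0, hence a combination of spanning vectors
with that eigenvalue; the Euler operator then selects those of degree d. -/
theorem UL_inf_homog (d : ℤ) : UL ⊓ homog d =
    (Submodule.span ℂ (gg '' {x | opMEig x = 0 ∧ ggDeg x = d})).map toFn := by
  refine le_antisymm ?_ ?_
  · rintro f ⟨hf, hd⟩
    obtain ⟨v, rfl⟩ := exists_toFn hf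
    refine ⟨v, ?_, rfl⟩
    have h1 := mem_span_of_eigenvector (v := gg) (A := opM) opM_gg (LV_span v) (c := 0) (by
      change mulN 1 (opC (opBox v)) = _
      rw [toFn_mem_UL_iff.1 hf, map_zero, zero_smul])
    rw [Set.image_eq_range] at h1
    have h2 := mem_span_of_eigenvector (v := fun x : {x // opMEig x = 0} => gg x.1) (A := eulerOp)
      (fun x => eulerOp_gg x.1) h1 (eulerOp_of_homog hd)
    refine Submodule.span_mono ?_ h2
    rintro _ ⟨x, hx, rfl⟩
    exact ⟨x.1, ⟨x.2, by exact_mod_cast hx⟩, rfl⟩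
  · rw [Submodule.map_span, Submodule.span_le]
    rintro _ ⟨_, ⟨x, ⟨h1, rfl⟩, rfl⟩, rfl⟩
    exact ⟨gg_mem_UL h1, gg_homog x⟩

theorem opMEig_eq_zero_false {p : ℤ} {a b : ℕ} {k : ℤ} (h : opMEig (false, p, a, b, k) = 0) :
    p = 0 ∨ p = -(a + b + 1) ∨ p = 1 := by
  simp only [opMEig] at h
  norm_cast at h
  rcases mul_eq_zero.1 h with h | h
  · rcases mul_eq_zero.1 h with h | h <;> omega
  · omega

theorem opMEig_eq_zero_true {p : ℤ} {a b : ℕ} {k : ℤ} (h : opMEig (true, p, a, b, k) = 0) :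
    p = 0 ∨ p = -(a + b + 1) ∨ p = -(a + b) := by
  simp only [opMEig] at h
  norm_cast at h
  rcases mul_eq_zero.1 h with h | h
  · rcases mul_eq_zero.1 h with h | h <;> omega
  · omega

/-- Of the roots p, those giving degree 2p + a + b ≥ 0 are p = 0 and p = 1 for f^{(1)} and p = 0 for
f^{(2)}. -/
theorem map_SS_eq : SS.map toFn = space .lplus := by
  refine le_antisymm ?_ ?_
  · rw [SS, Submodule.map_span, Submodule.span_le]
    rintro _ ⟨_, ⟨⟨α, a, b, k⟩, rfl⟩, rfl⟩
    have key : ∀ x, opMEig x = 0 → 0 ≤ ggDeg x → toFn (gg x) ∈ space .lplus := fun x h0 hd =>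
      Submodule.mem_iSup_of_mem (ggDeg x) (Submodule.mem_iSup_of_mem hd
        ⟨gg_mem_UL h0, gg_homog x⟩)
    fin_cases α
    · have h := key (false, 0, a, b, k) (by simp [opMEig]) (by simp only [ggDeg]; omega)
      rw [gg, mulN_zero] at h
      exact h
    · have h := key (true, 0, a, b, k) (by simp [opMEig]) (by simp only [ggDeg]; omega)
      rw [gg, mulN_zero] at h
      exact h
    · have h := key (false, 1, a, b, k) (by simp [opMEig]) (by simp only [ggDeg]; omega)
      rw [gg, mulN_one_f1] at h
      exact h
  · refine iSup_le fun d => iSup_le fun hd => ?_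
    rw [UL_inf_homog]
    refine Submodule.map_mono (Submodule.span_le.2 ?_)
    rintro _ ⟨⟨_ | _, p, a, b, k⟩, ⟨h1, h2⟩, rfl⟩
    · simp only [ggDeg] at h2
      rcases opMEig_eq_zero_false h1 with rfl | rfl | rfl
      · rw [gg, mulN_zero]; exact f1_mem a b k
      · omega
      · rw [gg, mulN_one_f1]; exact f3_mem a b k
    · simp only [ggDeg] at h2
      rcases opMEig_eq_zero_true h1 with rfl | rfl | rfl
      · rw [gg, mulN_zero]; exact f2_mem a b k
      · omega
      -- The root p = -(a + b) gives degree -(a + b), which is non-negative only for a = b = 0,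
      -- where it coincides with p = 0.
      · have e : -((a : ℤ) + b) = 0 := by omega
        rw [gg, e, mulN_zero]; exact f2_mem a b k

/-- The model of `𝒰⁻`. -/
def SM : Submodule ℂ LV := Submodule.span ℂ (gg '' {x | opMEig x = 0 ∧ ggDeg x < 0})

theorem map_SM_eq : SM.map toFn = space .lminus := by
  refine le_antisymm ?_ ?_
  · rw [SM, Submodule.map_span, Submodule.span_le]
    rintro _ ⟨_, ⟨x, ⟨h1, h2⟩, rfl⟩, rfl⟩
    exact Submodule.mem_iSup_of_mem (ggDeg x) (Submodule.mem_iSup_of_mem h2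
      ⟨gg_mem_UL h1, gg_homog x⟩)
  · refine iSup_le fun d => iSup_le fun hd => ?_
    rw [UL_inf_homog]
    refine Submodule.map_mono (Submodule.span_mono (Set.image_mono ?_))
    rintro x ⟨h1, h2⟩
    exact ⟨h1, by omega⟩

end Classification

/-! ### Inversion: from non-negative to negative degrees -/

section Inversion

/-- Inversion on the invertible elements. -/
def Zinv (Z : HCx) : HCx := ⟨Z.1⁻¹, (Matrix.isUnit_nonsing_inv_det Z.1 Z.2.isUnit).ne_zero⟩

theorem Zinv_Zinv (Z : HCx) : Zinv (Zinv Z) = Z :=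
  Subtype.ext (Matrix.nonsing_inv_nonsing_inv Z.1 Z.2.isUnit)

theorem Zinv_val (Z : HCx) : (Zinv Z).1 = Z.1.det⁻¹ • Z.1.adjugate := by
  change Z.1⁻¹ = _
  rw [Matrix.inv_def, Ring.inverse_eq_inv']

theorem det_Zinv (Z : HCx) : (Zinv Z).1.det = Z.1.det⁻¹ := by
  change (Z.1⁻¹).det = _
  rw [Matrix.det_nonsing_inv, Ring.inverse_eq_inv']

theorem isLaurent_Zinv (f : LA) : IsLaurent fun Z => f.1 (Zinv Z) := by
  induction f using LA_induction with
  | hC c => exact (algebraMap ℂ LA c).2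
  | hadd f g hf hg => exact hf.add hg
  | hz f i j hf =>
    have h : IsLaurent fun Z => (Zinv Z).1 i j := by
      have hf : (fun Z => (Zinv Z).1 i j) = (Np (-1) * zM.adjugate i j : LA).1 := by
        funext Z
        rw [← evalAt_apply, map_mul, evalAt_Np, zpow_neg_one, Zinv_val, Matrix.smul_apply,
          smul_eq_mul]
        congr 1
        fin_cases i <;> fin_cases j <;> simp [Matrix.adjugate_fin_two, evalAt_zM]
      rw [hf]
      exact (Np (-1) * zM.adjugate i j : LA).2
    exact hf.mul h
  | hN f hf =>
    have h : IsLaurent fun Z => (Zinv Z).1.det ^ (-1 : ℤ) := by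
      have hf : (fun Z => (Zinv Z).1.det ^ (-1 : ℤ)) = (zM.det : LA).1 := by
        funext Z
        rw [det_Zinv, zpow_neg_one, inv_inv, ← evalAt_apply, evalAt_det]
      rw [hf]
      exact (zM.det : LA).2
    exact hf.mul h

/-- Composition with the inversion. -/
def invLA (f : LA) : LA := ⟨fun Z => f.1 (Zinv Z), isLaurent_Zinv f⟩

theorem evalAt_invLA (Z : HCx) (f : LA) : evalAt Z (invLA f) = evalAt (Zinv Z) f := rfl

/-- The operator `f(Z) ↦ N(Z)⁻¹ Z f(Z⁻¹)`. -/
def opJ : LV →ₗ[ℂ] LV where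
  toFun v := fun r => Np (-1) * ∑ s, zM r s * invLA (v s)
  map_add' u v := by
    refine LV_ext fun Z r => ?_
    simp only [Pi.add_apply, map_mul, map_sum, map_add, evalAt_invLA, mul_add,
      Finset.sum_add_distrib]
  map_smul' c v := by
    refine LV_ext fun Z r => ?_
    simp only [Pi.smul_apply, map_mul, map_sum, map_smul, evalAt_invLA, smul_eq_mul,
      RingHom.id_apply, Finset.mul_sum]
    exact Finset.sum_congr rfl fun s _ => by ring

theorem evalAt_opJ (Z : HCx) (v : LV) (r : Fin 2) : evalAt Z (opJ v r) =
    Z.1.det⁻¹ * ∑ s, Z.1 r s * evalAt (Zinv Z) (v s) := by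
  change evalAt Z (Np (-1) * ∑ s, zM r s * invLA (v s)) = _
  rw [map_mul, map_sum, evalAt_Np, zpow_neg_one]
  simp only [map_mul, evalAt_zM, evalAt_invLA]

theorem toFn_opJ (Z : HCx) (v : LV) :
    toFn (opJ v) Z = Z.1.det⁻¹ • (Z.1 *ᵥ toFn v (Zinv Z)) := by
  funext r
  exact evalAt_opJ Z v r

theorem opJ_opJ (v : LV) : opJ (opJ v) = v := by
  refine toFn_injective (funext fun Z => ?_)
  rw [toFn_opJ, toFn_opJ, Zinv_Zinv, Matrix.mulVec_smul, smul_smul, det_Zinv,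
    Matrix.mulVec_mulVec, inv_inv, inv_mul_cancel₀ Z.2, one_smul]
  change (Z.1 * Z.1⁻¹) *ᵥ _ = _
  rw [Matrix.mul_nonsing_inv _ Z.2.isUnit, Matrix.one_mulVec]

theorem opJ_mulN (p : ℤ) (v : LV) : opJ (mulN p v) = mulN (-p) (opJ v) := by
  refine LV_ext fun Z r => ?_
  rw [mulN_apply, map_mul, evalAt_opJ, evalAt_opJ, evalAt_Np]
  simp only [mulN_apply, map_mul, evalAt_Np, det_Zinv, Finset.mul_sum]
  refine Finset.sum_congr rfl fun s _ => ?_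
  rw [inv_zpow']
  ring

/-- N(Z)⁻¹Z is the adjugate of W = Z⁻¹, so `opJ` becomes the polynomial operation f ↦ adj(W) f(W).
-/
theorem evalAt_opJ_adjugate (Z : HCx) (v : LV) (r : Fin 2) : evalAt Z (opJ v r) =
    ∑ s, (Zinv Z).1.adjugate r s * evalAt (Zinv Z) (v s) := by
  have h : (Zinv Z).1.adjugate = Z.1.det⁻¹ • Z.1 := by
    have h0 := Zinv_val (Zinv Z)
    rw [Zinv_Zinv] at h0
    calc (Zinv Z).1.adjugate = (Zinv Z).1.det • (Zinv Z).1.det⁻¹ • (Zinv Z).1.adjugate := by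
          rw [smul_smul, mul_inv_cancel₀ (Zinv Z).2, one_smul]
      _ = Z.1.det⁻¹ • Z.1 := by rw [← h0, det_Zinv]
  rw [evalAt_opJ, h, Finset.mul_sum]
  refine Finset.sum_congr rfl fun s _ => ?_
  rw [Matrix.smul_apply, smul_eq_mul, mul_assoc]

section Formulas

variable (Z : HCx) (a b : ℕ) (k : ℤ)

theorem evalAt_opJ_f1_zero : evalAt Z (opJ (f1 a b k) 0) = tt (Zinv Z).1 a (b + 1) k := by
  rw [evalAt_opJ_adjugate, tt_succ_right]
  simp [Matrix.adjugate_fin_two, f1, evalAt_tt]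
  ring

theorem evalAt_opJ_f1_one : evalAt Z (opJ (f1 a b k) 1) = -tt (Zinv Z).1 (a + 1) b k := by
  rw [evalAt_opJ_adjugate, tt_succ_left]
  simp [Matrix.adjugate_fin_two, f1, evalAt_tt]

theorem evalAt_opJ_f2_zero : evalAt Z (opJ (f2 a b k) 0) =
    a * ((Zinv Z).1.det * tt (Zinv Z).1 (a - 1) b k) := by
  rw [evalAt_opJ_adjugate]
  have h1 := index_mul_tt (Zinv Z).1 a b (k + 1)
  have h2 := coindex_mul_tt (Zinv Z).1 a b k
  have hd := Matrix.det_fin_two (Zinv Z).1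
  rw [add_sub_cancel_right] at h1
  push_cast at h1
  simp [Matrix.adjugate_fin_two, f2, evalAt_tt]
  linear_combination (Zinv Z).1 1 1 * h1 - (Zinv Z).1 0 1 * h2 -
    a * tt (Zinv Z).1 (a - 1) b k * hd

theorem evalAt_opJ_f2_one : evalAt Z (opJ (f2 a b k) 1) =
    b * ((Zinv Z).1.det * tt (Zinv Z).1 a (b - 1) k) := by
  rw [evalAt_opJ_adjugate]
  have h1 := index_mul_tt (Zinv Z).1 a b (k + 1)
  have h2 := coindex_mul_tt (Zinv Z).1 a b k
  have hd := Matrix.det_fin_two (Zinv Z).1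
  rw [add_sub_cancel_right] at h1
  push_cast at h1
  simp [Matrix.adjugate_fin_two, f2, evalAt_tt]
  linear_combination -(Zinv Z).1 1 0 * h1 + (Zinv Z).1 0 0 * h2 -
    b * tt (Zinv Z).1 a (b - 1) k * hd

theorem tt_Zinv : tt (Zinv Z).1 a b k =
    Z.1.det ^ (-((a : ℤ) + b)) * tt Z.1.adjugate a b k := by
  rw [Zinv_val, tt_smul, zpow_neg, inv_pow]
  norm_cast

end Formulas

/-- Multiplying by the adjugate adds one factor to the coefficient in each entry. Expressing
coefficients of the adjugate through those of Z by transposition exchanges (a, b) with (j, k), and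
its factorials produce exactly the numerical coefficients of f^{(2)}. -/
theorem opJ_f1 (a b k j : ℕ) (h : a + b + 1 = k + j) :
    ((k.factorial : ℂ) * j.factorial) • opJ (f1 a b k) =
      ((-1) ^ (a + k) * ((a.factorial : ℂ) * b.factorial)) • mulN (-(a + b + 1)) (f2 j k b) := by
  have hj : (j : ℂ) + k - b = a + 1 := by
    have : (a : ℂ) + b + 1 = k + j := by exact_mod_cast h
    linear_combination -this
  refine LV_ext fun Z r => ?_
  rw [Pi.smul_apply, Pi.smul_apply, map_smul, map_smul, smul_eq_mul, smul_eq_mul, mulN_apply,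
    map_mul, evalAt_Np]
  fin_cases r
  · change _ * evalAt Z (opJ (f1 a b k) 0) = _ * (_ * evalAt Z (f2 j k b 0))
    have h1 := tt_adjugate Z.1 a (b + 1) k j (by omega)
    rw [evalAt_opJ_f1_zero, tt_Zinv, f2_zero, map_smul, smul_eq_mul, evalAt_tt]
    rw [Nat.factorial_succ] at h1
    push_cast at h1 ⊢
    rw [← add_assoc]
    linear_combination Z.1.det ^ (-((a : ℤ) + b + 1)) * h1
  · change _ * evalAt Z (opJ (f1 a b k) 1) = _ * (_ * evalAt Z (f2 j k b 1))
    have h1 := tt_adjugate Z.1 (a + 1) b k j (by omega)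
    rw [evalAt_opJ_f1_one, tt_Zinv, f2_one, map_smul, smul_eq_mul, evalAt_tt]
    push_cast
    rw [hj, add_right_comm (a : ℤ) 1 b]
    rw [Nat.factorial_succ] at h1
    push_cast at h1
    linear_combination -Z.1.det ^ (-((a : ℤ) + b + 1)) * h1

theorem opJ_f2 (a b k j : ℕ) (h : a + b = k + j + 1) :
    ((k.factorial : ℂ) * j.factorial) • opJ (f2 a b k) =
      (-(-1) ^ (a + k) * ((a.factorial : ℂ) * b.factorial)) • mulN (-(a + b)) (f1 j k b) := by
  have hdet : ∀ (Z : HCx) (p : ℤ), (Zinv Z).1.det * Z.1.det ^ (-(p - 1)) = Z.1.det ^ (-p) := by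
    intro Z p
    rw [det_Zinv, ← zpow_neg_one, ← zpow_add₀ Z.2]
    congr 1
    ring
  refine LV_ext fun Z r => ?_
  rw [Pi.smul_apply, Pi.smul_apply, map_smul, map_smul, smul_eq_mul, smul_eq_mul, mulN_apply,
    map_mul, evalAt_Np]
  fin_cases r
  · change _ * evalAt Z (opJ (f2 a b k) 0) = _ * (_ * evalAt Z (f1 j k b 0))
    rw [evalAt_opJ_f2_zero, tt_Zinv, f1_zero, evalAt_tt]
    rcases a with _ | a
    · rw [tt_of_gt Z.1 j k b (by omega)]
      simp
    · have h1 := tt_adjugate Z.1 a b k j (by omega)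
      have h2 := hdet Z ((a + 1 : ℕ) + b)
      rw [show ((a + 1 : ℕ) + b - 1 : ℤ) = a + b by push_cast; ring] at h2
      rw [Nat.add_sub_cancel, Nat.factorial_succ, ← h2, add_right_comm, pow_succ]
      push_cast
      linear_combination ((a : ℂ) + 1) * (Zinv Z).1.det * Z.1.det ^ (-((a : ℤ) + b)) * h1
  · change _ * evalAt Z (opJ (f2 a b k) 1) = _ * (_ * evalAt Z (f1 j k b 1))
    rw [evalAt_opJ_f2_one, tt_Zinv, f1_one, map_neg, evalAt_tt]
    rcases b with _ | b
    · rw [tt_of_neg Z.1 j k _ (by simp)]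
      simp
    · have h1 := tt_adjugate Z.1 a b k j (by omega)
      have h2 := hdet Z (a + (b + 1 : ℕ))
      rw [show (a + (b + 1 : ℕ) - 1 : ℤ) = a + b by push_cast; ring] at h2
      rw [Nat.add_sub_cancel, Nat.factorial_succ, ← h2,
        show ((b + 1 : ℕ) : ℤ) - 1 = b by push_cast; ring]
      push_cast
      linear_combination ((b : ℂ) + 1) * (Zinv Z).1.det * Z.1.det ^ (-((a : ℤ) + b)) * h1

theorem factorial_mul_ne (k j : ℕ) : (k.factorial : ℂ) * j.factorial ≠ 0 := by
  exact_mod_cast mul_ne_zero k.factorial_ne_zero j.factorial_ne_zero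

theorem opJ_mulN_f1_mem {S : Submodule ℂ LV} (p : ℤ) (a b : ℕ) (k : ℤ)
    (h : ∀ j k : ℕ, a + b + 1 = k + j → mulN (-p - (a + b + 1)) (f2 j k b) ∈ S) :
    opJ (mulN p (f1 a b k)) ∈ S := by
  by_cases hk : 0 ≤ k ∧ k ≤ a + b + 1
  · obtain ⟨hk0, hk1⟩ := hk
    lift k to ℕ using hk0
    obtain ⟨j, hj⟩ : ∃ j, a + b + 1 = k + j := ⟨a + b + 1 - k, by omega⟩
    rw [opJ_mulN, ← S.smul_mem_iff (factorial_mul_ne k j), ← map_smul, opJ_f1 a b k j hj, map_smul,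
      mulN_mulN]
    exact S.smul_mem _ (h j k hj)
  · rw [f1_eq_zero hk, map_zero, map_zero]
    exact S.zero_mem

theorem opJ_mulN_f2_mem {S : Submodule ℂ LV} (p : ℤ) (a b : ℕ) (k : ℤ)
    (h : ∀ j k : ℕ, a + b = k + j + 1 → mulN (-p - (a + b)) (f1 j k b) ∈ S) :
    opJ (mulN p (f2 a b k)) ∈ S := by
  by_cases hk : 0 ≤ k ∧ k + 1 ≤ a + b
  · obtain ⟨hk0, hk1⟩ := hk
    lift k to ℕ using hk0
    obtain ⟨j, hj⟩ : ∃ j, a + b = k + j + 1 := ⟨a + b - k - 1, by omega⟩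
    rw [opJ_mulN, ← S.smul_mem_iff (factorial_mul_ne k j), ← map_smul, opJ_f2 a b k j hj, map_smul,
      mulN_mulN]
    exact S.smul_mem _ (h j k hj)
  · rw [f2_eq_zero hk, map_zero, map_zero]
    exact S.zero_mem

theorem gg_mem_SM {x : Bool × ℤ × ℕ × ℕ × ℤ} (h : opMEig x = 0) (hd : ggDeg x < 0) : gg x ∈ SM :=
  Submodule.subset_span ⟨x, ⟨h, hd⟩, rfl⟩

/-- f^{(1)}, f^{(2)}, f^{(3)} go to N^p f^{(2)}, N^p f^{(1)}, N^p f^{(2)} with p = -(j + k), -(j + k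
+ 1), -(j + k + 1); these are exactly the roots of negative degree. -/
theorem opJ_SS_le : SS.map opJ ≤ SM := by
  rw [SS, Submodule.map_span, Submodule.span_le]
  rintro _ ⟨_, ⟨⟨α, a, b, k⟩, rfl⟩, rfl⟩
  fin_cases α
  · change opJ (f1 a b k) ∈ SM
    rw [← mulN_zero (f1 a b k)]
    refine opJ_mulN_f1_mem _ _ _ _ fun j k h => ?_
    have h' : (j : ℂ) + k = a + b + 1 := by
      rw [add_comm]; exact_mod_cast h.symm
    refine gg_mem_SM (x := (true, _, j, k, b)) ?_ (by simp only [ggDeg]; omega)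
    simp only [opMEig]
    push_cast
    rw [add_assoc (-(0 : ℂ) - (a + b + 1)) j k, h']
    ring
  · change opJ (f2 a b k) ∈ SM
    rw [← mulN_zero (f2 a b k)]
    refine opJ_mulN_f2_mem _ _ _ _ fun j k h => ?_
    have h' : (j : ℂ) + k = a + b - 1 := by
      rw [eq_sub_iff_add_eq, add_comm (j : ℂ)]; exact_mod_cast h.symm
    refine gg_mem_SM (x := (false, _, j, k, b)) ?_ (by simp only [ggDeg]; omega)
    simp only [opMEig]
    push_cast
    rw [add_assoc (-(0 : ℂ) - (a + b)) j k, h']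
    ring
  · change opJ (f3 a b k) ∈ SM
    rw [← mulN_one_f1]
    refine opJ_mulN_f1_mem _ _ _ _ fun j k h => ?_
    have h' : (j : ℂ) + k = a + b + 1 := by
      rw [add_comm]; exact_mod_cast h.symm
    refine gg_mem_SM (x := (true, _, j, k, b)) ?_ (by simp only [ggDeg]; omega)
    simp only [opMEig]
    push_cast
    rw [add_assoc (-(1 : ℂ) - (a + b + 1)) j k, h']
    ring

theorem opJ_SM_le : SM.map opJ ≤ SS := by
  rw [SM, Submodule.map_span, Submodule.span_le]
  rintro _ ⟨_, ⟨⟨_ | _, p, a, b, k⟩, ⟨h1, h2⟩, rfl⟩, rfl⟩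
  · simp only [ggDeg] at h2
    rcases opMEig_eq_zero_false h1 with rfl | rfl | rfl
    · omega
    · refine opJ_mulN_f1_mem _ _ _ _ fun j k h => ?_
      rw [neg_neg, sub_self, mulN_zero]
      exact f2_mem _ _ _
    · omega
  · simp only [ggDeg] at h2
    rcases opMEig_eq_zero_true h1 with rfl | rfl | rfl
    · omega
    · refine opJ_mulN_f2_mem _ _ _ _ fun j k h => ?_
      rw [neg_neg, add_sub_cancel_left, mulN_one_f1]
      exact f3_mem _ _ _
    · refine opJ_mulN_f2_mem _ _ _ _ fun j k h => ?_
      rw [neg_neg, sub_self, mulN_zero]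
      exact f1_mem _ _ _

theorem map_opJ_SS : SS.map opJ = SM := by
  refine le_antisymm opJ_SS_le fun v hv => ?_
  exact ⟨opJ v, opJ_SM_le ⟨v, hv, rfl⟩, opJ_opJ v⟩

end Inversion

/-! ### Inversion and the Lie algebra action -/

section InversionEquivariance

/-- Exchange of the two diagonal and of the two off-diagonal blocks. -/
def swapBlocks (X : Mat4) : Mat4 :=
  Matrix.fromBlocks X.toBlocks₂₂ X.toBlocks₂₁ X.toBlocks₁₂ X.toBlocks₁₁

/-- As a fractional linear map the matrix (0, 1; 1, 0) is Z ↦ Z⁻¹, and `opJ` is minus its action.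
Writing the exchange of blocks as a conjugation lets it commute with the exponential. -/
theorem swapBlocks_eq (X : Mat4) : swapBlocks X =
    Matrix.fromBlocks 0 1 1 0 * X * (Matrix.fromBlocks 0 1 1 0)⁻¹ := by
  have h : (Matrix.fromBlocks 0 1 1 0 : Mat4) * Matrix.fromBlocks 0 1 1 0 = 1 := by
    rw [Matrix.fromBlocks_multiply]
    simp
  rw [Matrix.inv_eq_right_inv h]
  conv_rhs => rw [← Matrix.fromBlocks_toBlocks X, Matrix.fromBlocks_multiply,
    Matrix.fromBlocks_multiply]
  simp [swapBlocks]

theorem exp_swapBlocks (X : Mat4) :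
    NormedSpace.exp (swapBlocks X) = swapBlocks (NormedSpace.exp X) := by
  have h : (Matrix.fromBlocks 0 1 1 0 : Mat4) * Matrix.fromBlocks 0 1 1 0 = 1 := by
    rw [Matrix.fromBlocks_multiply]
    simp
  rw [swapBlocks_eq, swapBlocks_eq, Matrix.exp_conj _ _ (IsUnit.of_mul_eq_one _ h)]

theorem swapBlocks_smul (t : ℝ) (X : Mat4) : swapBlocks (t • X) = t • swapBlocks X := by
  rw [swapBlocks, swapBlocks, Matrix.fromBlocks_smul]
  rfl

theorem swapBlocks_swapBlocks (X : Mat4) : swapBlocks (swapBlocks X) = X := by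
  simp only [swapBlocks, Matrix.toBlocks_fromBlocks₁₁, Matrix.toBlocks_fromBlocks₁₂,
    Matrix.toBlocks_fromBlocks₂₁, Matrix.toBlocks_fromBlocks₂₂, Matrix.fromBlocks_toBlocks]

theorem swapBlocks_mem {X : Mat4} (hX : X ∈ u22) : swapBlocks X ∈ u22 := by
  obtain ⟨A, B, D, hA, hD, rfl⟩ := hX
  exact ⟨D, Bᴴ, A, hD, hA, by simp [swapBlocks]⟩

theorem actL_opJ {h : Mat4} (v : LV) (Z : HCx)
    (hP : (h.toBlocks₁₁ - Z.1 * h.toBlocks₂₁).det ≠ 0)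
    (hQ : (-h.toBlocks₁₂ + Z.1 * h.toBlocks₂₂).det ≠ 0) :
    actL h (toFn (opJ v)) Z =
      Z.1.det⁻¹ • (Z.1 *ᵥ actL (swapBlocks h) (toFn v) (Zinv Z)) := by
  set P := h.toBlocks₁₁ - Z.1 * h.toBlocks₂₁ with hPdef
  set Q := -h.toBlocks₁₂ + Z.1 * h.toBlocks₂₂ with hQdef
  have hZ := Z.2
  have hZi : Z.1⁻¹ * Z.1 = 1 := Matrix.nonsing_inv_mul _ Z.2.isUnit
  have hZi' : Z.1 * Z.1⁻¹ = 1 := Matrix.mul_nonsing_inv _ Z.2.isUnit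
  have hPi' : P * P⁻¹ = 1 := Matrix.mul_nonsing_inv _ hP.isUnit
  have e1 : (swapBlocks h).toBlocks₁₁ - (Zinv Z).1 * (swapBlocks h).toBlocks₂₁ = Z.1⁻¹ * Q := by
    change h.toBlocks₂₂ - Z.1⁻¹ * h.toBlocks₁₂ = _
    rw [hQdef, Matrix.mul_add, ← Matrix.mul_assoc, hZi, Matrix.one_mul, Matrix.mul_neg]
    abel
  have e2 : -(swapBlocks h).toBlocks₁₂ + (Zinv Z).1 * (swapBlocks h).toBlocks₂₂ = Z.1⁻¹ * P := by
    change -h.toBlocks₂₁ + Z.1⁻¹ * h.toBlocks₁₁ = _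
    rw [hPdef, Matrix.mul_sub, ← Matrix.mul_assoc, hZi, Matrix.one_mul]
    abel
  have hW : (P⁻¹ * Q).det ≠ 0 := by
    rw [Matrix.det_mul, Matrix.det_nonsing_inv, Ring.inverse_eq_inv']
    exact mul_ne_zero (inv_ne_zero hP) hQ
  have e3 : (Z.1⁻¹ * Q)⁻¹ * (Z.1⁻¹ * P) = (Zinv ⟨P⁻¹ * Q, hW⟩).1 := by
    change _ = (P⁻¹ * Q)⁻¹
    rw [Matrix.mul_inv_rev, Matrix.mul_inv_rev, Matrix.nonsing_inv_nonsing_inv _ Z.2.isUnit,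
      Matrix.nonsing_inv_nonsing_inv _ hP.isUnit, Matrix.mul_assoc, ← Matrix.mul_assoc Z.1, hZi',
      Matrix.one_mul]
  have l : actL h (toFn (opJ v)) Z = P.det⁻¹ • (P *ᵥ ext (toFn (opJ v)) (P⁻¹ * Q)) := rfl
  have r : actL (swapBlocks h) (toFn v) (Zinv Z) =
      (Z.1⁻¹ * Q).det⁻¹ • ((Z.1⁻¹ * Q) *ᵥ ext (toFn v) ((Z.1⁻¹ * Q)⁻¹ * (Z.1⁻¹ * P))) := by
    rw [← e1, ← e2]; rfl
  rw [l, r, e3, ext_mk, ext_of_ne _ hW, toFn_opJ, Matrix.mulVec_smul, Matrix.mulVec_smul,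
    Matrix.mulVec_mulVec, Matrix.mulVec_mulVec, smul_smul, smul_smul]
  have e4 : P * (P⁻¹ * Q) = Q := by rw [← Matrix.mul_assoc, hPi', Matrix.one_mul]
  have e5 : Z.1 * (Z.1⁻¹ * Q) = Q := by rw [← Matrix.mul_assoc, hZi', Matrix.one_mul]
  rw [e5]
  change (_ * _) • ((P * (P⁻¹ * Q)) *ᵥ _) = _
  rw [e4]
  congr 1
  simp only [Matrix.det_mul, Matrix.det_nonsing_inv, Ring.inverse_eq_inv']
  field_simp

/-- The group identity `actL_opJ` needs two determinants to be non-zero. They are 1 and N(Z) at t =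
0, so the identity holds near 0 and may be differentiated there. -/
theorem pL_opJ (X : Mat4) (v : LV) : pL X (opJ v) = opJ (pL (swapBlocks X) v) := by
  refine LV_ext fun Z r => ?_
  have h1 := hasDerivAt_actL X (opJ v) Z r
  have h2 : HasDerivAt (fun t : ℝ => Z.1.det⁻¹ * ∑ s, Z.1 r s *
      actL (NormedSpace.exp (t • swapBlocks X)) (toFn v) (Zinv Z) s)
      (Z.1.det⁻¹ * ∑ s, Z.1 r s * toFn (pL (swapBlocks X) v) (Zinv Z) s) 0 :=
    (HasDerivAt.fun_sum fun s _ =>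
      (hasDerivAt_actL (swapBlocks X) v (Zinv Z) s).const_mul (Z.1 r s)).const_mul _
  have hX := hasDerivAt_exp_entry X
  have hc : ∀ i j, ContinuousAt (fun t : ℝ => NormedSpace.exp (t • X) i j) 0 := fun i j =>
    (hX i j).continuousAt
  have hP : ∀ᶠ t in nhds (0 : ℝ), ((NormedSpace.exp (t • X)).toBlocks₁₁ -
      Z.1 * (NormedSpace.exp (t • X)).toBlocks₂₁).det ≠ 0 := by
    have hcont : ContinuousAt (fun t : ℝ => ((NormedSpace.exp (t • X)).toBlocks₁₁ -
      Z.1 * (NormedSpace.exp (t • X)).toBlocks₂₁).det) 0 := by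
      simp only [Matrix.det_fin_two, Matrix.sub_apply, Matrix.mul_apply, Fin.sum_univ_two,
        Matrix.toBlocks₁₁, Matrix.toBlocks₂₁, Matrix.of_apply]
      fun_prop
    refine hcont.eventually_ne ?_
    rw [exp_zero_entry]
    have : (1 : Mat4).toBlocks₁₁ - Z.1 * (1 : Mat4).toBlocks₂₁ = 1 := by
      ext i j
      simp [Matrix.mul_apply, Matrix.toBlocks₁₁, Matrix.toBlocks₂₁, Matrix.one_apply]
    rw [this, Matrix.det_one]
    exact one_ne_zero
  have hQ : ∀ᶠ t in nhds (0 : ℝ), (-(NormedSpace.exp (t • X)).toBlocks₁₂ +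
      Z.1 * (NormedSpace.exp (t • X)).toBlocks₂₂).det ≠ 0 := by
    have hcont : ContinuousAt (fun t : ℝ => (-(NormedSpace.exp (t • X)).toBlocks₁₂ +
      Z.1 * (NormedSpace.exp (t • X)).toBlocks₂₂).det) 0 := by
      simp only [Matrix.det_fin_two, Matrix.add_apply, Matrix.neg_apply, Matrix.mul_apply,
        Fin.sum_univ_two, Matrix.toBlocks₁₂, Matrix.toBlocks₂₂, Matrix.of_apply]
      fun_prop
    refine hcont.eventually_ne ?_
    rw [exp_zero_entry]
    have : -(1 : Mat4).toBlocks₁₂ + Z.1 * (1 : Mat4).toBlocks₂₂ = Z.1 := by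
      ext i j
      fin_cases j <;>
        simp [Matrix.mul_apply, Matrix.toBlocks₁₂, Matrix.toBlocks₂₂, Matrix.one_apply]
    rw [this]
    exact Z.2
  have h3 : HasDerivAt (fun t : ℝ => actL (NormedSpace.exp (t • X)) (toFn (opJ v)) Z r)
      (Z.1.det⁻¹ * ∑ s, Z.1 r s * toFn (pL (swapBlocks X) v) (Zinv Z) s) 0 := by
    refine h2.congr_of_eventuallyEq ?_
    filter_upwards [hP, hQ] with t ht ht'
    rw [actL_opJ v Z ht ht', ← swapBlocks_smul, exp_swapBlocks]
    rfl
  have h4 := h1.unique h3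
  rw [toFn_apply] at h4
  rw [h4, evalAt_opJ]
  rfl

end InversionEquivariance

/-! ### Transposition: from columns to rows -/

section Transposition

/-- Transposition on the invertible elements. -/
def Ztr (Z : HCx) : HCx := ⟨Z.1ᵀ, by rw [Matrix.det_transpose]; exact Z.2⟩

theorem Ztr_Ztr (Z : HCx) : Ztr (Ztr Z) = Z := rfl

theorem ext_comp_Ztr {V : Type} [Zero V] (f : HCx → V) (Z : HC) :
    ext (fun W => f (Ztr W)) Z = ext f Zᵀ := by
  by_cases h : Z.det = 0
  · rw [ext, ext, dif_neg (not_not.2 h), dif_neg]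
    rwa [Matrix.det_transpose, not_not]
  · have h' : Zᵀ.det ≠ 0 := by rwa [Matrix.det_transpose]
    rw [ext_of_ne _ h, ext_of_ne _ h']
    rfl

theorem pd_comp_Ztr (f : HCx → ℂ) (i j : Fin 2) :
    pd i j (fun Z => f (Ztr Z)) = fun Z => pd j i f (Ztr Z) := by
  funext Z
  simp only [pd, ext_comp_Ztr, Matrix.transpose_add, Matrix.transpose_smul,
    Matrix.transpose_single]
  rfl

theorem IsLaurent.comp_Ztr {f : HCx → ℂ} (hf : IsLaurent f) : IsLaurent fun Z => f (Ztr Z) := by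
  obtain ⟨P, k, hP⟩ := hf
  refine ⟨MvPolynomial.rename Prod.swap P, k, fun Z => ?_⟩
  refine (hP (Ztr Z)).trans ?_
  rw [MvPolynomial.eval_rename]
  change _ / Z.1ᵀ.det ^ k = _
  rw [Matrix.det_transpose]
  rfl

/-- Transposition exchanges ∂₁₂ and ∂₂₁, so the claim needs that they commute, which is known for
Laurent polynomials. -/
theorem box_comp_Ztr {f : HCx → ℂ} (hf : IsLaurent f) :
    box (fun Z => f (Ztr Z)) = fun Z => box f (Ztr Z) := by
  funext Z
  have h : pd 1 0 (pd 0 1 f) = pd 0 1 (pd 1 0 f) := congrArg Subtype.val (D_comm 1 0 0 1 ⟨f, hf⟩)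
  simp only [box, pd_comp_Ztr, h]

/-- Composition with the transposition. -/
def tr : Fn →ₗ[ℂ] Fn where
  toFun f := fun Z => f (Ztr Z)
  map_add' _ _ := rfl
  map_smul' _ _ := rfl

theorem tr_apply (f : Fn) (Z : HCx) : tr f Z = f (Ztr Z) := rfl

theorem tr_tr (f : Fn) : tr (tr f) = f := rfl

theorem tr_injective : Function.Injective tr := fun f g h => by
  rw [← tr_tr f, h, tr_tr]

theorem comp_boxV_tr {f : Fn} (hf : ∀ k, IsLaurent (comp f k)) (k : Fin 2) :
    comp (boxV (tr f)) k = fun Z => comp (boxV f) k (Ztr Z) :=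
  box_comp_Ztr (f := comp f k) (hf k)

theorem tr_mem_UR {f : Fn} (hf : f ∈ UL) : tr f ∈ UR := by
  refine ⟨fun k => (hf.1 k).comp_Ztr, ?_⟩
  funext Z j
  have h := congrFun (congrFun hf.2 (Ztr Z)) j
  simp only [nablaR, comp_boxV_tr hf.1, pd_comp_Ztr]
  exact h

theorem tr_mem_UL {f : Fn} (hf : f ∈ UR) : tr f ∈ UL := by
  refine ⟨fun k => (hf.1 k).comp_Ztr, ?_⟩
  funext Z j
  have h := congrFun (congrFun hf.2 (Ztr Z)) j
  simp only [nablaL, comp_boxV_tr hf.1, pd_comp_Ztr]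
  exact h

theorem tr_mem_homog {f : Fn} {d : ℤ} (hf : f ∈ homog d) : tr f ∈ homog d := by
  intro c hc Z W h
  refine hf c hc (Ztr Z) (Ztr W) ?_
  change W.1ᵀ = c • Z.1ᵀ
  rw [h, Matrix.transpose_smul]

theorem map_tr_UL_inf_homog (d : ℤ) : (UL ⊓ homog d).map tr = UR ⊓ homog d := by
  refine le_antisymm ?_ fun f hf => ?_
  · rintro _ ⟨f, hf, rfl⟩
    exact ⟨tr_mem_UR hf.1, tr_mem_homog hf.2⟩
  · exact ⟨tr f, ⟨tr_mem_UL hf.1, tr_mem_homog hf.2⟩, tr_tr f⟩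

theorem map_tr_lplus : (space .lplus).map tr = space .rplus := by
  simp only [space, Submodule.map_iSup, map_tr_UL_inf_homog]

theorem map_tr_lminus : (space .lminus).map tr = space .rminus := by
  simp only [space, Submodule.map_iSup, map_tr_UL_inf_homog]

/-- The involution `X ↦ S (-Xᵀ) S⁻¹` with `S = (0, 1; -1, 0)`. -/
def dualBlocks (X : Mat4) : Mat4 :=
  Matrix.fromBlocks (-X.toBlocks₂₂ᵀ) X.toBlocks₁₂ᵀ X.toBlocks₂₁ᵀ (-X.toBlocks₁₁ᵀ)

theorem fromBlocks_conj_transpose (Y : Mat4) :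
    Matrix.fromBlocks Y.toBlocks₂₂ᵀ (-Y.toBlocks₁₂ᵀ) (-Y.toBlocks₂₁ᵀ) Y.toBlocks₁₁ᵀ =
      Matrix.fromBlocks 0 1 (-1) 0 * Yᵀ * Matrix.fromBlocks 0 (-1) 1 0 := by
  conv_rhs => rw [← Matrix.fromBlocks_toBlocks Y, Matrix.fromBlocks_transpose,
    Matrix.fromBlocks_multiply, Matrix.fromBlocks_multiply]
  simp

theorem exp_dualBlocks (X : Mat4) (t : ℝ) : NormedSpace.exp (t • dualBlocks X) =
    Matrix.fromBlocks (NormedSpace.exp (t • X))⁻¹.toBlocks₂₂ᵀ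
      (-(NormedSpace.exp (t • X))⁻¹.toBlocks₁₂ᵀ) (-(NormedSpace.exp (t • X))⁻¹.toBlocks₂₁ᵀ)
      (NormedSpace.exp (t • X))⁻¹.toBlocks₁₁ᵀ := by
  have hS : (Matrix.fromBlocks 0 1 (-1) 0 : Mat4) * Matrix.fromBlocks 0 (-1) 1 0 = 1 := by
    rw [Matrix.fromBlocks_multiply]
    simp
  have h : t • dualBlocks X =
      Matrix.fromBlocks 0 1 (-1) 0 * (-(t • X))ᵀ * (Matrix.fromBlocks 0 1 (-1) 0)⁻¹ := by
    rw [Matrix.inv_eq_right_inv hS, ← fromBlocks_conj_transpose, dualBlocks,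
      Matrix.fromBlocks_smul]
    congr 1 <;> ext i j <;> simp [Matrix.toBlocks₁₁, Matrix.toBlocks₁₂, Matrix.toBlocks₂₁,
      Matrix.toBlocks₂₂]
  rw [fromBlocks_conj_transpose, h, Matrix.exp_conj _ _ (IsUnit.of_mul_eq_one _ hS),
    Matrix.exp_transpose, Matrix.exp_neg, Matrix.inv_eq_right_inv hS]

/-- Transposing (aZ + b)(cZ + d)⁻¹ gives a left fractional linear transformation in Zᵀ, with blocks
taken from the transpose of h⁻¹. -/
theorem actR_tr (h : Mat4) (f : Fn) (Z : HCx) : actR h (tr f) Z =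
    actL (Matrix.fromBlocks h⁻¹.toBlocks₂₂ᵀ (-h⁻¹.toBlocks₁₂ᵀ) (-h⁻¹.toBlocks₂₁ᵀ)
      h⁻¹.toBlocks₁₁ᵀ) f (Ztr Z) := by
  have e1 : h⁻¹.toBlocks₂₂ᵀ - (Ztr Z).1 * -h⁻¹.toBlocks₂₁ᵀ =
      (h⁻¹.toBlocks₂₁ * Z.1 + h⁻¹.toBlocks₂₂)ᵀ := by
    rw [Matrix.transpose_add, Matrix.transpose_mul, Matrix.mul_neg, sub_neg_eq_add, add_comm]
    rfl
  have e2 : - -h⁻¹.toBlocks₁₂ᵀ + (Ztr Z).1 * h⁻¹.toBlocks₁₁ᵀ =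
      (h⁻¹.toBlocks₁₁ * Z.1 + h⁻¹.toBlocks₁₂)ᵀ := by
    rw [Matrix.transpose_add, Matrix.transpose_mul, neg_neg, add_comm]
    rfl
  simp only [actL, Matrix.toBlocks_fromBlocks₁₁, Matrix.toBlocks_fromBlocks₁₂,
    Matrix.toBlocks_fromBlocks₂₁, Matrix.toBlocks_fromBlocks₂₂, e1, e2, Matrix.det_transpose,
    Matrix.mulVec_transpose, ← Matrix.transpose_nonsing_inv, ← Matrix.transpose_mul, actR]
  rw [← ext_comp_Ztr]
  rfl

theorem piR_tr (X : Mat4) (f : Fn) : piR X (tr f) = tr (piL (dualBlocks X) f) := by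
  funext Z
  simp only [piR, tr_apply, piL, exp_dualBlocks, actR_tr]

theorem dualBlocks_dualBlocks (X : Mat4) : dualBlocks (dualBlocks X) = X := by
  simp [dualBlocks, Matrix.fromBlocks_toBlocks]

theorem swapBlocks_dualBlocks_involutive (X : Mat4) :
    swapBlocks (dualBlocks (swapBlocks (dualBlocks X))) = X := by
  simp [dualBlocks, swapBlocks, Matrix.fromBlocks_toBlocks]

theorem dualBlocks_mem {X : Mat4} (hX : X ∈ u22) : dualBlocks X ∈ u22 := by
  obtain ⟨A, B, D, hA, hD, rfl⟩ := hX
  refine ⟨-Dᵀ, Bᵀ, -Aᵀ, ?_, ?_, by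
    simp only [dualBlocks, Matrix.toBlocks_fromBlocks₁₁, Matrix.toBlocks_fromBlocks₁₂,
      Matrix.toBlocks_fromBlocks₂₁, Matrix.toBlocks_fromBlocks₂₂]; rfl⟩
  · conv_lhs => rw [hD]
    rw [Matrix.transpose_neg, Matrix.conjTranspose_neg]
    rfl
  · conv_lhs => rw [hA]
    rw [Matrix.transpose_neg, Matrix.conjTranspose_neg]
    rfl

end Transposition

/-! ### Invariance of the surface measure under linear isometries -/

section SphereIsometry

open MeasureTheory Metric
open scoped Pointwise

variable {E : Type*} [NormedAddCommGroup E] [InnerProductSpace ℝ E] [MeasurableSpace E]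
  [BorelSpace E] [FiniteDimensional ℝ E]

/-- The map of the unit sphere induced by a linear isometry. -/
def sphereMap (L : E ≃ₗᵢ[ℝ] E) (x : sphere (0 : E) 1) : sphere (0 : E) 1 :=
  ⟨L x.1, by rw [mem_sphere_zero_iff_norm, L.norm_map]; exact mem_sphere_zero_iff_norm.1 x.2⟩

/-- The surface measure of a set is a multiple of the volume of the cone over it; cones correspond
under L, which preserves volume. -/
theorem measurePreserving_sphereMap (L : E ≃ₗᵢ[ℝ] E) :
    MeasurePreserving (sphereMap L) (volume : Measure E).toSphere
      (volume : Measure E).toSphere := by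
  have hc : Continuous (sphereMap L) :=
    (L.continuous.comp continuous_subtype_val).subtype_mk _
  refine ⟨hc.measurable, Measure.ext fun s hs => ?_⟩
  rw [Measure.map_apply hc.measurable hs, Measure.toSphere_apply' _ (hc.measurable hs),
    Measure.toSphere_apply' _ hs]
  congr 1
  have h : Set.Ioo (0 : ℝ) 1 • (Subtype.val '' (sphereMap L ⁻¹' s)) =
      L ⁻¹' (Set.Ioo (0 : ℝ) 1 • (Subtype.val '' s)) := by
    ext x
    simp only [Set.mem_smul, Set.mem_image, Set.mem_preimage]
    constructor
    · rintro ⟨r, hr, _, ⟨y, hy, rfl⟩, rfl⟩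
      exact ⟨r, hr, _, ⟨_, hy, rfl⟩, (L.map_smul r y.1).symm⟩
    · rintro ⟨r, hr, _, ⟨y, hy, rfl⟩, hx⟩
      refine ⟨r, hr, _, ⟨sphereMap L.symm y, ?_, rfl⟩, ?_⟩
      · have : sphereMap L (sphereMap L.symm y) = y := Subtype.ext (L.apply_symm_apply y.1)
        rwa [this]
      · apply L.injective
        rw [← hx, L.map_smul]
        congr 1
        exact L.apply_symm_apply y.1
  rw [h]
  exact (L.measurePreserving).measure_preimage_equiv (f := L.toHomeomorph.toMeasurableEquiv) _

theorem integral_comp_sphereMap (L : E ≃ₗᵢ[ℝ] E) (f : sphere (0 : E) 1 → ℂ) :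
    ∫ x, f (sphereMap L x) ∂(volume : Measure E).toSphere =
      ∫ x, f x ∂(volume : Measure E).toSphere := by
  have hL : ∀ (L : E ≃ₗᵢ[ℝ] E), Continuous (sphereMap L) := fun L =>
    (L.continuous.comp continuous_subtype_val).subtype_mk _
  let e : sphere (0 : E) 1 ≃ₜ sphere (0 : E) 1 :=
    { toFun := sphereMap L
      invFun := sphereMap L.symm
      left_inv := fun x => Subtype.ext (L.symm_apply_apply x.1)
      right_inv := fun x => Subtype.ext (L.apply_symm_apply x.1)
      continuous_toFun := hL L
      continuous_invFun := hL L.symm }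
  exact (measurePreserving_sphereMap L).integral_comp e.measurableEmbedding f

end SphereIsometry

/-! ### Transposition and inversion as isometries of S³ -/

section SignFlips

/-- Change of sign of some of the coordinates. -/
def signFlip (s : Fin 4 → Bool) : EuclideanSpace ℝ (Fin 4) ≃ₗᵢ[ℝ] EuclideanSpace ℝ (Fin 4) :=
  LinearIsometryEquiv.piLpCongrRight 2 fun i =>
    if s i then LinearIsometryEquiv.neg ℝ else LinearIsometryEquiv.refl ℝ ℝ

theorem signFlip_apply (s : Fin 4 → Bool) (x : EuclideanSpace ℝ (Fin 4)) (i : Fin 4) :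
    signFlip s x i = if s i then -x i else x i := by
  rw [signFlip, LinearIsometryEquiv.piLpCongrRight_apply]
  change (if s i then LinearIsometryEquiv.neg ℝ else LinearIsometryEquiv.refl ℝ ℝ :
    ℝ ≃ₗᵢ[ℝ] ℝ) (x i) = _
  split_ifs <;> rfl

/-- Only e₂ is antisymmetric, so transposition changes the sign of x². Inversion on S³ is
quaternionic conjugation and changes the signs of the three imaginary coordinates. -/
theorem sphPt_transpose (x : Metric.sphere (0 : EuclideanSpace ℝ (Fin 4)) 1) :
    sphPt (sphereMap (signFlip ![false, false, true, false]) x) = Ztr (sphPt x) := by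
  refine Subtype.ext ?_
  change quat (signFlip _ x.1) = (quat x.1)ᵀ
  ext i j
  fin_cases i <;> fin_cases j <;> simp [quat, signFlip_apply, sub_eq_add_neg]

theorem sphPt_inv (x : Metric.sphere (0 : EuclideanSpace ℝ (Fin 4)) 1) :
    sphPt (sphereMap (signFlip ![false, true, true, true]) x) = Zinv (sphPt x) := by
  refine Subtype.ext ?_
  rw [Zinv_val]
  change quat (signFlip _ x.1) = (quat x.1).det⁻¹ • (quat x.1).adjugate
  rw [det_quat, inv_one, one_smul, Matrix.adjugate_fin_two]
  ext i j
  fin_cases i <;> fin_cases j <;> simp [quat, signFlip_apply] <;> ring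

theorem sphereInner_tr (f g : Fn) : sphereInner (tr f) (tr g) = sphereInner f g := by
  rw [sphereInner_eq, sphereInner_eq,
    ← integral_comp_sphereMap (signFlip ![false, false, true, false])]
  simp only [sphPt_transpose, tr_apply, Ztr_Ztr]

theorem quat_unitary (x : Metric.sphere (0 : EuclideanSpace ℝ (Fin 4)) 1) (v w : Fin 2 → ℂ) :
    ∑ i, conj ((quat x.1 *ᵥ v) i) * (quat x.1 *ᵥ w) i = ∑ i, conj (v i) * w i := by
  have h := det_quat x
  rw [Matrix.det_fin_two] at h
  simp only [Fin.sum_univ_two, Matrix.mulVec, dotProduct, map_add, map_mul]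
  simp [quat] at h ⊢
  linear_combination (conj (v 0) * w 0 + conj (v 1) * w 1) * h

/-- On S³ one has N(Z) = 1 and Z is unitary, so the multiplier of `opJ` preserves the Hermitian
product pointwise; the change of variable is an isometry. -/
theorem sphereInner_opJ (u v : LV) :
    sphereInner (toFn (opJ u)) (toFn (opJ v)) = sphereInner (toFn u) (toFn v) := by
  rw [sphereInner_eq, sphereInner_eq,
    ← integral_comp_sphereMap (signFlip ![false, true, true, true]) fun x =>
      ∑ i, conj (toFn v (sphPt x) i) * toFn u (sphPt x) i]
  refine MeasureTheory.integral_congr_ae (Filter.Eventually.of_forall fun x => ?_)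
  simp only [toFn_opJ, sphPt_inv]
  have hd : (sphPt x).1.det = 1 := det_quat x
  rw [hd, inv_one, one_smul, one_smul]
  exact quat_unitary x _ _

end SignFlips

/-! ### From half-integer labels to integer indices -/

section Indices

/-- The half-integers `l`, `m`, `n` in terms of natural numbers. -/
def IndexRel (α : Fin 3) (l m n : ℚ) (a b k d : ℕ) : Prop :=
  match α with
  | 0 => l - m = a ∧ l + m = b ∧ l + 1 / 2 - n = k ∧ l + 1 / 2 + n = d
  | 1 => l - m = a ∧ l + m = b ∧ l - 1 / 2 - n = k ∧ l - 1 / 2 + n = d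
  | 2 => l - 1 - m = a ∧ l - 1 + m = b ∧ l - 1 / 2 - n = k ∧ l - 1 / 2 + n = d

/-- The index in the family `ee`. -/
def indexOf (α : Fin 3) (l m n : ℚ) : ℕ × ℕ × ℤ :=
  match α with
  | 0 => (⌊l - m⌋₊, ⌊l + m⌋₊, ⌊l + 1 / 2 - n⌋)
  | 1 => (⌊l - m⌋₊, ⌊l + m⌋₊, ⌊l - 1 / 2 - n⌋)
  | 2 => (⌊l - 1 - m⌋₊, ⌊l - 1 + m⌋₊, ⌊l - 1 / 2 - n⌋)

theorem exists_indexRel {α : Fin 3} {l m n : ℚ} (h : idx α l m n) :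
    ∃ a b k d, IndexRel α l m n a b k d := by
  fin_cases α <;> obtain ⟨⟨⟨a, ha⟩, b, hb⟩, ⟨k, hk⟩, d, hd⟩ := h <;>
    exact ⟨a, b, k, d, ha, hb, hk, hd⟩

namespace IndexRel

variable {α : Fin 3} {l m n : ℚ} {a b k d : ℕ}

theorem idx (h : IndexRel α l m n a b k d) : idx α l m n := by
  fin_cases α <;> obtain ⟨ha, hb, hk, hd⟩ := h <;>
    exact ⟨⟨⟨a, ha⟩, b, hb⟩, ⟨k, hk⟩, d, hd⟩

theorem indexOf_eq (h : IndexRel α l m n a b k d) : indexOf α l m n = (a, b, (k : ℤ)) := by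
  fin_cases α <;> obtain ⟨ha, hb, hk, hd⟩ := h <;> simp only [indexOf] <;>
    rw [ha, hb, hk, Nat.floor_natCast, Nat.floor_natCast, Int.floor_natCast]

theorem add_eq (h : IndexRel α l m n a b k d) (hα : α ≠ 1) : k + d = a + b + 1 := by
  have e : (k : ℚ) + d = a + b + 1 := by
    fin_cases α
    · obtain ⟨ha, hb, hk, hd⟩ := h
      linarith
    · exact absurd rfl hα
    · obtain ⟨ha, hb, hk, hd⟩ := h
      linarith
  exact_mod_cast e

theorem add_eq_one (h : IndexRel 1 l m n a b k d) : k + d + 1 = a + b := by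
  obtain ⟨ha, hb, hk, hd⟩ := h
  have e : (k : ℚ) + d + 1 = a + b := by linarith
  exact_mod_cast e

theorem valid (h : IndexRel α l m n a b k d) : Valid (α, a, b, (k : ℤ)) := by
  fin_cases α
  · have := h.add_eq (by decide)
    exact ⟨by omega, by omega⟩
  · have := h.add_eq_one
    exact ⟨by omega, by omega⟩
  · have := h.add_eq (by decide)
    exact ⟨by omega, by omega⟩

theorem weight_eq (h : IndexRel α l m n a b k d) :
    ((weight α l : ℚ) : ℂ) = wgt (α, a, b, (k : ℤ)) := by
  fin_cases α <;> obtain ⟨ha, hb, hk, hd⟩ := h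
  · have e : 2 * l + 1 = (a + b + 1 : ℚ) := by linarith
    change ((2 * l + 1 : ℚ) : ℂ) = a + b + 1
    rw [e]
    push_cast
    rfl
  · have e : 2 * l = (a + b : ℚ) := by linarith
    change ((-(2 * l * (2 * l + 1)) : ℚ) : ℂ) = -((a + b) * (a + b + 1))
    rw [e]
    push_cast
    rfl
  · have e : 2 * l = (a + b + 2 : ℚ) := by linarith
    change ((-(2 * l) : ℚ) : ℂ) = -(a + b + 2)
    rw [e]
    push_cast
    rfl

theorem unique {l' m' n' : ℚ} {d' : ℕ} (h : IndexRel α l m n a b k d)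
    (h' : IndexRel α l' m' n' a b k d') : l = l' ∧ m = m' ∧ n = n' := by
  fin_cases α <;> obtain ⟨ha, hb, hk, hd⟩ := h <;> obtain ⟨ha', hb', hk', hd'⟩ := h' <;>
    refine ⟨?_, ?_, ?_⟩ <;> linarith

end IndexRel

theorem exists_indexRel_of_valid {α : Fin 3} {a b : ℕ} {k : ℤ} (h : Valid (α, a, b, k)) :
    ∃ l m n, ∃ k' d : ℕ, (k' : ℤ) = k ∧ IndexRel α l m n a b k' d := by
  fin_cases α
  · obtain ⟨h0, h1⟩ := h
    lift k to ℕ using h0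
    obtain ⟨d, hd⟩ : ∃ d, k + d = a + b + 1 := ⟨a + b + 1 - k, by omega⟩
    have hq : (k : ℚ) + d = a + b + 1 := by exact_mod_cast hd
    refine ⟨(a + b) / 2, (b - a) / 2, (a + b + 1) / 2 - k, k, d, rfl, ?_, ?_, ?_, ?_⟩ <;> linarith
  · obtain ⟨h0, h1⟩ := h
    lift k to ℕ using h0
    obtain ⟨d, hd⟩ : ∃ d, k + d + 1 = a + b := ⟨a + b - k - 1, by omega⟩
    have hq : (k : ℚ) + d + 1 = a + b := by exact_mod_cast hd
    refine ⟨(a + b) / 2, (b - a) / 2, (a + b - 1) / 2 - k, k, d, rfl, ?_, ?_, ?_, ?_⟩ <;> linarith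
  · obtain ⟨h0, h1⟩ := h
    lift k to ℕ using h0
    obtain ⟨d, hd⟩ : ∃ d, k + d = a + b + 1 := ⟨a + b + 1 - k, by omega⟩
    have hq : (k : ℚ) + d = a + b + 1 := by exact_mod_cast hd
    refine ⟨(a + b) / 2 + 1, (b - a) / 2, (a + b + 1) / 2 - k, k, d, rfl, ?_, ?_, ?_, ?_⟩ <;>
      linarith

theorem valid_indexOf {α : Fin 3} {l m n : ℚ} (h : idx α l m n) :
    Valid (α, indexOf α l m n) := by
  obtain ⟨a, b, k, d, h⟩ := exists_indexRel h
  rw [h.indexOf_eq]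
  exact h.valid

theorem weight_indexOf {α : Fin 3} {l m n : ℚ} (h : idx α l m n) :
    ((weight α l : ℚ) : ℂ) = wgt (α, indexOf α l m n) := by
  obtain ⟨a, b, k, d, h⟩ := exists_indexRel h
  rw [h.indexOf_eq, h.weight_eq]

theorem indexOf_injective {α : Fin 3} {l m n l' m' n' : ℚ} (h : idx α l m n) (h' : idx α l' m' n')
    (e : indexOf α l m n = indexOf α l' m' n') : l = l' ∧ m = m' ∧ n = n' := by
  obtain ⟨a, b, k, d, h⟩ := exists_indexRel h
  obtain ⟨a', b', k', d', h'⟩ := exists_indexRel h'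
  rw [h.indexOf_eq, h'.indexOf_eq, Prod.mk.injEq, Prod.mk.injEq, Nat.cast_inj] at e
  obtain ⟨rfl, rfl, rfl⟩ := e
  exact h.unique h'

theorem indexOf_surjective {α : Fin 3} {y : ℕ × ℕ × ℤ} (h : Valid (α, y)) :
    ∃ l m n, idx α l m n ∧ indexOf α l m n = y := by
  obtain ⟨a, b, k⟩ := y
  obtain ⟨l, m, n, k', d, rfl, hr⟩ := exists_indexRel_of_valid h
  exact ⟨l, m, n, hr.idx, hr.indexOf_eq⟩

/-- The constants which relate the row valued functions to the transposes of the column valued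
ones. -/
def dualFactor : Ix → ℂ
  | (0, a, b, k) => k.toNat.factorial * (a + b + 1 - k).toNat.factorial /
      (a.factorial * b.factorial)
  | (1, a, b, k) => k.toNat.factorial * (a + b - 1 - k).toNat.factorial /
      (a.factorial * b.factorial)
  | (2, a, b, k) => k.toNat.factorial * (a + b + 1 - k).toNat.factorial /
      (a.factorial * b.factorial)

theorem IndexRel.dualFactor_eq {α : Fin 3} {l m n : ℚ} {a b k d : ℕ}
    (h : IndexRel α l m n a b k d) : dualFactor (α, a, b, (k : ℤ)) =
      k.factorial * d.factorial / (a.factorial * b.factorial) := by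
  fin_cases α
  · have e := h.add_eq (by decide)
    have e' : ((a : ℤ) + b + 1 - k).toNat = d := by omega
    change _ * (((a : ℤ) + b + 1 - k).toNat.factorial : ℂ) / _ = _
    rw [e', Int.toNat_natCast]
  · have e := h.add_eq_one
    have e' : ((a : ℤ) + b - 1 - k).toNat = d := by omega
    change _ * (((a : ℤ) + b - 1 - k).toNat.factorial : ℂ) / _ = _
    rw [e', Int.toNat_natCast]
  · have e := h.add_eq (by decide)
    have e' : ((a : ℤ) + b + 1 - k).toNat = d := by omega
    change _ * (((a : ℤ) + b + 1 - k).toNat.factorial : ℂ) / _ = _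
    rw [e', Int.toNat_natCast]

theorem dualFactor_ne (x : Ix) : dualFactor x ≠ 0 := by
  obtain ⟨α, a, b, k⟩ := x
  fin_cases α <;> exact div_ne_zero (factorial_mul_ne _ _) (factorial_mul_ne _ _)

end Indices

/-! ### The column valued basis functions in the model -/

section KTypes

theorem fPlus_eq {α : Fin 3} {l m n : ℚ} (h : idx α l m n) :
    fPlus α l m n = toFn (ee (α, indexOf α l m n)) := by
  obtain ⟨a, b, k, d, h⟩ := exists_indexRel h
  rw [h.indexOf_eq]
  fin_cases α <;> obtain ⟨ha, hb, hk, hd⟩ := h <;> funext Z r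
  · have h0 : tcoef l (n - 1 / 2) m Z.1 = tt Z.1 a b k :=
      tcoef_eq_tt _ _ _ _ _ _ _ ha hb (by push_cast; linarith)
    have h1 : tcoef l (n + 1 / 2) m Z.1 = tt Z.1 a b (k - 1) :=
      tcoef_eq_tt _ _ _ _ _ _ _ ha hb (by push_cast; linarith)
    change ![tcoef l (n - 1 / 2) m Z.1, -tcoef l (n + 1 / 2) m Z.1] r = evalAt Z (f1 a b k r)
    rw [h0, h1]
    fin_cases r <;> simp [f1, evalAt_tt]
  · have h0 : tcoef l (n - 1 / 2) m Z.1 = tt Z.1 a b (k + 1) :=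
      tcoef_eq_tt _ _ _ _ _ _ _ ha hb (by push_cast; linarith)
    have h1 : tcoef l (n + 1 / 2) m Z.1 = tt Z.1 a b k :=
      tcoef_eq_tt _ _ _ _ _ _ _ ha hb (by push_cast; linarith)
    have e0 : l - n + 1 / 2 = k + 1 := by linarith
    have e1 : l + n + 1 / 2 = a + b - k := by linarith
    change ![((l - n + 1 / 2 : ℚ) : ℂ) * tcoef l (n - 1 / 2) m Z.1,
           ((l + n + 1 / 2 : ℚ) : ℂ) * tcoef l (n + 1 / 2) m Z.1] r = evalAt Z (f2 a b k r)
    rw [h0, h1, e0, e1]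
    fin_cases r <;> simp [f2, evalAt_tt]
  · have h0 : tcoef (l - 1) (n - 1 / 2) m Z.1 = tt Z.1 a b k :=
      tcoef_eq_tt _ _ _ _ _ _ _ ha hb (by push_cast; linarith)
    have h1 : tcoef (l - 1) (n + 1 / 2) m Z.1 = tt Z.1 a b (k - 1) :=
      tcoef_eq_tt _ _ _ _ _ _ _ ha hb (by push_cast; linarith)
    change ![Z.1.det * tcoef (l - 1) (n - 1 / 2) m Z.1,
           -(Z.1.det * tcoef (l - 1) (n + 1 / 2) m Z.1)] r = evalAt Z (zM.det * f1 a b k r)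
    rw [h0, h1, map_mul, evalAt_det]
    fin_cases r <;> simp [f1, evalAt_tt]

theorem evalAt_opJ_f3 (Z : HCx) (a b : ℕ) (k : ℤ) (r : Fin 2) :
    evalAt Z (opJ (f3 a b k) r) = Z.1.det⁻¹ * evalAt Z (opJ (f1 a b k) r) := by
  rw [← mulN_one_f1, opJ_mulN, mulN_apply, map_mul, evalAt_Np, zpow_neg_one]

theorem fMinus_eq {α : Fin 3} {l m n : ℚ} (h : idx α l n m) :
    fMinus α l m n = toFn (opJ (ee (α, indexOf α l n m))) := by
  obtain ⟨a, b, k, d, h⟩ := exists_indexRel h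
  rw [h.indexOf_eq]
  fin_cases α <;> obtain ⟨ha, hb, hk, hd⟩ := h <;> funext Z r
  · have h0 : tcoef (l + 1 / 2) m (n + 1 / 2) Z.1⁻¹ = tt Z.1⁻¹ a (b + 1) k :=
      tcoef_eq_tt _ _ _ _ _ _ _ (by linarith) (by push_cast; linarith) (by push_cast; linarith)
    have h1 : tcoef (l + 1 / 2) m (n - 1 / 2) Z.1⁻¹ = tt Z.1⁻¹ (a + 1) b k :=
      tcoef_eq_tt _ _ _ _ _ _ _ (by push_cast; linarith) (by linarith) (by push_cast; linarith)
    change ![tcoef (l + 1 / 2) m (n + 1 / 2) Z.1⁻¹, -tcoef (l + 1 / 2) m (n - 1 / 2) Z.1⁻¹] r =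
      evalAt Z (opJ (f1 a b k) r)
    rw [h0, h1]
    fin_cases r
    · exact (evalAt_opJ_f1_zero Z a b k).symm
    · exact (evalAt_opJ_f1_one Z a b k).symm
  · change ![((l - n : ℚ) : ℂ) * Z.1.det⁻¹ * tcoef (l - 1 / 2) m (n + 1 / 2) Z.1⁻¹,
           ((l + n : ℚ) : ℂ) * Z.1.det⁻¹ * tcoef (l - 1 / 2) m (n - 1 / 2) Z.1⁻¹] r =
      evalAt Z (opJ (f2 a b k) r)
    rw [ha, hb, Rat.cast_natCast, Rat.cast_natCast]
    fin_cases r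
    · refine Eq.trans ?_ (evalAt_opJ_f2_zero Z a b k).symm
      change (a : ℂ) * Z.1.det⁻¹ * tcoef (l - 1 / 2) m (n + 1 / 2) Z.1⁻¹ = _
      -- At a = 0 the index of the integral is out of range and its rounded exponent has no meaning,
      -- but the coefficient l - n = a is zero. The other entry is treated likewise at b = 0.
      rcases a with _ | a
      · simp
      · have h0 : tcoef (l - 1 / 2) m (n + 1 / 2) Z.1⁻¹ = tt Z.1⁻¹ a b k :=
          tcoef_eq_tt _ _ _ _ _ _ _ (by push_cast at ha; linarith) (by linarith)
            (by push_cast; linarith)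
        rw [h0, det_Zinv, mul_assoc]
        rfl
    · refine Eq.trans ?_ (evalAt_opJ_f2_one Z a b k).symm
      change (b : ℂ) * Z.1.det⁻¹ * tcoef (l - 1 / 2) m (n - 1 / 2) Z.1⁻¹ = _
      rcases b with _ | b
      · simp
      · have h0 : tcoef (l - 1 / 2) m (n - 1 / 2) Z.1⁻¹ = tt Z.1⁻¹ a b k :=
          tcoef_eq_tt _ _ _ _ _ _ _ (by linarith) (by push_cast at hb; linarith)
            (by push_cast; linarith)
        rw [h0, det_Zinv, mul_assoc]
        rfl
  · have h0 : tcoef (l - 1 / 2) m (n + 1 / 2) Z.1⁻¹ = tt Z.1⁻¹ a (b + 1) k :=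
      tcoef_eq_tt _ _ _ _ _ _ _ (by linarith) (by push_cast; linarith) (by push_cast; linarith)
    have h1 : tcoef (l - 1 / 2) m (n - 1 / 2) Z.1⁻¹ = tt Z.1⁻¹ (a + 1) b k :=
      tcoef_eq_tt _ _ _ _ _ _ _ (by push_cast; linarith) (by linarith) (by push_cast; linarith)
    change ![Z.1.det⁻¹ * tcoef (l - 1 / 2) m (n + 1 / 2) Z.1⁻¹,
           -(Z.1.det⁻¹ * tcoef (l - 1 / 2) m (n - 1 / 2) Z.1⁻¹)] r =
      evalAt Z (opJ (f3 a b k) r)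
    rw [h0, h1, evalAt_opJ_f3]
    fin_cases r
    · exact congrArg (Z.1.det⁻¹ * ·) (evalAt_opJ_f1_zero Z a b k).symm
    · rw [← mul_neg]
      exact congrArg (Z.1.det⁻¹ * ·) (evalAt_opJ_f1_one Z a b k).symm

/-- The transposition formula with the quotient of factorials isolated. -/
theorem tt_eq_div_transpose (Z : HC) (k j a b : ℕ) (h : a + b = k + j) : tt Z k j a =
    (k.factorial * j.factorial) / (a.factorial * b.factorial) * tt Zᵀ a b k := by
  have := factorial_mul_ne a b
  have e := tt_transpose Zᵀ k j a b h
  rw [Matrix.transpose_transpose] at e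
  rw [div_mul_eq_mul_div, eq_div_iff this, e, mul_comm]

end KTypes

/-! ### The row valued basis functions in the model -/

section DualKTypes

/-- Transposing a coefficient costs the factor k! j!/(a! b!). The numerical coefficients of the g
functions complete the factorials in both entries to the same constant `dualFactor`. -/
theorem gPlus_eq {α : Fin 3} {l m n : ℚ} (h : idx α l n m) : gPlus α l m n =
    dualFactor (α, indexOf α l n m) • tr (toFn (ee (α, indexOf α l n m))) := by
  obtain ⟨a, b, k, d, h⟩ := exists_indexRel h
  rw [h.indexOf_eq, h.dualFactor_eq]
  have aux : ∀ (L M N : ℚ) (Z : HC), k + d = a + b + 1 → L - N = a → L + N = b →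
      L + 1 / 2 - M = k → L + 1 / 2 + M = d →
      (d : ℂ) * tcoef L N (M - 1 / 2) Z =
        k.factorial * d.factorial / (a.factorial * b.factorial) * tt Zᵀ a b k ∧
      (k : ℂ) * tcoef L N (M + 1 / 2) Z =
        k.factorial * d.factorial / (a.factorial * b.factorial) * tt Zᵀ a b (k - 1) := by
    intro L M N Z e ha hb hk hd
    constructor
    -- At d = 0 the left side has coefficient zero, and on the right k = a + b + 1 exceeds the
    -- degree; both sides vanish. At k = 0 below the index k - 1 is negative.
    · rcases d with _ | d
      · rw [tt_of_gt Zᵀ a b k (by omega)]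
        simp
      · have h0 : tcoef L N (M - 1 / 2) Z = tt Z k d a :=
          tcoef_eq_tt _ _ _ _ _ _ _ (by linarith) (by push_cast at hd; linarith)
            (by push_cast; linarith)
        rw [h0, tt_eq_div_transpose Z k d a b (by omega), Nat.factorial_succ]
        push_cast
        ring
    · rcases k with _ | k
      · rw [tt_of_neg Zᵀ a b _ (by simp)]
        simp
      · have h0 : tcoef L N (M + 1 / 2) Z = tt Z k d a :=
          tcoef_eq_tt _ _ _ _ _ _ _ (by push_cast at hk; linarith) (by linarith)
            (by push_cast; linarith)
        rw [h0, tt_eq_div_transpose Z k d a b (by omega), Nat.factorial_succ,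
          show ((k + 1 : ℕ) : ℤ) - 1 = k by simp]
        push_cast
        ring
  fin_cases α
  · have e := h.add_eq (by decide)
    obtain ⟨ha, hb, hk, hd⟩ := h
    funext Z r
    obtain ⟨h0, h1⟩ := aux l m n Z.1 e ha hb hk hd
    have e0 : l + m + 1 / 2 = d := by linarith
    have e1 : l - m + 1 / 2 = k := by linarith
    change ![((l + m + 1 / 2 : ℚ) : ℂ) * tcoef l n (m - 1 / 2) Z.1,
           -(((l - m + 1 / 2 : ℚ) : ℂ) * tcoef l n (m + 1 / 2) Z.1)] r =
      _ * evalAt (Ztr Z) (f1 a b k r)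
    rw [e0, e1, Rat.cast_natCast, Rat.cast_natCast, h0, h1]
    fin_cases r
    · simp [f1, evalAt_tt, Ztr]
    · simp [f1, evalAt_tt, Ztr]
  · have e := h.add_eq_one
    obtain ⟨ha, hb, hk, hd⟩ := h
    funext Z r
    have h0 : tcoef l n (m - 1 / 2) Z.1 = tt Z.1 (k + 1) d a :=
      tcoef_eq_tt _ _ _ _ _ _ _ (by push_cast; linarith) (by linarith) (by push_cast; linarith)
    have h1 : tcoef l n (m + 1 / 2) Z.1 = tt Z.1 k (d + 1) a :=
      tcoef_eq_tt _ _ _ _ _ _ _ (by linarith) (by push_cast; linarith) (by push_cast; linarith)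
    have e' : (a : ℂ) + b - k = d + 1 := by
      have : (k : ℂ) + d + 1 = a + b := by exact_mod_cast e
      linear_combination -this
    change ![tcoef l n (m - 1 / 2) Z.1, tcoef l n (m + 1 / 2) Z.1] r =
      _ * evalAt (Ztr Z) (f2 a b k r)
    rw [h0, h1, tt_eq_div_transpose Z.1 (k + 1) d a b (by omega),
      tt_eq_div_transpose Z.1 k (d + 1) a b (by omega), Nat.factorial_succ, Nat.factorial_succ]
    fin_cases r
    · simp [f2, evalAt_tt, Ztr]
      ring
    · simp [f2, evalAt_tt, Ztr, e']
      ring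
  · have e := h.add_eq (by decide)
    obtain ⟨ha, hb, hk, hd⟩ := h
    funext Z r
    obtain ⟨h0, h1⟩ := aux (l - 1) m n Z.1 e ha hb (by linarith) (by linarith)
    have e0 : l + m - 1 / 2 = d := by linarith
    have e1 : l - m - 1 / 2 = k := by linarith
    change ![Z.1.det * (((l + m - 1 / 2 : ℚ) : ℂ) * tcoef (l - 1) n (m - 1 / 2) Z.1),
           -(Z.1.det * (((l - m - 1 / 2 : ℚ) : ℂ) * tcoef (l - 1) n (m + 1 / 2) Z.1))] r =
      _ * evalAt (Ztr Z) (zM.det * f1 a b k r)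
    have hdet : (Ztr Z).1.det = Z.1.det := Matrix.det_transpose Z.1
    rw [e0, e1, Rat.cast_natCast, Rat.cast_natCast, h0, h1, map_mul, evalAt_det, hdet]
    fin_cases r
    · simp [f1, evalAt_tt, Ztr]
      ring
    · simp [f1, evalAt_tt, Ztr]
      ring

theorem Zinv_Ztr (Z : HCx) : (Zinv (Ztr Z)).1 = (Z.1⁻¹)ᵀ :=
  (Matrix.transpose_nonsing_inv Z.1).symm

theorem gMinus_eq {α : Fin 3} {l m n : ℚ} (h : idx α l m n) : gMinus α l m n =
    dualFactor (α, indexOf α l m n) • tr (toFn (opJ (ee (α, indexOf α l m n)))) := by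
  obtain ⟨a, b, k, d, h⟩ := exists_indexRel h
  rw [h.indexOf_eq, h.dualFactor_eq]
  have aux : ∀ (L M N : ℚ) (Z : HC), k + d = a + b + 1 → L - M = a + 1 / 2 → L + M = b + 1 / 2 →
      L - N = k → L + N = d →
      ((b : ℂ) + 1) * tcoef L (M + 1 / 2) N Z =
        k.factorial * d.factorial / (a.factorial * b.factorial) * tt Zᵀ a (b + 1) k ∧
      ((a : ℂ) + 1) * tcoef L (M - 1 / 2) N Z =
        k.factorial * d.factorial / (a.factorial * b.factorial) * tt Zᵀ (a + 1) b k := by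
    intro L M N Z e ha hb hk hd
    have h0 : tcoef L (M + 1 / 2) N Z = tt Z k d a :=
      tcoef_eq_tt _ _ _ _ _ _ _ hk hd (by push_cast; linarith)
    have h1 : tcoef L (M - 1 / 2) N Z = tt Z k d (a + 1 : ℕ) :=
      tcoef_eq_tt _ _ _ _ _ _ _ hk hd (by push_cast; linarith)
    rw [h0, h1, tt_eq_div_transpose Z k d a (b + 1) (by omega),
      tt_eq_div_transpose Z k d (a + 1) b (by omega), Nat.factorial_succ, Nat.factorial_succ]
    have ha' : (a : ℂ) + 1 ≠ 0 := by exact_mod_cast a.succ_ne_zero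
    have hb' : (b : ℂ) + 1 ≠ 0 := by exact_mod_cast b.succ_ne_zero
    have ha0 : (a.factorial : ℂ) ≠ 0 := by exact_mod_cast a.factorial_ne_zero
    have hb0 : (b.factorial : ℂ) ≠ 0 := by exact_mod_cast b.factorial_ne_zero
    push_cast
    constructor <;> field_simp
  have hdet : ∀ Z : HCx, (Zinv (Ztr Z)).1.det = Z.1.det⁻¹ := fun Z => by
    rw [det_Zinv]
    exact congrArg _ (Matrix.det_transpose Z.1)
  fin_cases α
  · have e := h.add_eq (by decide)
    obtain ⟨ha, hb, hk, hd⟩ := h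
    funext Z r
    obtain ⟨h0, h1⟩ := aux (l + 1 / 2) m n Z.1⁻¹ e (by linarith) (by linarith) hk hd
    have e0 : l + m + 1 = (b + 1 : ℚ) := by linarith
    have e1 : l - m + 1 = (a + 1 : ℚ) := by linarith
    change ![((l + m + 1 : ℚ) : ℂ) * tcoef (l + 1 / 2) (m + 1 / 2) n Z.1⁻¹,
           -(((l - m + 1 : ℚ) : ℂ) * tcoef (l + 1 / 2) (m - 1 / 2) n Z.1⁻¹)] r =
      _ * evalAt (Ztr Z) (opJ (f1 a b k) r)
    rw [e0, e1, Rat.cast_add, Rat.cast_add, Rat.cast_natCast, Rat.cast_natCast, Rat.cast_one,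
      h0, h1]
    fin_cases r
    · refine Eq.trans ?_ (congrArg _ (evalAt_opJ_f1_zero (Ztr Z) a b k).symm)
      rw [Zinv_Ztr]
      rfl
    · refine Eq.trans ?_ (congrArg _ (evalAt_opJ_f1_one (Ztr Z) a b k).symm)
      rw [Zinv_Ztr, mul_neg]
      rfl
  · have e := h.add_eq_one
    obtain ⟨ha, hb, hk, hd⟩ := h
    funext Z r
    have h0 : tcoef (l - 1 / 2) (m + 1 / 2) n Z.1⁻¹ = tt Z.1⁻¹ k d ((a : ℤ) - 1) :=
      tcoef_eq_tt _ _ _ _ _ _ _ hk hd (by push_cast; linarith)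
    have h1 : tcoef (l - 1 / 2) (m - 1 / 2) n Z.1⁻¹ = tt Z.1⁻¹ k d a :=
      tcoef_eq_tt _ _ _ _ _ _ _ hk hd (by push_cast; linarith)
    change ![Z.1.det⁻¹ * tcoef (l - 1 / 2) (m + 1 / 2) n Z.1⁻¹,
           Z.1.det⁻¹ * tcoef (l - 1 / 2) (m - 1 / 2) n Z.1⁻¹] r =
      _ * evalAt (Ztr Z) (opJ (f2 a b k) r)
    rw [h0, h1]
    have hdetT : ((Z.1⁻¹)ᵀ).det = Z.1.det⁻¹ := by rw [← Zinv_Ztr, hdet]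
    have ha0 : (a.factorial : ℂ) ≠ 0 := by exact_mod_cast a.factorial_ne_zero
    have hb0 : (b.factorial : ℂ) ≠ 0 := by exact_mod_cast b.factorial_ne_zero
    fin_cases r
    · refine Eq.trans ?_ (congrArg _ (evalAt_opJ_f2_zero (Ztr Z) a b k).symm)
      change Z.1.det⁻¹ * tt Z.1⁻¹ k d ((a : ℤ) - 1) = _
      rw [Zinv_Ztr, hdetT]
      -- For a = 0 the row index a - 1 is negative and the coefficient is zero, in agreement with
      -- the factor a on the right.
      rcases a with _ | a
      · rw [tt_of_neg _ _ _ _ (by simp)]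
        simp
      · have ha' : (a : ℂ) + 1 ≠ 0 := by exact_mod_cast a.succ_ne_zero
        rw [show ((a + 1 : ℕ) : ℤ) - 1 = a by simp,
          tt_eq_div_transpose _ k d a b (by omega), Nat.factorial_succ, Nat.add_sub_cancel]
        push_cast
        field_simp
    · refine Eq.trans ?_ (congrArg _ (evalAt_opJ_f2_one (Ztr Z) a b k).symm)
      change Z.1.det⁻¹ * tt Z.1⁻¹ k d a = _
      rw [Zinv_Ztr, hdetT]
      rcases b with _ | b
      · rw [tt_of_gt _ _ _ _ (by omega)]
        simp
      · have hb' : (b : ℂ) + 1 ≠ 0 := by exact_mod_cast b.succ_ne_zero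
        rw [tt_eq_div_transpose _ k d a b (by omega), Nat.factorial_succ, Nat.add_sub_cancel]
        push_cast
        field_simp
  · have e := h.add_eq (by decide)
    obtain ⟨ha, hb, hk, hd⟩ := h
    funext Z r
    obtain ⟨h0, h1⟩ := aux (l - 1 / 2) m n Z.1⁻¹ e (by linarith) (by linarith) hk hd
    have e0 : l + m = (b + 1 : ℚ) := by linarith
    have e1 : l - m = (a + 1 : ℚ) := by linarith
    change ![Z.1.det⁻¹ * (((l + m : ℚ) : ℂ) * tcoef (l - 1 / 2) (m + 1 / 2) n Z.1⁻¹),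
           -(Z.1.det⁻¹ * (((l - m : ℚ) : ℂ) * tcoef (l - 1 / 2) (m - 1 / 2) n Z.1⁻¹))] r =
      _ * evalAt (Ztr Z) (opJ (f3 a b k) r)
    have hd' : (Ztr Z).1.det = Z.1.det := Matrix.det_transpose Z.1
    rw [e0, e1, Rat.cast_add, Rat.cast_add, Rat.cast_natCast, Rat.cast_natCast, Rat.cast_one,
      h0, h1, evalAt_opJ_f3, mul_left_comm, hd']
    fin_cases r
    · refine Eq.trans ?_ (congrArg (fun x => _ * (_ * x)) (evalAt_opJ_f1_zero (Ztr Z) a b k).symm)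
      rw [Zinv_Ztr]
      rfl
    · refine Eq.trans ?_ (congrArg (fun x => _ * (_ * x)) (evalAt_opJ_f1_one (Ztr Z) a b k).symm)
      rw [Zinv_Ztr, mul_neg, mul_neg]
      exact congrArg Neg.neg (mul_left_comm _ _ _)

end DualKTypes

/-! ### The four realizations -/

section Realizations

/-- The realization of `(π'_l, 𝒰⁺)`. -/
def realizationLPlus : Realization .lplus where
  toFun := toFn
  injective := toFn_injective
  map_eq := map_SS_eq
  twist X := X
  twist_mem _ hX := hX
  twist_twist _ := rfl
  act_eq X u _ := piL_toFn X u
  index := indexOf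
  factor _ _ _ _ := 1
  valid _ _ _ _ h := valid_indexOf h
  factor_ne _ _ _ _ _ := one_ne_zero
  ktype_eq _ _ _ _ h := (fPlus_eq h).trans (one_smul _ _).symm
  weight_eq _ _ _ _ h := weight_indexOf h
  index_injective _ _ _ _ _ _ _ h h' e := indexOf_injective h h' e
  index_surjective _ _ h := indexOf_surjective h
  sphere _ _ := rfl

/-- The realization of `(π'_l, 𝒰⁻)`. -/
def realizationLMinus : Realization .lminus where
  toFun := toFn ∘ₗ opJ
  injective := toFn_injective.comp (Function.LeftInverse.injective opJ_opJ)
  map_eq := by rw [Submodule.map_comp, map_opJ_SS, map_SM_eq]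
  twist := swapBlocks
  twist_mem _ hX := swapBlocks_mem hX
  twist_twist := swapBlocks_swapBlocks
  act_eq X u _ := by
    change piL X (toFn (opJ u)) = toFn (opJ (pL (swapBlocks X) u))
    rw [piL_toFn, pL_opJ]
  index α l m n := indexOf α l n m
  factor _ _ _ _ := 1
  valid _ _ _ _ h := valid_indexOf h
  factor_ne _ _ _ _ _ := one_ne_zero
  ktype_eq _ _ _ _ h := (fMinus_eq h).trans (one_smul _ _).symm
  weight_eq _ _ _ _ h := weight_indexOf h
  index_injective _ _ _ _ _ _ _ h h' e := by
    obtain ⟨h1, h2, h3⟩ := indexOf_injective h h' e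
    exact ⟨h1, h3, h2⟩
  index_surjective _ _ h := by
    obtain ⟨l, m, n, h1, h2⟩ := indexOf_surjective h
    exact ⟨l, n, m, h1, h2⟩
  sphere := sphereInner_opJ

/-- The realization of `(π'_r, 𝒰'⁺)`. -/
def realizationRPlus : Realization .rplus where
  toFun := tr ∘ₗ toFn
  injective := tr_injective.comp toFn_injective
  map_eq := by rw [Submodule.map_comp, map_SS_eq, map_tr_lplus]
  twist := dualBlocks
  twist_mem _ hX := dualBlocks_mem hX
  twist_twist := dualBlocks_dualBlocks
  act_eq X u _ := by
    change piR X (tr (toFn u)) = tr (toFn (pL (dualBlocks X) u))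
    rw [piR_tr, piL_toFn]
  index α l m n := indexOf α l n m
  factor α l m n := dualFactor (α, indexOf α l n m)
  valid _ _ _ _ h := valid_indexOf h
  factor_ne _ _ _ _ _ := dualFactor_ne _
  ktype_eq _ _ _ _ h := gPlus_eq h
  weight_eq _ _ _ _ h := weight_indexOf h
  index_injective _ _ _ _ _ _ _ h h' e := by
    obtain ⟨h1, h2, h3⟩ := indexOf_injective h h' e
    exact ⟨h1, h3, h2⟩
  index_surjective _ _ h := by
    obtain ⟨l, m, n, h1, h2⟩ := indexOf_surjective h
    exact ⟨l, n, m, h1, h2⟩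
  sphere u v := sphereInner_tr (toFn u) (toFn v)

/-- The realization of `(π'_r, 𝒰'⁻)`. -/
def realizationRMinus : Realization .rminus where
  toFun := tr ∘ₗ toFn ∘ₗ opJ
  injective := tr_injective.comp
    (toFn_injective.comp (Function.LeftInverse.injective opJ_opJ))
  map_eq := by rw [Submodule.map_comp, Submodule.map_comp, map_opJ_SS, map_SM_eq, map_tr_lminus]
  twist X := swapBlocks (dualBlocks X)
  twist_mem _ hX := swapBlocks_mem (dualBlocks_mem hX)
  twist_twist := swapBlocks_dualBlocks_involutive
  act_eq X u _ := by
    change piR X (tr (toFn (opJ u))) = tr (toFn (opJ (pL (swapBlocks (dualBlocks X)) u)))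
    rw [piR_tr, piL_toFn, pL_opJ]
  index := indexOf
  factor α l m n := dualFactor (α, indexOf α l m n)
  valid _ _ _ _ h := valid_indexOf h
  factor_ne _ _ _ _ _ := dualFactor_ne _
  ktype_eq _ _ _ _ h := gMinus_eq h
  weight_eq _ _ _ _ h := weight_indexOf h
  index_injective _ _ _ _ _ _ _ h h' e := indexOf_injective h h' e
  index_surjective _ _ h := indexOf_surjective h
  sphere u v :=
    (sphereInner_tr (toFn (opJ u)) (toFn (opJ v))).trans (sphereInner_opJ u v)

/-- The realizations of the four representations. -/
def realization : ∀ c : Label, Realization c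
  | .lplus => realizationLPlus
  | .lminus => realizationLMinus
  | .rplus => realizationRPlus
  | .rminus => realizationRMinus

end Realizations

end

end QAR

theorem theorem6p1 (c : QAR.Label) :
    -- the space is stable under the Lie algebra action and irreducible, also over `𝔲(2,2)`
    (∀ X, ∀ f ∈ QAR.space c, QAR.act c X f ∈ QAR.space c) ∧
    QAR.space c ≠ ⊥ ∧
    (∀ W : Submodule ℂ QAR.Fn, W ≤ QAR.space c →
      (∀ X ∈ QAR.u22, ∀ f ∈ W, QAR.act c X f ∈ W) → W = ⊥ ∨ W = QAR.space c) ∧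
    -- the `K`-type functions form a basis of the space
    Submodule.span ℂ {f | ∃ α l m n, QAR.kidx c α l m n ∧ f = QAR.ktype c α l m n} =
      QAR.space c ∧
    LinearIndependent ℂ
      (fun p : {p : Fin 3 × ℚ × ℚ × ℚ // QAR.kidx c p.1 p.2.1 p.2.2.1 p.2.2.2} =>
        QAR.ktype c p.1.1 p.1.2.1 p.1.2.2.1 p.1.2.2.2) ∧
    -- the invariant pseudounitary structure
    (∃ B : QAR.space c →ₗ[ℂ] QAR.space c →ₗ⋆[ℂ] ℂ,
      QAR.IsHermitianForm B ∧ QAR.IsInvariantForm c B ∧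
      (∀ u, (∀ v, B u v = 0) → u = 0) ∧
      (∃ u, 0 < (B u u).re) ∧ (∃ u, (B u u).re < 0) ∧
      (∀ α l m n α' l' m' n', QAR.kidx c α l m n → QAR.kidx c α' l' m' n' →
        ∀ u v : QAR.space c,
          (u : QAR.Fn) = QAR.ktype c α l m n → (v : QAR.Fn) = QAR.ktype c α' l' m' n' →
          B u v = if α = α' then
              ((QAR.weight α l : ℚ) : ℂ) / (2 * (Real.pi : ℂ) ^ 2) *
                QAR.sphereInner (QAR.ktype c α l m n) (QAR.ktype c α' l' m' n')
            else 0) ∧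
      -- it is unique up to a real factor among the invariant Hermitian forms
      (∀ H : QAR.space c →ₗ[ℂ] QAR.space c →ₗ⋆[ℂ] ℂ,
        QAR.IsHermitianForm H → QAR.IsInvariantForm c H →
        ∃ r : ℝ, ∀ u v, H u v = (r : ℂ) * B u v)) ∧
    -- there is no invariant unitary structure
    ¬ ∃ H : QAR.space c →ₗ[ℂ] QAR.space c →ₗ⋆[ℂ] ℂ,
      QAR.IsHermitianForm H ∧ QAR.IsInvariantForm c H ∧ ∀ u, u ≠ 0 → 0 < (H u u).re := by
  have R := QAR.realization c
  exact ⟨fun X _ hf => R.stable X hf, R.ne_bot, fun W hW h => R.irreducible W hW h, R.span_eq,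
    R.linearIndependent, ⟨R.form, R.form_hermitian, R.form_invariant,
      fun _ h => R.form_nondegenerate h, R.form_pos, R.form_neg, R.form_ktype,
      fun H hH hH' => R.form_unique H hH hH'⟩, R.not_unitary⟩
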